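/- Let $k$ be an algebraically closed field of characteristic $\ne 2$, let $Y$ be a normal (integral) projective variety over $k$, let $G=\mathbb Z_2^n$ with $n\ge 0$, and let $G^*$ be its character group (characters take the values $\pm1$). A $G$-cover of $Y$ is a finite morphism $f:X\to Y$ with a faithful action of $G$ on $X$ over $Y$ such that $Y=X/G$ (i.e. $\mathcal O_Y=(f_*\mathcal O_X)^G$); $X$ may be reducible or disconnected. Isomorphisms of $G$-covers are $G$-equivariant isomorphisms over $Y$. Building data $(L_\chi,D_h)$ consist of a class $L_\chi\in\operatorname{Cl}(Y)$ for each $\chi\in G^*$ and an effective Weil divisor $D_h$ on $Y$ for each $h\in G\setminus\{0\}$ such that, for all $\chi,\chi'\in G^*$, $$L_\chi+L_{\chi'}=L_{\chi\chi'}+\sum_{h\neq 0}\epsilon_h^{\chi,\chi'}D_h\quad\text{in }\operatorname{Cl}(Y),$$ where $\epsilon_h^{\chi,\chi'}=1$ if $\chi(h)=\chi'(h)=-1$ and $\epsilon_h^{\chi,\chi'}=0$ otherwise. A $G$-cover is a standard cover for $(L_\chi,D_h)$ if it is isomorphic to $\operatorname{Spec}_Y\bigoplus_{\chi}\mathcal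 O_Y(-L_\chi)$, where $G$ acts on $\mathcal O_Y(-L_\chi)$ through $\chi$ and the multiplication $\mathcal O_Y(-L_\chi)\otimes\mathcal O_Y(-L_{\chi'})\to\mathcal O_Y(-L_{\chi\chi'})$ is given by a section of $\mathcal O_Y(L_\chi+L_{\chi'}-L_{\chi\chi'})$ with divisor of zeros $\sum_h\epsilon_h^{\chi,\chi'}D_h$. A scheme is normal crossing (n.c.) in codimension 1 if at every point of codimension $\le 1$ it is either regular or a node, where a node is a local ring $S/(F)$ with $S$ regular local of dimension 2 and $F$ having a nondegenerate quadratic leading form. Then: 1. A $G$-cover $f:X\to Y$ has $X$ reduced, $S_2$ and n.c. in codimension 1 if and only if it is a standard cover for some building data $(L_\chi,D_h)$ such that $\sum_h D_h$ has multiplicity at most $2$ along every prime divisor of $Y$. 2. If a $G$-cover $f:X\to Y$ is standard for building data $(L_\chi,D_h)$, then $X$ is reduced, $S_2$ and n.c. in codimension 1 if and only if $\sum_h D_h$ has multiplicity at most $2$ along every prime divisor of $Y$. 3. Assigning to a cover its building data is a well-defined bijection between the set of isomorphism classes of $G$-covers $f:X\to Y$ with $X$ reduced, $S_2$ and n.c.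 in codimension 1, and the set of building data $(L_\chi,D_h)$ such that $\sum_h D_h$ has multiplicity at most $2$ along every prime divisor of $Y$: each such cover is standard for exactly one such building data, and each such building data has a standard cover, unique up to isomorphism. -/

import Mathlib

open CategoryTheory AlgebraicGeometry

universe u

namespace ZTwoCovers

/-! ### The base: normal projective varieties, Weil divisors -/

/-- A morphism `s : Y ⟶ Spec k` is projective if it factors through a closed immersion
into some projective space over `k`. -/
def IsProjectiveOver {k : Type u} [Field k] {Y : Scheme.{u}} (s : Y ⟶ Spec (.of k)) : Prop :=
  letI (N : ℕ) : GradedAlgebra (MvPolynomial.homogeneousSubmodule (Fin (N + 1)) k) :=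
    MvPolynomial.gradedAlgebra
  ∃ (N : ℕ) (i : Y ⟶ Proj (MvPolynomial.homogeneousSubmodule (Fin (N + 1)) k)),
    IsClosedImmersion i ∧
      i ≫ Proj.toSpecZero (MvPolynomial.homogeneousSubmodule (Fin (N + 1)) k) ≫
        Spec.map (CommRingCat.ofHom
          (algebraMap k (MvPolynomial.homogeneousSubmodule (Fin (N + 1)) k 0))) = s

/-- An integral scheme is normal if all its local rings are integrally closed domains. -/
def IsNormalScheme (Y : Scheme.{u}) [IsIntegral Y] : Prop :=
  ∀ y : Y, IsIntegrallyClosed (Y.presheaf.stalk y)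

/-- Prime divisors, represented by their generic points: the points of codimension one. -/
abbrev PrimeDivisor (Y : Scheme.{u}) : Type u := {y : Y // Order.coheight y = 1}

/-- Weil divisors: finite integral combinations of prime divisors. -/
abbrev WeilDivisor (Y : Scheme.{u}) : Type u := PrimeDivisor Y →₀ ℤ

section Base

variable (Y : Scheme.{u}) [IsIntegral Y] [IsLocallyNoetherian Y]

/-- The group of principal divisors `div a`, for `a` a nonzero rational function. -/
noncomputable def principalDivisors : AddSubgroup (WeilDivisor Y) where
  carrier := {E | ∃ a : Y.functionField, a ≠ 0 ∧ ∀ y : PrimeDivisor Y, E y = Scheme.ord a y.1}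
  zero_mem' := ⟨1, one_ne_zero, fun y => by
    have h := Scheme.ord_mul (x := y.1) (one_ne_zero (α := Y.functionField)) one_ne_zero
    rw [one_mul] at h
    simp only [Finsupp.coe_zero, Pi.zero_apply]
    omega⟩
  add_mem' := by
    rintro E F ⟨a, ha, hE⟩ ⟨b, hb, hF⟩
    exact ⟨a * b, mul_ne_zero ha hb, fun y => by
      rw [Scheme.ord_mul ha hb, Finsupp.add_apply, hE, hF]⟩
  neg_mem' := by
    rintro E ⟨a, ha, hE⟩
    refine ⟨a⁻¹, inv_ne_zero ha, fun y => ?_⟩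
    have h1 := Scheme.ord_mul (x := y.1) (one_ne_zero (α := Y.functionField)) one_ne_zero
    have h2 := Scheme.ord_mul (x := y.1) ha (inv_ne_zero ha)
    rw [mul_inv_cancel₀ ha] at h2
    rw [one_mul] at h1
    rw [Finsupp.neg_apply, hE]
    omega

/-- The divisor class group `Cl(Y)`: Weil divisors modulo linear equivalence. -/
abbrev ClassGroupOf : Type u := WeilDivisor Y ⧸ principalDivisors Y

variable {Y}

/-- The class in `Cl(Y)` of a Weil divisor. -/
noncomputable def divClass (E : WeilDivisor Y) : ClassGroupOf Y := QuotientAddGroup.mk E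

/-- The sections over `U` of the divisorial sheaf `𝒪_Y(-E)`, as a set of rational functions. -/
def sectionsNeg (E : WeilDivisor Y) (U : Y.Opens) : Set Y.functionField :=
  {a | a = 0 ∨ ∀ y : PrimeDivisor Y, y.1 ∈ U → E y ≤ Scheme.ord a y.1}

end Base

/-! ### The group `ℤ₂ⁿ`, its characters, building data -/

/-- The group `ℤ₂ⁿ`. -/
abbrev Grp (n : ℕ) : Type := Fin n → ZMod 2

/-- The group of characters of `ℤ₂ⁿ`. Since every element of `ℤ₂ⁿ` is killed by `2`, characters
take the values `1` and `-1` only. -/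
abbrev Chars (n : ℕ) : Type := AddChar (Grp n) ℤˣ

/-- `ε_h^{χ,χ'}` is `1` if `χ(h) = χ'(h) = -1` and `0` otherwise. -/
def eps {n : ℕ} (χ χ' : Chars n) (h : Grp n) : ℤ := if χ h = -1 ∧ χ' h = -1 then 1 else 0

/-- The building data `(L_χ, D_h)` of a `ℤ₂ⁿ`-cover of `Y`: classes `L_χ` in `Cl(Y)` and effective
Weil divisors `D_h` for `h ≠ 0`, subject to the fundamental relations. -/
structure BuildingData (Y : Scheme.{u}) [IsIntegral Y] [IsLocallyNoetherian Y] (n : ℕ) where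
  L : Chars n → ClassGroupOf Y
  D : {h : Grp n // h ≠ 0} → WeilDivisor Y
  effective : ∀ h, 0 ≤ D h
  relation : ∀ χ χ' : Chars n,
    L χ + L χ' = L (χ * χ') + divClass (∑ h : {h : Grp n // h ≠ 0}, eps χ χ' h.1 • D h)

/-- The divisor `∑ D_h` has multiplicity at most `2` along each prime divisor. -/
def BuildingData.MultLETwo {Y : Scheme.{u}} [IsIntegral Y] [IsLocallyNoetherian Y] {n : ℕ}
    (B : BuildingData Y n) : Prop :=
  ∀ y : PrimeDivisor Y, (∑ h : {h : Grp n // h ≠ 0}, B.D h) y ≤ 2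

/-! ### `ℤ₂ⁿ`-covers -/

/-- A `ℤ₂ⁿ`-cover of `Y`: a finite morphism `f : X ⟶ Y` together with a faithful action of `ℤ₂ⁿ`
on `X` over `Y` such that `Y = X / ℤ₂ⁿ`, that is, `𝒪_Y` is the invariant subsheaf of `f_* 𝒪_X`. -/
structure Cover (Y : Scheme.{u}) (n : ℕ) where
  X : Scheme.{u}
  f : X ⟶ Y
  finite : IsFinite f
  ρ : Multiplicative (Grp n) →* Aut X
  comp_f : ∀ g : Multiplicative (Grp n), (ρ g).hom ≫ f = f
  faithful : Function.Injective ρ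
  injective : ∀ U : Y.Opens, Function.Injective (f.app U)
  range_eq : ∀ U : Y.Opens, Set.range (f.app U) =
    {s : Γ(X, f ⁻¹ᵁ U) | ∀ g : Multiplicative (Grp n),
      (ρ g).hom.appLE (f ⁻¹ᵁ U) (f ⁻¹ᵁ U)
        (by rw [← Scheme.Hom.comp_preimage, comp_f g]) s = s}

namespace Cover

variable {Y : Scheme.{u}} {n : ℕ}

/-- The action of a group element on the sections of `f_* 𝒪_X` over `U` by pullback. -/
noncomputable def act (c : Cover Y n) (g : Grp n) (U : Y.Opens) :
    Γ(c.X, c.f ⁻¹ᵁ U) ⟶ Γ(c.X, c.f ⁻¹ᵁ U) :=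
  (c.ρ (Multiplicative.ofAdd g)).hom.appLE (c.f ⁻¹ᵁ U) (c.f ⁻¹ᵁ U)
    (by rw [← Scheme.Hom.comp_preimage, c.comp_f])

/-- The sections over `U` of the `χ`-eigensheaf of `f_* 𝒪_X`. -/
def eigen (c : Cover Y n) (χ : Chars n) (U : Y.Opens) : Set Γ(c.X, c.f ⁻¹ᵁ U) :=
  {s | ∀ g : Grp n, c.act g U s = ((χ g : ℤˣ) : ℤ) • s}

/-- Two covers of `Y` are isomorphic if there is an equivariant isomorphism over `Y`. -/
def IsIso (c c' : Cover Y n) : Prop :=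
  ∃ e : c.X ≅ c'.X, e.hom ≫ c'.f = c.f ∧
    ∀ g : Multiplicative (Grp n), (c.ρ g).hom ≫ e.hom = e.hom ≫ (c'.ρ g).hom

/-- The cover is the standard cover for the building data `(L_χ, D_h)`. That is, `X` is the relative
spectrum of the algebra `⨁ 𝒪_Y(-E_χ)` for divisors `E_χ` in the classes `L_χ`, on which the group
acts on the summand of index `χ` by `χ`, and whose multiplication
`𝒪_Y(-E_χ) ⊗ 𝒪_Y(-E_χ') → 𝒪_Y(-E_χχ')` is multiplication by (the rational function `φ χ χ'`
representing) a global section of `𝒪_Y(E_χ + E_χ' - E_χχ')` whose divisor of zeros is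
`∑_h ε_h^{χ,χ'} D_h`. The maps `Φ χ U` restrict to the isomorphisms between the `χ`-eigensheaf
of `f_* 𝒪_X` and `𝒪_Y(-E_χ)`. -/
def IsStandard [IsIntegral Y] [IsLocallyNoetherian Y] (c : Cover Y n) (B : BuildingData Y n) :
    Prop :=
  ∃ (E : Chars n → WeilDivisor Y) (φ : Chars n → Chars n → Y.functionField)
    (Φ : ∀ (_ : Chars n) (U : Y.Opens), Γ(c.X, c.f ⁻¹ᵁ U) →+ Y.functionField),
    (∀ χ, divClass (E χ) = B.L χ) ∧
    (∀ χ χ', φ χ χ' ≠ 0) ∧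
    (∀ χ χ' (y : PrimeDivisor Y), Scheme.ord (φ χ χ') y.1 + E χ y + E χ' y =
      E (χ * χ') y + (∑ h : {h : Grp n // h ≠ 0}, eps χ χ' h.1 • B.D h) y) ∧
    (∀ χ (U : Y.Opens) [Nonempty U], Set.BijOn (Φ χ U) (c.eigen χ U) (sectionsNeg (E χ) U)) ∧
    (∀ χ (U : Y.Opens) [Nonempty U] (r : Γ(Y, U)), ∀ s ∈ c.eigen χ U,
      Φ χ U (c.f.app U r * s) = Y.germToFunctionField U r * Φ χ U s) ∧
    (∀ χ (U V : Y.Opens) [Nonempty U] [Nonempty V] (hVU : V ≤ U), ∀ s ∈ c.eigen χ U,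
      Φ χ V (c.X.presheaf.map (homOfLE (c.f.preimage_mono hVU)).op s) = Φ χ U s) ∧
    (∀ χ χ' (U : Y.Opens) [Nonempty U], ∀ s ∈ c.eigen χ U, ∀ t ∈ c.eigen χ' U,
      Φ (χ * χ') U (s * t) = φ χ χ' * Φ χ U s * Φ χ' U t)

end Cover

/-! ### Singularities of the covers -/

/-- Serre's condition `S₂`: each local ring has depth at least `min(2, dim)`. -/
def IsSTwo (X : Scheme.{u}) : Prop :=
  ∀ (x : X) (m : ℕ), m ≤ 2 → (m : WithBot ℕ∞) ≤ ringKrullDim (X.presheaf.stalk x) →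
    ∃ rs : List (X.presheaf.stalk x), rs.length = m ∧
      (∀ r ∈ rs, r ∈ IsLocalRing.maximalIdeal (X.presheaf.stalk x)) ∧
      RingTheory.Sequence.IsRegular (X.presheaf.stalk x) rs

/-- A local ring `R` (with `2` invertible) is a node if it is `S / (F)` for a regular local ring `S`
of dimension two, with maximal ideal `(p, q)`, and an `F` whose leading form at the closed point
is a nondegenerate quadratic form `a p² + b p q + c q²`. This is the local ring at the generic
point of the double locus of a normal crossing variety: étale locally `F = u v`. -/
def IsNode (R : Type u) [CommRing R] : Prop :=
  ∃ (S : Type u) (_ : CommRing S) (_ : IsRegularLocalRing S) (p q a b c F : S),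
    ringKrullDim S = 2 ∧
    IsLocalRing.maximalIdeal S = Ideal.span {p, q} ∧
    F - (a * p ^ 2 + b * p * q + c * q ^ 2) ∈ IsLocalRing.maximalIdeal S ^ 3 ∧
    IsUnit (b ^ 2 - 4 * a * c) ∧
    Nonempty (R ≃+* S ⧸ Ideal.span {F})

/-- `X` is normal crossing in codimension one: at each point of codimension at most one it is
regular or a node. -/
def IsNCInCodimOne (X : Scheme.{u}) : Prop :=
  ∀ x : X, Order.coheight x ≤ 1 →
    IsRegularLocalRing (X.presheaf.stalk x) ∨ IsNode (X.presheaf.stalk x)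

/-- The covers `X → Y` with `X` reduced, `S₂`, and normal crossing in codimension one. -/
def Cover.IsSTwoNC {Y : Scheme.{u}} {n : ℕ} (c : Cover Y n) : Prop :=
  IsReduced c.X ∧ IsSTwo c.X ∧ IsNCInCodimOne c.X

/-- Isomorphism, as an equivalence relation on these covers. -/
def isoSetoid (Y : Scheme.{u}) (n : ℕ) : Setoid {c : Cover Y n // c.IsSTwoNC} where
  r c c' := c.1.IsIso c'.1
  iseqv :=
    { refl := fun c => ⟨Iso.refl _, by simp, by simp⟩
      symm := by
        rintro c c' ⟨e, h1, h2⟩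
        exact ⟨e.symm, by simp [← h1], fun g => by
          simp only [Iso.symm_hom, Iso.comp_inv_eq, Category.assoc, h2 g, Iso.inv_hom_id_assoc]⟩
      trans := by
        rintro c c' c'' ⟨e, h1, h2⟩ ⟨e', h1', h2'⟩
        exact ⟨e.trans e', by simp [h1, h1'], fun g => by
          simp [reassoc_of% h2 g, h2' g]⟩ }

end ZTwoCovers

namespace ZTwoCovers

/-! ### Characters of `ℤ₂ⁿ` -/

section Characters

variable {n : ℕ}

/-! Since 2 is invertible, a cover amounts to the algebra `f_* 𝒪_X` together with its splitting into
eigensheaves. Reducedness makes the eigensheaves torsion free, and faithfulness makes each of them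
nonzero. Going down for quotients by finite groups shows that a point of `X` and its image have the
same codimension, so condition S₂ says that divisibility by functions of the base can be tested at
the prime divisors (`isDivisorial_of_depthTwo`, `depthTwo_of_isDivisorial`). Hence every eigensheaf
of a reduced S₂ cover is some `𝒪_Y(-E_χ)`, with multiplication given by rational functions `φ χ ψ`
(`Cover.nonempty_eigenData`). Conversely every such algebra is reduced and S₂, so what remains is
decided over the prime divisors.

Over the discrete valuation ring of a prime divisor the algebra has a basis `b χ` with `b χ * b ψ` a
unit times `π ^ e χ ψ` times `b (χ * ψ)` (`CharBasis`). The ideal generated by `π` and the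
non-invertible `b χ` is radical, and it becomes the maximal ideal at each prime over `π`, so
cotangent spaces can be computed with characters. A node or a regular point of dimension at most one
has embedding dimension at most two, and `x² ∈ 𝔪³` only for `x ∈ 𝔪²` (`NodeLike`). This leaves at
most two classes of indecomposable characters modulo the invertible ones and bounds their exponents,
so the exponents are sums of `eps χ ψ h * m h` with `m ≥ 0` of total at most 2
(`IsExponent.exists_multiplicities`). For such exponents, conversely, the local ring is regular or
comes from an equation `z² = v t²` over a subalgebra, which is a node (`isNode_of_double_cover`).
The `m h` are recovered from the exponents by Fourier inversion (`eq_of_sum_eps_eq`). Letting the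
prime divisor vary they form the `D_h`, and the functions `φ` provide the linear equivalences.

Building data are unique because two identifications of an eigensheaf with a divisorial sheaf differ
by a rational function: this moves `E_χ` by a principal divisor and preserves all exponents. Two
covers with the same data have multiplications differing by a symmetric cocycle in the functions
without zeros and poles. On a projective variety over an algebraically closed field these are
constants, hence squares, and such a cocycle is a coboundary (`IsSymmCocycle.exists_coboundary`).

For existence, choices are needed only for the coordinate characters: divisors `e i` in the given
classes and functions `f i` realizing the relations for these characters. The algebra is realized
inside functions on the group with values in an algebraic closure of the function field, `b χ` being
`χ` times a product of square roots of the `f i`; the ring axioms then come for free, and a relative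
spectrum gives the cover (`TwistData.exists_cover`). -/

instance : Finite (Chars n) := DFunLike.finite _

noncomputable instance : Fintype (Chars n) := Fintype.ofFinite _

noncomputable instance : DecidableEq (Chars n) := Classical.decEq _

lemma Chars.mul_self (χ : Chars n) : χ * χ = 1 := by
  ext g
  simp

lemma Chars.eq_neg_one_of_ne_one {χ : Chars n} {g : Grp n} (h : χ g ≠ 1) : χ g = -1 :=
  (Int.units_eq_one_or _).resolve_left h

lemma Chars.inv_eq (χ : Chars n) : χ⁻¹ = χ := inv_eq_of_mul_eq_one_left χ.mul_self

/-- The nontrivial character of `ℤ₂`. -/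
def sgn : AddChar (ZMod 2) ℤˣ where
  toFun a := if a = 0 then 1 else -1
  map_zero_eq_one' := by simp
  map_add_eq_mul' := by decide

/-- The coordinate characters of `ℤ₂ⁿ`. -/
def coordChar (i : Fin n) : Chars n :=
  sgn.compAddMonoidHom (Pi.evalAddMonoidHom (fun _ : Fin n => ZMod 2) i)

lemma coordChar_apply (i : Fin n) (g : Grp n) : coordChar i g = sgn (g i) := rfl

/-- `χ` is nontrivial on the `i`-th factor. -/
def bit (χ : Chars n) (i : Fin n) : Prop := χ (Pi.single i 1) = -1

instance (χ : Chars n) (i : Fin n) : Decidable (bit χ i) := inferInstanceAs (Decidable (_ = _))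

lemma bit_mul (χ ψ : Chars n) (i : Fin n) : bit (χ * ψ) i ↔ ¬ (bit χ i ↔ bit ψ i) := by
  unfold bit
  rw [AddChar.mul_apply]
  rcases Int.units_eq_one_or (χ (Pi.single i 1)) with h | h <;>
  rcases Int.units_eq_one_or (ψ (Pi.single i 1)) with h' | h' <;> rw [h, h'] <;> decide

lemma bit_coordChar (i j : Fin n) : bit (coordChar i) j ↔ j = i := by
  unfold bit
  rw [coordChar_apply]
  by_cases h : j = i
  · subst h
    simp [sgn]
  · simp [h, Ne.symm h, sgn]

lemma not_bit_one (i : Fin n) : ¬ bit (1 : Chars n) i := by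
  simp [bit]

/-- The coordinate characters are a basis of the dual of `ℤ₂ⁿ`, with `bit` reading off coordinates.
Through this, choices indexed by all characters reduce to `n` free choices. -/
lemma Chars.eq_prod (χ : Chars n) : χ = ∏ i, if bit χ i then coordChar i else 1 := by
  have key : ∀ (i : Fin n) (a : ZMod 2),
      χ (Pi.single i a) = (if bit χ i then sgn a else 1) := by
    intro i a
    have : a = 0 ∨ a = 1 := by revert a; decide
    rcases this with rfl | rfl
    · simp
    · split_ifs with h
      · rw [h]; rfl
      · exact (Int.units_eq_one_or _).resolve_right h
  ext g
  rw [AddChar.coe_prod, Finset.prod_apply]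
  have e1 : χ g = ∏ i, χ (Pi.single i (g i)) := by
    conv_lhs => rw [← Finset.univ_sum_single g]
    exact map_prod χ.toMonoidHom (fun i => Multiplicative.ofAdd (Pi.single i (g i))) Finset.univ
  rw [e1]
  congr 1
  refine Finset.prod_congr rfl fun i _ => ?_
  rw [key]
  split_ifs <;> rfl

/-- Every homomorphism from the character group to `±1` is an evaluation. -/
lemma exists_eval (l : Chars n →* ℤˣ) : ∃ g : Grp n, ∀ χ, l χ = χ g := by
  refine ⟨fun i => if l (coordChar i) = 1 then 0 else 1, fun χ => ?_⟩
  conv_lhs => rw [χ.eq_prod]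
  conv_rhs => rw [χ.eq_prod]
  rw [AddChar.coe_prod, Finset.prod_apply, map_prod]
  refine Finset.prod_congr rfl fun i _ => ?_
  split_ifs with h
  · rw [coordChar_apply]
    split_ifs with h'
    · simp [h']
    · rw [(Int.units_eq_one_or _).resolve_left h']; rfl
  · simp

lemma exists_char_eq_neg_one {g : Grp n} (hg : g ≠ 0) : ∃ χ : Chars n, χ g = -1 := by
  obtain ⟨i, hi⟩ := Function.ne_iff.mp hg
  refine ⟨coordChar i, ?_⟩
  rw [coordChar_apply]
  exact if_neg hi

/-- A proper subgroup of the character group is annihilated by a nonzero element. -/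
lemma exists_annihilated (H : Subgroup (Chars n)) (hH : H ≠ ⊤) :
    ∃ g : Grp n, g ≠ 0 ∧ ∀ χ ∈ H, χ g = 1 := by
  -- The character group is an `𝔽₂`-vector space. A nonzero linear form vanishing on the proper
  -- subspace is an evaluation by biduality, and its point is the required element.
  let _ : Module (ZMod 2) (Additive (Chars n)) := AddCommGroup.zmodModule (n := 2) (fun x => by
    rw [two_nsmul]; exact congrArg Additive.ofMul (Chars.mul_self x.toMul))
  let p : Submodule (ZMod 2) (Additive (Chars n)) := AddSubgroup.toZModSubmodule 2 H.toAddSubgroup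
  have hp : p < ⊤ := by
    rw [lt_top_iff_ne_top]
    intro h
    apply hH
    rw [eq_top_iff]
    intro x _
    have : Additive.ofMul x ∈ p := by rw [h]; trivial
    exact this
  obtain ⟨f, hf, hpf⟩ := Submodule.exists_le_ker_of_lt_top p hp
  let l : Chars n →* ℤˣ :=
    { toFun := fun χ => sgn (f (Additive.ofMul χ))
      map_one' := by simp
      map_mul' := fun χ ψ => by rw [ofMul_mul, map_add, AddChar.map_add_eq_mul] }
  obtain ⟨g, hg⟩ := exists_eval l
  refine ⟨g, ?_, fun χ hχ => ?_⟩
  · rintro rfl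
    apply hf
    ext x
    have := hg x.toMul
    simp only [AddChar.map_zero_eq_one] at this
    change (if f x = (0 : ZMod 2) then (1 : ℤˣ) else -1) = 1 at this
    by_contra h
    rw [if_neg (fun h' => h (by rw [h']; rfl))] at this
    exact absurd this (by decide)
  · rw [← hg χ]
    have : f (Additive.ofMul χ) = 0 := hpf (show Additive.ofMul χ ∈ p from hχ)
    change (if _ = 0 then (1 : ℤˣ) else -1) = 1
    rw [if_pos this]

lemma sum_chars_eq_zero {g : Grp n} (hg : g ≠ 0) : ∑ χ : Chars n, ((χ g : ℤˣ) : ℤ) = 0 := by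
  obtain ⟨χ₀, h₀⟩ := exists_char_eq_neg_one hg
  have h := Equiv.sum_comp (Equiv.mulLeft χ₀) (fun χ : Chars n => ((χ g : ℤˣ) : ℤ))
  simp only [Equiv.coe_mulLeft, AddChar.mul_apply, h₀, Units.val_neg,
    neg_mul, one_mul, Finset.sum_neg_distrib] at h
  omega

/-- The sum of the values of the characters at `g`, and the corresponding orthogonality. -/
lemma sum_elements_eq_zero {χ : Chars n} (hχ : χ ≠ 1) : ∑ g : Grp n, ((χ g : ℤˣ) : ℤ) = 0 := by
  obtain ⟨g₀, h₀⟩ : ∃ g, χ g ≠ 1 := by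
    by_contra! h
    exact hχ (by ext g; simp [h g])
  have h₁ := Chars.eq_neg_one_of_ne_one h₀
  have h := Equiv.sum_comp (Equiv.addLeft g₀) (fun g : Grp n => ((χ g : ℤˣ) : ℤ))
  simp only [Equiv.coe_addLeft, AddChar.map_add_eq_mul, h₁, Units.val_neg,
    neg_mul, one_mul, Finset.sum_neg_distrib] at h
  omega

lemma eps_self (χ : Chars n) (g : Grp n) : 2 * eps χ χ g = 1 - ((χ g : ℤˣ) : ℤ) := by
  unfold eps
  rcases Int.units_eq_one_or (χ g) with h | h <;> rw [h] <;> simp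

/-- A function on the nonzero elements is determined by its sums over the complements of the
kernels of characters. -/
lemma eq_of_sum_eps_eq {x y : {h : Grp n // h ≠ 0} → ℤ}
    (h : ∀ χ : Chars n, ∑ g, eps χ χ g.1 * x g = ∑ g, eps χ χ g.1 * y g) : x = y := by
  funext g₀
  -- Fourier inversion: since `2 * eps χ χ g = 1 - χ g`, multiplying by `χ g₀` and summing over `χ`
  -- kills every term except the one with `g = g₀`.
  have aux : ∀ z : {h : Grp n // h ≠ 0} → ℤ,
      ∑ χ : Chars n, ((χ g₀.1 : ℤˣ) : ℤ) * (2 * ∑ g, eps χ χ g.1 * z g)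
        = - (Fintype.card (Chars n)) * z g₀ := by
    intro z
    have e1 : ∀ χ : Chars n, ((χ g₀.1 : ℤˣ) : ℤ) * (2 * ∑ g, eps χ χ g.1 * z g)
        = ∑ g : {h : Grp n // h ≠ 0},
          (((χ g₀.1 : ℤˣ) : ℤ) * z g - ((χ (g₀.1 + g.1) : ℤˣ) : ℤ) * z g) := by
      intro χ
      rw [Finset.mul_sum, Finset.mul_sum]
      refine Finset.sum_congr rfl fun g _ => ?_
      have := eps_self χ g.1
      rw [AddChar.map_add_eq_mul, Units.val_mul]
      linear_combination ((χ g₀.1 : ℤˣ) : ℤ) * z g * this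
    simp_rw [e1]
    rw [Finset.sum_comm]
    simp_rw [Finset.sum_sub_distrib, ← Finset.sum_mul, sum_chars_eq_zero g₀.2, zero_mul]
    simp only [zero_sub, neg_mul, neg_inj, Finset.sum_const_zero]
    rw [Finset.sum_eq_single g₀]
    · have : g₀.1 + g₀.1 = 0 := by
        ext i; exact CharTwo.add_self_eq_zero _
      rw [this]
      simp
    · intro g _ hg
      have : g₀.1 + g.1 ≠ 0 := by
        intro h0
        apply hg
        apply Subtype.ext
        have h1 : g.1 + g.1 = 0 := by ext i; exact CharTwo.add_self_eq_zero _
        exact add_right_cancel (h1.trans h0.symm)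
      rw [sum_chars_eq_zero this, zero_mul]
    · simp
  have e := aux x
  simp_rw [h, aux y] at e
  have hc : (Fintype.card (Chars n) : ℤ) ≠ 0 := by
    exact_mod_cast Fintype.card_ne_zero
  have : (Fintype.card (Chars n) : ℤ) * (x g₀ - y g₀) = 0 := by linarith
  rcases mul_eq_zero.mp this with h | h
  · exact absurd h hc
  · omega

/-- The extension of the group of characters by `M` attached to a symmetric cocycle. -/
@[ext]
structure TwistedExt (M : Type*) (n : ℕ) where
  base : M
  char : Chars n

/-- Symmetric two-cocycles. -/
structure IsSymmCocycle {M : Type*} [CommGroup M] (c : Chars n → Chars n → M) : Prop where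
  symm : ∀ χ ψ, c χ ψ = c ψ χ
  cocycle : ∀ χ ψ θ, c χ ψ * c (χ * ψ) θ = c ψ θ * c χ (ψ * θ)

lemma IsSymmCocycle.one_left {M : Type*} [CommGroup M] {c : Chars n → Chars n → M}
    (hc : IsSymmCocycle c) (θ : Chars n) : c 1 θ = c 1 1 := by
  have := hc.cocycle 1 1 θ
  simp only [one_mul] at this
  exact (mul_right_cancel this).symm

/-- The group structure on the extension attached to a symmetric cocycle. -/
@[reducible]
def TwistedExt.commGroup {M : Type*} [CommGroup M] {c : Chars n → Chars n → M}
    (hc : IsSymmCocycle c) : CommGroup (TwistedExt M n) :=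
  { mul := fun x y => ⟨x.base * y.base * c x.char y.char, x.char * y.char⟩
    -- The cocycle is not assumed normalized, so the identity carries a correction by `c 1 1`; the
    -- same factor reappears in inverses and in the embedding of `M`.
    one := ⟨(c 1 1)⁻¹, 1⟩
    inv := fun x => ⟨(x.base * c x.char x.char * c 1 1)⁻¹, x.char⟩
    mul_assoc := fun x y z => by
      refine TwistedExt.ext ?_ (mul_assoc x.char y.char z.char)
      change x.base * y.base * c x.char y.char * z.base * c (x.char * y.char) z.char =
        x.base * (y.base * z.base * c y.char z.char) * c x.char (y.char * z.char)
      have := hc.cocycle x.char y.char z.char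
      calc _ = x.base * y.base * z.base * (c x.char y.char * c (x.char * y.char) z.char) := by
            rw [mul_right_comm (x.base * y.base)]; simp only [mul_assoc]
        _ = _ := by rw [this]; simp only [mul_assoc]
    one_mul := fun x => by
      refine TwistedExt.ext ?_ (one_mul x.char)
      change (c 1 1)⁻¹ * x.base * c 1 x.char = x.base
      rw [hc.one_left x.char, mul_right_comm, inv_mul_cancel, one_mul]
    mul_one := fun x => by
      refine TwistedExt.ext ?_ (mul_one x.char)
      change x.base * (c 1 1)⁻¹ * c x.char 1 = x.base
      rw [hc.symm x.char 1, hc.one_left x.char, mul_assoc, inv_mul_cancel, mul_one]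
    inv_mul_cancel := fun x => by
      refine TwistedExt.ext ?_ x.char.mul_self
      change (x.base * c x.char x.char * c 1 1)⁻¹ * x.base * c x.char x.char = (c 1 1)⁻¹
      rw [mul_assoc, mul_inv_rev, mul_assoc, inv_mul_cancel, mul_one]
    mul_comm := fun x y => by
      refine TwistedExt.ext ?_ (mul_comm x.char y.char)
      change x.base * y.base * c x.char y.char = y.base * x.base * c y.char x.char
      rw [hc.symm, mul_comm x.base] }

/-- A symmetric cocycle on an elementary abelian `2`-group becomes, after the coboundary of a
function with prescribed values on the coordinate characters, a product over the common support. -/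
theorem IsSymmCocycle.exists_cochain {M : Type*} [CommGroup M] {c : Chars n → Chars n → M}
    (hc : IsSymmCocycle c) (e : Fin n → M) :
    ∃ a : Chars n → M, ∀ χ ψ, a χ * a ψ * c χ ψ = a (χ * ψ) *
      ∏ i, if bit χ i ∧ bit ψ i
        then e i * e i * c (coordChar i) (coordChar i) * c 1 1 else 1 := by
  let _ := TwistedExt.commGroup hc
  let γ : Fin n → TwistedExt M n := fun i => ⟨e i, coordChar i⟩
  -- Multiplying chosen lifts `γ i` of the coordinate characters gives a set-theoretic section. As
  -- the extension is commutative, `s χ * s ψ` and `s (χ * ψ)` differ only by the squares `γ i * γ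
  -- i` over the common support.
  let s : Chars n → TwistedExt M n := fun χ => ∏ i, if bit χ i then γ i else 1
  let charHom : TwistedExt M n →* Chars n :=
    { toFun := TwistedExt.char, map_one' := rfl, map_mul' := fun _ _ => rfl }
  have hs : ∀ χ, (s χ).char = χ := by
    intro χ
    change charHom (s χ) = χ
    conv_rhs => rw [χ.eq_prod]
    rw [map_prod]
    refine Finset.prod_congr rfl fun i _ => ?_
    split_ifs
    · rfl
    · exact map_one _
  let ι : M →* TwistedExt M n :=
    { toFun := fun m => ⟨m * (c 1 1)⁻¹, 1⟩
      map_one' := by rw [one_mul]; rfl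
      map_mul' := fun m m' => by
        refine TwistedExt.ext ?_ (mul_one _).symm
        change m * m' * (c 1 1)⁻¹ = m * (c 1 1)⁻¹ * (m' * (c 1 1)⁻¹) * c 1 1
        simp only [mul_assoc, inv_mul_cancel, mul_one]
        rw [mul_comm m'] }
  have hmul : ∀ χ ψ, s χ * s ψ = s (χ * ψ) *
      ι (∏ i, if bit χ i ∧ bit ψ i
        then e i * e i * c (coordChar i) (coordChar i) * c 1 1 else 1) := by
    intro χ ψ
    rw [map_prod, ← Finset.prod_mul_distrib, ← Finset.prod_mul_distrib]
    refine Finset.prod_congr rfl fun i _ => ?_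
    have hγ : γ i * γ i = ι (e i * e i * c (coordChar i) (coordChar i) * c 1 1) := by
      refine TwistedExt.ext ?_ (coordChar i).mul_self
      change e i * e i * c (coordChar i) (coordChar i) = _ * _ * _ * _ * _
      rw [mul_assoc _ (c 1 1), mul_inv_cancel, mul_one]
    have := bit_mul χ ψ i
    by_cases h : bit χ i <;> by_cases h' : bit ψ i <;> simp [h, h', this, hγ]
  refine ⟨fun χ => (s χ).base, fun χ ψ => ?_⟩
  have := congrArg TwistedExt.base (hmul χ ψ)
  change (s χ).base * (s ψ).base * c (s χ).char (s ψ).char =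
    (s (χ * ψ)).base * (_ * (c 1 1)⁻¹) * c (s (χ * ψ)).char 1 at this
  rw [hs, hs, hs, hc.symm (χ * ψ) 1, hc.one_left (χ * ψ)] at this
  simpa only [mul_assoc, inv_mul_cancel, mul_one] using this

/-- A symmetric cocycle with values in a group whose elements are squares is a coboundary. -/
theorem IsSymmCocycle.exists_coboundary {M : Type*} [CommGroup M] {c : Chars n → Chars n → M}
    (hc : IsSymmCocycle c) (hM : ∀ m : M, ∃ r, r * r = m) :
    ∃ a : Chars n → M, ∀ χ ψ, a χ * a ψ * c χ ψ = a (χ * ψ) := by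
  choose r hr using hM
  -- These values make the lifts of the coordinate characters involutions of the extension, so every
  -- factor over the common support is trivial.
  obtain ⟨a, ha⟩ := hc.exists_cochain
    (fun i => r (c (coordChar i) (coordChar i) * c 1 1)⁻¹)
  refine ⟨a, fun χ ψ => ?_⟩
  rw [ha]
  simp [hr, mul_assoc]

end Characters

/-! ### Regular local rings of dimension at most one, and nodes -/

section LocalRings

open IsLocalRing

lemma isRegularLocalRing_of_maximalIdeal_eq_span_singleton {S : Type*} [CommRing S] [IsLocalRing S]
    [IsNoetherianRing S] {t : S} (ht : maximalIdeal S = Ideal.span {t}) (hd : ringKrullDim S = 1) :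
    IsRegularLocalRing S := by
  apply IsRegularLocalRing.of_spanFinrank_maximalIdeal_le
  rw [hd, ht]
  have := Submodule.spanFinrank_span_le_ncard_of_finite (R := S) (Set.finite_singleton t)
  rw [Set.ncard_singleton] at this
  exact_mod_cast this

lemma maximalIdeal_fg (S : Type*) [CommRing S] [IsLocalRing S] [IsNoetherianRing S] :
    (maximalIdeal S).FG := (isNoetherianRing_iff_ideal_fg S).mp inferInstance _

lemma IsRegularLocalRing.exists_maximalIdeal_eq_span_singleton {S : Type*} [CommRing S]
    [IsRegularLocalRing S] (hd : ringKrullDim S ≤ 1) :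
    ∃ t, maximalIdeal S = Ideal.span {t} := by
  have h := (IsRegularLocalRing.spanFinrank_maximalIdeal (R := S)).trans_le hd
  have h1 : (maximalIdeal S).spanFinrank ≤ 1 := by exact_mod_cast h
  have hfg := maximalIdeal_fg S
  rw [← Submodule.FG.generators_ncard hfg] at h1
  have hfin : (Submodule.generators (maximalIdeal S)).Finite := Submodule.FG.finite_generators hfg
  rcases (Set.ncard_le_one_iff_eq hfin).mp h1 with h0 | ⟨t, ht⟩
  · refine ⟨0, ?_⟩
    rw [← Submodule.span_generators (maximalIdeal S), h0]
    simp
  · refine ⟨t, ?_⟩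
    rw [← ht]
    exact (Submodule.span_generators (maximalIdeal S)).symm

/-- If `α p² + β p q + γ q²` vanishes to third order with `γ` a unit, the dimension is at most
one. -/
lemma ringKrullDim_le_one_of_isUnit_coeff {S : Type*} [CommRing S] [IsLocalRing S]
    [IsNoetherianRing S] {p q α β γ : S} (hm : maximalIdeal S = Ideal.span {p, q})
    (hγ : IsUnit γ) (h : α * p ^ 2 + β * p * q + γ * q ^ 2 ∈ maximalIdeal S ^ 3) :
    ringKrullDim S ≤ 1 := by
  set m := maximalIdeal S with hm_def
  have hq : q ^ 2 ∈ Ideal.span {p} ⊔ m • m ^ 2 := by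
    obtain ⟨g, hg⟩ := hγ.exists_right_inv
    have e : q ^ 2 = -(g * (α * p + β * q)) * p +
        g * (α * p ^ 2 + β * p * q + γ * q ^ 2) := by
      linear_combination (- q ^ 2) * hg
    rw [e]
    refine Submodule.add_mem_sup (Ideal.mul_mem_left _ _ (Ideal.mem_span_singleton_self p)) ?_
    rw [smul_eq_mul, ← pow_succ']
    exact Ideal.mul_mem_left _ _ h
  -- All products of generators other than `q ^ 2` are multiples of `p`. Nakayama then gives `m ^ 2
  -- ≤ (p)`, so `m` is minimal over a principal ideal and Krull's theorem applies.
  have hle : m ^ 2 ≤ Ideal.span {p} ⊔ m • m ^ 2 := by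
    conv_lhs => rw [sq, hm]
    rw [Ideal.mul_le]
    intro r hr s hs
    obtain ⟨a, b, rfl⟩ := Ideal.mem_span_pair.mp hr
    obtain ⟨c, d, rfl⟩ := Ideal.mem_span_pair.mp hs
    have e : (a * p + b * q) * (c * p + d * q) =
        (a * (c * p + d * q) + b * q * c) * p + b * d * q ^ 2 := by ring
    rw [e]
    exact Ideal.add_mem _ (Ideal.mem_sup_left
      (Ideal.mul_mem_left _ _ (Ideal.mem_span_singleton_self p))) (Ideal.mul_mem_left _ _ hq)
  have hle' : m ^ 2 ≤ Ideal.span {p} :=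
    Submodule.le_of_le_smul_of_le_jacobson_bot ((isNoetherianRing_iff_ideal_fg S).mp inferInstance _)
      (maximalIdeal_le_jacobson _) hle
  have hmin : m ∈ (Ideal.span {p}).minimalPrimes := by
    refine ⟨⟨(maximalIdeal.isMaximal S).isPrime, ?_⟩, ?_⟩
    · rw [hm]; exact Ideal.span_mono (by simp)
    · rintro P ⟨hP, hpP⟩ _
      intro x hx
      exact hP.mem_of_pow_mem 2 (hpP (hle' (Ideal.pow_mem_pow hx 2)))
  have := Ideal.height_le_one_of_isPrincipal_of_mem_minimalPrimes (Ideal.span {p}) m hmin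
  rw [← maximalIdeal_height_eq_ringKrullDim]
  exact_mod_cast this

/-- A unit among the coefficients would allow a choice of generators in which the coefficient of the
square of one generator is a unit, forcing dimension at most one. In dimension two, then, quadratic
forms are independent modulo `𝔪³`. -/
lemma coeff_mem_of_quadratic_mem {S : Type*} [CommRing S] [IsRegularLocalRing S]
    (hd : ringKrullDim S = 2) {p q α β γ : S} (hm : maximalIdeal S = Ideal.span {p, q})
    (h : α * p ^ 2 + β * p * q + γ * q ^ 2 ∈ maximalIdeal S ^ 3) :
    α ∈ maximalIdeal S ∧ β ∈ maximalIdeal S ∧ γ ∈ maximalIdeal S := by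
  have hd' : ¬ ringKrullDim S ≤ 1 := by rw [hd]; decide
  have hγ : γ ∈ maximalIdeal S := by
    by_contra hγ
    rw [mem_maximalIdeal, mem_nonunits_iff, not_not] at hγ
    exact hd' (ringKrullDim_le_one_of_isUnit_coeff hm hγ h)
  have hα : α ∈ maximalIdeal S := by
    by_contra hα
    rw [mem_maximalIdeal, mem_nonunits_iff, not_not] at hα
    rw [Set.pair_comm] at hm
    refine hd' (ringKrullDim_le_one_of_isUnit_coeff (α := γ) (β := β) hm hα ?_)
    convert h using 1; ring
  refine ⟨hα, ?_, hγ⟩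
  by_contra hβ
  rw [mem_maximalIdeal, mem_nonunits_iff, not_not] at hβ
  -- In the coordinates `p - q`, `q` the coefficient of `q ^ 2` is `α + β + γ`, which is a unit when
  -- only `β` is.
  have hm' : maximalIdeal S = Ideal.span {p - q, q} := by
    rw [hm]
    apply le_antisymm <;> rw [Ideal.span_le, Set.insert_subset_iff, Set.singleton_subset_iff]
    · exact ⟨Ideal.mem_span_pair.mpr ⟨1, 1, by ring⟩, Ideal.mem_span_pair.mpr ⟨0, 1, by ring⟩⟩
    · exact ⟨Ideal.mem_span_pair.mpr ⟨1, -1, by ring⟩, Ideal.mem_span_pair.mpr ⟨0, 1, by ring⟩⟩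
  have hu : IsUnit (α + β + γ) := by
    by_contra hu
    have : α + β + γ ∈ maximalIdeal S := hu
    have h2 : β ∈ maximalIdeal S := by
      have := Ideal.sub_mem _ (Ideal.sub_mem _ this hα) hγ
      convert this using 1; ring
    exact h2 hβ
  refine hd' (ringKrullDim_le_one_of_isUnit_coeff (α := α) (β := 2 * α + β) hm' hu ?_)
  convert h using 1; ring

/-- The two properties shared by nodes and regular local rings of dimension at most one: the
embedding dimension is at most two, and `x² ∈ 𝔪³` only for `x ∈ 𝔪²`. -/
def NodeLike (S : Type*) [CommRing S] [IsLocalRing S] : Prop :=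
  (∃ p q, maximalIdeal S = Ideal.span {p, q}) ∧
    ∀ x ∈ maximalIdeal S, x ^ 2 ∈ maximalIdeal S ^ 3 → x ∈ maximalIdeal S ^ 2

lemma IsRegularLocalRing.nodeLike {S : Type*} [CommRing S] [IsRegularLocalRing S]
    (hd : ringKrullDim S ≤ 1) : NodeLike S := by
  obtain ⟨t, ht⟩ := IsRegularLocalRing.exists_maximalIdeal_eq_span_singleton hd
  refine ⟨⟨t, t, by simpa using ht⟩, fun x hx hx3 => ?_⟩
  have hx' := hx
  rw [ht, Ideal.mem_span_singleton'] at hx'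
  obtain ⟨a, rfl⟩ := hx'
  have htm : t ∈ maximalIdeal S := by rw [ht]; exact Ideal.mem_span_singleton_self t
  by_cases ha : IsUnit a
  · obtain ⟨b, hb⟩ := ha.exists_right_inv
    -- If `a` were a unit, Nakayama would give `𝔪² = 0`, hence dimension zero; regularity then makes
    -- the maximal ideal zero, and the claim is trivial.
    have ht3 : t ^ 2 ∈ maximalIdeal S ^ 3 := by
      have := Ideal.mul_mem_left _ (b ^ 2) hx3
      have e : b ^ 2 * (a * t) ^ 2 = t ^ 2 := by
        linear_combination (t ^ 2 * (a * b + 1)) * hb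
      rwa [e] at this
    have hle : maximalIdeal S ^ 2 ≤ maximalIdeal S • maximalIdeal S ^ 2 := by
      rw [smul_eq_mul, ← pow_succ']
      conv_lhs => rw [ht]
      rw [Ideal.span_singleton_pow, Ideal.span_singleton_le_iff_mem]
      exact ht3
    have h0 := Submodule.eq_bot_of_le_smul_of_le_jacobson_bot _ _
      ((isNoetherianRing_iff_ideal_fg S).mp inferInstance _) hle (maximalIdeal_le_jacobson _)
    have hdim : ringKrullDim S ≤ 0 := by
      rw [← maximalIdeal_height_eq_ringKrullDim]
      have : (maximalIdeal S) ∈ minimalPrimes S := by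
        refine ⟨⟨(maximalIdeal.isMaximal S).isPrime, bot_le⟩, ?_⟩
        rintro P ⟨hP, _⟩ _ x hx
        refine hP.mem_of_pow_mem 2 ?_
        have := Ideal.pow_mem_pow hx 2
        rw [h0] at this
        rw [(Submodule.mem_bot S).mp this]
        exact zero_mem _
      rw [Ideal.height_eq_zero_iff.mpr this]
      rfl
    have hs : (maximalIdeal S).spanFinrank = 0 := by
      have := (IsRegularLocalRing.spanFinrank_maximalIdeal (R := S)).trans_le hdim
      have h1 : (maximalIdeal S).spanFinrank ≤ 0 := by exact_mod_cast this
      omega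
    have : maximalIdeal S = ⊥ := by
      rw [← Submodule.FG.generators_ncard (maximalIdeal_fg S),
        Set.ncard_eq_zero (Submodule.FG.finite_generators (maximalIdeal_fg S))] at hs
      rw [← Submodule.span_generators (maximalIdeal S), hs]
      simp
    rw [this] at hx
    rw [(Submodule.mem_bot S).mp hx]
    exact zero_mem _
  · rw [sq]
    exact Ideal.mul_mem_mul ha htm

/-- If `x²` vanishes to third order on the node, then the square of a linear form equals `g` times
the quadratic leading form modulo `𝔪³`. The square has discriminant zero and the leading form does
not, so `g` is in the maximal ideal, and with it the coefficients of the linear form. -/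
lemma IsNode.nodeLike {R : Type u} [CommRing R] [IsLocalRing R] (h : IsNode R) : NodeLike R := by
  obtain ⟨S, _, _, p, q, a, b, c, F, hd, hm, hF, hu, ⟨e⟩⟩ := h
  let f : S →+* R := (e.symm : _ →+* R).comp (Ideal.Quotient.mk (Ideal.span {F}))
  have hf : Function.Surjective f := e.symm.surjective.comp Ideal.Quotient.mk_surjective
  have hker : ∀ x, f x = 0 ↔ ∃ g, g * F = x := by
    intro x
    rw [← Ideal.mem_span_singleton', ← Ideal.Quotient.eq_zero_iff_mem]
    exact EmbeddingLike.map_eq_zero_iff (f := e.symm)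
  have hmap : maximalIdeal R = (maximalIdeal S).map f := by
    symm
    refine IsLocalRing.eq_maximalIdeal ?_
    refine Or.resolve_left (Ideal.map_eq_top_or_isMaximal_of_surjective f hf
      (maximalIdeal.isMaximal S)) ?_
    intro htop
    have h1 : (1 : R) ∈ (maximalIdeal S).map f := by rw [htop]; trivial
    obtain ⟨x, hx, hx1⟩ := (Ideal.mem_map_iff_of_surjective f hf).mp h1
    obtain ⟨g, hg⟩ := (hker (x - 1)).mp (by rw [map_sub, hx1, map_one, sub_self])
    have hpm : p ∈ maximalIdeal S := by rw [hm]; exact Ideal.subset_span (by simp)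
    have hqm : q ∈ maximalIdeal S := by rw [hm]; exact Ideal.subset_span (by simp)
    have hFm : F ∈ maximalIdeal S := by
      have h3 : F - (a * p ^ 2 + b * p * q + c * q ^ 2) ∈ maximalIdeal S :=
        Ideal.pow_le_self (by norm_num) hF
      have h4 : a * p ^ 2 + b * p * q + c * q ^ 2 ∈ maximalIdeal S :=
        Ideal.add_mem _ (Ideal.add_mem _ (Ideal.mul_mem_left _ _ (Ideal.pow_mem_of_mem _ hpm 2
          (by norm_num))) (Ideal.mul_mem_left _ _ hqm))
          (Ideal.mul_mem_left _ _ (Ideal.pow_mem_of_mem _ hqm 2 (by norm_num)))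
      simpa using Ideal.add_mem _ h3 h4
    have h5 : (1 : S) ∈ maximalIdeal S := by
      have := Ideal.sub_mem _ hx (Ideal.mul_mem_left _ g hFm)
      rw [hg] at this
      simp at this
    exact (maximalIdeal.isMaximal S).ne_top ((Ideal.eq_top_iff_one _).mpr h5)
  refine ⟨⟨f p, f q, ?_⟩, ?_⟩
  · rw [hmap, hm, Ideal.map_span, Set.image_pair]
  · intro x hx hx3
    rw [hmap] at hx
    obtain ⟨X, hX, rfl⟩ := (Ideal.mem_map_iff_of_surjective f hf).mp hx
    rw [hmap, ← Ideal.map_pow] at hx3 ⊢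
    obtain ⟨Z, hZ, hZX⟩ := (Ideal.mem_map_iff_of_surjective f hf).mp hx3
    obtain ⟨g, hg⟩ := (hker (X ^ 2 - Z)).mp (by rw [map_sub, hZX, map_pow, sub_self])
    obtain ⟨α, β, hαβ⟩ := Ideal.mem_span_pair.mp (hm ▸ hX)
    have hq : (α ^ 2 - g * a) * p ^ 2 + (2 * α * β - g * b) * p * q + (β ^ 2 - g * c) * q ^ 2 ∈
        maximalIdeal S ^ 3 := by
      have := Ideal.add_mem _ (Ideal.mul_mem_left _ g hF) hZ
      convert this using 1
      rw [← hαβ] at hg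
      linear_combination -hg
    obtain ⟨h1, h2, h3⟩ := coeff_mem_of_quadratic_mem hd hm hq
    have hprime := (maximalIdeal.isMaximal S).isPrime
    have hg0 : g ∈ maximalIdeal S := by
      -- Comparison of discriminants: the left side is the discriminant of `g` times the leading
      -- form, congruent to that of a square, which vanishes.
      have : g ^ 2 * (b ^ 2 - 4 * a * c) ∈ maximalIdeal S := by
        have e : g ^ 2 * (b ^ 2 - 4 * a * c) =
            - (2 * α * β + g * b) * (2 * α * β - g * b) + 4 * β ^ 2 * (α ^ 2 - g * a)
              + 4 * g * a * (β ^ 2 - g * c) := by ring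
        rw [e]
        exact Ideal.add_mem _ (Ideal.add_mem _ (Ideal.mul_mem_left _ _ h2)
          (Ideal.mul_mem_left _ _ h1)) (Ideal.mul_mem_left _ _ h3)
      rcases hprime.mem_or_mem this with h | h
      · exact hprime.mem_of_pow_mem 2 h
      · exact absurd hu h
    have hα : α ∈ maximalIdeal S := by
      refine hprime.mem_of_pow_mem 2 ?_
      simpa using Ideal.add_mem _ h1 (Ideal.mul_mem_right a _ hg0)
    have hβ : β ∈ maximalIdeal S := by
      refine hprime.mem_of_pow_mem 2 ?_
      simpa using Ideal.add_mem _ h3 (Ideal.mul_mem_right c _ hg0)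
    refine Ideal.mem_map_of_mem f ?_
    rw [← hαβ, sq]
    exact Ideal.add_mem _
      (Ideal.mul_mem_mul hα (by rw [hm]; exact Ideal.subset_span (by simp)))
      (Ideal.mul_mem_mul hβ (by rw [hm]; exact Ideal.subset_span (by simp)))

/-- Three elements of the maximal ideal of a local ring of embedding dimension at most two are
dependent modulo the square of the maximal ideal. -/
lemma NodeLike.exists_relation {S : Type*} [CommRing S] [IsLocalRing S] (h : NodeLike S)
    {x : Fin 3 → S} (hx : ∀ i, x i ∈ maximalIdeal S) :
    ∃ c : Fin 3 → S, (∃ i, c i ∉ maximalIdeal S) ∧ ∑ i, c i * x i ∈ maximalIdeal S ^ 2 := by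
  obtain ⟨⟨p, q, hpq⟩, -⟩ := h
  have h' : ∀ i, ∃ a b, a * p + b * q = x i := fun i =>
    Ideal.mem_span_pair.mp (hpq ▸ hx i)
  choose a b hab using h'
  -- Coefficients with respect to `p` and `q` modulo the maximal ideal: three vectors in a plane are
  -- dependent.
  let v : Fin 3 → Fin 2 → ResidueField S := fun i => ![residue S (a i), residue S (b i)]
  have hv : ¬ LinearIndependent (ResidueField S) v := by
    intro hv
    have := hv.fintype_card_le_finrank
    simp at this
  obtain ⟨g, hg, i, hi⟩ := Fintype.not_linearIndependent_iff.mp hv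
  choose c hc using fun i => residue_surjective (g i)
  refine ⟨c, ⟨i, fun h => hi ?_⟩, ?_⟩
  · rw [← hc i]; exact (residue_eq_zero_iff _).mpr h
  · have h0 : ∑ i, c i * a i ∈ maximalIdeal S := by
      rw [← residue_eq_zero_iff, map_sum]
      have := congrFun hg 0
      simpa [v, hc] using this
    have h1 : ∑ i, c i * b i ∈ maximalIdeal S := by
      rw [← residue_eq_zero_iff, map_sum]
      have := congrFun hg 1
      simpa [v, hc] using this
    have e : ∑ i, c i * x i = (∑ i, c i * a i) * p + (∑ i, c i * b i) * q := by
      rw [Finset.sum_mul, Finset.sum_mul, ← Finset.sum_add_distrib]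
      exact Finset.sum_congr rfl fun i _ => by rw [← hab]; ring
    rw [e, sq]
    exact Ideal.add_mem _
      (Ideal.mul_mem_mul h0 (by rw [hpq]; exact Ideal.subset_span (by simp)))
      (Ideal.mul_mem_mul h1 (by rw [hpq]; exact Ideal.subset_span (by simp)))

end LocalRings

/-! ### Nodes as double covers -/

section NodeConstruction

open IsLocalRing Polynomial

/-- A double cover `z² = v t²` of a one-dimensional ring with local parameter `t` has a node where
`t` and `z` generate the maximal ideal. -/
theorem isNode_of_double_cover {B₁ B S : Type u} [CommRing B₁] [CommRing B] [CommRing S]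
    [IsNoetherianRing B₁] [Algebra B₁ B] [Algebra B S] (Q : Ideal B) [Q.IsPrime]
    [IsLocalization.AtPrime S Q] (hd : ringKrullDim S = 1) {t v : B₁} {z : B}
    (h2 : IsUnit (2 : B₁)) (hv : IsUnit v)
    (hz : z ^ 2 = algebraMap B₁ B (v * t ^ 2))
    (hspan : ∀ b : B, ∃ a a' : B₁, b = algebraMap B₁ B a + algebraMap B₁ B a' * z)
    (hindep : ∀ a a' : B₁, algebraMap B₁ B a + algebraMap B₁ B a' * z = 0 → a = 0 ∧ a' = 0)
    (htQ : algebraMap B₁ B t ∈ Q) (hzQ : z ∈ Q)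
    (hQ : ∀ q ∈ Q, ∃ s ∉ Q, s * q ∈ Ideal.span {algebraMap B₁ B t, z}) : IsNode S := by
  let φ : B₁[X] →+* B := eval₂RingHom (algebraMap B₁ B) z
  let F₀ : B₁[X] := X ^ 2 - C (v * t ^ 2)
  have hF₀ : F₀.Monic := monic_X_pow_sub_C _ (by norm_num)
  have hdeg : F₀.degree ≤ (2 : ℕ) := by
    refine (degree_sub_le _ _).trans (max_le (by simpa using degree_X_pow_le 2) ?_)
    exact degree_C_le.trans (by norm_num)
  have hφX : φ X = z := by simp [φ]
  have hφC : ∀ a, φ (C a) = algebraMap B₁ B a := fun a => by simp [φ]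
  have hφF : φ F₀ = 0 := by
    simp only [F₀, map_sub, map_pow, hφX, hφC, hz, sub_self]
  have hφsurj : Function.Surjective φ := by
    intro b
    obtain ⟨a, a', rfl⟩ := hspan b
    exact ⟨C a + C a' * X, by rw [map_add, map_mul, hφC, hφC, hφX]⟩
  -- Division by the monic `F₀` leaves a remainder of degree at most one, which vanishes by the
  -- independence of `1` and `z` over `B₁`. Thus `B` is `B₁[X] / (F₀)`.
  have hφker : ∀ f, φ f = 0 → ∃ g, f = F₀ * g := by
    intro f hf
    refine ⟨f /ₘ F₀, ?_⟩
    have e := modByMonic_add_div f F₀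
    have hr : φ (f %ₘ F₀) = 0 := by
      have := congrArg φ e
      rwa [map_add, map_mul, hφF, zero_mul, add_zero, hf] at this
    have hlt : (f %ₘ F₀).degree < (2 : ℕ) := by
      by_cases hB : Nontrivial B₁
      · exact (degree_modByMonic_lt f hF₀).trans_le hdeg
      · rw [not_nontrivial_iff_subsingleton] at hB
        rw [Subsingleton.elim (f %ₘ F₀) 0, degree_zero]
        exact WithBot.bot_lt_coe 2
    have hr' : f %ₘ F₀ = C ((f %ₘ F₀).coeff 0) + C ((f %ₘ F₀).coeff 1) * X := by
      ext i
      simp only [coeff_add, coeff_C, coeff_C_mul, coeff_X]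
      match i with
      | 0 => simp
      | 1 => simp
      | (i + 2) =>
        rw [coeff_eq_zero_of_degree_lt (hlt.trans_le (by exact_mod_cast (by omega)))]
        simp
    rw [hr', map_add, map_mul, hφC, hφC, hφX] at hr
    obtain ⟨h0, h1⟩ := hindep _ _ hr
    rw [hr', h0, h1] at e
    simpa using e.symm
  -- The ambient regular ring is the localization of the polynomial ring `B₁[X]` at the preimage of
  -- `Q`. Its regularity is not inherited from `B₁`: it follows from the two generators of its
  -- maximal ideal and its dimension.
  let P : Ideal B₁[X] := Q.comap φ
  have hP : P.IsPrime := Ideal.comap_isPrime φ Q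
  let S₀ := Localization.AtPrime P
  have : IsNoetherianRing S₀ := IsLocalization.isNoetherianRing P.primeCompl S₀ inferInstance
  let ψ : B₁[X] →+* S := (algebraMap B S).comp φ
  have hψ : ∀ y : P.primeCompl, IsUnit (ψ y) := fun y =>
    IsLocalization.map_units (M := Q.primeCompl) S ⟨φ y, y.2⟩
  let g : S₀ →+* S := IsLocalization.lift hψ
  have hg : ∀ x, g (algebraMap B₁[X] S₀ x) = algebraMap B S (φ x) := fun x =>
    IsLocalization.lift_eq hψ x
  have hgsurj : Function.Surjective g := by
    intro y
    obtain ⟨b, s, rfl⟩ := IsLocalization.exists_mk'_eq Q.primeCompl y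
    obtain ⟨f, rfl⟩ := hφsurj b
    obtain ⟨w, hw⟩ := hφsurj s
    have hwP : w ∈ P.primeCompl := by
      change φ w ∉ Q; rw [hw]; exact s.2
    refine ⟨IsLocalization.mk' S₀ f ⟨w, hwP⟩, ?_⟩
    rw [IsLocalization.lift_mk'_spec]
    change ψ f = algebraMap B S (φ w) * _
    rw [hw, mul_comm, IsLocalization.mk'_spec]
    rfl
  let F : S₀ := algebraMap B₁[X] S₀ F₀
  have hgker : RingHom.ker g = Ideal.span {F} := by
    apply le_antisymm
    · intro x hx
      obtain ⟨f, s, rfl⟩ := IsLocalization.exists_mk'_eq P.primeCompl x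
      rw [RingHom.mem_ker, IsLocalization.lift_mk'_spec, mul_zero] at hx
      change algebraMap B S (φ f) = 0 at hx
      rw [IsLocalization.map_eq_zero_iff Q.primeCompl S] at hx
      obtain ⟨w, hw⟩ := hx
      obtain ⟨w', hw'⟩ := hφsurj w
      have hwP : w' ∈ P.primeCompl := by
        change φ w' ∉ Q; rw [hw']; exact w.2
      rw [← hw', ← map_mul] at hw
      obtain ⟨g', hg'⟩ := hφker _ hw
      rw [Ideal.mem_span_singleton]
      have h1 : F ∣ algebraMap B₁[X] S₀ (w' * f) := by rw [hg', map_mul]; exact dvd_mul_right _ _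
      rw [map_mul] at h1
      have h2 : F ∣ algebraMap B₁[X] S₀ f :=
        (IsUnit.dvd_mul_left (IsLocalization.map_units (M := P.primeCompl) S₀ ⟨w', hwP⟩)).mp h1
      rw [← IsLocalization.mk'_spec S₀ f s] at h2
      exact (IsUnit.dvd_mul_right (IsLocalization.map_units S₀ s)).mp h2
    · rw [Ideal.span_singleton_le_iff_mem, RingHom.mem_ker, hg, hφF, map_zero]
  let e : S₀ ⧸ Ideal.span {F} ≃+* S :=
    (Ideal.quotEquivOfEq hgker.symm).trans (RingHom.quotientKerEquivOfSurjective hgsurj)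
  let p : S₀ := algebraMap B₁[X] S₀ (C t)
  let q : S₀ := algebraMap B₁[X] S₀ X
  have hpm : p ∈ maximalIdeal S₀ := (IsLocalization.AtPrime.to_map_mem_maximal_iff S₀ P _).mpr
    (show φ (C t) ∈ Q by rwa [hφC])
  have hqm : q ∈ maximalIdeal S₀ := (IsLocalization.AtPrime.to_map_mem_maximal_iff S₀ P _).mpr
    (show φ X ∈ Q by rwa [hφX])
  have hFpq : F = -algebraMap B₁[X] S₀ (C v) * p ^ 2 + 0 * p * q + 1 * q ^ 2 := by
    simp only [F, F₀, p, q, map_sub, map_pow, map_mul]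
    ring
  have hm : maximalIdeal S₀ = Ideal.span {p, q} := by
    apply le_antisymm
    · rw [← IsLocalization.AtPrime.map_eq_maximalIdeal P S₀, Ideal.map_le_iff_le_comap]
      intro f hf
      obtain ⟨s, hs, hsf⟩ := hQ (φ f) hf
      obtain ⟨a, b, hab⟩ := Ideal.mem_span_pair.mp hsf
      obtain ⟨s', rfl⟩ := hφsurj s
      obtain ⟨a', rfl⟩ := hφsurj a
      obtain ⟨b', rfl⟩ := hφsurj b
      obtain ⟨c, hc⟩ := hφker (s' * f - (a' * C t + b' * X)) (by
        rw [map_sub, map_add, map_mul, map_mul, map_mul, hφC, hφX, hab, sub_self])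
      have hmem : algebraMap B₁[X] S₀ (s' * f) ∈ Ideal.span {p, q} := by
        have : s' * f = a' * C t + b' * X + F₀ * c := by rw [← hc]; ring
        rw [this, map_add, map_add, map_mul, map_mul, map_mul]
        change _ * p + _ * q + F * _ ∈ _
        rw [hFpq]
        refine Ideal.mem_span_pair.mpr ⟨algebraMap _ _ a' - algebraMap B₁[X] S₀ (C v) * p *
          algebraMap _ _ c, algebraMap _ _ b' + q * algebraMap _ _ c, ?_⟩
        ring
      rw [map_mul] at hmem
      exact (Ideal.unit_mul_mem_iff_mem _
        (IsLocalization.map_units (M := P.primeCompl) S₀ ⟨s', hs⟩)).mp hmem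
    · rw [Ideal.span_le, Set.insert_subset_iff, Set.singleton_subset_iff]
      exact ⟨hpm, hqm⟩
  have hle : (maximalIdeal S₀).spanFinrank ≤ 2 := by
    rw [hm]
    refine (Submodule.spanFinrank_span_le_ncard_of_finite (Set.toFinite _)).trans ?_
    exact (Set.ncard_insert_le p {q}).trans (by rw [Set.ncard_singleton])
  have hFnzd : F ∈ nonZeroDivisors S₀ :=
    IsLocalization.map_nonZeroDivisors_le P.primeCompl S₀
      (Submonoid.mem_map_of_mem _ hF₀.mem_nonZeroDivisors)
  -- Dividing by the nonzerodivisor `F` drops the dimension by at least one, and the quotient `S`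
  -- has dimension one.
  have hge : 2 ≤ ringKrullDim S₀ := by
    have := ringKrullDim_quotient_succ_le_of_nonZeroDivisor hFnzd
    rw [ringKrullDim_eq_of_ringEquiv e, hd] at this
    exact this
  have hreg : IsRegularLocalRing S₀ := by
    apply IsRegularLocalRing.of_spanFinrank_maximalIdeal_le
    refine le_trans ?_ hge
    exact_mod_cast hle
  refine ⟨S₀, inferInstance, hreg, p, q, -algebraMap B₁[X] S₀ (C v), 0, 1, F, ?_, hm, ?_, ?_,
    ⟨e.symm⟩⟩
  · apply le_antisymm _ hge
    refine (ringKrullDim_le_spanFinrank_maximalIdeal S₀).trans ?_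
    exact_mod_cast hle
  · rw [hFpq, sub_self]
    exact zero_mem _
  · have : (0 : S₀) ^ 2 - 4 * (-algebraMap B₁[X] S₀ (C v)) * 1 =
        algebraMap B₁[X] S₀ (C (2 * 2 * v)) := by
      simp only [map_mul, map_ofNat]
      ring
    rw [this]
    exact ((h2.mul h2).mul hv).map ((algebraMap B₁[X] S₀).comp C)

end NodeConstruction

/-! ### Combinatorics of the structure constants over a discrete valuation ring -/

section Combinatorics

variable {n : ℕ}

/-- The exponents of the structure constants of an algebra with a basis indexed by the
characters. -/
def IsExponent (e : Chars n → Chars n → ℕ) : Prop :=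
  ∀ χ ψ, 2 * e χ ψ + e (χ * ψ) (χ * ψ) = e χ χ + e ψ ψ

lemma eps_exponent (χ ψ : Chars n) (g : Grp n) :
    2 * eps χ ψ g + eps (χ * ψ) (χ * ψ) g = eps χ χ g + eps ψ ψ g := by
  unfold eps
  rw [AddChar.mul_apply]
  rcases Int.units_eq_one_or (χ g) with h | h <;> rcases Int.units_eq_one_or (ψ g) with h' | h' <;>
    rw [h, h'] <;> decide

lemma sum_eps_exponent (m : {h : Grp n // h ≠ 0} → ℤ) (χ ψ : Chars n) :
    2 * ∑ h, eps χ ψ h.1 * m h + ∑ h, eps (χ * ψ) (χ * ψ) h.1 * m h =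
      ∑ h, eps χ χ h.1 * m h + ∑ h, eps ψ ψ h.1 * m h := by
  rw [Finset.mul_sum, ← Finset.sum_add_distrib, ← Finset.sum_add_distrib]
  refine Finset.sum_congr rfl fun h _ => ?_
  linear_combination m h * eps_exponent χ ψ h.1

lemma Chars.mul_mul_self (χ ψ : Chars n) : χ * ψ * ψ = χ := by
  rw [mul_assoc, ψ.mul_self, mul_one]

namespace IsExponent

variable {e : Chars n → Chars n → ℕ} (he : IsExponent e)

include he

lemma diag_one : e 1 1 = 0 := by
  have := he 1 1
  rw [mul_one] at this
  omega

/-- The exponent relation for `χ, ψ` gives one inequality, and the relation for `χ * ψ, ψ` gives the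
other. Multiplying by an invertible basis element therefore does not change the exponent. -/
lemma diag_mul_of_eq_zero {χ ψ : Chars n} (h : e ψ ψ = 0) : e (χ * ψ) (χ * ψ) = e χ χ := by
  have h1 := he χ ψ
  have h2 := he (χ * ψ) ψ
  rw [Chars.mul_mul_self] at h2
  omega

lemma eq_zero_of_left {χ ψ : Chars n} (h : e χ χ = 0) : e χ ψ = 0 := by
  have h1 := he χ ψ
  rw [mul_comm χ ψ, he.diag_mul_of_eq_zero h] at h1
  omega

/-- The characters with unit structure constants. -/
def unitSubgroup : Subgroup (Chars n) where
  carrier := {χ | e χ χ = 0}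
  one_mem' := he.diag_one
  mul_mem' := fun {χ ψ} hχ hψ => (he.diag_mul_of_eq_zero hψ).trans hχ
  inv_mem' := fun {χ} hχ => by rw [Chars.inv_eq]; exact hχ

lemma mem_unitSubgroup {χ : Chars n} : χ ∈ he.unitSubgroup ↔ e χ χ = 0 := Iff.rfl

end IsExponent

/-- The subgroup generated by a subgroup and one more character. -/
def adjoinChar (H : Subgroup (Chars n)) (α : Chars n) : Subgroup (Chars n) where
  carrier := {χ | χ ∈ H ∨ χ * α ∈ H}
  one_mem' := Or.inl H.one_mem
  mul_mem' := by
    rintro χ ψ (h | h) (h' | h')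
    · exact Or.inl (H.mul_mem h h')
    · exact Or.inr (by rw [mul_assoc]; exact H.mul_mem h h')
    · exact Or.inr (by rw [mul_right_comm]; exact H.mul_mem h h')
    · refine Or.inl ?_
      have := H.mul_mem h h'
      rwa [mul_mul_mul_comm, α.mul_self, mul_one] at this
  inv_mem' := fun {χ} hχ => by rw [Chars.inv_eq]; exact hχ

lemma mem_adjoinChar {H : Subgroup (Chars n)} {α χ : Chars n} :
    χ ∈ adjoinChar H α ↔ χ ∈ H ∨ χ * α ∈ H := Iff.rfl

/-- A subgroup of index two is the annihilator of an element. -/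
lemma exists_mem_iff_apply_eq_one {H : Subgroup (Chars n)} {α : Chars n} (hα : α ∉ H)
    (h : adjoinChar H α = ⊤) : ∃ g : {g : Grp n // g ≠ 0}, ∀ χ : Chars n, χ ∈ H ↔ χ g.1 = 1 := by
  classical
  have hor : ∀ χ, χ ∈ H ∨ χ * α ∈ H := fun χ => by
    have : χ ∈ adjoinChar H α := by rw [h]; trivial
    exact this
  let l : Chars n →* ℤˣ :=
    { toFun := fun χ => if χ ∈ H then 1 else -1
      map_one' := if_pos H.one_mem
      map_mul' := fun χ ψ => by
        by_cases h1 : χ ∈ H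
        · rw [if_pos h1, one_mul]
          exact if_congr (H.mul_mem_cancel_left h1) rfl rfl
        · by_cases h2 : ψ ∈ H
          · rw [if_pos h2, mul_one]
            exact if_congr (H.mul_mem_cancel_right h2) rfl rfl
          · have := H.mul_mem ((hor χ).resolve_left h1) ((hor ψ).resolve_left h2)
            rw [mul_mul_mul_comm, α.mul_self, mul_one] at this
            rw [if_neg h1, if_neg h2, if_pos this]; rfl }
  obtain ⟨g, hg⟩ := exists_eval l
  have hmem : ∀ χ : Chars n, χ ∈ H ↔ χ g = 1 := by
    intro χ
    rw [← hg χ]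
    change _ ↔ (if χ ∈ H then (1 : ℤˣ) else -1) = 1
    split_ifs with h1
    · simp [h1]
    · simp only [h1, false_iff]; decide
  refine ⟨⟨g, ?_⟩, hmem⟩
  rintro rfl
  exact hα ((hmem α).mpr (AddChar.map_zero_eq_one α))

/-- The indecomposable characters: the basis elements which are part of a minimal system of
generators of the maximal ideal. -/
def IsExponent.Indecomposable (e : Chars n → Chars n → ℕ) (χ : Chars n) : Prop :=
  e χ χ ≠ 0 ∧ ∀ ψ, e ψ ψ ≠ 0 → e (χ * ψ) (χ * ψ) ≠ 0 → e ψ (χ * ψ) ≠ 0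

namespace IsExponent

variable {e : Chars n → Chars n → ℕ} (he : IsExponent e)

include he

/-- Induction on `e χ χ`: a decomposable `χ` splits as `ψ` times `χ * ψ` without loss of a power of
`π`, so the two diagonal exponents are positive and add up to `e χ χ`. -/
lemma eq_top_of_indecomposable_mem {H : Subgroup (Chars n)} (h0 : he.unitSubgroup ≤ H)
    (h1 : ∀ χ, Indecomposable e χ → χ ∈ H) : H = ⊤ := by
  rw [eq_top_iff]
  intro χ _
  induction hd : e χ χ using Nat.strong_induction_on generalizing χ with
  | _ d ih =>
  subst hd
  by_cases hχ0 : e χ χ = 0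
  · exact h0 hχ0
  by_cases hχ : Indecomposable e χ
  · exact h1 χ hχ
  · unfold Indecomposable at hχ
    push Not at hχ
    obtain ⟨ψ, hψ, hχψ, hz⟩ := hχ hχ0
    have := he ψ (χ * ψ)
    rw [mul_comm ψ, Chars.mul_mul_self, hz] at this
    have e1 := ih (e ψ ψ) (by omega) (χ := ψ) trivial rfl
    have e2 := ih _ (by omega) (χ := χ * ψ) trivial rfl
    exact (H.mul_mem_cancel_right e1).mp e2

lemma exists_indecomposable (h : he.unitSubgroup ≠ ⊤) : ∃ χ, Indecomposable e χ := by
  by_contra! h'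
  exact h (he.eq_top_of_indecomposable_mem le_rfl fun χ hχ => absurd hχ (h' χ))

/-- The relation defining exponents expresses twice an off-diagonal value by diagonal ones, and the
sums of `eps` satisfy the same relation. It thus suffices to match the diagonal. -/
lemma eq_sum_eps {m : {h : Grp n // h ≠ 0} → ℤ}
    (h : ∀ χ, (e χ χ : ℤ) = ∑ h, eps χ χ h.1 * m h) (χ ψ : Chars n) :
    (e χ ψ : ℤ) = ∑ h, eps χ ψ h.1 * m h := by
  have h1 := sum_eps_exponent m χ ψ
  rw [← h, ← h, ← h] at h1
  have h2 := he χ ψ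
  omega

/-- The structure constants of an algebra whose local rings are regular or nodes. -/
theorem exists_multiplicities
    (h3 : ∀ χ₁ χ₂ χ₃, Indecomposable e χ₁ → Indecomposable e χ₂ → Indecomposable e χ₃ →
      e (χ₁ * χ₂) (χ₁ * χ₂) ≠ 0 → e (χ₁ * χ₃) (χ₁ * χ₃) ≠ 0 → e (χ₂ * χ₃) (χ₂ * χ₃) ≠ 0 → False)
    (h2 : (∀ χ, e χ χ ≠ 1) → ∀ χ₁ χ₂, Indecomposable e χ₁ → Indecomposable e χ₂ →
      e (χ₁ * χ₂) (χ₁ * χ₂) ≠ 0 → False)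
    (hle : ∀ χ, Indecomposable e χ → e χ χ ≤ 2)
    (h1 : ∀ α χ, e α α = 1 → Indecomposable e χ → e χ χ = 1) :
    ∃ m : {h : Grp n // h ≠ 0} → ℤ, (∀ h, 0 ≤ m h) ∧ ∑ h, m h ≤ 2 ∧
      ∀ χ ψ, (e χ ψ : ℤ) = ∑ h, eps χ ψ h.1 * m h := by
  classical
  by_cases htop : he.unitSubgroup = ⊤
  · have h0 : ∀ χ, e χ χ = 0 := fun χ => by
      have : χ ∈ he.unitSubgroup := by rw [htop]; trivial
      exact this
    exact ⟨0, by simp, by simp, he.eq_sum_eps (by simp [h0])⟩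
  obtain ⟨α, hα⟩ := he.exists_indecomposable htop
  have hαn : α ∉ he.unitSubgroup := hα.1
  by_cases hone : ∀ χ, Indecomposable e χ → χ * α ∈ he.unitSubgroup
  · -- a single class of indecomposable characters
    have hadj : adjoinChar he.unitSubgroup α = ⊤ :=
      he.eq_top_of_indecomposable_mem (fun χ hχ => Or.inl hχ) (fun χ hχ => Or.inr (hone χ hχ))
    obtain ⟨g, hg⟩ := exists_mem_iff_apply_eq_one hαn hadj
    refine ⟨Pi.single g (e α α : ℤ), fun h => ?_, ?_, he.eq_sum_eps fun χ => ?_⟩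
    · rw [Pi.single_apply]; split_ifs <;> omega
    · rw [Finset.sum_pi_single']
      have := hle α hα
      simp only [Finset.mem_univ, if_true]
      omega
    · simp only [Pi.single_apply, mul_ite, mul_zero, Finset.sum_ite_eq', Finset.mem_univ, if_true]
      by_cases hχ : χ ∈ he.unitSubgroup
      · rw [he.mem_unitSubgroup.mp hχ, eps, (hg χ).mp hχ]
        simp
      · have hχg : χ g.1 = -1 := Chars.eq_neg_one_of_ne_one fun h => hχ ((hg χ).mpr h)
        have hχα : χ * α ∈ he.unitSubgroup := by
          have : χ ∈ adjoinChar he.unitSubgroup α := by rw [hadj]; trivial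
          exact this.resolve_left hχ
        have : e χ χ = e α α := by
          have := he.diag_mul_of_eq_zero (χ := α) hχα
          rwa [mul_comm, Chars.mul_mul_self] at this
        rw [this, eps, hχg]
        simp
  · -- two classes of indecomposable characters
    push Not at hone
    obtain ⟨β, hβ, hβα⟩ := hone
    -- If no exponent were 1, then `π` would itself be a minimal generator, and together with two
    -- classes of characters there would be three; this is what `h2` excludes.
    have hex : ∃ γ, e γ γ = 1 := by
      by_contra! h
      exact h2 h β α hβ hα hβα
    obtain ⟨γ, hγ⟩ := hex
    have dα := h1 γ α hγ hα
    have dβ := h1 γ β hγ hβ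
    have hall : ∀ χ, Indecomposable e χ → χ * α ∈ he.unitSubgroup ∨ χ * β ∈ he.unitSubgroup := by
      intro χ hχ
      by_contra! h
      exact h3 χ α β hχ hα hβ h.1 h.2 (by rwa [mul_comm])
    have hadj : adjoinChar (adjoinChar he.unitSubgroup α) β = ⊤ := by
      refine he.eq_top_of_indecomposable_mem (fun χ hχ => Or.inl (Or.inl hχ)) (fun χ hχ => ?_)
      rcases hall χ hχ with h | h
      · exact Or.inl (Or.inr h)
      · exact Or.inr (Or.inl h)
    have hadj' : adjoinChar (adjoinChar he.unitSubgroup β) α = ⊤ := by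
      refine he.eq_top_of_indecomposable_mem (fun χ hχ => Or.inl (Or.inl hχ)) (fun χ hχ => ?_)
      rcases hall χ hχ with h | h
      · exact Or.inr (Or.inl h)
      · exact Or.inl (Or.inr h)
    have hβn : β ∉ he.unitSubgroup := hβ.1
    -- The invertible characters have index four. The element `g₁` annihilates them and `α`, while
    -- `g₂` annihilates them and `β`: so `α` is nontrivial only on `g₂`, and `β` only on `g₁`.
    obtain ⟨g₁, hg₁⟩ := exists_mem_iff_apply_eq_one
      (fun h => (mem_adjoinChar.mp h).elim hβn hβα) hadj
    obtain ⟨g₂, hg₂⟩ := exists_mem_iff_apply_eq_one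
      (fun h => (mem_adjoinChar.mp h).elim hαn (fun h => hβα (by rwa [mul_comm]))) hadj'
    have dαβ : e (α * β) (α * β) = 2 := by
      have hr : ¬ Indecomposable e (α * β) := by
        intro h
        rcases hall _ h with h | h
        · rw [mul_right_comm, α.mul_self, one_mul] at h; exact hβn h
        · rw [Chars.mul_mul_self] at h; exact hαn h
      -- The relation reads `2 * e α β + e (α * β) (α * β) = 2` with second summand nonzero, so that
      -- summand is 2.
      have := he α β
      have hne : e (α * β) (α * β) ≠ 0 := by rw [mul_comm]; exact hβα
      omega
    refine ⟨Pi.single g₁ 1 + Pi.single g₂ 1, fun h => ?_, ?_, he.eq_sum_eps fun χ => ?_⟩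
    · rw [Pi.add_apply, Pi.single_apply, Pi.single_apply]; split_ifs <;> omega
    · simp [Finset.sum_add_distrib]
    · simp only [Pi.add_apply, Pi.single_apply, mul_add, Finset.sum_add_distrib, mul_ite, mul_zero,
        mul_one, Finset.sum_ite_eq', Finset.mem_univ, if_true]
      have k₁ : eps χ χ g₁.1 = if χ ∈ adjoinChar he.unitSubgroup α then 0 else 1 := by
        split_ifs with h
        · rw [eps, (hg₁ χ).mp h]; simp
        · rw [eps, Chars.eq_neg_one_of_ne_one fun h' => h ((hg₁ χ).mpr h')]; simp
      have k₂ : eps χ χ g₂.1 = if χ ∈ adjoinChar he.unitSubgroup β then 0 else 1 := by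
        split_ifs with h
        · rw [eps, (hg₂ χ).mp h]; simp
        · rw [eps, Chars.eq_neg_one_of_ne_one fun h' => h ((hg₂ χ).mpr h')]; simp
      rw [k₁, k₂]
      have hχ : χ ∈ adjoinChar (adjoinChar he.unitSubgroup α) β := by rw [hadj]; trivial
      have hsame : ∀ θ, χ * θ ∈ he.unitSubgroup → e χ χ = e θ θ := by
        intro θ hθ
        have := he.diag_mul_of_eq_zero (χ := θ) hθ
        rwa [mul_comm, Chars.mul_mul_self] at this
      have hex : ∀ θ, e θ θ = 1 → χ * θ ∈ he.unitSubgroup → χ ∉ he.unitSubgroup := by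
        intro θ hθ h1 h2
        have h3 := hsame θ h1
        rw [he.mem_unitSubgroup.mp h2] at h3
        omega
      have hexαβ : ¬ (χ * α ∈ he.unitSubgroup ∧ χ * β ∈ he.unitSubgroup) := by
        rintro ⟨h1, h2⟩
        have := he.unitSubgroup.mul_mem h1 h2
        rw [mul_mul_mul_comm, χ.mul_self, one_mul, he.mem_unitSubgroup] at this
        omega
      simp only [mem_adjoinChar] at hχ ⊢
      by_cases c0 : χ ∈ he.unitSubgroup
      · simp [c0, he.mem_unitSubgroup.mp c0]
      by_cases c1 : χ * α ∈ he.unitSubgroup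
      · have c2 : χ * β ∉ he.unitSubgroup := fun h => hexαβ ⟨c1, h⟩
        simp [c0, c1, c2, hsame α c1, dα]
      by_cases c2 : χ * β ∈ he.unitSubgroup
      · simp [c0, c1, c2, hsame β c2, dβ]
      · have : χ * β * α ∈ he.unitSubgroup := by
          rcases hχ with h | h
          · exact absurd h (by simp [c0, c1])
          · exact h.resolve_left c2
        have h5 := hsame (β * α) (by rwa [← mul_assoc])
        rw [mul_comm β α, dαβ] at h5
        simp [c0, c1, c2, h5]

end IsExponent

end Combinatorics

/-! ### Algebras with a basis of characters over a discrete valuation ring -/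

open IsLocalRing

/-- An algebra over `O` with a basis of elements indexed by the characters, multiplied as in a
standard cover, with structure constants which are units times powers of `π`. -/
structure CharBasis (O B : Type*) [CommRing O] [CommRing B] [Algebra O B] (n : ℕ) where
  b : Module.Basis (Chars n) O B
  π : O
  u : Chars n → Chars n → Oˣ
  e : Chars n → Chars n → ℕ
  mul : ∀ χ ψ, b χ * b ψ = ((u χ ψ : O) * π ^ e χ ψ) • b (χ * ψ)
  one : b 1 = 1
  prime : Prime π
  maximal : (Ideal.span {π}).IsMaximal

namespace CharBasis

variable {O B : Type*} [CommRing O] [IsDomain O] [CommRing B] [Algebra O B] {n : ℕ}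
  (D : CharBasis O B n)

omit [IsDomain O] in
lemma repr_algebraMap (x : O) (χ : Chars n) :
    D.b.repr (algebraMap O B x) χ = if χ = 1 then x else 0 := by
  rw [Algebra.algebraMap_eq_smul_one, ← D.one, map_smul, Module.Basis.repr_self]
  simp [Finsupp.single_apply, eq_comm]

include D in
omit [IsDomain O] in
lemma algebraMap_injective : Function.Injective (algebraMap O B) := by
  intro x y h
  have := D.repr_algebraMap x 1
  rw [h, D.repr_algebraMap] at this
  simpa using this.symm

omit [IsDomain O] in
lemma mul_self (χ : Chars n) :
    D.b χ * D.b χ = algebraMap O B ((D.u χ χ : O) * D.π ^ D.e χ χ) := by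
  rw [D.mul, χ.mul_self, D.one, Algebra.algebraMap_eq_smul_one]

/-- Compute `(b χ * b ψ)²` in two ways and compare `π`-adic valuations in the domain `O`. -/
lemma isExponent : IsExponent D.e := by
  intro χ ψ
  have h1 : (D.b χ * D.b ψ) * (D.b χ * D.b ψ) = (D.b χ * D.b χ) * (D.b ψ * D.b ψ) := by ring
  rw [D.mul, smul_mul_smul_comm, D.mul_self, D.mul_self, D.mul_self, ← map_mul,
    Algebra.smul_def, ← map_mul] at h1
  have h2 := D.algebraMap_injective h1
  have h3 : Associated (D.π ^ (2 * D.e χ ψ + D.e (χ * ψ) (χ * ψ)))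
      (D.π ^ (D.e χ χ + D.e ψ ψ)) := by
    refine ⟨D.u χ ψ * D.u χ ψ * D.u (χ * ψ) (χ * ψ) * (D.u χ χ)⁻¹ * (D.u ψ ψ)⁻¹, ?_⟩
    have e1 : (D.u χ χ : O) * ((D.u χ χ)⁻¹ : Oˣ) = 1 := Units.mul_inv _
    have e2 : (D.u ψ ψ : O) * ((D.u ψ ψ)⁻¹ : Oˣ) = 1 := Units.mul_inv _
    push_cast
    rw [pow_add, pow_add, pow_mul]
    linear_combination ((D.u χ χ)⁻¹ : Oˣ) * ((D.u ψ ψ)⁻¹ : Oˣ) * h2 +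
      D.π ^ D.e χ χ * D.π ^ D.e ψ ψ * ((D.u ψ ψ : O) * ((D.u ψ ψ)⁻¹ : Oˣ)) * e1 +
      D.π ^ D.e χ χ * D.π ^ D.e ψ ψ * e2
  have hu := D.prime.not_isUnit
  have h0 := D.prime.ne_zero
  exact le_antisymm ((pow_dvd_pow_iff h0 hu).mp h3.dvd) ((pow_dvd_pow_iff h0 hu).mp h3.symm.dvd)

omit [IsDomain O] in
lemma repr_mul_basis (x : B) (χ θ : Chars n) :
    D.b.repr (x * D.b χ) θ =
      D.b.repr x (θ * χ) * ((D.u (θ * χ) χ : O) * D.π ^ D.e (θ * χ) χ) := by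
  let f : B →ₗ[O] O := (D.b.coord θ).comp (LinearMap.mulRight O (D.b χ))
  let g : B →ₗ[O] O :=
    ((D.u (θ * χ) χ : O) * D.π ^ D.e (θ * χ) χ) • D.b.coord (θ * χ)
  have : f = g := by
    refine D.b.ext fun ψ => ?_
    simp only [f, g, LinearMap.comp_apply, LinearMap.mulRight_apply, Module.Basis.coord_apply,
      LinearMap.smul_apply, D.mul, map_smul, Module.Basis.repr_self,
      Finsupp.single_apply]
    by_cases h : ψ = θ * χ
    · subst h
      rw [Chars.mul_mul_self]
      simp
    · have h' : ψ * χ ≠ θ := fun h' => h (by rw [← h', Chars.mul_mul_self])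
      simp [h, h']
  have h := LinearMap.congr_fun this x
  simp only [f, g, LinearMap.comp_apply, LinearMap.mulRight_apply, Module.Basis.coord_apply,
    LinearMap.smul_apply, smul_eq_mul] at h
  rw [h, mul_comm]

omit [IsDomain O] in
lemma repr_mul (x y : B) (θ : Chars n) :
    D.b.repr (x * y) θ = ∑ χ, D.b.repr y χ *
      (D.b.repr x (θ * χ) * ((D.u (θ * χ) χ : O) * D.π ^ D.e (θ * χ) χ)) := by
  conv_lhs => rw [← D.b.sum_repr y, Finset.mul_sum, map_sum]
  rw [Finsupp.finsetSum_apply]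
  refine Finset.sum_congr rfl fun χ _ => ?_
  rw [mul_smul_comm, map_smul, Finsupp.smul_apply, repr_mul_basis, smul_eq_mul]

lemma two_mul_exponent (θ χ : Chars n) :
    2 * D.e (θ * χ) χ + D.e θ θ = D.e (θ * χ) (θ * χ) + D.e χ χ := by
  have := D.isExponent (θ * χ) χ
  rwa [Chars.mul_mul_self] at this

/-- When a non-invertible `b χ` contributes to an invertible component, its partner `b (θ * χ)` is
non-invertible with the same exponent, so the product acquires a power of `π`. -/
lemma exponent_pos {θ χ : Chars n} (h : D.e θ θ = 0) (hχ : D.e χ χ ≠ 0) : D.e (θ * χ) χ ≠ 0 := by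
  have := D.two_mul_exponent θ χ
  rw [mul_comm θ, D.isExponent.diag_mul_of_eq_zero h] at this
  rw [mul_comm]
  omega

lemma exponent_symm (χ ψ : Chars n) : D.e χ ψ = D.e ψ χ := by
  have h1 := D.isExponent χ ψ
  have h2 := D.isExponent ψ χ
  rw [mul_comm ψ] at h2
  omega

/-- The ideal generated by `π` and the basis elements which are not units. -/
def jac : Ideal B where
  carrier := {x | ∀ χ, D.e χ χ = 0 → D.π ∣ D.b.repr x χ}
  zero_mem' := fun χ _ => by simp
  add_mem' := fun {x y} hx hy χ h => by
    rw [map_add, Finsupp.add_apply]; exact dvd_add (hx χ h) (hy χ h)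
  smul_mem' := fun c x hx θ h => by
    rw [smul_eq_mul, D.repr_mul]
    refine Finset.dvd_sum fun χ _ => ?_
    by_cases hχ : D.e χ χ = 0
    · exact Dvd.dvd.mul_right (hx χ hχ) _
    · have := D.exponent_pos h hχ
      exact Dvd.dvd.mul_left (Dvd.dvd.mul_left (Dvd.dvd.mul_left (dvd_pow_self _ this) _) _) _

lemma algebraMap_mem_jac : algebraMap O B D.π ∈ D.jac := by
  intro χ _
  rw [D.repr_algebraMap]
  split_ifs
  · exact dvd_rfl
  · exact dvd_zero _

lemma basis_mem_jac {χ : Chars n} (h : D.e χ χ ≠ 0) : D.b χ ∈ D.jac := by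
  intro ψ hψ
  rw [Module.Basis.repr_self, Finsupp.single_apply, if_neg]
  · exact dvd_zero _
  · rintro rfl
    exact h hψ

lemma jac_le {I : Ideal B} (h0 : algebraMap O B D.π ∈ I) (h1 : ∀ χ, D.e χ χ ≠ 0 → D.b χ ∈ I) :
    D.jac ≤ I := by
  intro x hx
  rw [← D.b.sum_repr x]
  refine Ideal.sum_mem _ fun χ _ => ?_
  by_cases hχ : D.e χ χ = 0
  · obtain ⟨r, hr⟩ := hx χ hχ
    rw [hr, mul_smul, Algebra.smul_def]
    exact Ideal.mul_mem_right _ _ h0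
  · rw [Algebra.smul_def]
    exact Ideal.mul_mem_left _ _ (h1 χ hχ)

/-- These divisibilities detect minimal generators of `jac`. At an indecomposable character no
product of two generators has a component that is a unit; and if no diagonal exponent is 1, products
of generators reach invertible components only with a factor `π ^ 2`, so `π` is a minimal generator
too. -/
lemma mem_jac_sq {x : B} (hx : x ∈ D.jac ^ 2) (χ : Chars n) :
    (IsExponent.Indecomposable D.e χ → D.π ∣ D.b.repr x χ) ∧
      ((∀ α, D.e α α ≠ 1) → D.e χ χ = 0 → D.π ^ 2 ∣ D.b.repr x χ) := by
  rw [sq] at hx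
  induction hx using Submodule.mul_induction_on' with
  | mem_mul_mem y hy z hz =>
    rw [D.repr_mul]
    refine ⟨fun hχ => Finset.dvd_sum fun ψ _ => ?_, fun h1 hχ => Finset.dvd_sum fun ψ _ => ?_⟩
    · by_cases hψ : D.e ψ ψ = 0
      · exact Dvd.dvd.mul_right (hz ψ hψ) _
      · refine Dvd.dvd.mul_left ?_ _
        by_cases hψ' : D.e (χ * ψ) (χ * ψ) = 0
        · exact Dvd.dvd.mul_right (hy _ hψ') _
        · have := hχ.2 ψ hψ hψ'
          rw [D.exponent_symm] at this
          exact Dvd.dvd.mul_left (Dvd.dvd.mul_left (dvd_pow_self _ this) _) _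
    · have h2 := D.two_mul_exponent χ ψ
      have h3 := D.isExponent.diag_mul_of_eq_zero (χ := ψ) hχ
      rw [mul_comm ψ] at h3
      by_cases hψ : D.e ψ ψ = 0
      · rw [sq, ← mul_assoc]
        exact Dvd.dvd.mul_right (mul_dvd_mul (hz ψ hψ) (hy _ (h3.trans hψ))) _
      · have h4 := h1 ψ
        exact Dvd.dvd.mul_left (Dvd.dvd.mul_left (Dvd.dvd.mul_left
          (pow_dvd_pow _ (by omega)) _) _) _
  | add y _ z _ hy hz =>
    rw [map_add, Finsupp.add_apply]
    exact ⟨fun h => dvd_add (hy.1 h) (hz.1 h), fun h h' => dvd_add (hy.2 h h') (hz.2 h h')⟩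

omit [IsDomain O] in
/-- The action of a group element on the algebra. -/
lemma exists_action (g : Grp n) : ∃ σ : B →ₐ[O] B, ∀ x χ,
    D.b.repr (σ x) χ = (((χ g : ℤˣ) : ℤ) : O) * D.b.repr x χ := by
  let f : B →ₗ[O] B := D.b.constr O (fun χ => (((χ g : ℤˣ) : ℤ) : O) • D.b χ)
  have hf : ∀ χ, f (D.b χ) = (((χ g : ℤˣ) : ℤ) : O) • D.b χ := fun χ => D.b.constr_basis _ _ _
  have h1 : f 1 = 1 := by
    have := hf 1
    rw [D.one] at this
    simpa using this
  have hmul : ∀ x y, f (x * y) = f x * f y := by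
    have : (LinearMap.mul O B).compr₂ f = (LinearMap.mul O B).compl₁₂ f f := by
      refine LinearMap.ext_basis D.b D.b fun χ ψ => ?_
      simp only [LinearMap.compr₂_apply, LinearMap.mul_apply', LinearMap.compl₁₂_apply, hf, D.mul,
        map_smul, LinearMap.smul_apply, smul_smul, AddChar.mul_apply, Units.val_mul, Int.cast_mul]
      congr 1
      ring
    exact fun x y => LinearMap.congr_fun₂ this x y
  refine ⟨AlgHom.ofLinearMap f h1 hmul, fun x χ => ?_⟩
  have : (D.b.coord χ).comp f = (((χ g : ℤˣ) : ℤ) : O) • D.b.coord χ := by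
    refine D.b.ext fun ψ => ?_
    simp only [LinearMap.comp_apply, hf, map_smul, LinearMap.smul_apply, Module.Basis.coord_apply,
      Module.Basis.repr_self, Finsupp.single_apply]
    split_ifs with h
    · rw [h]
    · simp
  exact LinearMap.congr_fun this x

/-- The ideal is stable under the group and 2 is invertible, so averaging against `χ` keeps the
component `x_χ b χ` of an element of the radical. Multiplying by the invertible `b χ` brings it into
`O`, where a power of `x_χ` is divisible by the prime `π`. -/
lemma jac_radical_le (h2 : IsUnit (2 : O)) : D.jac.radical ≤ D.jac := by
  intro x hx χ hχ
  choose σ hσ using D.exists_action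
  have hσJ : ∀ g, σ g x ∈ D.jac.radical := by
    intro g
    obtain ⟨k, hk⟩ := hx
    refine ⟨k, ?_⟩
    rw [← map_pow]
    intro ψ hψ
    rw [hσ]
    exact Dvd.dvd.mul_left (hk ψ hψ) _
  let y : B := ∑ g, algebraMap O B (((χ g : ℤˣ) : ℤ) : O) * σ g x
  have hy : y ∈ D.jac.radical := Ideal.sum_mem _ fun g _ => Ideal.mul_mem_left _ _ (hσJ g)
  have hy' : y = algebraMap O B (2 ^ n * D.b.repr x χ) * D.b χ := by
    apply D.b.repr.injective
    ext ψ
    simp only [y, map_sum, Finsupp.finsetSum_apply, ← Algebra.smul_def, map_smul,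
      Finsupp.smul_apply, hσ, Module.Basis.repr_self, Finsupp.single_apply, smul_eq_mul]
    simp_rw [← mul_assoc]
    rw [← Finset.sum_mul]
    have e1 : ∀ g : Grp n, (((χ g : ℤˣ) : ℤ) : O) * (((ψ g : ℤˣ) : ℤ) : O) =
        ((((χ * ψ) g : ℤˣ) : ℤ) : O) := by intro g; simp
    simp_rw [e1]
    rw [← Int.cast_sum]
    by_cases h : χ = ψ
    · subst h
      rw [χ.mul_self]
      simp [Fintype.card_pi, ZMod.card]
    · have : χ * ψ ≠ 1 := fun h' => h (by
        rw [← one_mul ψ, ← h', Chars.mul_mul_self])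
      rw [sum_elements_eq_zero this]
      simp [h]
  have hz := Ideal.mul_mem_right (D.b χ) _ hy
  rw [hy', mul_assoc, D.mul_self, hχ, pow_zero, mul_one, ← map_mul] at hz
  obtain ⟨k, hk⟩ := hz
  rw [← map_pow] at hk
  have := hk 1 D.isExponent.diag_one
  rw [D.repr_algebraMap, if_pos rfl] at this
  have h3 := D.prime.dvd_of_dvd_pow this
  rw [mul_right_comm] at h3
  exact (((h2.pow n).mul (D.u χ χ).isUnit).dvd_mul_left).mp h3

section Prime

variable (Q : Ideal B) [Q.IsPrime]

omit [IsDomain O] in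
lemma basis_mem_prime (hQ : algebraMap O B D.π ∈ Q) {χ : Chars n} (h : D.e χ χ ≠ 0) :
    D.b χ ∈ Q := by
  have : D.b χ * D.b χ ∈ Q := by
    rw [D.mul_self, map_mul, map_pow]
    exact Ideal.mul_mem_left _ _ (Ideal.pow_mem_of_mem _ hQ _ (Nat.pos_of_ne_zero h))
  exact (Ideal.IsPrime.mem_or_mem inferInstance this).elim id id

lemma jac_le_prime (hQ : algebraMap O B D.π ∈ Q) : D.jac ≤ Q :=
  D.jac_le hQ fun _ h => D.basis_mem_prime Q hQ h

/-- The quotient by `jac` is finite over the field `O / π`, hence Artinian, and it is reduced. So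
every prime containing `jac` agrees with it after localization at that prime. -/
lemma exists_mul_mem_jac (h2 : IsUnit (2 : O)) {q : B} (hq : q ∈ Q) : ∃ s ∉ Q, s * q ∈ D.jac := by
  let P : Ideal O := Ideal.span {D.π}
  have hP : P.IsMaximal := D.maximal
  let _ : Field (O ⧸ P) := Ideal.Quotient.field P
  have hle : P ≤ Ideal.comap (algebraMap O B) D.jac := by
    rw [Ideal.span_singleton_le_iff_mem]
    exact D.algebraMap_mem_jac
  let _ : Algebra (O ⧸ P) (B ⧸ D.jac) := Ideal.Quotient.algebraQuotientOfLEComap hle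
  have : IsScalarTower O (O ⧸ P) (B ⧸ D.jac) := .of_algebraMap_eq' rfl
  have : Module.Finite O B := Module.Finite.of_basis D.b
  have : Module.Finite (O ⧸ P) (B ⧸ D.jac) := Module.Finite.of_restrictScalars_finite O _ _
  have : IsArtinianRing (B ⧸ D.jac) := isArtinian_of_tower (O ⧸ P) inferInstance
  obtain ⟨k, y, hy⟩ := IsArtinian.exists_pow_succ_smul_dvd (R := B ⧸ D.jac) (M := B ⧸ D.jac)
    (Ideal.Quotient.mk D.jac q) 1
  obtain ⟨y, rfl⟩ := Ideal.Quotient.mk_surjective y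
  -- Stabilization of the powers of `q` gives `q ^ k * (1 - q * y) ∈ jac`. Hence `(1 - q * y) * q`
  -- is nilpotent modulo `jac`, while `1 - q * y` is outside `Q` because `q` is inside.
  refine ⟨1 - q * y, fun h => ?_, D.jac_radical_le h2 ⟨k + 1, ?_⟩⟩
  · have h1 : (1 : B) ∈ Q := by
      have := Ideal.add_mem _ h (Ideal.mul_mem_right y _ hq)
      simpa using this
    exact (inferInstance : Q.IsPrime).ne_top ((Ideal.eq_top_iff_one _).mpr h1)
  · rw [← Ideal.Quotient.eq_zero_iff_mem]
    simp only [smul_eq_mul, mul_one] at hy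
    set z := Ideal.Quotient.mk D.jac q
    set w := Ideal.Quotient.mk D.jac y
    have h0 : z ^ k * (1 - z * w) = 0 := by
      rw [Nat.succ_eq_add_one] at hy
      linear_combination -hy
    simp only [map_mul, map_pow, map_sub, map_one]
    change ((1 - z * w) * z) ^ (k + 1) = 0
    rw [mul_pow, pow_succ (1 - z * w), pow_succ z]
    linear_combination ((1 - z * w) ^ k * z) * h0

variable {S : Type*} [CommRing S] [IsLocalRing S] [Algebra B S] [IsLocalization.AtPrime S Q]

lemma map_jac_eq_maximalIdeal (h2 : IsUnit (2 : O)) (hQ : algebraMap O B D.π ∈ Q) :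
    D.jac.map (algebraMap B S) = maximalIdeal S := by
  rw [← IsLocalization.AtPrime.map_eq_maximalIdeal Q S]
  refine le_antisymm (Ideal.map_mono (D.jac_le_prime Q hQ)) ?_
  rw [Ideal.map_le_iff_le_comap]
  intro q hq
  obtain ⟨s, hs, hsq⟩ := D.exists_mul_mem_jac Q h2 hq
  have := Ideal.mem_map_of_mem (algebraMap B S) hsq
  rw [map_mul] at this
  exact (Ideal.unit_mul_mem_iff_mem _
    (IsLocalization.map_units (M := Q.primeCompl) S ⟨s, hs⟩)).mp this

lemma exists_not_dvd_repr (hQ : algebraMap O B D.π ∈ Q) {c : B} (hc : c ∉ Q) :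
    ∃ ψ, D.e ψ ψ = 0 ∧ ¬ D.π ∣ D.b.repr c ψ := by
  by_contra! h
  exact hc (D.jac_le_prime Q hQ h)

end Prime

end CharBasis

/-! ### From regular points and nodes to exponents -/

section CharBasisForward

open IsLocalRing

lemma IsExponent.Indecomposable.unit_mul {n : ℕ} {e : Chars n → Chars n → ℕ} (he : IsExponent e)
    {ψ χ : Chars n} (hψ : e ψ ψ = 0) (h : IsExponent.Indecomposable e χ) :
    IsExponent.Indecomposable e (ψ * χ) := by
  have h0 : ∀ θ, e (ψ * θ) (ψ * θ) = e θ θ := fun θ => by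
    rw [mul_comm]; exact he.diag_mul_of_eq_zero hψ
  refine ⟨by rw [h0]; exact h.1, fun θ hθ hθ' => ?_⟩
  rw [mul_assoc, h0] at hθ'
  have h1 := h.2 θ hθ hθ'
  have h2 := he θ (χ * θ)
  have h3 := he θ (ψ * χ * θ)
  have e1 : θ * (χ * θ) = χ := by rw [mul_comm, Chars.mul_mul_self]
  have e2 : θ * (ψ * χ * θ) = ψ * χ := by rw [mul_comm, Chars.mul_mul_self]
  rw [e1] at h2
  rw [e2, h0] at h3
  rw [mul_assoc, h0] at h3
  rw [mul_assoc]
  omega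

namespace CharBasis

variable {O B : Type*} [CommRing O] [IsDomain O] [CommRing B] [Algebra O B] {n : ℕ}
  (D : CharBasis O B n) (Q : Ideal B) [Q.IsPrime] {S : Type*} [CommRing S] [IsLocalRing S]
  [Algebra B S] [IsLocalization.AtPrime S Q]

/-- An element `c` outside `Q` has an invertible component `ψ` not divisible by `π`. It makes the `ψ
* χ` component of `c * b χ` prime to `π`, whereas elements of `jac ^ 2` have divisible components at
indecomposable characters. -/
lemma not_mem_jac_sq (hQ : algebraMap O B D.π ∈ Q) {c r : B} {χ : Chars n} (hc : c ∉ Q)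
    (hχ : IsExponent.Indecomposable D.e χ)
    (hr : ∀ ψ, D.e ψ ψ = 0 → D.π ∣ D.b.repr r (ψ * χ)) : c * D.b χ + r ∉ D.jac ^ 2 := by
  intro h
  obtain ⟨ψ, hψ, hd⟩ := D.exists_not_dvd_repr Q hQ hc
  have h1 := (D.mem_jac_sq h (ψ * χ)).1 (hχ.unit_mul D.isExponent hψ)
  rw [map_add, Finsupp.add_apply, dvd_add_left (hr ψ hψ), D.repr_mul_basis, Chars.mul_mul_self,
    D.isExponent.eq_zero_of_left hψ, pow_zero, mul_one] at h1
  exact hd ((D.u ψ χ).isUnit.dvd_mul_right.mp h1)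

lemma dvd_repr_mul_basis {χ χ' ψ : Chars n} (c : B) (hχ : IsExponent.Indecomposable D.e χ)
    (hψ : D.e ψ ψ = 0) (hχ' : D.e χ' χ' ≠ 0) (h : D.e (χ * χ') (χ * χ') ≠ 0) :
    D.π ∣ D.b.repr (c * D.b χ') (ψ * χ) := by
  rw [D.repr_mul_basis]
  refine Dvd.dvd.mul_left (Dvd.dvd.mul_left (dvd_pow_self _ ?_) _) _
  rw [D.exponent_symm]
  refine (hχ.unit_mul D.isExponent hψ).2 χ' hχ' ?_
  rwa [mul_assoc, mul_comm, D.isExponent.diag_mul_of_eq_zero hψ]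

variable (S)

-- The dependence of three cotangent vectors of `S`, with denominators cleared so that it becomes a
-- statement about ideals of `B`.
include S in
lemma exists_relation (h2 : IsUnit (2 : O)) (hQ : algebraMap O B D.π ∈ Q) (hS : NodeLike S)
    (x : Fin 3 → B) (hx : ∀ i, x i ∈ D.jac) :
    ∃ c : Fin 3 → B, (∃ i, c i ∉ Q) ∧ ∑ i, c i * x i ∈ D.jac ^ 2 := by
  have hm := D.map_jac_eq_maximalIdeal Q (S := S) h2 hQ
  obtain ⟨c, ⟨i, hi⟩, hc⟩ := hS.exists_relation (x := fun i => algebraMap B S (x i)) fun i => by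
    rw [← hm]; exact Ideal.mem_map_of_mem _ (hx i)
  obtain ⟨s, hs⟩ := IsLocalization.exist_integer_multiples_of_finite Q.primeCompl c
  choose c' hc' using hs
  have h3 : algebraMap B S (∑ i, c' i * x i) ∈ (D.jac ^ 2).map (algebraMap B S) := by
    rw [Ideal.map_pow, hm, map_sum]
    simp_rw [map_mul, hc', Algebra.smul_mul_assoc]
    rw [← Finset.smul_sum, Algebra.smul_def]
    exact Ideal.mul_mem_left _ _ hc
  rw [IsLocalization.algebraMap_mem_map_algebraMap_iff Q.primeCompl] at h3
  obtain ⟨m, hm', h3⟩ := h3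
  refine ⟨fun i => m * c' i, ⟨i, fun h => ?_⟩, ?_⟩
  · have h4 : c' i ∈ Q := (Ideal.IsPrime.mem_or_mem inferInstance h).resolve_left hm'
    have h5 := Ideal.mem_map_of_mem (algebraMap B S) h4
    rw [IsLocalization.AtPrime.map_eq_maximalIdeal Q S, hc',
      Algebra.smul_def] at h5
    exact hi ((Ideal.unit_mul_mem_iff_mem _
      (IsLocalization.map_units (M := Q.primeCompl) S s)).mp h5)
  · simp_rw [mul_assoc]
    rwa [← Finset.mul_sum]

-- The second property of `NodeLike` would otherwise put the minimal generator `b χ` into the square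
-- of the maximal ideal, contradicting `not_mem_jac_sq`.
include S in
lemma sq_not_mem_jac_cube (h2 : IsUnit (2 : O)) (hQ : algebraMap O B D.π ∈ Q) (hS : NodeLike S)
    {χ : Chars n} (hχ : IsExponent.Indecomposable D.e χ) : D.b χ * D.b χ ∉ D.jac ^ 3 := by
  intro h
  have hm := D.map_jac_eq_maximalIdeal Q (S := S) h2 hQ
  have h3 : algebraMap B S (D.b χ) ∈ (D.jac ^ 2).map (algebraMap B S) := by
    rw [Ideal.map_pow, hm]
    refine hS.2 _ ?_ ?_
    · rw [← hm]; exact Ideal.mem_map_of_mem _ (D.basis_mem_jac hχ.1)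
    · rw [← hm, ← Ideal.map_pow, sq, ← map_mul]; exact Ideal.mem_map_of_mem _ h
  rw [IsLocalization.algebraMap_mem_map_algebraMap_iff Q.primeCompl] at h3
  obtain ⟨m, hm', h3⟩ := h3
  refine D.not_mem_jac_sq Q hQ (c := m) (r := 0) hm' hχ (fun ψ _ => by simp) ?_
  rwa [add_zero]

include S in
/-- If one local ring of the algebra over the closed point is regular or a node, the structure
constants are those of a standard cover with branch divisor of multiplicity at most two. -/
theorem exists_multiplicities (h2 : IsUnit (2 : O)) (hQ : algebraMap O B D.π ∈ Q)
    (hS : NodeLike S) : ∃ m : {h : Grp n // h ≠ 0} → ℤ, (∀ h, 0 ≤ m h) ∧ ∑ h, m h ≤ 2 ∧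
      ∀ χ ψ, (D.e χ ψ : ℤ) = ∑ h, eps χ ψ h.1 * m h := by
  refine D.isExponent.exists_multiplicities ?_ ?_ ?_ ?_
  -- Three indecomposable characters from different classes would give three independent cotangent
  -- vectors. Whichever coefficient of the relation is outside `Q`, the other two terms do not reach
  -- the components of that class.
  · intro χ₁ χ₂ χ₃ i1 i2 i3 h12 h13 h23
    obtain ⟨c, ⟨i, hi⟩, hc⟩ := D.exists_relation Q S h2 hQ hS ![D.b χ₁, D.b χ₂, D.b χ₃] (by
      intro i
      fin_cases i
      · exact D.basis_mem_jac i1.1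
      · exact D.basis_mem_jac i2.1
      · exact D.basis_mem_jac i3.1)
    rw [Fin.sum_univ_three] at hc
    simp only [Matrix.cons_val_zero, Matrix.cons_val_one, Matrix.cons_val] at hc
    have h21 := mul_comm χ₁ χ₂ ▸ h12
    have h31 := mul_comm χ₁ χ₃ ▸ h13
    have h32 := mul_comm χ₂ χ₃ ▸ h23
    fin_cases i
    · rw [add_assoc] at hc
      refine D.not_mem_jac_sq Q hQ hi i1 (fun ψ hψ => ?_) hc
      rw [map_add, Finsupp.add_apply]
      exact dvd_add (D.dvd_repr_mul_basis _ i1 hψ i2.1 h12) (D.dvd_repr_mul_basis _ i1 hψ i3.1 h13)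
    · rw [add_comm (c 0 * _), add_assoc] at hc
      refine D.not_mem_jac_sq Q hQ hi i2 (fun ψ hψ => ?_) hc
      rw [map_add, Finsupp.add_apply]
      exact dvd_add (D.dvd_repr_mul_basis _ i2 hψ i1.1 h21) (D.dvd_repr_mul_basis _ i2 hψ i3.1 h23)
    · rw [add_comm] at hc
      refine D.not_mem_jac_sq Q hQ hi i3 (fun ψ hψ => ?_) hc
      rw [map_add, Finsupp.add_apply]
      exact dvd_add (D.dvd_repr_mul_basis _ i3 hψ i1.1 h31) (D.dvd_repr_mul_basis _ i3 hψ i2.1 h32)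
  -- Without exponent 1, the uniformizer `π` takes the part of the third independent cotangent
  -- vector.
  · intro hne χ₁ χ₂ i1 i2 h12
    obtain ⟨c, ⟨i, hi⟩, hc⟩ := D.exists_relation Q S h2 hQ hS
      ![algebraMap O B D.π, D.b χ₁, D.b χ₂] (by
      intro i
      fin_cases i
      · exact D.algebraMap_mem_jac
      · exact D.basis_mem_jac i1.1
      · exact D.basis_mem_jac i2.1)
    rw [Fin.sum_univ_three] at hc
    simp only [Matrix.cons_val_zero, Matrix.cons_val_one, Matrix.cons_val] at hc
    have h21 := mul_comm χ₁ χ₂ ▸ h12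
    have hπ : ∀ (c : B) θ, D.b.repr (c * algebraMap O B D.π) θ = D.π * D.b.repr c θ := by
      intro c θ
      rw [mul_comm, ← Algebra.smul_def, map_smul, Finsupp.smul_apply, smul_eq_mul]
    fin_cases i
    · obtain ⟨ψ, hψ, hd⟩ := D.exists_not_dvd_repr Q hQ hi
      have h1 := (D.mem_jac_sq hc ψ).2 hne hψ
      have h3 : ∀ (c : B) {χ}, IsExponent.Indecomposable D.e χ →
          D.π ^ 2 ∣ D.b.repr (c * D.b χ) ψ := by
        intro c χ hχ
        rw [D.repr_mul_basis]
        refine Dvd.dvd.mul_left (Dvd.dvd.mul_left (pow_dvd_pow _ ?_) _) _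
        have h4 := D.two_mul_exponent ψ χ
        have h5 := D.isExponent.diag_mul_of_eq_zero (χ := χ) hψ
        rw [mul_comm χ] at h5
        have := hne χ
        have := hχ.1
        omega
      rw [map_add, map_add, Finsupp.add_apply, Finsupp.add_apply, dvd_add_left (h3 _ i2),
        dvd_add_left (h3 _ i1), hπ, sq] at h1
      exact hd ((mul_dvd_mul_iff_left D.prime.ne_zero).mp h1)
    · rw [add_comm (c 0 * _), add_assoc] at hc
      refine D.not_mem_jac_sq Q hQ hi i1 (fun ψ hψ => ?_) hc
      rw [map_add, Finsupp.add_apply, hπ]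
      exact dvd_add (dvd_mul_right _ _) (D.dvd_repr_mul_basis _ i1 hψ i2.1 h12)
    · rw [add_comm] at hc
      refine D.not_mem_jac_sq Q hQ hi i2 (fun ψ hψ => ?_) hc
      rw [map_add, Finsupp.add_apply, hπ]
      exact dvd_add (dvd_mul_right _ _) (D.dvd_repr_mul_basis _ i2 hψ i1.1 h21)
  -- If the exponent were at least 3, then `b χ ^ 2` would be a multiple of `π ^ 3`.
  · intro χ hχ
    by_contra! h
    refine D.sq_not_mem_jac_cube Q S h2 hQ hS hχ ?_
    rw [D.mul_self, map_mul, map_pow]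
    exact Ideal.mul_mem_left _ _ (Ideal.pow_le_pow_right h (Ideal.pow_mem_pow D.algebraMap_mem_jac _))
  -- Exponent 1 makes `π` a unit times `b α ^ 2`, hence an element of `jac ^ 2`. An exponent at
  -- least 2 would then put `b χ ^ 2` in the fourth power of `jac`.
  · intro α χ hα hχ
    by_contra! h
    refine D.sq_not_mem_jac_cube Q S h2 hQ hS hχ ?_
    have hα' : algebraMap O B D.π ∈ D.jac ^ 2 := by
      have h3 := Ideal.mul_mem_mul (D.basis_mem_jac (χ := α) (by omega))
        (D.basis_mem_jac (χ := α) (by omega))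
      rw [D.mul_self, hα, pow_one, map_mul, ← sq] at h3
      exact (Ideal.unit_mul_mem_iff_mem _ ((D.u α α).isUnit.map _)).mp h3
    rw [D.mul_self, map_mul, map_pow]
    have h3 : 2 ≤ D.e χ χ := by have := hχ.1; omega
    refine Ideal.mul_mem_left _ _ ?_
    obtain ⟨k, hk⟩ := Nat.exists_eq_add_of_le h3
    rw [hk, pow_add]
    refine Ideal.mul_mem_right _ _ (Ideal.pow_le_pow_right (show 3 ≤ 2 * 2 by norm_num) ?_)
    rw [pow_mul]
    exact Ideal.pow_mem_pow hα' 2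

end CharBasis

end CharBasisForward

/-! ### From exponents to regular points and nodes -/

section CharBasisBackward

open IsLocalRing

/-- Two distinct nonzero elements are separated by characters. -/
lemma exists_char_separating {n : ℕ} {g h : Grp n} (hg : g ≠ 0) (hgh : g ≠ h) :
    ∃ α : Chars n, α g = -1 ∧ α h = 1 := by
  have hgh' : g + h ≠ 0 := fun h0 => hgh (by
    funext i
    have h1 : g i + h i = 0 := congrFun h0 i
    generalize g i = a at h1
    generalize h i = b at h1
    revert a b
    decide)
  obtain ⟨χ, hχ⟩ := exists_char_eq_neg_one hgh'
  obtain ⟨ψ, hψ⟩ := exists_char_eq_neg_one hg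
  rw [AddChar.map_add_eq_mul] at hχ
  rcases Int.units_eq_one_or (χ g) with h1 | h1
  · rw [h1, one_mul] at hχ
    rcases Int.units_eq_one_or (ψ h) with h3 | h3
    · exact ⟨ψ, hψ, h3⟩
    · exact ⟨ψ * χ, by rw [AddChar.mul_apply, hψ, h1, mul_one], by
        rw [AddChar.mul_apply, h3, hχ]; decide⟩
  · exact ⟨χ, h1, by
      rw [h1] at hχ
      rcases Int.units_eq_one_or (χ h) with h3 | h3
      · exact h3
      · rw [h3] at hχ; exact absurd hχ (by decide)⟩

namespace CharBasis

variable {O B : Type*} [CommRing O] [IsDomain O] [CommRing B] [Algebra O B] {n : ℕ}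
  (D : CharBasis O B n)

/-- The subalgebra spanned by the characters which are trivial on `g`. -/
def evenSubalgebra (g : Grp n) : Subalgebra O B where
  carrier := {x | ∀ χ : Chars n, χ g = -1 → D.b.repr x χ = 0}
  mul_mem' := fun {x y} hx hy θ hθ => by
    rw [D.repr_mul]
    refine Finset.sum_eq_zero fun χ _ => ?_
    rcases Int.units_eq_one_or (χ g) with h | h
    · rw [hx (θ * χ) (by rw [AddChar.mul_apply, hθ, h, mul_one]), zero_mul, mul_zero]
    · rw [hy χ h, zero_mul]
  add_mem' := fun {x y} hx hy χ h => by
    rw [map_add, Finsupp.add_apply, hx χ h, hy χ h, add_zero]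
  algebraMap_mem' := fun x χ h => by
    rw [D.repr_algebraMap, if_neg]
    rintro rfl
    rw [AddChar.one_apply] at h
    exact absurd h (by decide)

omit [IsDomain O] in
lemma basis_mem_evenSubalgebra {g : Grp n} {χ : Chars n} (h : χ g = 1) :
    D.b χ ∈ D.evenSubalgebra g := by
  intro ψ hψ
  rw [Module.Basis.repr_self, Finsupp.single_apply, if_neg]
  rintro rfl
  rw [h] at hψ
  exact absurd hψ (by decide)

omit [IsDomain O] in
lemma basis_mem_of_mul {I : Ideal B} {χ α : Chars n} (hα : D.b α ∈ I)
    (he : D.e (χ * α) α = 0) : D.b χ ∈ I := by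
  have h := D.mul (χ * α) α
  rw [he, pow_zero, mul_one, Chars.mul_mul_self, Algebra.smul_def] at h
  have h1 : algebraMap O B (D.u (χ * α) α) * D.b χ ∈ I := h ▸ Ideal.mul_mem_left _ _ hα
  exact (Ideal.unit_mul_mem_iff_mem _ ((D.u (χ * α) α).isUnit.map _)).mp h1

-- An odd basis element is an even one times `b β` up to a unit, because the exponent between an
-- even character and `β` is zero. With `eq_zero_of_add_mul`, the algebra is a double cover of its
-- even subalgebra.
omit [IsDomain O] in
lemma exists_eq_add_mul {g : Grp n} {β : Chars n} (hβ : β g = -1)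
    (he : ∀ χ : Chars n, χ g = 1 → D.e χ β = 0) (b : B) :
    ∃ a ∈ D.evenSubalgebra g, ∃ a' ∈ D.evenSubalgebra g, b = a + a' * D.b β := by
  let W : Submodule O B := (D.evenSubalgebra g).toSubmodule ⊔
    (D.evenSubalgebra g).toSubmodule.map (LinearMap.mulRight O (D.b β))
  have hW : b ∈ W := by
    have : (⊤ : Submodule O B) ≤ W := by
      rw [← D.b.span_eq, Submodule.span_le]
      rintro _ ⟨χ, rfl⟩
      rcases Int.units_eq_one_or (χ g) with h | h
      · exact Submodule.mem_sup_left (D.basis_mem_evenSubalgebra h)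
      · have h' : (χ * β) g = 1 := by rw [AddChar.mul_apply, h, hβ]; decide
        refine Submodule.mem_sup_right ⟨((D.u (χ * β) β)⁻¹ : Oˣ) • D.b (χ * β), ?_, ?_⟩
        · exact Submodule.smul_mem _ _ (D.basis_mem_evenSubalgebra h')
        · rw [LinearMap.mulRight_apply, smul_mul_assoc, D.mul, he _ h', pow_zero, mul_one,
            Chars.mul_mul_self]
          exact inv_smul_smul (D.u (χ * β) β) (D.b χ)
    exact this trivial
  obtain ⟨a, ha, _, ⟨a', ha', rfl⟩, h⟩ := Submodule.mem_sup.mp hW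
  exact ⟨a, ha, a', ha', h.symm⟩

omit [IsDomain O] in
lemma eq_zero_of_add_mul {g : Grp n} {β : Chars n} (hβ : β g = -1)
    (he : ∀ χ : Chars n, χ g = 1 → D.e χ β = 0) {a a' : B} (ha : a ∈ D.evenSubalgebra g)
    (ha' : a' ∈ D.evenSubalgebra g) (h : a + a' * D.b β = 0) : a = 0 ∧ a' = 0 := by
  have h0 : ∀ θ, D.b.repr a θ + D.b.repr (a' * D.b β) θ = 0 := fun θ => by
    rw [← Finsupp.add_apply, ← map_add, h]; simp
  have h1 : ∀ θ : Chars n, θ g = 1 → D.b.repr a θ = 0 := fun θ hθ => by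
    have := h0 θ
    rw [D.repr_mul_basis, ha' (θ * β) (by rw [AddChar.mul_apply, hθ, hβ, one_mul])] at this
    simpa using this
  have h2 : a = 0 := by
    apply D.b.repr.injective
    ext θ
    rw [map_zero, Finsupp.zero_apply]
    exact (Int.units_eq_one_or (θ g)).elim (h1 θ) (ha θ)
  refine ⟨h2, ?_⟩
  apply D.b.repr.injective
  ext θ
  rw [map_zero, Finsupp.zero_apply]
  refine (Int.units_eq_one_or (θ g)).elim (fun hθ => ?_) (ha' θ)
  have := h0 (θ * β)
  rw [h2, map_zero, Finsupp.zero_apply, zero_add, D.repr_mul_basis, Chars.mul_mul_self, he θ hθ,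
    pow_zero, mul_one] at this
  exact (D.u θ β).isUnit.mul_left_eq_zero.mp this

end CharBasis

namespace CharBasis

variable {O : Type*} {B : Type u} [CommRing O] [IsDomain O] [IsNoetherianRing O] [CommRing B]
  [Algebra O B] {n : ℕ} (D : CharBasis O B n) (Q : Ideal B) [Q.IsPrime] {S : Type u} [CommRing S]
  [Algebra B S] [IsLocalization.AtPrime S Q]

-- The node is `z² = v t²` with `z = b β`, over the subalgebra of characters trivial on `g`. The
-- parameter `t` is left free, since it is `π` or another basis element according to the case.
include D in
lemma isNode_of_jac_le (h2 : IsUnit (2 : O)) (hd : ringKrullDim S = 1)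
    (hQ : algebraMap O B D.π ∈ Q) {g : Grp n} {β : Chars n} (hβ : β g = -1)
    (he : ∀ χ : Chars n, χ g = 1 → D.e χ β = 0) (hβ0 : D.e β β ≠ 0) {t : B}
    (ht : t ∈ D.evenSubalgebra g) (htQ : t ∈ Q) (v : Oˣ) (hz : D.b β ^ 2 = (v : O) • t ^ 2)
    (hJ : D.jac ≤ Ideal.span {t, D.b β}) : IsNode S := by
  have : Module.Finite O B := Module.Finite.of_basis D.b
  have : IsNoetherian O B := isNoetherian_of_isNoetherianRing_of_finite O B
  have : IsNoetherian O (D.evenSubalgebra g) :=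
    inferInstanceAs (IsNoetherian O (D.evenSubalgebra g).toSubmodule)
  have : IsNoetherianRing (D.evenSubalgebra g) := isNoetherian_of_tower O inferInstance
  refine isNode_of_double_cover (B₁ := D.evenSubalgebra g) (B := B) Q hd
    (t := ⟨t, ht⟩) (v := algebraMap O _ (v : O)) (z := D.b β) ?_ (v.isUnit.map _) ?_ ?_ ?_ htQ
    (D.basis_mem_prime Q hQ hβ0) ?_
  · have := h2.map (algebraMap O (D.evenSubalgebra g))
    rwa [map_ofNat] at this
  · rw [hz, Algebra.smul_def]; rfl
  · intro b
    obtain ⟨a, ha, a', ha', h⟩ := D.exists_eq_add_mul hβ he b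
    exact ⟨⟨a, ha⟩, ⟨a', ha'⟩, h⟩
  · intro a a' h
    obtain ⟨h1, h2⟩ := D.eq_zero_of_add_mul hβ he a.2 a'.2 h
    exact ⟨Subtype.ext h1, Subtype.ext h2⟩
  · intro q hq
    obtain ⟨s, hs, h⟩ := D.exists_mul_mem_jac Q h2 hq
    exact ⟨s, hs, hJ h⟩

include D in
lemma isRegularLocalRing_of_jac_le [IsLocalRing S] (h2 : IsUnit (2 : O)) (hd : ringKrullDim S = 1)
    (hQ : algebraMap O B D.π ∈ Q) {t : B} (htQ : t ∈ Q) (hJ : D.jac ≤ Ideal.span {t}) :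
    IsRegularLocalRing S := by
  have : Module.Finite O B := Module.Finite.of_basis D.b
  have : IsNoetherianRing B := isNoetherian_of_tower O
    (isNoetherian_of_isNoetherianRing_of_finite O B)
  have : IsNoetherianRing S := IsLocalization.isNoetherianRing Q.primeCompl S inferInstance
  refine isRegularLocalRing_of_maximalIdeal_eq_span_singleton (t := algebraMap B S t) ?_ hd
  refine le_antisymm ?_ ?_
  · rw [← D.map_jac_eq_maximalIdeal Q h2 hQ, ← Set.image_singleton, ← Ideal.map_span]
    exact Ideal.map_mono hJ
  · rw [Ideal.span_singleton_le_iff_mem, ← IsLocalization.AtPrime.map_eq_maximalIdeal Q S]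
    exact Ideal.mem_map_of_mem _ htQ

include D in
/-- The local rings over the closed point of a standard cover with branch divisor of multiplicity
at most two are regular or nodes. -/
theorem isRegularLocalRing_or_isNode [IsLocalRing S] (h2 : IsUnit (2 : O)) (hd : ringKrullDim S = 1)
    (hQ : algebraMap O B D.π ∈ Q) (m : {h : Grp n // h ≠ 0} → ℤ) (hm : ∀ h, 0 ≤ m h)
    (hm2 : ∑ h, m h ≤ 2) (he : ∀ χ ψ, (D.e χ ψ : ℤ) = ∑ h, eps χ ψ h.1 * m h) :
    IsRegularLocalRing S ∨ IsNode S := by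
  -- Unramified case: all basis elements are invertible and `π` generates the maximal ideal.
  by_cases h0 : ∀ h, m h = 0
  · refine Or.inl (D.isRegularLocalRing_of_jac_le Q h2 hd hQ hQ (D.jac_le ?_ fun χ hχ => ?_))
    · exact Ideal.mem_span_singleton_self _
    · refine absurd ?_ hχ
      have := he χ χ
      simpa [h0] using this
  push Not at h0
  obtain ⟨g, hg⟩ := h0
  have hg1 : 1 ≤ m g := by have := hm g; omega
  -- Multiplicity one: for `α` nontrivial on `g`, the square of `b α` is a unit times `π`, and `b α`
  -- generates the maximal ideal.
  by_cases h1 : ∀ h, m h = if h = g then 1 else 0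
  · obtain ⟨α, hα⟩ := exists_char_eq_neg_one g.2
    have he' : ∀ χ ψ, (D.e χ ψ : ℤ) = eps χ ψ g.1 := fun χ ψ => by
      rw [he]; simp [h1]
    have hαα : D.e α α = 1 := by
      have := he' α α
      simp only [eps, hα, and_self, if_true] at this
      exact_mod_cast this
    refine Or.inl (D.isRegularLocalRing_of_jac_le Q h2 hd hQ
      (D.basis_mem_prime Q hQ (χ := α) (by omega)) (D.jac_le ?_ fun χ hχ => ?_))
    · have h3 : D.b α * D.b α ∈ Ideal.span {D.b α} :=
        Ideal.mul_mem_left _ _ (Ideal.mem_span_singleton_self _)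
      rw [D.mul_self, hαα, pow_one, map_mul] at h3
      exact (Ideal.unit_mul_mem_iff_mem _ ((D.u α α).isUnit.map _)).mp h3
    · refine D.basis_mem_of_mul (Ideal.mem_span_singleton_self _) ?_
      have h3 : χ g.1 = -1 := by
        by_contra h3
        have := he' χ χ
        simp only [eps, h3, false_and, if_false] at this
        exact hχ (by exact_mod_cast this)
      have := he' (χ * α) α
      simp only [eps, AddChar.mul_apply, h3, hα] at this
      exact_mod_cast this
  push Not at h1
  obtain ⟨h, hh⟩ := h1
  -- In the remaining case the multiplicities are those of `g + h`, with `g = h` allowed.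
  have hsum : ∃ h, ∀ χ ψ, (D.e χ ψ : ℤ) = eps χ ψ g.1 + eps χ ψ (h : {h : Grp n // h ≠ 0}).1 := by
    have hs : ∑ h, (m h - if h = g then 1 else 0) ≤ 1 := by
      rw [Finset.sum_sub_distrib]; simp; omega
    have hn : ∀ h, 0 ≤ m h - if h = g then 1 else 0 := fun h => by
      split_ifs with h'
      · subst h'; omega
      · simpa using hm h
    have hh1 : 1 ≤ m h - if h = g then 1 else 0 := by have := hn h; omega
    refine ⟨h, fun χ ψ => ?_⟩
    have hm' : ∀ x, m x = (if x = g then 1 else 0) + if x = h then 1 else 0 := by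
      intro x
      have hle : ∀ y, y ≠ h → m y - (if y = g then 1 else 0) = 0 := by
        intro y hy
        have := Finset.sum_le_sum_of_subset_of_nonneg (Finset.subset_univ {y, h})
          (f := fun h => m h - if h = g then 1 else 0) fun i _ _ => hn i
        rw [Finset.sum_pair hy] at this
        have := hn y
        omega
      by_cases hx : x = h
      · subst hx
        have := Finset.single_le_sum (f := fun h => m h - if h = g then 1 else 0)
          (fun i _ => hn i) (Finset.mem_univ x)
        simp only [if_true]
        omega
      · have := hle x hx
        rw [if_neg hx]
        omega
    rw [he]
    simp_rw [hm', mul_add, Finset.sum_add_distrib]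
    simp
  clear hh hg hg1 he hm hm2
  obtain ⟨h, he⟩ := hsum
  right
  -- A character odd on `h` and, when the two elements differ, trivial on `g`: it has zero exponent
  -- with every character trivial on `h`, as the decomposition into a double cover needs.
  have hβe : ∃ β : Chars n, β h.1 = -1 ∧ (∀ χ : Chars n, χ h.1 = 1 → D.e χ β = 0) ∧
      (g ≠ h → β g.1 = 1) := by
    by_cases hgh : g = h
    · obtain ⟨β, hβ⟩ := exists_char_eq_neg_one h.2
      refine ⟨β, hβ, fun χ hχ => ?_, fun h' => absurd hgh h'⟩
      have := he χ β
      subst hgh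
      simp only [eps, hχ, hβ] at this
      exact_mod_cast this
    · obtain ⟨β, hβ, hβ'⟩ := exists_char_separating h.2 fun h' => hgh (Subtype.ext h'.symm)
      refine ⟨β, hβ, fun χ hχ => ?_, fun _ => hβ'⟩
      have := he χ β
      simp only [eps, hχ, hβ, hβ', show ¬ (1 : ℤˣ) = -1 by decide, false_and, and_false,
        if_false] at this
      exact_mod_cast this
  obtain ⟨β, hβ, hβe, hβg⟩ := hβe
  have hmem : ∀ {I : Ideal B} {χ : Chars n}, D.b β ∈ I → χ h.1 = -1 → D.b χ ∈ I := by
    intro I χ hI hχ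
    refine D.basis_mem_of_mul hI (hβe _ ?_)
    rw [AddChar.mul_apply, hχ, hβ]; decide
  have hβ0 : D.e β β ≠ 0 := by
    intro h0
    have := he β β
    rw [h0] at this
    simp only [eps, hβ, and_self, if_true] at this
    split_ifs at this <;> simp at this
  -- If `g = h`, then `b β ^ 2` is a unit times `π ^ 2` and the parameter is `π`. Otherwise `b α ^
  -- 2` and `b β ^ 2` are both units times `π`, so `b β ^ 2` is a unit times `b α ^ 2` and the
  -- parameter is `b α`.
  by_cases hgh : g = h
  · subst hgh
    have hββ : D.e β β = 2 := by
      have := he β β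
      simp only [eps, hβ, and_self, if_true] at this
      omega
    refine D.isNode_of_jac_le Q h2 hd hQ hβ hβe hβ0 (t := algebraMap O B D.π)
      (Subalgebra.algebraMap_mem _ _) hQ (D.u β β) ?_ (D.jac_le (Ideal.subset_span (by simp)) ?_)
    · rw [sq, D.mul_self, hββ, Algebra.smul_def, map_mul, map_pow]
    · intro χ hχ
      refine hmem (Ideal.subset_span (by simp)) ?_
      by_contra h3
      have := he χ χ
      simp only [eps, h3, false_and, if_false] at this
      exact hχ (by exact_mod_cast this)
  · obtain ⟨α, hα, hα'⟩ := exists_char_separating g.2 fun h' => hgh (Subtype.ext h')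
    have hβg := hβg hgh
    have hαα : D.e α α = 1 := by
      have := he α α
      simp only [eps, hα, hα'] at this
      exact_mod_cast this
    have hββ : D.e β β = 1 := by
      have := he β β
      simp only [eps, hβ, hβg] at this
      exact_mod_cast this
    have e1 := D.mul_self α
    have e2 := D.mul_self β
    rw [hαα, pow_one, ← sq, map_mul] at e1
    rw [hββ, pow_one, ← sq, map_mul] at e2
    refine D.isNode_of_jac_le Q h2 hd hQ hβ hβe hβ0 (t := D.b α)
      (D.basis_mem_evenSubalgebra hα') (D.basis_mem_prime Q hQ (by omega))
      (D.u β β * (D.u α α)⁻¹) ?_ (D.jac_le ?_ ?_)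
    · rw [e1, e2, Algebra.smul_def, Units.val_mul, map_mul]
      have : algebraMap O B ((D.u α α)⁻¹ : Oˣ) * algebraMap O B (D.u α α) = 1 := by
        rw [← map_mul, Units.inv_mul, map_one]
      linear_combination (-algebraMap O B (D.u β β) * algebraMap O B D.π) * this
    · have h3 : D.b α ^ 2 ∈ Ideal.span {D.b α, D.b β} :=
        Ideal.pow_mem_of_mem _ (Ideal.subset_span (by simp)) _ (by norm_num)
      rw [e1] at h3
      exact (Ideal.unit_mul_mem_iff_mem _ ((D.u α α).isUnit.map _)).mp h3
    · intro χ hχ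
      rcases Int.units_eq_one_or (χ h.1) with hχh | hχh
      · refine D.basis_mem_of_mul (α := α) (Ideal.subset_span (by simp)) ?_
        have hχg : χ g.1 = -1 := by
          by_contra h3
          have := he χ χ
          simp only [eps, h3, hχh, false_and, if_false] at this
          exact hχ (by exact_mod_cast this)
        have := he (χ * α) α
        simp only [eps, AddChar.mul_apply, hχg, hχh, hα, hα'] at this
        exact_mod_cast this
      · exact hmem (Ideal.subset_span (by simp)) hχh

end CharBasis

end CharBasisBackward

/-! ### Quotients by finite groups preserve heights -/

section Invariants

open Ideal Pointwise

variable {R A : Type*} [CommRing R] [CommRing A] [Algebra R A] (G : Type*) [Group G] [Finite G]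
  [MulSemiringAction G A] [SMulCommClass G R A] [Algebra.IsInvariant R A G]

-- Lift the smaller prime to some `P`, go up from `P` to a prime over the larger one, and move the
-- result to the prescribed `Q` by a group element, since the group permutes the primes in a fibre
-- transitively.
include G in
lemma hasGoingDown_of_isInvariant (hinj : Function.Injective (algebraMap R A)) :
    Algebra.HasGoingDown R A := by
  have := Algebra.IsInvariant.isIntegral R A G
  refine ⟨fun {p} _ Q _ hlt => ?_⟩
  obtain ⟨P, -, _, hP⟩ := exists_ideal_over_prime_of_isIntegral p (⊥ : Ideal A) (by
    rw [← RingHom.ker_eq_comap_bot, (RingHom.injective_iff_ker_eq_bot _).mp hinj]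
    exact bot_le)
  obtain ⟨Q', hPQ, _, hQ'⟩ := exists_ideal_over_prime_of_isIntegral (Q.under R) P (by
    rw [hP]; exact hlt.le)
  obtain ⟨g, hg⟩ := Algebra.IsInvariant.exists_smul_of_under_eq R A G Q' Q hQ'
  refine ⟨g • P, ?_, inferInstance, ?_⟩
  · rw [hg]
    exact Ideal.pointwise_smul_le_pointwise_smul_iff.mpr hPQ
  · have : P.LiesOver p := ⟨hP.symm⟩
    infer_instance

-- Integrality makes contraction strictly monotone, which bounds one height by the other; going down
-- gives the opposite bound.
include G in
lemma height_under_of_isInvariant [IsNoetherianRing A] [IsNoetherianRing R]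
    (hinj : Function.Injective (algebraMap R A))
    (P : Ideal A) [P.IsPrime] : P.height = (P.under R).height := by
  have := Algebra.IsInvariant.isIntegral R A G
  have := hasGoingDown_of_isInvariant G hinj
  refine le_antisymm ?_ ?_
  · have hmono : StrictMono (PrimeSpectrum.comap (algebraMap R A)) := fun I J h =>
      Ideal.IsIntegral.comap_lt_comap h
    have := Order.height_le_height_apply_of_strictMono _ hmono ⟨P, inferInstance⟩
    rwa [← PrimeSpectrum.height_eq_orderHeight, ← PrimeSpectrum.height_eq_orderHeight] at this
  · rw [height_eq_height_add_of_liesOver_of_hasGoingDown (P.under R) P]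
    exact le_self_add

end Invariants

/-! ### Condition S₂ and divisibility in codimension one -/

section SerreTwo

/-- Depth at least `min(2, dim)`. -/
def DepthTwo (R : Type*) [CommRing R] [IsLocalRing R] : Prop :=
  ∀ m : ℕ, m ≤ 2 → (m : WithBot ℕ∞) ≤ ringKrullDim R →
    ∃ rs : List R, rs.length = m ∧ (∀ r ∈ rs, r ∈ IsLocalRing.maximalIdeal R) ∧
      RingTheory.Sequence.IsRegular R rs

lemma isWeaklyRegular_pair_iff {R : Type*} [CommRing R] (r s : R) :
    RingTheory.Sequence.IsWeaklyRegular R [r, s] ↔ (∀ a, r * a = 0 → a = 0) ∧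
      ∀ a b, s * a = r * b → ∃ c, a = r * c := by
  rw [RingTheory.Sequence.isWeaklyRegular_cons_iff,
    RingTheory.Sequence.isWeaklyRegular_singleton_iff]
  refine and_congr (by rw [isSMulRegular_iff_right_eq_zero_of_smul]; rfl) ?_
  rw [isSMulRegular_iff_right_eq_zero_of_smul]
  have h0 : ∀ a : R, (Submodule.Quotient.mk a : QuotSMulTop r R) = 0 ↔ ∃ c, a = r * c := by
    intro a
    rw [Submodule.Quotient.mk_eq_zero, Submodule.mem_smul_pointwise_iff_exists]
    simp only [Submodule.mem_top, true_and, smul_eq_mul, eq_comm]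
  constructor
  · intro h a b hab
    rw [← h0]
    refine h _ ?_
    rw [← Submodule.Quotient.mk_smul, h0]
    exact ⟨b, hab⟩
  · intro h x hx
    obtain ⟨a, rfl⟩ := Submodule.Quotient.mk_surjective _ x
    rw [← Submodule.Quotient.mk_smul, h0] at hx
    obtain ⟨b, hb⟩ := hx
    exact (h0 a).mpr (h a b hb)

/-- Membership in multiples of elements of the base can be tested in codimension one. -/
def IsDivisorial (R A : Type*) [CommRing R] [CommRing A] [Algebra R A] : Prop :=
  ∀ (r : R) (a : A), r ≠ 0 →
    (∀ q : Ideal R, q.IsPrime → q.height = 1 → ∃ t ∉ q, ∃ b : A, t • a = r • b) →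
    ∃ b : A, a = r • b

variable {R A : Type*} [CommRing R] [IsDomain R] [CommRing A] [Algebra R A] [IsNoetherianRing R]
  [IsNoetherianRing A] (G : Type*) [Group G] [Finite G] [MulSemiringAction G A]
  [SMulCommClass G R A] [Algebra.IsInvariant R A G]

lemma two_le_height {q : Ideal R} {r : R} (hr : r ≠ 0) (hrq : r ∈ q) [q.IsPrime]
    (h1 : q.height ≠ 1) : 2 ≤ q.height := by
  have h0 : q.height ≠ 0 := by
    rw [Ne, Ideal.height_eq_zero_iff_eq_bot]
    rintro rfl
    exact hr hrq
  have : q.height ≠ ⊤ := Ideal.height_ne_top Ideal.IsPrime.ne_top'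
  generalize q.height = h at *
  induction h with
  | top => exact le_top
  | coe n =>
    norm_cast at h0 h1 ⊢
    omega

-- If `u` is not divisible by `r`, the annihilator of `u` modulo `r` lies in an associated prime `P`
-- of `A / r`. Divisibility in codimension one forces `P` to lie over height at least two. There
-- depth two is incompatible with `P` being associated to a principal ideal generated by a
-- nonzerodivisor.
include G in
theorem isDivisorial_of_depthTwo.{w} (htf : ∀ (r : R) (a : A), r ≠ 0 → r • a = 0 → a = 0)
    (h : ∀ (P : Ideal A) [P.IsPrime], ∃ (S : Type w) (_ : CommRing S) (_ : IsLocalRing S)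
      (_ : Algebra A S), IsLocalization.AtPrime S P ∧ DepthTwo S) : IsDivisorial R A := by
  intro r u hr hu
  by_contra hne
  push Not at hne
  have : Nontrivial A := ⟨u, r • 0, hne 0⟩
  have hinj : Function.Injective (algebraMap R A) := by
    rw [injective_iff_map_eq_zero]
    intro x hx
    by_contra hx0
    refine one_ne_zero (htf x (1 : A) hx0 ?_)
    rw [Algebra.smul_def, hx, zero_mul]
  let I : Ideal A := Ideal.span {algebraMap R A r}
  have hI : ∀ x : A, x ∈ I ↔ ∃ b : A, x = r • b := fun x => by
    rw [Ideal.mem_span_singleton']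
    simp only [Algebra.smul_def, eq_comm, mul_comm]
  have hu0 : (Ideal.Quotient.mk I u) ≠ 0 := by
    rw [Ne, Ideal.Quotient.eq_zero_iff_mem, hI]
    push Not
    exact hne
  obtain ⟨P, hPass, hle⟩ := exists_le_isAssociatedPrime_of_isNoetherianRing A
    (M := A ⧸ I) _ hu0
  rw [isAssociatedPrime_iff] at hPass
  obtain ⟨hP, w, hw⟩ := hPass
  obtain ⟨c, rfl⟩ := Ideal.Quotient.mk_surjective w
  have hmemP : ∀ x : A, x ∈ P ↔ ∃ b : A, x * c = r • b := fun x => by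
    rw [hw, Submodule.mem_colon_singleton, Submodule.mem_bot, ← hI,
      ← Ideal.Quotient.eq_zero_iff_mem]
    rfl
  have hmemu : ∀ t : R, (∃ b : A, t • u = r • b) → t ∈ P.under R := fun t ht => by
    refine hle (Submodule.mem_colon_singleton.mpr ?_)
    rw [Submodule.mem_bot]
    refine (Ideal.Quotient.eq_zero_iff_mem.mpr ?_ : Ideal.Quotient.mk I (algebraMap R A t * u) = 0)
    rw [hI, ← Algebra.smul_def]
    exact ht
  have hrP : r ∈ P.under R := hmemu r ⟨u, rfl⟩
  have hq1 : (P.under R).height ≠ 1 := fun h1 => by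
    obtain ⟨t, ht, b, hb⟩ := hu _ inferInstance h1
    exact ht (hmemu t ⟨b, hb⟩)
  have hq2 := two_le_height hr hrP hq1
  rw [← height_under_of_isInvariant G hinj P] at hq2
  obtain ⟨S, _, _, _, _, hS⟩ := h P
  have hd : ((2 : ℕ) : WithBot ℕ∞) ≤ ringKrullDim S := by
    rw [IsLocalization.AtPrime.ringKrullDim_eq_height P S]
    exact WithBot.coe_le_coe.mpr hq2
  obtain ⟨rs, hlen, hmem, hreg⟩ := hS 2 le_rfl hd
  obtain ⟨r1, r2, rfl⟩ := List.length_eq_two.mp hlen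
  obtain ⟨hr1, hr2⟩ := (isWeaklyRegular_pair_iff _ _).mp hreg.toIsWeaklyRegular
  let ι := algebraMap A S
  -- The class of `c` modulo `r` has annihilator `P`, so the whole maximal ideal of `S` multiplies
  -- `c` into `(r)`. Two members of a regular sequence then show that `c` itself is in `(r)`.
  have key : ∀ x ∈ IsLocalRing.maximalIdeal S, ∃ b, x * ι c = ι (algebraMap R A r) * b := by
    intro x hx
    obtain ⟨y, s, rfl⟩ := IsLocalization.exists_mk'_eq P.primeCompl x
    rw [IsLocalization.AtPrime.mk'_mem_maximal_iff S P] at hx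
    obtain ⟨b, hb⟩ := (hmemP y).mp hx
    refine ⟨IsLocalization.mk' S b s, ?_⟩
    rw [mul_comm, IsLocalization.mul_mk'_eq_mk'_of_mul, IsLocalization.mul_mk'_eq_mk'_of_mul,
      mul_comm c, hb, Algebra.smul_def]
  have hrS : ∀ x, ι (algebraMap R A r) * x = 0 → x = 0 := by
    intro x hx
    obtain ⟨y, s, rfl⟩ := IsLocalization.exists_mk'_eq P.primeCompl x
    rw [IsLocalization.mul_mk'_eq_mk'_of_mul, IsLocalization.mk'_eq_zero_iff] at hx
    obtain ⟨m, hm⟩ := hx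
    rw [IsLocalization.mk'_eq_zero_iff]
    refine ⟨m, htf r _ hr ?_⟩
    rw [Algebra.smul_def, ← hm]
    ring
  obtain ⟨c1, hc1⟩ := key r1 (hmem r1 (by simp))
  obtain ⟨c2, hc2⟩ := key r2 (hmem r2 (by simp))
  have h12 : r2 * c1 = r1 * c2 := by
    rw [← sub_eq_zero]
    refine hrS _ ?_
    linear_combination r1 * hc2 - r2 * hc1
  obtain ⟨d, rfl⟩ := hr2 _ _ h12
  have hd0 : ι c = ι (algebraMap R A r) * d := by
    rw [← sub_eq_zero]
    refine hr1 _ ?_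
    linear_combination hc1
  obtain ⟨y, s, rfl⟩ := IsLocalization.exists_mk'_eq P.primeCompl d
  rw [IsLocalization.mul_mk'_eq_mk'_of_mul, eq_comm, IsLocalization.mk'_eq_iff_eq_mul, ← map_mul,
    IsLocalization.eq_iff_exists P.primeCompl] at hd0
  obtain ⟨m, hm⟩ := hd0
  refine (m * s).2 ((hmemP _).mpr ⟨m * y, ?_⟩)
  rw [Algebra.smul_def]
  push_cast
  linear_combination -hm

-- A regular sequence is found already in the base: a nonzero `r` below `P`, and an `s` below `P`
-- avoiding the minimal primes of `r`. Regularity of `s` modulo `r` is a divisibility by `r`,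
-- checked at height one primes: there `s` or `r` is invertible.
include G in
theorem depthTwo_of_isDivisorial (htf : ∀ (r : R) (a : A), r ≠ 0 → r • a = 0 → a = 0)
    (h : IsDivisorial R A) (P : Ideal A) [P.IsPrime] {S : Type*} [CommRing S] [IsLocalRing S]
    [Algebra A S] [IsLocalization.AtPrime S P] : DepthTwo S := by
  have : Nontrivial A := ⟨0, 1, fun h => (inferInstance : P.IsPrime).ne_top
    ((Ideal.eq_top_iff_one P).mpr (h ▸ P.zero_mem))⟩
  have hinj : Function.Injective (algebraMap R A) := by
    rw [injective_iff_map_eq_zero]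
    intro x hx
    by_contra hx0
    refine one_ne_zero (htf x (1 : A) hx0 ?_)
    rw [Algebra.smul_def, hx, zero_mul]
  intro m hm hd
  suffices ∃ rs : List A, rs.length = m ∧ (∀ r ∈ rs, r ∈ P) ∧
      RingTheory.Sequence.IsWeaklyRegular A rs by
    obtain ⟨rs, hl, hP, hw⟩ := this
    refine ⟨rs.map (algebraMap A S), by simpa using hl, fun r hr => ?_,
      hw.isRegular_of_isLocalization_of_mem S P hP⟩
    obtain ⟨x, hx, rfl⟩ := List.mem_map.mp hr
    rw [IsLocalization.AtPrime.to_map_mem_maximal_iff S P]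
    exact hP x hx
  rw [IsLocalization.AtPrime.ringKrullDim_eq_height P S, height_under_of_isInvariant G hinj P] at hd
  replace hd : (m : ℕ∞) ≤ (P.under R).height := by exact_mod_cast hd
  rcases Nat.eq_zero_or_pos m with rfl | hm0
  · exact ⟨[], rfl, by simp, .nil _ _⟩
  have hq0 : P.under R ≠ ⊥ := by
    intro h0
    rw [← Ideal.height_eq_zero_iff_eq_bot] at h0
    rw [h0] at hd
    have : m ≤ 0 := by exact_mod_cast hd
    omega
  obtain ⟨r, hrP, hr⟩ := Submodule.exists_mem_ne_zero_of_ne_bot hq0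
  have hreg : ∀ a : A, algebraMap R A r * a = 0 → a = 0 := fun a ha =>
    htf r a hr (by rwa [Algebra.smul_def])
  by_cases hm1 : m = 1
  · subst hm1
    refine ⟨[algebraMap R A r], rfl, by simpa using hrP, ?_⟩
    rw [RingTheory.Sequence.isWeaklyRegular_singleton_iff,
      isSMulRegular_iff_right_eq_zero_of_smul]
    exact hreg
  obtain rfl : m = 2 := by omega
  -- Prime avoidance: the minimal primes of `r` have height at most one, whereas the prime below `P`
  -- has height at least two.
  have hs : ∃ s ∈ P.under R, ∀ q ∈ (Ideal.span {r}).minimalPrimes, s ∉ q := by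
    by_contra! hs
    have hfin := Ideal.finite_minimalPrimes_of_isNoetherianRing R (Ideal.span {r})
    have hsub : ((P.under R : Ideal R) : Set R) ⊆
        ⋃ q ∈ (hfin.toFinset : Set (Ideal R)), ((id q : Ideal R) : Set R) := by
      intro s hs'
      obtain ⟨q, hq, hsq⟩ := hs s hs'
      simp only [Set.mem_iUnion]
      exact ⟨q, Finset.mem_coe.mpr (hfin.mem_toFinset.mpr hq), hsq⟩
    rw [Ideal.subset_union_prime (f := id) ⊥ ⊥ fun q hq _ _ =>
      (hfin.mem_toFinset.mp hq).1.1] at hsub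
    obtain ⟨q, hq, hle⟩ := hsub
    have hq' := hfin.mem_toFinset.mp hq
    have := hq'.1.1
    have h1 := Ideal.height_le_one_of_isPrincipal_of_mem_minimalPrimes _ q hq'
    have h2 := (hd.trans (Ideal.height_mono hle)).trans h1
    exact absurd h2 (by decide)
  obtain ⟨s, hsP, hs⟩ := hs
  refine ⟨[algebraMap R A r, algebraMap R A s], rfl, ?_, ?_⟩
  · intro x hx
    simp only [List.mem_cons, List.not_mem_nil, or_false] at hx
    rcases hx with rfl | rfl
    · exact hrP
    · exact hsP
  rw [isWeaklyRegular_pair_iff]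
  refine ⟨hreg, fun a b hab => ?_⟩
  simp only [← Algebra.smul_def] at hab ⊢
  refine h r a hr fun q hq hq1 => ?_
  by_cases hrq : r ∈ q
  · refine ⟨s, hs q ?_, b, hab⟩
    refine ⟨⟨hq, by simpa [Ideal.span_le] using hrq⟩, fun p ⟨hp, hrp⟩ hpq => ?_⟩
    by_contra hqp
    have hlt : p < q := lt_of_le_of_ne hpq fun h => hqp h.ge
    have h3 := Ideal.height_strict_mono_of_isPrime_of_isPrime hlt
    rw [hq1, Order.lt_one_iff, Ideal.height_eq_zero_iff_eq_bot] at h3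
    subst h3
    exact hr (by simpa using hrp)
  · exact ⟨r, hrq, a, rfl⟩

end SerreTwo

/-- On a normal noetherian domain, divisibility can be tested in codimension one. -/
theorem isDivisorial_self (R : Type*) [CommRing R] [IsDomain R] [IsNoetherianRing R]
    [IsIntegrallyClosed R] : IsDivisorial R R := by
  intro r u hr hu
  simp only [smul_eq_mul] at hu ⊢
  by_contra hne
  push Not at hne
  let I : Ideal R := Ideal.span {r}
  have hI : ∀ x : R, x ∈ I ↔ ∃ b : R, x = r * b := fun x => by
    rw [Ideal.mem_span_singleton]; rfl
  have hu0 : (Ideal.Quotient.mk I u) ≠ 0 := by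
    rw [Ne, Ideal.Quotient.eq_zero_iff_mem, hI]
    push Not
    exact hne
  obtain ⟨P, hPass, hle⟩ := exists_le_isAssociatedPrime_of_isNoetherianRing R
    (M := R ⧸ I) _ hu0
  rw [isAssociatedPrime_iff] at hPass
  obtain ⟨hP, w, hw⟩ := hPass
  obtain ⟨c, rfl⟩ := Ideal.Quotient.mk_surjective w
  have hmemP : ∀ x : R, x ∈ P ↔ ∃ b : R, x * c = r * b := fun x => by
    rw [hw, Submodule.mem_colon_singleton, Submodule.mem_bot, ← hI,
      ← Ideal.Quotient.eq_zero_iff_mem]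
    rfl
  have hmemu : ∀ t : R, (∃ b : R, t * u = r * b) → t ∈ P := fun t ht => by
    refine hle (Submodule.mem_colon_singleton.mpr ?_)
    rw [Submodule.mem_bot]
    exact (Ideal.Quotient.eq_zero_iff_mem.mpr ((hI _).mpr ht) : Ideal.Quotient.mk I (t * u) = 0)
  have hrP : r ∈ P := hmemu r ⟨u, rfl⟩
  -- Write the associated prime as `(r) : c`. If `c / r` maps `P` into itself, it is integral by the
  -- determinant trick, hence regular, which makes `P` the unit ideal. Otherwise some `p ∈ P` has `p
  -- * c = r * s` with `s ∉ P`, so `P` is minimal over `p` and has height one.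
  by_cases hint : ∀ p ∈ P, ∃ p' ∈ P, p * c = r * p'
  · have h1 : IsIntegral R (algebraMap R (FractionRing R) c / algebraMap R (FractionRing R) r) := by
      refine isIntegral_of_smul_mem_submodule (R := R) (A := FractionRing R) (M := FractionRing R)
        (Submodule.map (Algebra.linearMap R (FractionRing R)) P) ?_ ?_ _ ?_
      · rw [Submodule.ne_bot_iff]
        exact ⟨_, ⟨r, hrP, rfl⟩, (IsFractionRing.to_map_eq_zero_iff (K := FractionRing R)).not.mpr hr⟩
      · exact Submodule.FG.map _ (IsNoetherian.noetherian P)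
      · rintro _ ⟨p, hp, rfl⟩
        obtain ⟨p', hp', h⟩ := hint p hp
        refine ⟨p', hp', ?_⟩
        have h3 : algebraMap R (FractionRing R) r ≠ 0 := (IsFractionRing.to_map_eq_zero_iff (K := FractionRing R)).not.mpr hr
        have h4 := congrArg (algebraMap R (FractionRing R)) h
        rw [map_mul, map_mul] at h4
        rw [Algebra.linearMap_apply, Algebra.linearMap_apply, smul_eq_mul]
        field_simp
        linear_combination -h4
    obtain ⟨y, hy⟩ := IsIntegrallyClosed.algebraMap_eq_of_integral h1
    refine hP.ne_top ((Ideal.eq_top_iff_one P).mpr ((hmemP 1).mpr ⟨y, ?_⟩))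
    have h3 : algebraMap R (FractionRing R) r ≠ 0 := (IsFractionRing.to_map_eq_zero_iff (K := FractionRing R)).not.mpr hr
    apply IsFractionRing.injective R (FractionRing R)
    rw [one_mul, map_mul, hy, mul_div_cancel₀ _ h3]
  · push Not at hint
    obtain ⟨p, hp, hps⟩ := hint
    obtain ⟨s, hs⟩ := (hmemP p).mp hp
    have hsP : s ∉ P := fun h => hps s h hs
    have hdvd : ∀ y ∈ P, ∃ z, s * y = p * z := by
      intro y hy
      obtain ⟨z, hz⟩ := (hmemP y).mp hy
      refine ⟨z, mul_left_cancel₀ hr ?_⟩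
      linear_combination p * hz - y * hs
    have hmin : P ∈ (Ideal.span {p}).minimalPrimes := by
      refine ⟨⟨hP, by simpa [Ideal.span_le] using hp⟩, fun q ⟨hq, hpq⟩ hqP y hy => ?_⟩
      obtain ⟨z, hz⟩ := hdvd y hy
      have : s * y ∈ q := by
        rw [hz]
        exact Ideal.mul_mem_right _ _ (hpq (Ideal.mem_span_singleton_self p))
      exact (hq.mem_or_mem this).resolve_left fun h => hsP (hqP h)
    have h1 := Ideal.height_le_one_of_isPrincipal_of_mem_minimalPrimes _ P hmin
    have h2 : P.height ≠ 1 := fun h => by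
      obtain ⟨t, ht, b, hb⟩ := hu P hP h
      exact ht (hmemu t ⟨b, hb⟩)
    exact absurd ((two_le_height hr hrP h2).trans h1) (by decide)

/-! ### Orders of rational functions at prime divisors -/

section Ord

variable {Y : Scheme.{u}} [IsIntegral Y] [IsLocallyNoetherian Y]

lemma isDiscreteValuationRing_stalk (hN : IsNormalScheme Y) (y : PrimeDivisor Y) :
    IsDiscreteValuationRing (Y.presheaf.stalk y.1) := by
  have := hN y.1
  have hk : Ring.KrullDimLE 1 (Y.presheaf.stalk y.1) := krullDimLE_of_coheight_le y.2.le
  have hd := ringKrullDim_stalk_eq_coheight y.1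
  rw [y.2] at hd
  have hf : ¬ IsField (Y.presheaf.stalk y.1) := fun h => by
    rw [ringKrullDim_eq_zero_of_isField h] at hd
    exact absurd hd (by decide)
  have : Ring.DimensionLEOne (Y.presheaf.stalk y.1) :=
    ⟨fun hp hpr => (Ring.krullDimLE_one_iff_of_isPrime_bot.mp hk) _ hp hpr⟩
  have : IsDedekindDomain (Y.presheaf.stalk y.1) := { }
  exact ((IsDiscreteValuationRing.TFAE _ hf).out 0 2).mpr this

lemma ord_one (y : Y) : Scheme.ord (1 : Y.functionField) y = 0 := by
  have h := Scheme.ord_mul (x := y) (one_ne_zero (α := Y.functionField)) one_ne_zero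
  rw [one_mul] at h
  omega

lemma ord_inv {a : Y.functionField} (ha : a ≠ 0) (y : Y) :
    Scheme.ord a⁻¹ y = - Scheme.ord a y := by
  have h := Scheme.ord_mul (x := y) ha (inv_ne_zero ha)
  rw [mul_inv_cancel₀ ha, ord_one] at h
  omega

lemma ord_pow {a : Y.functionField} (ha : a ≠ 0) (y : Y) (k : ℕ) :
    Scheme.ord (a ^ k) y = k * Scheme.ord a y := by
  induction k with
  | zero => simp [ord_one]
  | succ k ih => rw [pow_succ, Scheme.ord_mul (pow_ne_zero _ ha) ha, ih]; push_cast; ring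

lemma ord_zpow {a : Y.functionField} (ha : a ≠ 0) (y : Y) (k : ℤ) :
    Scheme.ord (a ^ k) y = k * Scheme.ord a y := by
  cases k with
  | ofNat k => simpa using ord_pow ha y k
  | negSucc k =>
    rw [zpow_negSucc, ord_inv (pow_ne_zero _ ha), ord_pow ha]
    simp only [Int.negSucc_eq]; push_cast; ring

lemma ord_prod {ι : Type*} (s : Finset ι) (a : ι → Y.functionField) (ha : ∀ i, a i ≠ 0) (y : Y) :
    Scheme.ord (∏ i ∈ s, a i) y = ∑ i ∈ s, Scheme.ord (a i) y := by
  classical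
  induction s using Finset.induction_on with
  | empty => simp [ord_one]
  | insert i s hi ih =>
    rw [Finset.prod_insert hi, Finset.sum_insert hi,
      Scheme.ord_mul (ha i) (Finset.prod_ne_zero_iff.mpr fun i _ => ha i), ih]

lemma ord_algebraMap_nonneg (y : PrimeDivisor Y) (x : Y.presheaf.stalk y.1) :
    0 ≤ Scheme.ord (algebraMap (Y.presheaf.stalk y.1) Y.functionField x) y.1 := by
  by_cases hx : x = 0
  · simp [hx]
  have : Ring.KrullDimLE 1 (Y.presheaf.stalk y.1) := krullDimLE_of_coheight_le y.2.le
  have hx' : algebraMap (Y.presheaf.stalk y.1) Y.functionField x ≠ 0 := by simpa using hx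
  rw [Scheme.le_ord_iff y.2 hx']
  exact Ring.ordFrac_ge_one_of_ne_zero hx

lemma ord_algebraMap_eq_zero (y : PrimeDivisor Y) {x : Y.presheaf.stalk y.1} (hx : IsUnit x) :
    Scheme.ord (algebraMap (Y.presheaf.stalk y.1) Y.functionField x) y.1 = 0 := by
  have : Ring.KrullDimLE 1 (Y.presheaf.stalk y.1) := krullDimLE_of_coheight_le y.2.le
  have hx' : algebraMap (Y.presheaf.stalk y.1) Y.functionField x ≠ 0 := by simpa using hx.ne_zero
  rw [Scheme.ord_eq_iff y.2 hx']
  exact Ring.ordFrac_of_isUnit hx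

lemma isUnit_of_ord_eq_zero (hN : IsNormalScheme Y) (y : PrimeDivisor Y)
    {x : Y.presheaf.stalk y.1} (hx0 : x ≠ 0)
    (hx : Scheme.ord (algebraMap (Y.presheaf.stalk y.1) Y.functionField x) y.1 = 0) :
    IsUnit x := by
  have := isDiscreteValuationRing_stalk hN y
  have hx' : algebraMap (Y.presheaf.stalk y.1) Y.functionField x ≠ 0 := by simpa using hx0
  rw [Scheme.ord_eq_iff y.2 hx'] at hx
  exact Ring.isUnit_iff_ordFrac_one_of_isDiscreteValuationRing.mpr hx

/-- In a valuation ring `a` or its inverse is integral. In the second case the inverse has order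
both at least and at most zero, so it is a unit. -/
lemma exists_stalk_of_ord_nonneg (hN : IsNormalScheme Y) (y : PrimeDivisor Y)
    {a : Y.functionField} (ha : 0 ≤ Scheme.ord a y.1) :
    ∃ x : Y.presheaf.stalk y.1, algebraMap _ _ x = a := by
  have := isDiscreteValuationRing_stalk hN y
  by_cases ha0 : a = 0
  · exact ⟨0, by simp [ha0]⟩
  rcases ValuationRing.isInteger_or_isInteger (Y.presheaf.stalk y.1) a with h | ⟨x, hx⟩
  · exact h
  · have hx0 : x ≠ 0 := by
      rintro rfl
      rw [map_zero, eq_comm, inv_eq_zero] at hx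
      exact ha0 hx
    have h1 := ord_algebraMap_nonneg y x
    rw [hx, ord_inv ha0] at h1
    have hu := isUnit_of_ord_eq_zero hN y hx0 (by rw [hx, ord_inv ha0]; omega)
    obtain ⟨v, hv⟩ := hu.exists_right_inv
    refine ⟨v, ?_⟩
    have h2 := congrArg (algebraMap (Y.presheaf.stalk y.1) Y.functionField) hv
    rw [map_mul, map_one, hx] at h2
    field_simp at h2
    exact h2

lemma exists_ord_eq_one (hN : IsNormalScheme Y) (y : PrimeDivisor Y) :
    ∃ a : Y.functionField, a ≠ 0 ∧ Scheme.ord a y.1 = 1 := by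
  have := isDiscreteValuationRing_stalk hN y
  obtain ⟨ϖ, hϖ⟩ := IsDiscreteValuationRing.exists_irreducible (Y.presheaf.stalk y.1)
  have h0 : algebraMap (Y.presheaf.stalk y.1) Y.functionField ϖ ≠ 0 := by
    simpa using hϖ.ne_zero
  refine ⟨_, h0, ?_⟩
  rw [Scheme.ord_eq_iff y.2 h0]
  exact Ring.ordFrac_irreducible hϖ

lemma exists_ord_eq (hN : IsNormalScheme Y) (y : PrimeDivisor Y) (m : ℤ) :
    ∃ a : Y.functionField, a ≠ 0 ∧ Scheme.ord a y.1 = m := by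
  obtain ⟨a, ha, h⟩ := exists_ord_eq_one hN y
  exact ⟨a ^ m, zpow_ne_zero _ ha, by rw [ord_zpow ha, h, mul_one]⟩

end Ord

/-! ### Points of affine open sets as prime ideals -/

section Points

variable {X : Scheme.{u}} {U : X.Opens} (hU : IsAffineOpen U)

lemma exists_primeIdealOf_eq (q : Ideal Γ(X, U)) [hq : q.IsPrime] :
    ∃ x : U, (hU.primeIdealOf x).asIdeal = q := by
  have hmem : hU.fromSpec ⟨q, hq⟩ ∈ U := by
    have : hU.fromSpec ⟨q, hq⟩ ∈ (U : Set X) := by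
      rw [← hU.range_fromSpec]; exact ⟨_, rfl⟩
    exact this
  refine ⟨⟨hU.fromSpec ⟨q, hq⟩, hmem⟩, ?_⟩
  have h := hU.fromSpec_primeIdealOf ⟨hU.fromSpec ⟨q, hq⟩, hmem⟩
  rw [hU.fromSpec.isOpenEmbedding.injective h]

lemma mem_primeIdealOf_iff (x : U) (r : Γ(X, U)) :
    r ∈ (hU.primeIdealOf x).asIdeal ↔ ¬ IsUnit (X.presheaf.germ U x.1 x.2 r) := by
  have := hU.isLocalization_stalk x
  exact (IsLocalization.AtPrime.to_map_mem_maximal_iff (X.presheaf.stalk x.1)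
    (hU.primeIdealOf x).asIdeal r).symm

lemma height_primeIdealOf (x : U) :
    ((hU.primeIdealOf x).asIdeal.height : WithBot ℕ∞) = Order.coheight x.1 := by
  have := hU.isLocalization_stalk x
  rw [← ringKrullDim_stalk_eq_coheight,
    IsLocalization.AtPrime.ringKrullDim_eq_height (hU.primeIdealOf x).asIdeal]

lemma height_primeIdealOf' (x : U) :
    (hU.primeIdealOf x).asIdeal.height = Order.coheight x.1 :=
  WithBot.coe_injective (height_primeIdealOf hU x)

include hU in
lemma exists_primeDivisor_of_height_eq_one (q : Ideal Γ(X, U)) [q.IsPrime] (h : q.height = 1) :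
    ∃ (y : PrimeDivisor X) (hy : y.1 ∈ U),
      ∀ r : Γ(X, U), r ∉ q ↔ IsUnit (X.presheaf.germ U y.1 hy r) := by
  obtain ⟨x, rfl⟩ := exists_primeIdealOf_eq hU q
  rw [height_primeIdealOf'] at h
  exact ⟨⟨x.1, h⟩, x.2, fun r => by rw [mem_primeIdealOf_iff, not_not]⟩

include hU in
lemma exists_germ_mul_eq (x : U) (s : X.presheaf.stalk x.1) :
    ∃ a t : Γ(X, U), IsUnit (X.presheaf.germ U x.1 x.2 t) ∧
      X.presheaf.germ U x.1 x.2 t * s = X.presheaf.germ U x.1 x.2 a := by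
  have := hU.isLocalization_stalk x
  obtain ⟨⟨a, t⟩, h⟩ := IsLocalization.surj (hU.primeIdealOf x).asIdeal.primeCompl s
  refine ⟨a, t, ?_, ?_⟩
  · have := (mem_primeIdealOf_iff hU x t.1).not.mp t.2
    rwa [not_not] at this
  · rw [mul_comm]
    exact h

end Points

/-! ### Finiteness of divisors and sections of divisorial sheaves -/

section PrimeDivisors

variable {Y : Scheme.{u}} [IsIntegral Y]

omit [IsIntegral Y] in
lemma PrimeDivisor.eq_of_specializes {y z : PrimeDivisor Y} (h : y.1 ⤳ z.1) : y = z := by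
  by_contra hne
  have hlt : z.1 < y.1 := by
    refine lt_of_le_not_ge (Scheme.le_iff_specializes.mpr h) fun h' => hne (Subtype.ext ?_)
    exact (h.antisymm (Scheme.le_iff_specializes.mp h')).eq
  have := Order.coheight_strictAnti hlt (by rw [y.2]; exact ENat.one_lt_top)
  rw [y.2, z.2] at this
  exact lt_irrefl _ this

lemma eq_genericPoint_of_specializes {y : PrimeDivisor Y} {z : Y} (h : z ⤳ y.1) :
    z = y.1 ∨ z = genericPoint Y := by
  by_contra! hne
  have hlt : y.1 < z := by
    refine lt_of_le_not_ge (Scheme.le_iff_specializes.mpr h) fun h' => hne.1 ?_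
    exact (h.antisymm (Scheme.le_iff_specializes.mp h')).eq
  have hlt' : z < genericPoint Y := by
    have hs : genericPoint Y ⤳ z := genericPoint_specializes z
    refine lt_of_le_not_ge (Scheme.le_iff_specializes.mpr hs) fun h' => hne.2 ?_
    exact (hs.antisymm (Scheme.le_iff_specializes.mp h')).symm.eq
  have h1 := Order.coheight_add_one_le hlt
  have h2 := Order.coheight_add_one_le hlt'
  rw [y.2] at h1
  have h3 : Order.coheight z + 1 ≤ 0 + 1 := by rwa [zero_add]
  have h4 : Order.coheight z = 0 :=
    le_antisymm ((ENat.add_le_add_iff_right ENat.one_ne_top).mp h3) bot_le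
  rw [h4] at h2
  simp at h2

/-- The closed complement has finitely many irreducible components. None contains the generic point
of `Y`, so a point of codimension one in a component must be its generic point. -/
lemma finite_primeDivisors_notMem [IsLocallyNoetherian Y] [CompactSpace Y] (U : Y.Opens)
    [hU : Nonempty U] : {y : PrimeDivisor Y | y.1 ∉ U}.Finite := by
  have : IsNoetherian Y := ⟨⟩
  have : TopologicalSpace.NoetherianSpace Y := IsNoetherian.noetherianSpace
  obtain ⟨S, hS, hcl, hirr, hsup⟩ :=
    TopologicalSpace.NoetherianSpace.exists_finite_set_isClosed_irreducible
      U.isOpen.isClosed_compl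
  have hgen : genericPoint Y ∈ U :=
    ((genericPoint_spec Y).mem_open_set_iff U.isOpen).mpr (by simpa using hU)
  have key : ∀ y : PrimeDivisor Y, y.1 ∉ U → ∃ t ∈ S, t = closure {y.1} := by
    intro y hy
    have hmem : y.1 ∈ ⋃₀ S := by
      rw [← hsup]; exact hy
    obtain ⟨t, ht, hyt⟩ := hmem
    obtain ⟨z, hz⟩ := QuasiSober.sober (hirr t ht) (hcl t ht)
    have hzy : z ⤳ y.1 := hz.specializes hyt
    refine ⟨t, ht, ?_⟩
    rcases eq_genericPoint_of_specializes hzy with rfl | rfl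
    · exact hz.def.symm
    · exfalso
      have : genericPoint Y ∈ ⋃₀ S := ⟨t, ht, hz.mem⟩
      rw [← hsup] at this
      exact this hgen
  choose! f hf using key
  refine Set.Finite.of_finite_image (f := f) (hS.subset ?_) ?_
  · rintro _ ⟨y, hy, rfl⟩
    exact (hf y hy).1
  · intro y hy z hz h
    have h1 : closure {y.1} = closure {z.1} := by
      rw [← (hf y hy).2, ← (hf z hz).2, h]
    refine PrimeDivisor.eq_of_specializes (specializes_iff_mem_closure.mpr ?_)
    rw [h1]
    exact subset_closure rfl

omit [IsIntegral Y] in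
lemma exists_affine_mem_forall_notMem (y : PrimeDivisor Y) (V : Y.Opens) (hy : y.1 ∈ V)
    {T : Set (PrimeDivisor Y)} (hT : T.Finite) (hyT : y ∉ T) :
    ∃ U : Y.Opens, IsAffineOpen U ∧ y.1 ∈ U ∧ U ≤ V ∧ ∀ z ∈ T, z.1 ∉ U := by
  let W : Y.Opens := ⟨(V : Set Y) ∩ (⋃ z ∈ T, closure {z.1})ᶜ,
    V.isOpen.inter (hT.isClosed_biUnion fun _ _ => isClosed_closure).isOpen_compl⟩
  have hyW : y.1 ∈ W := by
    refine ⟨hy, ?_⟩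
    simp only [Set.mem_compl_iff, Set.mem_iUnion, not_exists]
    intro z hz h
    exact hyT (PrimeDivisor.eq_of_specializes (specializes_iff_mem_closure.mpr h) ▸ hz)
  obtain ⟨_, ⟨U, hU, rfl⟩, hyU, hUW⟩ :=
    Y.isBasis_affineOpens.exists_subset_of_mem_open hyW W.isOpen
  refine ⟨U, hU, hyU, fun x hx => (hUW hx).1, fun z hz hzU => (hUW hzU).2 ?_⟩
  simp only [Set.mem_iUnion]
  exact ⟨z, hz, subset_closure rfl⟩

variable [IsLocallyNoetherian Y]

lemma finite_ord_ne_zero [CompactSpace Y] {a : Y.functionField} (ha : a ≠ 0) :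
    {y : PrimeDivisor Y | Scheme.ord a y.1 ≠ 0}.Finite := by
  obtain ⟨U, -, f, _, rfl, hf⟩ := exists_isUnit_germ_eq Y a ha
  refine (finite_primeDivisors_notMem U).subset fun y hy hyU => hy ?_
  exact Scheme.ord_of_isUnit hf hyU

/-- Divisorial sheaves are generated by one element near each prime divisor. -/
lemma exists_mem_sectionsNeg [CompactSpace Y] (hN : IsNormalScheme Y) (E : WeilDivisor Y)
    (y : PrimeDivisor Y) (V : Y.Opens) (hy : y.1 ∈ V) :
    ∃ U : Y.Opens, IsAffineOpen U ∧ y.1 ∈ U ∧ U ≤ V ∧ ∃ a : Y.functionField, a ≠ 0 ∧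
      Scheme.ord a y.1 = E y ∧ a ∈ sectionsNeg E U := by
  obtain ⟨a, ha, hord⟩ := exists_ord_eq hN y (E y)
  -- Shrinking away from the finitely many prime divisors other than `y` at which `a` or `E` is
  -- nontrivial leaves `y` as the only condition.
  obtain ⟨U, hU, hyU, hUV, hT⟩ := exists_affine_mem_forall_notMem y V hy
    (T := ({z | Scheme.ord a z.1 ≠ 0} ∪ (E.support : Set (PrimeDivisor Y))) \ {y})
    (((finite_ord_ne_zero ha).union E.support.finite_toSet).sdiff) (by simp)
  refine ⟨U, hU, hyU, hUV, a, ha, hord, Or.inr fun z hz => ?_⟩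
  by_cases hzy : z = y
  · rw [hzy, hord]
  · by_contra h
    refine hT z ⟨?_, hzy⟩ hz
    by_contra h'
    simp only [Set.mem_union, Set.mem_ofPred_eq, Finset.mem_coe, Finsupp.mem_support_iff, not_or,
      not_not] at h'
    rw [h'.1, h'.2] at h
    exact h le_rfl

/-- Algebraic Hartogs: write `a` as a fraction over an affine open set and test divisibility of the
numerator at the prime divisors, using `isDivisorial_self`. -/
lemma exists_germToFunctionField_eq (hN : IsNormalScheme Y) {U : Y.Opens} (hU : IsAffineOpen U)
    [Nonempty U] {a : Y.functionField}
    (ha : ∀ y : PrimeDivisor Y, y.1 ∈ U → 0 ≤ Scheme.ord a y.1) :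
    ∃ r : Γ(Y, U), Y.germToFunctionField U r = a := by
  have := functionField_isFractionRing_of_isAffineOpen Y U hU
  have hnoeth : IsNoetherianRing Γ(Y, U) := IsLocallyNoetherian.component_noetherian ⟨U, hU⟩
  have hic : IsIntegrallyClosed Γ(Y, U) := by
    refine IsIntegrallyClosed.of_localization_maximal fun p _ hp => ?_
    obtain ⟨x, rfl⟩ := exists_primeIdealOf_eq hU p
    have := hU.isLocalization_stalk x
    have := hN x.1
    exact IsIntegrallyClosed.of_equiv (IsLocalization.algEquiv
      (hU.primeIdealOf x).asIdeal.primeCompl (Y.presheaf.stalk x.1)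
      (Localization.AtPrime (hU.primeIdealOf x).asIdeal)).toRingEquiv
  obtain ⟨u, r, hr, rfl⟩ := IsFractionRing.div_surjective (A := Γ(Y, U)) a
  have hr0 : r ≠ 0 := nonZeroDivisors.ne_zero hr
  have hr' : algebraMap Γ(Y, U) Y.functionField r ≠ 0 := by simpa using hr0
  obtain ⟨b, hb⟩ := isDivisorial_self Γ(Y, U) r u hr0 fun q hq hq1 => by
    obtain ⟨y, hy, hyq⟩ := exists_primeDivisor_of_height_eq_one hU q hq1
    obtain ⟨x, hx⟩ := exists_stalk_of_ord_nonneg hN y (ha y hy)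
    obtain ⟨b, t, ht, hbt⟩ := exists_germ_mul_eq hU ⟨y.1, hy⟩ x
    refine ⟨t, (hyq t).mpr ht, b, ?_⟩
    apply IsFractionRing.injective Γ(Y, U) Y.functionField
    have h1 := congrArg (algebraMap (Y.presheaf.stalk y.1) Y.functionField) hbt
    rw [map_mul, hx] at h1
    rw [Scheme.algebraMap_germ_eq_germToFunctionField,
      Scheme.algebraMap_germ_eq_germToFunctionField] at h1
    change algebraMap Γ(Y, U) Y.functionField t * _ = algebraMap Γ(Y, U) Y.functionField b at h1
    rw [smul_eq_mul, smul_eq_mul, map_mul, map_mul, ← h1]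
    field_simp
  refine ⟨b, ?_⟩
  rw [hb, smul_eq_mul, map_mul]
  change algebraMap Γ(Y, U) Y.functionField b = _
  field_simp

end PrimeDivisors

/-! ### Direct images determined on nonempty affine open sets -/

section Gluing

variable {X Y : Scheme.{u}} (f : X ⟶ Y)

/-- Restriction of sections of a direct image. -/
noncomputable abbrev resOver {U V : Y.Opens} (h : V ≤ U) : Γ(X, f ⁻¹ᵁ U) ⟶ Γ(X, f ⁻¹ᵁ V) :=
  X.presheaf.map (homOfLE (f.preimage_mono h)).op

lemma resOver_resOver {U V W : Y.Opens} (h : V ≤ U) (h' : W ≤ V) (s : Γ(X, f ⁻¹ᵁ U)) :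
    resOver f h' (resOver f h s) = resOver f (h'.trans h) s := by
  rw [← CommRingCat.comp_apply, ← Functor.map_comp]
  rfl

lemma resOver_self {U : Y.Opens} (s : Γ(X, f ⁻¹ᵁ U)) : resOver f le_rfl s = s := by
  have : (homOfLE (f.preimage_mono (le_refl U))).op = 𝟙 _ := rfl
  rw [resOver, this, X.presheaf.map_id]
  rfl

lemma resOver_app {U V : Y.Opens} (h : V ≤ U) (r : Γ(Y, U)) :
    resOver f h (f.app U r) = f.app V (Y.presheaf.map (homOfLE h).op r) := by
  rw [← CommRingCat.comp_apply, ← CommRingCat.comp_apply]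
  exact congrArg (fun g => g.hom r) (f.naturality (homOfLE h).op).symm

lemma exists_affine_le {U : Y.Opens} {y : Y} (hy : y ∈ U) :
    ∃ V : Y.Opens, IsAffineOpen V ∧ y ∈ V ∧ V ≤ U := by
  obtain ⟨_, ⟨V, hV, rfl⟩, hyV, hVU⟩ :=
    Y.isBasis_affineOpens.exists_subset_of_mem_open hy U.isOpen
  exact ⟨V, hV, hyV, hVU⟩

/-- Only nonempty affine sets are used, since sections are compared with rational functions only
there; the family may be empty, and then `U` is empty. -/
lemma eq_of_resOver_affine {U : Y.Opens} {s t : Γ(X, f ⁻¹ᵁ U)}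
    (h : ∀ (V : Y.Opens) [Nonempty V] (_ : IsAffineOpen V) (hVU : V ≤ U),
      resOver f hVU s = resOver f hVU t) : s = t := by
  let ι := {V : Y.Opens // IsAffineOpen V ∧ V ≤ U ∧ Nonempty V}
  refine TopCat.Sheaf.eq_of_locally_eq' X.sheaf (fun V : ι => f ⁻¹ᵁ V.1) (f ⁻¹ᵁ U)
    (fun V => homOfLE (f.preimage_mono V.2.2.1)) ?_ s t fun V => ?_
  · intro x hx
    obtain ⟨V, hV, hxV, hVU⟩ := exists_affine_le (U := U) (y := f x) hx
    exact TopologicalSpace.Opens.mem_iSup.mpr ⟨⟨V, hV, hVU, ⟨⟨_, hxV⟩⟩⟩, hxV⟩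
  · have := V.2.2.2
    exact h V.1 V.2.1 V.2.2.1

lemma exists_resOver_eq {U : Y.Opens}
    (s : ∀ (V : Y.Opens) [Nonempty V] (_ : IsAffineOpen V) (_ : V ≤ U), Γ(X, f ⁻¹ᵁ V))
    (hs : ∀ (V W : Y.Opens) [Nonempty V] [Nonempty W] (hV : IsAffineOpen V) (hW : IsAffineOpen W)
      (hVU : V ≤ U) (hWV : W ≤ V), resOver f hWV (s V hV hVU) = s W hW (hWV.trans hVU)) :
    ∃ t : Γ(X, f ⁻¹ᵁ U), ∀ (V : Y.Opens) [Nonempty V] (hV : IsAffineOpen V) (hVU : V ≤ U),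
      resOver f hVU t = s V hV hVU := by
  let ι := {V : Y.Opens // IsAffineOpen V ∧ V ≤ U ∧ Nonempty V}
  obtain ⟨t, ht, -⟩ := TopCat.Sheaf.existsUnique_gluing' X.sheaf (fun V : ι => f ⁻¹ᵁ V.1) (f ⁻¹ᵁ U)
    (fun V => homOfLE (f.preimage_mono V.2.2.1)) (by
      intro x hx
      obtain ⟨V, hV, hxV, hVU⟩ := exists_affine_le (U := U) (y := f x) hx
      exact TopologicalSpace.Opens.mem_iSup.mpr ⟨⟨V, hV, hVU, ⟨⟨_, hxV⟩⟩⟩, hxV⟩)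
    (fun V => haveI := V.2.2.2; s V.1 V.2.1 V.2.2.1) (by
      intro V W
      have := V.2.2.2
      have := W.2.2.2
      refine eq_of_resOver_affine (U := V.1 ⊓ W.1) f ?_
      intro Z _ hZ hle
      have h1 := hs V.1 Z V.2.1 hZ V.2.2.1 (hle.trans inf_le_left)
      have h2 := hs W.1 Z W.2.1 hZ W.2.2.1 (hle.trans inf_le_right)
      have h3 := (h1.trans h2.symm)
      rw [← resOver_resOver f inf_le_left hle, ← resOver_resOver f inf_le_right hle] at h3
      exact h3)
  exact ⟨t, fun V _ hV hVU => ht ⟨V, hV, hVU, ‹_›⟩⟩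

end Gluing

section Base

variable {Y : Scheme.{u}} [IsIntegral Y]

lemma nonempty_inf (U V : Y.Opens) [hU : Nonempty U] [hV : Nonempty V] : Nonempty ↑(U ⊓ V) := by
  have h1 : genericPoint Y ∈ U :=
    ((genericPoint_spec Y).mem_open_set_iff U.isOpen).mpr (by simpa using hU)
  have h2 : genericPoint Y ∈ V :=
    ((genericPoint_spec Y).mem_open_set_iff V.isOpen).mpr (by simpa using hV)
  exact ⟨⟨genericPoint Y, h1, h2⟩⟩

omit [IsIntegral Y] in
lemma exists_affine_nonempty_le (U : Y.Opens) [hU : Nonempty U] :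
    ∃ V : Y.Opens, IsAffineOpen V ∧ Nonempty V ∧ V ≤ U := by
  obtain ⟨y⟩ := hU
  obtain ⟨V, hV, hy, hle⟩ := exists_affine_le y.2
  exact ⟨V, hV, ⟨⟨_, hy⟩⟩, hle⟩

lemma germToFunctionField_res {U V : Y.Opens} [Nonempty U] [Nonempty V] (h : V ≤ U) (r : Γ(Y, U)) :
    Y.germToFunctionField V (Y.presheaf.map (homOfLE h).op r) = Y.germToFunctionField U r :=
  Y.presheaf.germ_res_apply (homOfLE h) _ _ r

end Base

/-- Double counting: summing all values `χ g` leaves only the trivial character, or only the zero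
element, according to the order of summation. -/
lemma card_chars (n : ℕ) : Fintype.card (Chars n) = 2 ^ n := by
  have h1 : ∑ χ : Chars n, ∑ g : Grp n, ((χ g : ℤˣ) : ℤ) = 2 ^ n := by
    rw [Finset.sum_eq_single 1 (fun χ _ hχ => sum_elements_eq_zero hχ) (by simp)]
    simp [ZMod.card]
  rw [Finset.sum_comm, Finset.sum_eq_single 0 (fun g _ hg => sum_chars_eq_zero hg) (by simp)] at h1
  simp only [AddChar.map_zero_eq_one, Units.val_one, Finset.sum_const, Finset.card_univ,
    nsmul_eq_mul, mul_one] at h1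
  exact_mod_cast h1

/-! ### Eigenspace decomposition of a cover -/

namespace Cover

variable {Y : Scheme.{u}} {n : ℕ} (c : Cover Y n)

lemma act_zero (U : Y.Opens) (s : Γ(c.X, c.f ⁻¹ᵁ U)) : c.act 0 U s = s := by
  have h : (c.ρ (Multiplicative.ofAdd 0)).hom = 𝟙 _ := by
    rw [ofAdd_zero, map_one]; rfl
  simp only [act, h]
  simp only [Scheme.Hom.appLE, Scheme.Hom.id_app]
  exact resOver_self c.f s

lemma act_act (g h : Grp n) (U : Y.Opens) (s : Γ(c.X, c.f ⁻¹ᵁ U)) :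
    c.act g U (c.act h U s) = c.act (g + h) U s := by
  have hg : (c.ρ (Multiplicative.ofAdd (g + h))).hom =
      (c.ρ (Multiplicative.ofAdd g)).hom ≫ (c.ρ (Multiplicative.ofAdd h)).hom := by
    rw [add_comm, ofAdd_add, map_mul]; rfl
  simp only [act, hg]
  rw [← CommRingCat.comp_apply, Scheme.Hom.appLE_comp_appLE]

lemma act_res (g : Grp n) {U V : Y.Opens} (h : V ≤ U) (s : Γ(c.X, c.f ⁻¹ᵁ U)) :
    resOver c.f h (c.act g U s) = c.act g V (resOver c.f h s) := by
  simp only [act]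
  rw [← CommRingCat.comp_apply, ← CommRingCat.comp_apply, resOver, Scheme.Hom.appLE_map,
    Scheme.Hom.map_appLE]

lemma act_app (g : Grp n) {U : Y.Opens} (r : Γ(Y, U)) : c.act g U (c.f.app U r) = c.f.app U r := by
  have h : c.f.app U r ∈ Set.range (c.f.app U) := ⟨r, rfl⟩
  rw [c.range_eq] at h
  exact h (Multiplicative.ofAdd g)

lemma exists_app_eq {U : Y.Opens} {s : Γ(c.X, c.f ⁻¹ᵁ U)} (h : ∀ g, c.act g U s = s) :
    ∃ r, c.f.app U r = s := by
  have h : s ∈ Set.range (c.f.app U) := by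
    rw [c.range_eq]
    exact fun g => h g.toAdd
  exact h

/-- The group acts on the sections of `f_* 𝒪_X` over an open set. -/
@[reducible]
noncomputable def mulSemiringAction (U : Y.Opens) :
    MulSemiringAction (Multiplicative (Grp n)) Γ(c.X, c.f ⁻¹ᵁ U) where
  smul g s := c.act g.toAdd U s
  one_smul s := c.act_zero U s
  mul_smul g h s := (c.act_act g.toAdd h.toAdd U s).symm
  smul_zero g := map_zero (c.act g.toAdd U).hom
  smul_add g := map_add (c.act g.toAdd U).hom
  smul_one g := map_one (c.act g.toAdd U).hom
  smul_mul g := map_mul (c.act g.toAdd U).hom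

lemma zero_mem_eigen (χ : Chars n) (U : Y.Opens) : 0 ∈ c.eigen χ U := fun g => by simp

lemma add_mem_eigen {χ : Chars n} {U : Y.Opens} {s t : Γ(c.X, c.f ⁻¹ᵁ U)} (hs : s ∈ c.eigen χ U)
    (ht : t ∈ c.eigen χ U) : s + t ∈ c.eigen χ U := fun g => by
  rw [map_add, hs g, ht g, smul_add]

lemma neg_mem_eigen {χ : Chars n} {U : Y.Opens} {s : Γ(c.X, c.f ⁻¹ᵁ U)} (hs : s ∈ c.eigen χ U) :
    -s ∈ c.eigen χ U := fun g => by
  rw [map_neg, hs g, smul_neg]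

lemma sub_mem_eigen {χ : Chars n} {U : Y.Opens} {s t : Γ(c.X, c.f ⁻¹ᵁ U)} (hs : s ∈ c.eigen χ U)
    (ht : t ∈ c.eigen χ U) : s - t ∈ c.eigen χ U := by
  rw [sub_eq_add_neg]
  exact c.add_mem_eigen hs (c.neg_mem_eigen ht)

lemma app_mem_eigen {U : Y.Opens} (r : Γ(Y, U)) : c.f.app U r ∈ c.eigen 1 U := fun g => by
  rw [act_app]; simp

lemma mul_mem_eigen {χ ψ : Chars n} {U : Y.Opens} {s t : Γ(c.X, c.f ⁻¹ᵁ U)}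
    (hs : s ∈ c.eigen χ U) (ht : t ∈ c.eigen ψ U) : s * t ∈ c.eigen (χ * ψ) U := fun g => by
  rw [map_mul, hs g, ht g, AddChar.mul_apply, Units.val_mul, smul_mul_smul_comm]

lemma app_mul_mem_eigen {χ : Chars n} {U : Y.Opens} (r : Γ(Y, U)) {s : Γ(c.X, c.f ⁻¹ᵁ U)}
    (hs : s ∈ c.eigen χ U) : c.f.app U r * s ∈ c.eigen χ U := by
  simpa using c.mul_mem_eigen (c.app_mem_eigen r) hs

lemma mul_self_mem_eigen {χ : Chars n} {U : Y.Opens} {s t : Γ(c.X, c.f ⁻¹ᵁ U)}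
    (hs : s ∈ c.eigen χ U) (ht : t ∈ c.eigen χ U) : s * t ∈ c.eigen 1 U := by
  have := c.mul_mem_eigen hs ht
  rwa [χ.mul_self] at this

lemma res_mem_eigen {χ : Chars n} {U V : Y.Opens} (h : V ≤ U) {s : Γ(c.X, c.f ⁻¹ᵁ U)}
    (hs : s ∈ c.eigen χ U) : resOver c.f h s ∈ c.eigen χ V := fun g => by
  rw [← act_res, hs g, map_zsmul]

lemma exists_app_eq_of_mem_eigen_one {U : Y.Opens} {s : Γ(c.X, c.f ⁻¹ᵁ U)}
    (hs : s ∈ c.eigen 1 U) : ∃ r, c.f.app U r = s :=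
  c.exists_app_eq fun g => by rw [hs g]; simp

lemma one_mem_eigen (U : Y.Opens) : 1 ∈ c.eigen 1 U := fun g => by simp

lemma isUnit_two (h2 : IsUnit (2 : Γ(Y, ⊤))) (U : Y.Opens) : IsUnit (2 : Γ(Y, U)) := by
  have := h2.map (Y.presheaf.map (homOfLE (le_top : U ≤ ⊤)).op).hom
  rwa [map_ofNat] at this

/-- Projection to an eigenspace. -/
noncomputable def proj (χ : Chars n) (U : Y.Opens) : Γ(c.X, c.f ⁻¹ᵁ U) →+ Γ(c.X, c.f ⁻¹ᵁ U) where
  -- `Ring.inverse` has the value zero at nonunits, so the projection is defined without assuming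
  -- that 2 is invertible.
  toFun s := c.f.app U (Ring.inverse (2 ^ n)) * ∑ g : Grp n, ((χ g : ℤˣ) : ℤ) • c.act g U s
  map_zero' := by simp
  map_add' s t := by simp [Finset.sum_add_distrib, mul_add]

lemma proj_apply (χ : Chars n) (U : Y.Opens) (s : Γ(c.X, c.f ⁻¹ᵁ U)) : c.proj χ U s =
    c.f.app U (Ring.inverse (2 ^ n)) * ∑ g : Grp n, ((χ g : ℤˣ) : ℤ) • c.act g U s := rfl

lemma proj_mem_eigen (χ : Chars n) (U : Y.Opens) (s : Γ(c.X, c.f ⁻¹ᵁ U)) :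
    c.proj χ U s ∈ c.eigen χ U := by
  refine c.app_mul_mem_eigen _ fun g => ?_
  rw [map_sum, Finset.smul_sum]
  refine Fintype.sum_equiv (Equiv.addLeft g) _ _ fun h => ?_
  rw [map_zsmul, act_act, smul_smul, Equiv.coe_addLeft, AddChar.map_add_eq_mul, ← Units.val_mul,
    ← mul_assoc, Int.units_mul_self, one_mul]

variable (h2 : IsUnit (2 : Γ(Y, ⊤)))
include h2

lemma app_inverse_mul (U : Y.Opens) : c.f.app U (Ring.inverse (2 ^ n)) * 2 ^ n = 1 := by
  have h : c.f.app U (2 ^ n) = 2 ^ n := by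
    rw [map_pow, map_ofNat]
  rw [← h, ← map_mul, Ring.inverse_mul_cancel _ ((isUnit_two h2 U).pow n), map_one]

/-- After exchanging sums, orthogonality of characters leaves only the identity element, whose
multiplicity cancels the denominator `2 ^ n`. -/
lemma sum_proj (U : Y.Opens) (s : Γ(c.X, c.f ⁻¹ᵁ U)) : ∑ χ, c.proj χ U s = s := by
  simp_rw [proj_apply]
  rw [← Finset.mul_sum, Finset.sum_comm]
  simp_rw [← Finset.sum_smul]
  rw [Finset.sum_eq_single 0]
  · have h0 : ∑ χ : Chars n, ((χ 0 : ℤˣ) : ℤ) = 2 ^ n := by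
      simp [AddChar.map_zero_eq_one, card_chars]
    rw [h0, act_zero, zsmul_eq_mul, ← mul_assoc]
    push_cast
    rw [c.app_inverse_mul h2, one_mul]
  · intro g _ hg
    rw [sum_chars_eq_zero hg, zero_smul]
  · simp

lemma proj_of_mem_eigen {χ : Chars n} {U : Y.Opens} {s : Γ(c.X, c.f ⁻¹ᵁ U)}
    (hs : s ∈ c.eigen χ U) (ψ : Chars n) : c.proj ψ U s = if ψ = χ then s else 0 := by
  rw [proj_apply]
  simp_rw [hs _, smul_smul]
  rw [← Finset.sum_smul]
  have h0 : ∀ g, ((ψ g : ℤˣ) : ℤ) * ((χ g : ℤˣ) : ℤ) = (((ψ * χ) g : ℤˣ) : ℤ) := fun g => by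
    simp
  simp_rw [h0]
  split_ifs with h
  · subst h
    rw [ψ.mul_self]
    simp only [AddChar.one_apply, Units.val_one, Finset.sum_const, Finset.card_univ,
      zsmul_eq_mul, mul_one, nsmul_eq_mul]
    rw [← mul_assoc]
    have : Fintype.card (Grp n) = 2 ^ n := by simp [ZMod.card]
    rw [this]
    push_cast
    rw [c.app_inverse_mul h2, one_mul]
  · have h' : ψ * χ ≠ 1 := fun h' => h (by rw [← one_mul χ, ← h', Chars.mul_mul_self])
    rw [sum_elements_eq_zero h', zero_smul, mul_zero]

lemma eq_zero_of_sum_eq_zero {U : Y.Opens} {s : Chars n → Γ(c.X, c.f ⁻¹ᵁ U)}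
    (hs : ∀ χ, s χ ∈ c.eigen χ U) (h : ∑ χ, s χ = 0) (χ : Chars n) : s χ = 0 := by
  have h1 := congrArg (c.proj χ U) h
  rw [map_sum, map_zero, Finset.sum_congr rfl fun ψ _ => c.proj_of_mem_eigen h2 (hs ψ) χ] at h1
  simpa using h1

omit h2

lemma proj_app_mul (χ : Chars n) {U : Y.Opens} (r : Γ(Y, U)) (s : Γ(c.X, c.f ⁻¹ᵁ U)) :
    c.proj χ U (c.f.app U r * s) = c.f.app U r * c.proj χ U s := by
  have h : ∀ g : Grp n, ((χ g : ℤˣ) : ℤ) • c.act g U (c.f.app U r * s) =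
      c.f.app U r * (((χ g : ℤˣ) : ℤ) • c.act g U s) := fun g => by
    rw [map_mul, act_app, mul_smul_comm]
  rw [proj_apply, proj_apply, Finset.sum_congr rfl fun g _ => h g, ← Finset.mul_sum,
    mul_left_comm]

end Cover

/-! ### Identification of eigensheaves with divisorial sheaves -/

namespace Cover

variable {Y : Scheme.{u}} {n : ℕ} [IsIntegral Y] [IsLocallyNoetherian Y]

/-- Isomorphisms of the eigensheaves of a cover with divisorial sheaves, compatible with the
multiplication. -/
structure EigenData (c : Cover Y n) where
  E : Chars n → WeilDivisor Y
  φ : Chars n → Chars n → Y.functionField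
  Φ : ∀ (_ : Chars n) (U : Y.Opens), Γ(c.X, c.f ⁻¹ᵁ U) →+ Y.functionField
  ne_zero : ∀ χ χ', φ χ χ' ≠ 0
  bijOn : ∀ χ (U : Y.Opens) [Nonempty U], Set.BijOn (Φ χ U) (c.eigen χ U) (sectionsNeg (E χ) U)
  map_app_mul : ∀ χ (U : Y.Opens) [Nonempty U] (r : Γ(Y, U)), ∀ s ∈ c.eigen χ U,
    Φ χ U (c.f.app U r * s) = Y.germToFunctionField U r * Φ χ U s
  map_res : ∀ χ (U V : Y.Opens) [Nonempty U] [Nonempty V] (hVU : V ≤ U), ∀ s ∈ c.eigen χ U,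
    Φ χ V (resOver c.f hVU s) = Φ χ U s
  map_mul : ∀ χ χ' (U : Y.Opens) [Nonempty U], ∀ s ∈ c.eigen χ U, ∀ t ∈ c.eigen χ' U,
    Φ (χ * χ') U (s * t) = φ χ χ' * Φ χ U s * Φ χ' U t

/-- The divisor of zeros of the multiplication map. -/
noncomputable def EigenData.exponent {c : Cover Y n} (M : c.EigenData) (y : PrimeDivisor Y)
    (χ ψ : Chars n) : ℤ :=
  Scheme.ord (M.φ χ ψ) y.1 + M.E χ y + M.E ψ y - M.E (χ * ψ) y

lemma isStandard_iff (c : Cover Y n) (B : BuildingData Y n) :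
    c.IsStandard B ↔ ∃ M : c.EigenData, (∀ χ, divClass (M.E χ) = B.L χ) ∧
      ∀ y χ ψ, M.exponent y χ ψ = ∑ h : {h : Grp n // h ≠ 0}, eps χ ψ h.1 * B.D h y := by
  have hsum : ∀ χ ψ (y : PrimeDivisor Y),
      (∑ h : {h : Grp n // h ≠ 0}, eps χ ψ h.1 • B.D h) y =
        ∑ h : {h : Grp n // h ≠ 0}, eps χ ψ h.1 * B.D h y := fun χ ψ y => by
    simp [Finsupp.finsetSum_apply]
  constructor
  · rintro ⟨E, φ, Φ, h1, h2, h3, h4, h5, h6, h7⟩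
    refine ⟨⟨E, φ, Φ, h2, fun χ U _ => h4 χ U, fun χ U _ => h5 χ U, fun χ U V _ _ => h6 χ U V,
      fun χ χ' U _ => h7 χ χ' U⟩, h1, fun y χ ψ => ?_⟩
    have := h3 χ ψ y
    rw [hsum] at this
    simp only [EigenData.exponent]
    omega
  · rintro ⟨M, h1, h3⟩
    refine ⟨M.E, M.φ, M.Φ, h1, M.ne_zero, fun χ ψ y => ?_, fun χ U _ => M.bijOn χ U,
      fun χ U _ => M.map_app_mul χ U, fun χ U V _ _ => M.map_res χ U V,
      fun χ χ' U _ => M.map_mul χ χ' U⟩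
    have := h3 y χ ψ
    rw [hsum, ← this, EigenData.exponent]
    ring

/-- It suffices to give the isomorphisms over affine open sets. -/
theorem exists_eigenData (c : Cover Y n) (E : Chars n → WeilDivisor Y)
    (φ : Chars n → Chars n → Y.functionField)
    (Φ : ∀ (_ : Chars n) (U : Y.Opens), Γ(c.X, c.f ⁻¹ᵁ U) →+ Y.functionField)
    (ne_zero : ∀ χ χ', φ χ χ' ≠ 0)
    (bijOn : ∀ χ (U : Y.Opens) [Nonempty U], IsAffineOpen U →
      Set.BijOn (Φ χ U) (c.eigen χ U) (sectionsNeg (E χ) U))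
    (map_app_mul : ∀ χ (U : Y.Opens) [Nonempty U], IsAffineOpen U → ∀ (r : Γ(Y, U)),
      ∀ s ∈ c.eigen χ U, Φ χ U (c.f.app U r * s) = Y.germToFunctionField U r * Φ χ U s)
    (map_res : ∀ χ (U V : Y.Opens) [Nonempty U] [Nonempty V], IsAffineOpen U → IsAffineOpen V →
      ∀ (hVU : V ≤ U), ∀ s ∈ c.eigen χ U, Φ χ V (resOver c.f hVU s) = Φ χ U s)
    (map_mul : ∀ χ χ' (U : Y.Opens) [Nonempty U], IsAffineOpen U → ∀ s ∈ c.eigen χ U,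
      ∀ t ∈ c.eigen χ' U, Φ (χ * χ') U (s * t) = φ χ χ' * Φ χ U s * Φ χ' U t) :
    ∃ M : c.EigenData, M.E = E ∧ M.φ = φ := by
  classical
  -- Each open set receives an auxiliary affine subset on which its sections are evaluated. By `key`
  -- below, the value on an eigensection does not depend on this choice.
  have hch : ∀ U : Y.Opens, ∃ V : Y.Opens, V ≤ U ∧ (Nonempty U → Nonempty V ∧ IsAffineOpen V) := by
    intro U
    by_cases h : Nonempty U
    · obtain ⟨V, hV, hne, hle⟩ := exists_affine_nonempty_le U
      exact ⟨V, hle, fun _ => ⟨hne, hV⟩⟩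
    · exact ⟨U, le_rfl, fun h' => absurd h' h⟩
  choose V hVU hV using hch
  let Ψ : ∀ (_ : Chars n) (U : Y.Opens), Γ(c.X, c.f ⁻¹ᵁ U) →+ Y.functionField := fun χ U =>
    (Φ χ (V U)).comp (resOver c.f (hVU U)).hom.toAddMonoidHom
  have key : ∀ χ (U W : Y.Opens) [Nonempty U] [Nonempty W] (_ : IsAffineOpen W) (hWU : W ≤ U),
      ∀ s ∈ c.eigen χ U, Ψ χ U s = Φ χ W (resOver c.f hWU s) := by
    intro χ U W _ _ hW hWU s hs
    obtain ⟨hne, haff⟩ := hV U inferInstance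
    have := nonempty_inf (V U) W
    obtain ⟨Z, hZ, _, hZle⟩ := exists_affine_nonempty_le (V U ⊓ W)
    have h1 := map_res χ (V U) Z haff hZ (hZle.trans inf_le_left) _
      (c.res_mem_eigen (hVU U) hs)
    have h2 := map_res χ W Z hW hZ (hZle.trans inf_le_right) _ (c.res_mem_eigen hWU hs)
    rw [resOver_resOver] at h1 h2
    exact h1.symm.trans h2
  refine ⟨⟨E, φ, Ψ, ne_zero, fun χ U _ => ⟨?_, ?_, ?_⟩, ?_, ?_, ?_⟩, rfl, rfl⟩
  · intro s hs
    by_cases h0 : Ψ χ U s = 0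
    · exact Or.inl h0
    refine Or.inr fun y hy => ?_
    obtain ⟨W, hW, hyW, hWU⟩ := exists_affine_le hy
    have : Nonempty W := ⟨⟨_, hyW⟩⟩
    have h1 := (bijOn χ W hW).mapsTo (c.res_mem_eigen hWU hs)
    rw [← key χ U W hW hWU s hs] at h1
    exact h1.resolve_left h0 y hyW
  · intro s hs t ht h
    refine eq_of_resOver_affine c.f fun W _ hW hWU => ?_
    refine (bijOn χ W hW).injOn (c.res_mem_eigen hWU hs) (c.res_mem_eigen hWU ht) ?_
    rw [← key χ U W hW hWU s hs, ← key χ U W hW hWU t ht, h]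
  · intro a ha
    have hmem : ∀ W : Y.Opens, W ≤ U → a ∈ sectionsNeg (E χ) W := fun W hWU =>
      ha.imp id fun h y hy => h y (hWU hy)
    have hex : ∀ (W : Y.Opens) [Nonempty W] (_ : IsAffineOpen W) (_ : W ≤ U),
        ∃ s, s ∈ c.eigen χ W ∧ Φ χ W s = a := fun W _ hW hWU => by
      obtain ⟨s, hs, hsa⟩ := (bijOn χ W hW).surjOn (hmem W hWU)
      exact ⟨s, hs, hsa⟩
    choose s hs hsa using hex
    obtain ⟨t, ht⟩ := exists_resOver_eq c.f (U := U) s fun W W' _ _ hW hW' hWU hWW => by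
      refine (bijOn χ W' hW').injOn (c.res_mem_eigen hWW (hs W hW hWU)) (hs _ _ _) ?_
      rw [map_res χ W W' hW hW' hWW _ (hs W hW hWU), hsa, hsa]
    have hteig : t ∈ c.eigen χ U := by
      intro g
      refine eq_of_resOver_affine c.f fun W _ hW hWU => ?_
      rw [act_res, map_zsmul, ht W hW hWU]
      exact hs W hW hWU g
    refine ⟨t, hteig, ?_⟩
    obtain ⟨W, hW, _, hWU⟩ := exists_affine_nonempty_le U
    rw [key χ U W hW hWU t hteig, ht W hW hWU, hsa]
  · intro χ U _ r s hs
    obtain ⟨W, hW, _, hWU⟩ := exists_affine_nonempty_le U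
    rw [key χ U W hW hWU _ (c.app_mul_mem_eigen r hs), key χ U W hW hWU _ hs, _root_.map_mul,
      resOver_app, map_app_mul χ W hW _ _ (c.res_mem_eigen hWU hs), germToFunctionField_res]
  · intro χ U W _ _ hWU s hs
    obtain ⟨Z, hZ, _, hZW⟩ := exists_affine_nonempty_le W
    rw [key χ W Z hZ hZW _ (c.res_mem_eigen hWU hs), key χ U Z hZ (hZW.trans hWU) _ hs,
      resOver_resOver]
  · intro χ ψ U _ s hs t ht
    obtain ⟨W, hW, _, hWU⟩ := exists_affine_nonempty_le U
    rw [key _ U W hW hWU _ (c.mul_mem_eigen hs ht), key χ U W hW hWU _ hs, key ψ U W hW hWU _ ht,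
      _root_.map_mul, map_mul χ ψ W hW _ (c.res_mem_eigen hWU hs) _ (c.res_mem_eigen hWU ht)]

end Cover

/-! ### Condition S₂ for covers, tested at prime divisors of the base -/

namespace Cover

variable {Y : Scheme.{u}} {n : ℕ} (c : Cover Y n)

lemma isAffineOpen_preimage {U : Y.Opens} (hU : IsAffineOpen U) : IsAffineOpen (c.f ⁻¹ᵁ U) := by
  have := c.finite
  exact hU.preimage c.f

/-- The sections of `f_* 𝒪_X` over `U` as an algebra over the sections of `𝒪_Y`. -/
@[reducible]
noncomputable def algebra (U : Y.Opens) : Algebra Γ(Y, U) Γ(c.X, c.f ⁻¹ᵁ U) :=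
  (c.f.app U).hom.toAlgebra

lemma finite_app {U : Y.Opens} (hU : IsAffineOpen U) : (c.f.app U).hom.Finite := by
  have := c.finite
  exact IsFinite.finite_app c.f U hU

lemma isNoetherianRing [IsLocallyNoetherian Y] {U : Y.Opens} (hU : IsAffineOpen U) :
    IsNoetherianRing Γ(c.X, c.f ⁻¹ᵁ U) := by
  have : IsNoetherianRing Γ(Y, U) := IsLocallyNoetherian.component_noetherian ⟨U, hU⟩
  let _ := c.algebra U
  have : Module.Finite Γ(Y, U) Γ(c.X, c.f ⁻¹ᵁ U) := c.finite_app hU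
  exact isNoetherian_of_tower Γ(Y, U) (isNoetherian_of_isNoetherianRing_of_finite _ _)

lemma smulCommClass (U : Y.Opens) :
    letI := c.algebra U
    letI := c.mulSemiringAction U
    SMulCommClass (Multiplicative (Grp n)) Γ(Y, U) Γ(c.X, c.f ⁻¹ᵁ U) := by
  let _ := c.algebra U
  let _ := c.mulSemiringAction U
  refine ⟨fun g r s => ?_⟩
  change c.act g.toAdd U (c.f.app U r * s) = c.f.app U r * c.act g.toAdd U s
  rw [map_mul, act_app]

lemma isInvariant (U : Y.Opens) :
    letI := c.algebra U
    letI := c.mulSemiringAction U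
    Algebra.IsInvariant Γ(Y, U) Γ(c.X, c.f ⁻¹ᵁ U) (Multiplicative (Grp n)) := by
  let _ := c.algebra U
  let _ := c.mulSemiringAction U
  exact ⟨fun s hs => c.exists_app_eq fun g => hs (Multiplicative.ofAdd g)⟩

/-- Functions on the base act without torsion on the sections of `f_* 𝒪_X`. -/
def IsTorsionFree : Prop :=
  ∀ (U : Y.Opens) [Nonempty U], IsAffineOpen U → ∀ (r : Γ(Y, U)) (a : Γ(c.X, c.f ⁻¹ᵁ U)),
    r ≠ 0 → c.f.app U r * a = 0 → a = 0

/-- Divisibility by functions on the base can be tested at the prime divisors. -/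
def IsDivisorialOn (U : Y.Opens) : Prop :=
  ∀ (r : Γ(Y, U)) (a : Γ(c.X, c.f ⁻¹ᵁ U)), r ≠ 0 →
    (∀ (y : PrimeDivisor Y) (hy : y.1 ∈ U), ∃ t : Γ(Y, U), IsUnit (Y.presheaf.germ U y.1 hy t) ∧
      ∃ b, c.f.app U t * a = c.f.app U r * b) → ∃ b, a = c.f.app U r * b

lemma isDivisorialOn_iff {U : Y.Opens} (hU : IsAffineOpen U) : c.IsDivisorialOn U ↔
    letI := c.algebra U
    IsDivisorial Γ(Y, U) Γ(c.X, c.f ⁻¹ᵁ U) := by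
  let _ := c.algebra U
  constructor
  · intro h r a hr ha
    refine h r a hr fun y hy => ?_
    obtain ⟨t, ht, b, hb⟩ := ha (hU.primeIdealOf ⟨y.1, hy⟩).asIdeal inferInstance (by
      rw [height_primeIdealOf', y.2])
    rw [mem_primeIdealOf_iff, not_not] at ht
    exact ⟨t, ht, b, hb⟩
  · intro h r a hr ha
    refine h r a hr fun q hq hq1 => ?_
    obtain ⟨y, hy, hyq⟩ := exists_primeDivisor_of_height_eq_one hU q hq1
    obtain ⟨t, ht, b, hb⟩ := ha y hy
    exact ⟨t, (hyq t).mpr ht, b, hb⟩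

lemma height_primeIdealOf_preimage [IsIntegral Y] [IsLocallyNoetherian Y] {U : Y.Opens}
    (hU : IsAffineOpen U) (x : c.f ⁻¹ᵁ U) : Order.coheight x.1 = Order.coheight (c.f x.1) := by
  let _ := c.algebra U
  let _ := c.mulSemiringAction U
  have := c.smulCommClass U
  have := c.isInvariant U
  have : IsNoetherianRing Γ(Y, U) := IsLocallyNoetherian.component_noetherian ⟨U, hU⟩
  have := c.isNoetherianRing hU
  have h := height_under_of_isInvariant (R := Γ(Y, U)) (Multiplicative (Grp n)) (c.injective U)
    ((c.isAffineOpen_preimage hU).primeIdealOf x).asIdeal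
  rw [height_primeIdealOf'] at h
  have h1 := congrArg PrimeSpectrum.asIdeal (IsAffineOpen.comap_primeIdealOf_appLE (f := c.f) U hU
    (c.f ⁻¹ᵁ U) (c.isAffineOpen_preimage hU) le_rfl x.2)
  rw [← height_primeIdealOf' hU ⟨c.f x.1, x.2⟩, ← h1, h]
  simp only [Scheme.Hom.appLE_eq_app]
  rfl

/-- A point of the cover has the same codimension as its image. -/
lemma coheight_eq [IsIntegral Y] [IsLocallyNoetherian Y] (x : c.X) :
    Order.coheight x = Order.coheight (c.f x) := by
  obtain ⟨U, hU, hx, -⟩ := exists_affine_le (U := (⊤ : Y.Opens)) (y := c.f x) trivial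
  exact c.height_primeIdealOf_preimage hU ⟨x, hx⟩

variable [IsIntegral Y] [IsLocallyNoetherian Y]

theorem isSTwo_of_isDivisorialOn (htf : c.IsTorsionFree)
    (h : ∀ (U : Y.Opens) [Nonempty U], IsAffineOpen U → c.IsDivisorialOn U) : IsSTwo c.X := by
  intro x
  obtain ⟨U, hU, hx, -⟩ := exists_affine_le (U := (⊤ : Y.Opens)) (y := c.f x) trivial
  have : Nonempty U := ⟨⟨_, hx⟩⟩
  obtain ⟨x, rfl⟩ : ∃ x' : c.f ⁻¹ᵁ U, x'.1 = x := ⟨⟨x, hx⟩, rfl⟩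
  let _ := c.algebra U
  let _ := c.mulSemiringAction U
  have := c.smulCommClass U
  have := c.isInvariant U
  have : IsNoetherianRing Γ(Y, U) := IsLocallyNoetherian.component_noetherian ⟨U, hU⟩
  have := c.isNoetherianRing hU
  have := (c.isAffineOpen_preimage hU).isLocalization_stalk x
  exact depthTwo_of_isDivisorial (R := Γ(Y, U)) (Multiplicative (Grp n))
    (fun r a hr ha => htf U hU r a hr ha) ((c.isDivisorialOn_iff hU).mp (h U hU))
    ((c.isAffineOpen_preimage hU).primeIdealOf x).asIdeal

theorem isDivisorialOn_of_isSTwo (htf : c.IsTorsionFree) (h : IsSTwo c.X) {U : Y.Opens}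
    [Nonempty U] (hU : IsAffineOpen U) : c.IsDivisorialOn U := by
  rw [c.isDivisorialOn_iff hU]
  let _ := c.algebra U
  let _ := c.mulSemiringAction U
  have := c.smulCommClass U
  have := c.isInvariant U
  have : IsNoetherianRing Γ(Y, U) := IsLocallyNoetherian.component_noetherian ⟨U, hU⟩
  have := c.isNoetherianRing hU
  refine isDivisorial_of_depthTwo (Multiplicative (Grp n))
    (fun r a hr ha => htf U hU r a hr ha) fun P _ => ?_
  obtain ⟨x, rfl⟩ := exists_primeIdealOf_eq (c.isAffineOpen_preimage hU) P
  exact ⟨c.X.presheaf.stalk x.1, _, _, _,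
    (c.isAffineOpen_preimage hU).isLocalization_stalk x, h x.1⟩

-- An eigencomponent killed by a nonzero function has its square in the base, which is a domain; the
-- square is therefore zero, and so is the component.
omit [IsLocallyNoetherian Y] in
lemma isTorsionFree_of_isReduced (h2 : IsUnit (2 : Γ(Y, ⊤))) [IsReduced c.X] :
    c.IsTorsionFree := by
  intro U _ hU r a hr ha
  have hχ : ∀ χ, c.proj χ U a = 0 := by
    intro χ
    set b := c.proj χ U a with hb
    have hbe : b ∈ c.eigen χ U := c.proj_mem_eigen χ U a
    have h1 : c.f.app U r * b = 0 := by rw [hb, ← proj_app_mul, ha, map_zero]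
    obtain ⟨t, ht⟩ := c.exists_app_eq_of_mem_eigen_one (c.mul_self_mem_eigen hbe hbe)
    have h3 : r * t = 0 := c.injective U (by
      rw [map_mul, map_zero, ht, ← mul_assoc, h1, zero_mul])
    have h4 : t = 0 := (mul_eq_zero.mp h3).resolve_left hr
    rw [h4, map_zero] at ht
    exact (pow_eq_zero_iff two_ne_zero).mp (by rw [sq, ← ht])
  rw [← c.sum_proj h2 U a]
  exact Finset.sum_eq_zero fun χ _ => hχ χ

end Cover

/-! ### Covers given by divisorial sheaves are reduced and S₂ -/

namespace Cover

variable {Y : Scheme.{u}} {n : ℕ} [IsIntegral Y] [IsLocallyNoetherian Y] {c : Cover Y n}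

omit [IsLocallyNoetherian Y] in
lemma germToFunctionField_ne_zero {U : Y.Opens} [Nonempty U] {r : Γ(Y, U)} (hr : r ≠ 0) :
    Y.germToFunctionField U r ≠ 0 := fun h =>
  hr (Scheme.germToFunctionField_injective Y U (by rw [h, map_zero]))

namespace EigenData

variable (M : c.EigenData)
include M

lemma eq_zero {χ : Chars n} {U : Y.Opens} [Nonempty U] {s : Γ(c.X, c.f ⁻¹ᵁ U)}
    (hs : s ∈ c.eigen χ U) (h : M.Φ χ U s = 0) : s = 0 :=
  (M.bijOn χ U).injOn hs (c.zero_mem_eigen χ U) (by rw [h, map_zero])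

lemma eq_zero_of_mul_self {χ : Chars n} {U : Y.Opens} [Nonempty U] {s : Γ(c.X, c.f ⁻¹ᵁ U)}
    (hs : s ∈ c.eigen χ U) (h : s * s = 0) : s = 0 := by
  refine M.eq_zero hs ?_
  have := M.map_mul χ χ U s hs s hs
  rw [h, map_zero, mul_assoc] at this
  simpa [M.ne_zero] using this.symm

lemma isTorsionFree (h2 : IsUnit (2 : Γ(Y, ⊤))) : c.IsTorsionFree := by
  intro U _ hU r a hr ha
  rw [← c.sum_proj h2 U a]
  refine Finset.sum_eq_zero fun χ _ => M.eq_zero (c.proj_mem_eigen χ U a) ?_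
  have h := M.map_app_mul χ U r _ (c.proj_mem_eigen χ U a)
  rw [← proj_app_mul, ha, map_zero, map_zero] at h
  exact (mul_eq_zero.mp h.symm).resolve_left (germToFunctionField_ne_zero hr)

/-- The eigencomponents of a nilpotent section are nilpotent, and their squares are nilpotent in the
base, which is a domain. As `φ χ χ ≠ 0`, an eigensection with square zero vanishes. -/
lemma isReduced_sections (h2 : IsUnit (2 : Γ(Y, ⊤))) (U : Y.Opens) [Nonempty U] :
    _root_.IsReduced Γ(c.X, c.f ⁻¹ᵁ U) := by
  refine ⟨fun a ha => ?_⟩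
  rw [← c.sum_proj h2 U a]
  refine Finset.sum_eq_zero fun χ _ => ?_
  have hb : IsNilpotent (c.proj χ U a) := by
    rw [← mem_nilradical, proj_apply]
    refine Ideal.mul_mem_left _ _ (Ideal.sum_mem _ fun g _ => ?_)
    rw [mem_nilradical]
    have h1 : IsNilpotent (c.act g U a) := ha.map (c.act g U).hom
    rcases Int.units_eq_one_or (χ g) with h | h <;> simpa [h] using h1
  have he := c.proj_mem_eigen χ U a
  set b := c.proj χ U a
  obtain ⟨t, ht⟩ := c.exists_app_eq_of_mem_eigen_one (c.mul_self_mem_eigen he he)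
  have h3 : IsNilpotent t := by
    have : IsNilpotent (c.f.app U t) := by
      rw [ht]
      exact (Commute.all b b).isNilpotent_mul_left hb
    exact (IsNilpotent.map_iff (f := (c.f.app U).hom) (c.injective U)).mp this
  rw [h3.eq_zero, map_zero] at ht
  exact M.eq_zero_of_mul_self he ht.symm

lemma isReduced (h2 : IsUnit (2 : Γ(Y, ⊤))) : IsReduced c.X := by
  have : ∀ x : c.X, _root_.IsReduced (c.X.presheaf.stalk x) := by
    intro x
    obtain ⟨U, hU, hx, -⟩ := exists_affine_le (U := (⊤ : Y.Opens)) (y := c.f x) trivial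
    have : Nonempty U := ⟨⟨_, hx⟩⟩
    obtain ⟨x, rfl⟩ : ∃ x' : c.f ⁻¹ᵁ U, x'.1 = x := ⟨⟨x, hx⟩, rfl⟩
    have := (c.isAffineOpen_preimage hU).isLocalization_stalk x
    exact isReduced_localizationPreserves
      ((c.isAffineOpen_preimage hU).primeIdealOf x).asIdeal.primeCompl _
      (M.isReduced_sections h2 U)
  exact isReduced_of_isReduced_stalk c.X

/-- Dividing each eigencomponent by `r` gives a rational function, and membership in a divisorial
sheaf is by definition a condition at the prime divisors. -/
lemma isDivisorialOn (h2 : IsUnit (2 : Γ(Y, ⊤))) (U : Y.Opens) [Nonempty U] :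
    c.IsDivisorialOn U := by
  intro r a hr ha
  have hr' := germToFunctionField_ne_zero hr
  have key : ∀ χ, ∃ b, c.proj χ U a = c.f.app U r * b := by
    intro χ
    have he := c.proj_mem_eigen χ U a
    have hmem : M.Φ χ U (c.proj χ U a) / Y.germToFunctionField U r ∈ sectionsNeg (M.E χ) U := by
      refine or_iff_not_imp_left.mpr fun h0 y hy => ?_
      obtain ⟨t, ht, b, hb⟩ := ha y hy
      have h1 := congrArg (fun z => M.Φ χ U (c.proj χ U z)) hb
      simp only [proj_app_mul] at h1
      rw [M.map_app_mul χ U _ _ he, M.map_app_mul χ U _ _ (c.proj_mem_eigen χ U b)] at h1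
      have ht0 : t ≠ 0 := by
        rintro rfl
        rw [map_zero] at ht
        exact not_isUnit_zero ht
      have h2 : Scheme.ord (Y.germToFunctionField U t) y.1 = 0 := by
        have := ord_algebraMap_eq_zero y ht
        rwa [show algebraMap (Y.presheaf.stalk y.1) Y.functionField (Y.presheaf.germ U y.1 hy t) =
          Y.germToFunctionField U t from ?_] at this
        exact Y.presheaf.germ_stalkSpecializes_apply _ _ _
      have ht' := germToFunctionField_ne_zero ht0
      set u := M.Φ χ U (c.proj χ U a) / Y.germToFunctionField U r with hu
      have h3 : Y.germToFunctionField U t * u = M.Φ χ U (c.proj χ U b) := by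
        rw [hu, mul_div_assoc', h1, mul_div_cancel_left₀ _ hr']
      have h4 := (M.bijOn χ U).mapsTo (c.proj_mem_eigen χ U b)
      rw [← h3] at h4
      have h5 := h4.resolve_left (mul_ne_zero ht' h0) y hy
      rwa [Scheme.ord_mul ht' h0, h2, zero_add] at h5
    obtain ⟨b, hb, hbu⟩ := (M.bijOn χ U).surjOn hmem
    refine ⟨b, (M.bijOn χ U).injOn he (c.app_mul_mem_eigen r hb) ?_⟩
    rw [M.map_app_mul χ U r b hb, hbu, mul_div_cancel₀ _ hr']
  choose b hb using key
  refine ⟨∑ χ, b χ, ?_⟩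
  rw [Finset.mul_sum, ← c.sum_proj h2 U a]
  exact Finset.sum_congr rfl fun χ _ => hb χ

theorem isSTwo (h2 : IsUnit (2 : Γ(Y, ⊤))) : IsSTwo c.X :=
  c.isSTwo_of_isDivisorialOn (M.isTorsionFree h2) fun U _ _ => M.isDivisorialOn h2 U

end EigenData

end Cover

/-! ### Morphisms between schemes affine over the base -/

section Morphisms

variable {X X' Y : Scheme.{u}} (f : X ⟶ Y) (f' : X' ⟶ Y)

lemma exists_pullback_lift_homOfLE_eq (U V : Y.affineOpens)
    (x : ↥(Limits.pullback (f ⁻¹ᵁ U.1).ι (f ⁻¹ᵁ V.1).ι)) :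
    ∃ (W : Y.affineOpens) (hU : W ≤ U) (hV : W ≤ V) (y : (f ⁻¹ᵁ W.1 : Scheme)),
      Limits.pullback.lift (X.homOfLE (f.preimage_mono hU)) (X.homOfLE (f.preimage_mono hV))
        (by simp) y = x := by
  obtain ⟨W, hW, hxW, hWU⟩ := exists_affine_le (U := U.1 ⊓ V.1)
    (y := f ((Limits.pullback.fst (f ⁻¹ᵁ U.1).ι (f ⁻¹ᵁ V.1).ι ≫ (f ⁻¹ᵁ U.1).ι) x)) (by
    constructor
    · rw [Scheme.Hom.comp_apply]
      exact (Limits.pullback.fst (f ⁻¹ᵁ U.1).ι (f ⁻¹ᵁ V.1).ι x).2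
    · rw [Limits.pullback.condition, Scheme.Hom.comp_apply]
      exact (Limits.pullback.snd (f ⁻¹ᵁ U.1).ι (f ⁻¹ᵁ V.1).ι x).2)
  obtain ⟨W, rfl⟩ : ∃ W' : Y.affineOpens, W'.1 = W := ⟨⟨W, hW⟩, rfl⟩
  obtain ⟨y, hy⟩ : ∃ y : (f ⁻¹ᵁ W.1 : Scheme), (f ⁻¹ᵁ W.1).ι y =
    (Limits.pullback.fst (f ⁻¹ᵁ U.1).ι (f ⁻¹ᵁ V.1).ι ≫ (f ⁻¹ᵁ U.1).ι) x := ⟨⟨_, hxW⟩, rfl⟩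
  refine ⟨W, hWU.trans inf_le_left, hWU.trans inf_le_right, y, ?_⟩
  apply (Limits.pullback.fst (f ⁻¹ᵁ U.1).ι (f ⁻¹ᵁ V.1).ι ≫ (f ⁻¹ᵁ U.1).ι).isOpenEmbedding.injective
  rw [← Scheme.Hom.comp_apply, Limits.pullback.lift_fst_assoc, X.homOfLE_ι, hy]

/-- The cover by the preimages of the affine open sets. -/
noncomputable def preimageCover : X.OpenCover where
  I₀ := Y.affineOpens
  X U := f ⁻¹ᵁ U.1
  f U := (f ⁻¹ᵁ U.1).ι
  mem₀ := by
    rw [Scheme.presieve₀_mem_precoverage_iff]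
    refine ⟨fun x => ?_, inferInstance⟩
    obtain ⟨U, hU, hx, -⟩ := exists_affine_le (U := (⊤ : Y.Opens)) (y := f x) trivial
    exact ⟨⟨U, hU⟩, ⟨x, hx⟩, rfl⟩

noncomputable instance : Preorder (preimageCover f).I₀ := inferInstanceAs (Preorder Y.affineOpens)

noncomputable instance : Scheme.Cover.LocallyDirected (preimageCover f) where
  trans {U V} h := X.homOfLE (f.preimage_mono (leOfHom h))
  trans_id U := X.homOfLE_rfl _
  trans_comp h h' := (X.homOfLE_homOfLE _ _).symm
  w h := X.homOfLE_ι _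
  directed {U V} x := by
    obtain ⟨W, hU, hV, y, h⟩ := exists_pullback_lift_homOfLE_eq f U V x
    exact ⟨W, homOfLE hU, homOfLE hV, y, h⟩
  property_trans h := inferInstanceAs (IsOpenImmersion (X.homOfLE _))

variable {f f'}

lemma preimage_le_preimage {a : X ⟶ X'} (ha : a ≫ f' = f) (U : Y.Opens) :
    f ⁻¹ᵁ U ≤ a ⁻¹ᵁ f' ⁻¹ᵁ U := by
  rw [← Scheme.Hom.comp_preimage, ha]

lemma ι_comp_eq_toSpecΓ {V : X.Opens} {W : X'.Opens} (hW : IsAffineOpen W) (a : X ⟶ X')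
    (h : V ≤ a ⁻¹ᵁ W) : V.ι ≫ a = V.toSpecΓ ≫ Spec.map (a.appLE W V h) ≫ hW.fromSpec := by
  simp

lemma hom_ext_over [IsAffineHom f'] {a b : X ⟶ X'} (ha : a ≫ f' = f) (hb : b ≫ f' = f)
    (h : ∀ (U : Y.Opens) [Nonempty U], IsAffineOpen U →
      a.appLE (f' ⁻¹ᵁ U) (f ⁻¹ᵁ U) (preimage_le_preimage ha U) =
        b.appLE (f' ⁻¹ᵁ U) (f ⁻¹ᵁ U) (preimage_le_preimage hb U)) : a = b := by
  refine (preimageCover f).hom_ext _ _ fun U => ?_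
  change (f ⁻¹ᵁ U.1).ι ≫ a = (f ⁻¹ᵁ U.1).ι ≫ b
  have hU' : IsAffineOpen (f' ⁻¹ᵁ U.1) := U.2.preimage f'
  rw [ι_comp_eq_toSpecΓ hU' a (preimage_le_preimage ha U.1),
    ι_comp_eq_toSpecΓ hU' b (preimage_le_preimage hb U.1)]
  by_cases hne : Nonempty U.1
  · rw [h U.1 U.2]
  · have : IsEmpty (f ⁻¹ᵁ U.1) := ⟨fun x => hne ⟨⟨f x.1, x.2⟩⟩⟩
    exact (isInitialOfIsEmpty).hom_ext _ _

/-- A compatible family of homomorphisms of algebras over the affine open sets comes from a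
morphism. -/
theorem exists_hom_over [IsAffineHom f] [IsAffineHom f']
    (ψ : ∀ U : Y.affineOpens, Γ(X', f' ⁻¹ᵁ U.1) ⟶ Γ(X, f ⁻¹ᵁ U.1))
    (hψ : ∀ U, f'.app U.1 ≫ ψ U = f.app U.1)
    (hres : ∀ (U V : Y.affineOpens) (h : V ≤ U), ψ U ≫ resOver f h = resOver f' h ≫ ψ V) :
    ∃ (a : X ⟶ X') (ha : a ≫ f' = f), ∀ U : Y.affineOpens,
      a.appLE (f' ⁻¹ᵁ U.1) (f ⁻¹ᵁ U.1) (preimage_le_preimage ha U.1) = ψ U := by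
  have hU' : ∀ U : Y.affineOpens, IsAffineOpen (f' ⁻¹ᵁ U.1) := fun U => U.2.preimage f'
  let g : ∀ U : Y.affineOpens, (f ⁻¹ᵁ U.1 : Scheme) ⟶ X' := fun U =>
    (f ⁻¹ᵁ U.1).toSpecΓ ≫ Spec.map (ψ U) ≫ (hU' U).fromSpec
  have hg : ∀ {U V : (preimageCover f).I₀} (h : U ⟶ V), (preimageCover f).trans h ≫ g V = g U := by
    intro U V h
    change X.homOfLE (f.preimage_mono (leOfHom h)) ≫ (f ⁻¹ᵁ V.1).toSpecΓ ≫ Spec.map (ψ V) ≫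
      (hU' V).fromSpec = (f ⁻¹ᵁ U.1).toSpecΓ ≫ Spec.map (ψ U) ≫ (hU' U).fromSpec
    rw [← Scheme.Opens.toSpecΓ_SpecMap_presheaf_map_assoc, ← Spec.map_comp_assoc]
    have h1 := hres V U (leOfHom h)
    simp only [resOver] at h1
    rw [h1, Spec.map_comp_assoc, IsAffineOpen.map_fromSpec _ (hU' U)]
  let a := (preimageCover f).glueMorphismsOfLocallyDirected g hg
  have hιa : ∀ U : Y.affineOpens, (f ⁻¹ᵁ U.1).ι ≫ a = g U := fun U =>
    Scheme.OpenCover.map_glueMorphismsOfLocallyDirected (preimageCover f) g hg U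
  have ha' : ∀ U : Y.affineOpens, (f ⁻¹ᵁ U.1).ι ≫ a ≫ f' = (f ⁻¹ᵁ U.1).ι ≫ f := fun U => by
    rw [reassoc_of% hιa U, ι_comp_eq_toSpecΓ U.2 f (V := f ⁻¹ᵁ U.1) le_rfl,
      ← Scheme.Hom.app_eq_appLE, ← hψ, Spec.map_comp_assoc]
    simp only [g, Category.assoc]
    rw [← IsAffineOpen.SpecMap_appLE_fromSpec f' U.2 (hU' U) le_rfl, ← Scheme.Hom.app_eq_appLE]
  have ha : a ≫ f' = f := (preimageCover f).hom_ext _ _ ha'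
  refine ⟨a, ha, fun U => ?_⟩
  have h1 := ι_comp_eq_toSpecΓ (hU' U) a (preimage_le_preimage ha U.1)
  rw [hιa] at h1
  simp only [g] at h1
  rw [← Category.assoc, ← Category.assoc, cancel_mono,
    ← (U.2.preimage f).isoSpec_hom, cancel_epi] at h1
  exact (Spec.map_injective h1).symm

end Morphisms

/-! ### Generic structure of reduced covers -/

namespace Cover

variable {Y : Scheme.{u}} {n : ℕ}

lemma isAffineHom (c : Cover Y n) : IsAffineHom c.f := by
  have := c.finite
  infer_instance

/-- An automorphism over the base is determined by its action on sections over affine open sets, so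
faithfulness applies. -/
lemma eq_zero_of_act_eq (c : Cover Y n) {g : Grp n}
    (h : ∀ (U : Y.Opens) [Nonempty U], IsAffineOpen U → ∀ s, c.act g U s = s) : g = 0 := by
  have := c.isAffineHom
  have h1 : (c.ρ (Multiplicative.ofAdd g)).hom = 𝟙 _ := by
    refine hom_ext_over (c.comp_f _) (Category.id_comp c.f) fun U _ hU => ?_
    ext s
    refine (h U hU s).trans ?_
    simp only [Scheme.Hom.appLE, Scheme.Hom.id_app]
    exact (resOver_self c.f s).symm
  have h2 : c.ρ (Multiplicative.ofAdd g) = 1 := by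
    ext1
    exact h1
  exact Multiplicative.ofAdd.injective (c.faithful (h2.trans (map_one _).symm))

variable [IsIntegral Y] (c : Cover Y n)

lemma nonempty_top (Y : Scheme.{u}) [IsIntegral Y] : Nonempty (⊤ : Y.Opens) :=
  ⟨⟨genericPoint Y, trivial⟩⟩

section Reduced

variable (h2 : IsUnit (2 : Γ(Y, ⊤)))

lemma res_injective {U V : Y.Opens} [Nonempty U] [Nonempty V] (h : V ≤ U) {r : Γ(Y, U)}
    (hr : Y.presheaf.map (homOfLE h).op r = 0) : r = 0 :=
  Scheme.germToFunctionField_injective Y U (by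
    rw [← germToFunctionField_res h, hr, map_zero, map_zero])

variable [IsReduced c.X]

omit [IsIntegral Y] in
lemma exists_mul_self_eq {χ : Chars n} {U : Y.Opens} {s : Γ(c.X, c.f ⁻¹ᵁ U)}
    (hs : s ∈ c.eigen χ U) : ∃ r, c.f.app U r = s * s ∧ (r = 0 → s = 0) := by
  obtain ⟨r, hr⟩ := c.exists_app_eq_of_mem_eigen_one (c.mul_self_mem_eigen hs hs)
  refine ⟨r, hr, fun h => ?_⟩
  rw [h, map_zero] at hr
  exact (pow_eq_zero_iff two_ne_zero).mp (by rw [sq, ← hr])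

lemma resOver_ne_zero {χ : Chars n} {U V : Y.Opens} [Nonempty U] [Nonempty V] (h : V ≤ U)
    {s : Γ(c.X, c.f ⁻¹ᵁ U)} (hs : s ∈ c.eigen χ U) (hs0 : s ≠ 0) : resOver c.f h s ≠ 0 := by
  intro h0
  obtain ⟨r, hr, hr0⟩ := c.exists_mul_self_eq hs
  refine hs0 (hr0 (res_injective h (c.injective V ?_)))
  rw [← resOver_app, hr, map_mul, h0, mul_zero, map_zero]

lemma mul_ne_zero_of_mem_eigen {χ ψ : Chars n} {U : Y.Opens} [Nonempty U]
    {s t : Γ(c.X, c.f ⁻¹ᵁ U)} (hs : s ∈ c.eigen χ U) (ht : t ∈ c.eigen ψ U)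
    (hs0 : s ≠ 0) (ht0 : t ≠ 0) : s * t ≠ 0 := by
  intro h
  obtain ⟨r, hr, hr0⟩ := c.exists_mul_self_eq hs
  obtain ⟨r', hr', hr0'⟩ := c.exists_mul_self_eq ht
  have : r * r' = 0 := c.injective U (by
    rw [map_mul, hr, hr', mul_mul_mul_comm, h, mul_zero, map_zero])
  exact (mul_eq_zero.mp this).elim (fun h => hs0 (hr0 h)) fun h => ht0 (hr0' h)

/-- The characters whose eigensheaves do not vanish. -/
noncomputable def eigenSupport : Subgroup (Chars n) where
  carrier := {χ | ∃ U : Y.Opens, Nonempty U ∧ ∃ s ∈ c.eigen χ U, s ≠ 0}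
  one_mem' := ⟨⊤, nonempty_top Y, 1, c.one_mem_eigen ⊤, fun h => one_ne_zero (α := Γ(Y, ⊤))
    (c.injective ⊤ (by rw [map_one, map_zero]; exact h))⟩
  mul_mem' := by
    rintro χ ψ ⟨U, _, s, hs, hs0⟩ ⟨V, _, t, ht, ht0⟩
    have := nonempty_inf U V
    exact ⟨U ⊓ V, this, _, c.mul_mem_eigen (c.res_mem_eigen inf_le_left hs)
      (c.res_mem_eigen inf_le_right ht), c.mul_ne_zero_of_mem_eigen
      (c.res_mem_eigen inf_le_left hs) (c.res_mem_eigen inf_le_right ht)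
      (c.resOver_ne_zero inf_le_left hs hs0) (c.resOver_ne_zero inf_le_right ht ht0)⟩
  inv_mem' := by
    rintro χ h
    rwa [inv_eq_of_mul_eq_one_left χ.mul_self]

-- If the support were a proper subgroup, a nonzero group element would annihilate it and act
-- trivially on all eigencomponents, contradicting faithfulness.
include h2 in
lemma eigenSupport_eq_top : c.eigenSupport = ⊤ := by
  by_contra hne
  obtain ⟨g, hg, hgχ⟩ := exists_annihilated c.eigenSupport hne
  refine hg (c.eq_zero_of_act_eq fun U _ hU s => ?_)
  rw [← c.sum_proj h2 U s, map_sum]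
  refine Finset.sum_congr rfl fun χ _ => ?_
  have he := c.proj_mem_eigen χ U s
  by_cases h0 : c.proj χ U s = 0
  · rw [h0, map_zero]
  · rw [he g, hgχ χ ⟨U, inferInstance, _, he, h0⟩]
    simp

include h2 in
/-- All eigensheaves have a nonzero section over a common open set. -/
lemma exists_common_eigen_ne_zero :
    ∃ U : Y.Opens, Nonempty U ∧ ∀ χ, ∃ s ∈ c.eigen χ U, s ≠ 0 := by
  classical
  have key : ∀ S : Finset (Chars n),
      ∃ U : Y.Opens, Nonempty U ∧ ∀ χ ∈ S, ∃ s ∈ c.eigen χ U, s ≠ 0 := by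
    intro S
    induction S using Finset.induction_on with
    | empty => exact ⟨⊤, nonempty_top Y, by simp⟩
    | insert χ S _ ih =>
      obtain ⟨U, _, hU⟩ := ih
      obtain ⟨V, _, s, hs, hs0⟩ : χ ∈ c.eigenSupport := by
        rw [c.eigenSupport_eq_top h2]; trivial
      have := nonempty_inf U V
      refine ⟨U ⊓ V, this, fun ψ hψ => ?_⟩
      rcases Finset.mem_insert.mp hψ with rfl | hψ
      · exact ⟨_, c.res_mem_eigen inf_le_right hs, c.resOver_ne_zero inf_le_right hs hs0⟩
      · obtain ⟨t, ht, ht0⟩ := hU ψ hψ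
        exact ⟨_, c.res_mem_eigen inf_le_left ht, c.resOver_ne_zero inf_le_left ht ht0⟩
  obtain ⟨U, hU, h⟩ := key Finset.univ
  exact ⟨U, hU, fun χ => h χ (Finset.mem_univ χ)⟩

end Reduced

/-- The rational function on the base represented by the invariant part of a section. -/
noncomputable def toFunctionField (U : Y.Opens) : Γ(c.X, c.f ⁻¹ᵁ U) →+ Y.functionField := by
  classical
  exact if h : Nonempty U then
    (Y.germToFunctionField U).hom.toAddMonoidHom.comp (AddMonoidHom.mk' (fun s =>
      (c.exists_app_eq_of_mem_eigen_one (c.proj_mem_eigen 1 U s)).choose) fun s t =>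
        c.injective U <|
          (c.exists_app_eq_of_mem_eigen_one (c.proj_mem_eigen 1 U (s + t))).choose_spec.trans <| by
          rw [map_add (c.f.app U).hom, map_add]
          exact (congrArg₂ _
            (c.exists_app_eq_of_mem_eigen_one (c.proj_mem_eigen 1 U s)).choose_spec
            (c.exists_app_eq_of_mem_eigen_one (c.proj_mem_eigen 1 U t)).choose_spec).symm)
    else 0

variable (h2 : IsUnit (2 : Γ(Y, ⊤)))
include h2

lemma toFunctionField_app (U : Y.Opens) [hU : Nonempty U] (r : Γ(Y, U)) :
    c.toFunctionField U (c.f.app U r) = Y.germToFunctionField U r := by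
  rw [toFunctionField, dif_pos hU]
  refine congrArg (Y.germToFunctionField U) (c.injective U ?_)
  refine (c.exists_app_eq_of_mem_eigen_one (c.proj_mem_eigen 1 U _)).choose_spec.trans ?_
  rw [c.proj_of_mem_eigen h2 (c.app_mem_eigen r), if_pos rfl]

lemma toFunctionField_mul (U : Y.Opens) [Nonempty U] {s t : Γ(c.X, c.f ⁻¹ᵁ U)}
    (hs : s ∈ c.eigen 1 U) (ht : t ∈ c.eigen 1 U) :
    c.toFunctionField U (s * t) = c.toFunctionField U s * c.toFunctionField U t := by
  obtain ⟨r, rfl⟩ := c.exists_app_eq_of_mem_eigen_one hs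
  obtain ⟨r', rfl⟩ := c.exists_app_eq_of_mem_eigen_one ht
  rw [← map_mul, c.toFunctionField_app h2, c.toFunctionField_app h2, c.toFunctionField_app h2,
    map_mul]

lemma toFunctionField_res {U V : Y.Opens} [Nonempty U] [Nonempty V] (h : V ≤ U)
    {s : Γ(c.X, c.f ⁻¹ᵁ U)} (hs : s ∈ c.eigen 1 U) :
    c.toFunctionField V (resOver c.f h s) = c.toFunctionField U s := by
  obtain ⟨r, rfl⟩ := c.exists_app_eq_of_mem_eigen_one hs
  rw [resOver_app, c.toFunctionField_app h2, c.toFunctionField_app h2, germToFunctionField_res]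

lemma eq_zero_of_toFunctionField {U : Y.Opens} [Nonempty U] {s : Γ(c.X, c.f ⁻¹ᵁ U)}
    (hs : s ∈ c.eigen 1 U) (h : c.toFunctionField U s = 0) : s = 0 := by
  obtain ⟨r, rfl⟩ := c.exists_app_eq_of_mem_eigen_one hs
  rw [c.toFunctionField_app h2] at h
  rw [Scheme.germToFunctionField_injective Y U (h.trans (map_zero _).symm), map_zero]

omit h2

/-- Compatible embeddings of the eigensheaves of a cover into the field of rational functions. -/
structure GenericData where
  φ : Chars n → Chars n → Y.functionField
  Φ : ∀ (_ : Chars n) (U : Y.Opens), Γ(c.X, c.f ⁻¹ᵁ U) →+ Y.functionField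
  ne_zero : ∀ χ χ', φ χ χ' ≠ 0
  eq_zero : ∀ χ (U : Y.Opens) [Nonempty U], ∀ s ∈ c.eigen χ U, Φ χ U s = 0 → s = 0
  map_app_mul : ∀ χ (U : Y.Opens) [Nonempty U] (r : Γ(Y, U)), ∀ s ∈ c.eigen χ U,
    Φ χ U (c.f.app U r * s) = Y.germToFunctionField U r * Φ χ U s
  map_res : ∀ χ (U V : Y.Opens) [Nonempty U] [Nonempty V] (hVU : V ≤ U), ∀ s ∈ c.eigen χ U,
    Φ χ V (resOver c.f hVU s) = Φ χ U s
  map_mul : ∀ χ χ' (U : Y.Opens) [Nonempty U], ∀ s ∈ c.eigen χ U, ∀ t ∈ c.eigen χ' U,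
    Φ (χ * χ') U (s * t) = φ χ χ' * Φ χ U s * Φ χ' U t
  exists_eq_one : ∃ U : Y.Opens, Nonempty U ∧ ∀ χ, ∃ s ∈ c.eigen χ U, Φ χ U s = 1

include h2

/-- Nonzero eigensections `z χ` over a common open set trivialize the eigensheaves generically: an
eigensection `s` corresponds to `s * z χ / z χ ^ 2`, a quotient of invariant sections. The
multiplication functions are `z χ * z ψ * z (χ * ψ) / z (χ * ψ) ^ 2`. -/
theorem nonempty_genericData [IsReduced c.X] : Nonempty c.GenericData := by
  obtain ⟨U₀, _, h⟩ := c.exists_common_eigen_ne_zero h2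
  choose z hz hz0 using h
  let T := c.toFunctionField
  have hz2 : ∀ χ, z χ * z χ ∈ c.eigen 1 U₀ := fun χ => c.mul_self_mem_eigen (hz χ) (hz χ)
  let w : Chars n → Y.functionField := fun χ => T U₀ (z χ * z χ)
  have hw : ∀ χ, w χ ≠ 0 := fun χ h0 =>
    c.mul_ne_zero_of_mem_eigen (hz χ) (hz χ) (hz0 χ) (hz0 χ)
      (c.eq_zero_of_toFunctionField h2 (hz2 χ) h0)
  have hI : ∀ U : Y.Opens, [Nonempty U] → Nonempty ↑(U ⊓ U₀) := fun U _ => nonempty_inf U U₀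
  let Φ : ∀ (_ : Chars n) (U : Y.Opens), Γ(c.X, c.f ⁻¹ᵁ U) →+ Y.functionField := fun χ U =>
    (AddMonoidHom.mulRight (w χ)⁻¹).comp ((T (U ⊓ U₀)).comp
      ((AddMonoidHom.mulRight (resOver c.f inf_le_right (z χ))).comp
        (resOver c.f (inf_le_left : U ⊓ U₀ ≤ U)).hom.toAddMonoidHom))
  have hΦ : ∀ χ U s, Φ χ U s = T (U ⊓ U₀) (resOver c.f inf_le_left s *
    resOver c.f inf_le_right (z χ)) * (w χ)⁻¹ := fun χ U s => rfl
  have hTw : ∀ (V : Y.Opens) [Nonempty V] (hV : V ≤ U₀) χ,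
      T V (resOver c.f hV (z χ) * resOver c.f hV (z χ)) = w χ := fun V _ hV χ => by
    rw [← map_mul]
    exact c.toFunctionField_res h2 hV (hz2 χ)
  have hTmem : ∀ χ (U V : Y.Opens) (hU : V ≤ U) (hV : V ≤ U₀), ∀ s ∈ c.eigen χ U,
      resOver c.f hU s * resOver c.f hV (z χ) ∈ c.eigen 1 V := fun χ U V hU hV s hs =>
    c.mul_self_mem_eigen (c.res_mem_eigen hU hs) (c.res_mem_eigen hV (hz χ))
  have hΦ' : ∀ χ (U V : Y.Opens) [Nonempty U] [Nonempty V] (hU : V ≤ U) (hV : V ≤ U₀),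
      ∀ s ∈ c.eigen χ U,
      Φ χ U s = T V (resOver c.f hU s * resOver c.f hV (z χ)) * (w χ)⁻¹ := by
    intro χ U V _ _ hU hV s hs
    have := hI U
    rw [hΦ, ← c.toFunctionField_res h2 (le_inf hU hV) (hTmem χ U _ _ _ s hs), map_mul,
      resOver_resOver, resOver_resOver]
  have hzzz : ∀ χ ψ, z χ * z ψ * z (χ * ψ) ∈ c.eigen 1 U₀ := fun χ ψ =>
    c.mul_self_mem_eigen (c.mul_mem_eigen (hz χ) (hz ψ)) (hz (χ * ψ))
  refine ⟨⟨fun χ ψ => T U₀ (z χ * z ψ * z (χ * ψ)) * (w (χ * ψ))⁻¹, Φ, ?_, ?_, ?_, ?_, ?_, ?_⟩⟩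
  · intro χ ψ
    refine mul_ne_zero (fun h0 => ?_) (inv_ne_zero (hw _))
    refine c.mul_ne_zero_of_mem_eigen (c.mul_mem_eigen (hz χ) (hz ψ)) (hz (χ * ψ))
      (c.mul_ne_zero_of_mem_eigen (hz χ) (hz ψ) (hz0 χ) (hz0 ψ)) (hz0 _) ?_
    exact c.eq_zero_of_toFunctionField h2 (hzzz χ ψ) h0
  · intro χ U _ s hs h0
    by_contra hs0
    have := hI U
    rw [hΦ] at h0
    have h1 := (mul_eq_zero.mp h0).resolve_right (inv_ne_zero (hw χ))
    exact c.mul_ne_zero_of_mem_eigen (c.res_mem_eigen inf_le_left hs)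
      (c.res_mem_eigen inf_le_right (hz χ)) (c.resOver_ne_zero _ hs hs0)
      (c.resOver_ne_zero _ (hz χ) (hz0 χ))
      (c.eq_zero_of_toFunctionField h2 (hTmem χ U _ _ _ s hs) h1)
  · intro χ U _ r s hs
    have := hI U
    have e : resOver c.f (inf_le_left : U ⊓ U₀ ≤ U) (c.f.app U r * s) =
      c.f.app (U ⊓ U₀) (Y.presheaf.map (homOfLE inf_le_left).op r) * resOver c.f inf_le_left s := by
      rw [map_mul, resOver_app]
    rw [hΦ, hΦ, e, mul_assoc, c.toFunctionField_mul h2 _ (c.app_mem_eigen _)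
      (hTmem χ U _ _ _ s hs), c.toFunctionField_app h2, germToFunctionField_res, mul_assoc]
  · intro χ U V _ _ hVU s hs
    have := hI V
    rw [hΦ' χ U (V ⊓ U₀) (inf_le_left.trans hVU) inf_le_right s hs, hΦ, resOver_resOver]
  · intro χ ψ U _ s hs t ht
    have := hI U
    rw [hΦ, hΦ, hΦ, ← c.toFunctionField_res h2 (inf_le_right : U ⊓ U₀ ≤ U₀) (hzzz χ ψ)]
    have e1 := hTmem χ U _ inf_le_left (inf_le_right : U ⊓ U₀ ≤ U₀) s hs
    have e2 := hTmem ψ U _ inf_le_left (inf_le_right : U ⊓ U₀ ≤ U₀) t ht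
    have e3 := hTmem (χ * ψ) U _ inf_le_left (inf_le_right : U ⊓ U₀ ≤ U₀) _ (c.mul_mem_eigen hs ht)
    have e4 := c.res_mem_eigen (inf_le_right : U ⊓ U₀ ≤ U₀) (hzzz χ ψ)
    have e5 : ∀ χ, resOver c.f (inf_le_right : U ⊓ U₀ ≤ U₀) (z χ) *
      resOver c.f (inf_le_right : U ⊓ U₀ ≤ U₀) (z χ) ∈ c.eigen 1 (U ⊓ U₀) := fun χ =>
      hTmem χ U₀ _ inf_le_right inf_le_right _ (hz χ)
    -- The multiplication rule with denominators cleared. Both sides are products of invariant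
    -- sections, so they can be compared before passing to rational functions.
    have key : T (U ⊓ U₀) (resOver c.f inf_le_right (z χ * z ψ * z (χ * ψ))) *
        T (U ⊓ U₀) (resOver c.f inf_le_left s * resOver c.f inf_le_right (z χ)) *
        T (U ⊓ U₀) (resOver c.f inf_le_left t * resOver c.f inf_le_right (z ψ)) =
        T (U ⊓ U₀) (resOver c.f inf_le_left (s * t) * resOver c.f inf_le_right (z (χ * ψ))) *
          w χ * w ψ := by
      rw [← hTw (U ⊓ U₀) inf_le_right χ, ← hTw (U ⊓ U₀) inf_le_right ψ,
        ← c.toFunctionField_mul h2 _ e4 e1, ← c.toFunctionField_mul h2 _ (by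
          simpa only [one_mul] using c.mul_mem_eigen e4 e1) e2, ← c.toFunctionField_mul h2 _ e3 (e5 χ),
        ← c.toFunctionField_mul h2 _ (by simpa only [one_mul] using c.mul_mem_eigen e3 (e5 χ)) (e5 ψ)]
      congr 1
      simp only [map_mul]
      ring
    have := hw χ
    have := hw ψ
    have := hw (χ * ψ)
    field_simp
    linear_combination (-1 : Y.functionField) * key
  · refine ⟨U₀, inferInstance, fun χ => ⟨z χ, hz χ, ?_⟩⟩
    rw [hΦ' χ U₀ U₀ le_rfl le_rfl _ (hz χ), hTw, mul_inv_cancel₀ (hw χ)]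

end Cover

/-! ### Reduced S₂ covers have divisorial eigensheaves -/

namespace Cover

variable {Y : Scheme.{u}} {n : ℕ} (c : Cover Y n)

lemma exists_pow_mul_eq_res {X : Scheme.{u}} {U : X.Opens} (hU : IsAffineOpen U) (r : Γ(X, U))
    {W : X.Opens} (hW : W = X.basicOpen r) (hWU : W ≤ U) (s : Γ(X, W)) : ∃ (k : ℕ) (b : Γ(X, U)),
      X.presheaf.map (homOfLE hWU).op b = X.presheaf.map (homOfLE hWU).op (r ^ k) * s := by
  subst hW
  have := hU.isLocalization_basicOpen r
  obtain ⟨⟨b, ⟨_, k, rfl⟩⟩, h⟩ := IsLocalization.surj (Submonoid.powers r) s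
  exact ⟨k, b, by rw [mul_comm]; exact h.symm⟩

/-- A section of an eigensheaf extends to an affine open set after multiplication by a function
which is invertible at a given point. -/
lemma exists_eigen_extension {χ : Chars n} {U V : Y.Opens} (hU : IsAffineOpen U) {y : Y}
    (hyU : y ∈ U) (hyV : y ∈ V) {s : Γ(c.X, c.f ⁻¹ᵁ V)} (hs : s ∈ c.eigen χ V)
    (h2 : IsUnit (2 : Γ(Y, ⊤))) :
    ∃ g : Γ(Y, U), IsUnit (Y.presheaf.germ U y hyU g) ∧ ∃ t ∈ c.eigen χ U,
      ∃ (W : Y.Opens) (hWU : W ≤ U) (hWV : W ≤ V), y ∈ W ∧ resOver c.f hWU t =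
        c.f.app W (Y.presheaf.map (homOfLE hWU).op g) * resOver c.f hWV s := by
  obtain ⟨g, hgV, hyg⟩ := hU.exists_basicOpen_le ⟨y, hyV⟩ hyU
  have hle : Y.basicOpen g ≤ U := Y.basicOpen_le g
  obtain ⟨k, b, hb⟩ := exists_pow_mul_eq_res (c.isAffineOpen_preimage hU) (c.f.app U g)
    (c.f.preimage_basicOpen g) (c.f.preimage_mono hle) (resOver c.f hgV s)
  refine ⟨g ^ k, ?_, c.proj χ U b, c.proj_mem_eigen χ U b, Y.basicOpen g, hle, hgV, hyg, ?_⟩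
  · rw [map_pow]
    exact ((Y.mem_basicOpen _ _ hyU).mp hyg).pow k
  · have h1 : ∀ ψ, resOver c.f hle (c.proj ψ U b) = c.proj ψ _ (resOver c.f hle b) := fun ψ => by
      have e : ∀ ψ, resOver c.f hle (c.proj ψ U b) ∈ c.eigen ψ (Y.basicOpen g) := fun ψ =>
        c.res_mem_eigen hle (c.proj_mem_eigen ψ U b)
      conv_rhs => rw [← c.sum_proj h2 U b, map_sum, map_sum]
      rw [Finset.sum_congr rfl fun ψ' _ => c.proj_of_mem_eigen h2 (e ψ') ψ]
      simp
    have h3 : resOver c.f hle b =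
        c.f.app _ (Y.presheaf.map (homOfLE hle).op (g ^ k)) * resOver c.f hgV s := by
      rw [← resOver_app, map_pow (c.f.app U).hom]
      exact hb
    rw [h1, h3, proj_app_mul, c.proj_of_mem_eigen h2 (c.res_mem_eigen hgV hs), if_pos rfl]

variable {c} [IsIntegral Y] [IsLocallyNoetherian Y]

omit [IsLocallyNoetherian Y] in
lemma GenericData.exists_extension (M : c.GenericData) (h2 : IsUnit (2 : Γ(Y, ⊤)))
    {χ : Chars n} {U V : Y.Opens} [Nonempty U] [Nonempty V] (hU : IsAffineOpen U) {y : Y}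
    (hyU : y ∈ U) (hyV : y ∈ V) {s : Γ(c.X, c.f ⁻¹ᵁ V)} (hs : s ∈ c.eigen χ V) :
    ∃ g : Γ(Y, U), IsUnit (Y.presheaf.germ U y hyU g) ∧ ∃ t ∈ c.eigen χ U,
      M.Φ χ U t = Y.germToFunctionField U g * M.Φ χ V s := by
  obtain ⟨g, hg, t, ht, W, hWU, hWV, hyW, h⟩ := c.exists_eigen_extension hU hyU hyV hs h2
  refine ⟨g, hg, t, ht, ?_⟩
  have : Nonempty W := ⟨⟨y, hyW⟩⟩
  rw [← M.map_res χ U W hWU t ht, h, M.map_app_mul _ _ _ _ (c.res_mem_eigen hWV hs),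
    germToFunctionField_res, M.map_res χ V W hWV s hs]

lemma ord_germToFunctionField_nonneg {U : Y.Opens} [Nonempty U] (r : Γ(Y, U)) (y : PrimeDivisor Y)
    (hy : y.1 ∈ U) : 0 ≤ Scheme.ord (Y.germToFunctionField U r) y.1 := by
  have := ord_algebraMap_nonneg y (Y.presheaf.germ U y.1 hy r)
  rwa [show algebraMap (Y.presheaf.stalk y.1) Y.functionField (Y.presheaf.germ U y.1 hy r) =
    Y.germToFunctionField U r from Y.presheaf.germ_stalkSpecializes_apply _ _ _] at this

lemma ord_germToFunctionField_eq_zero {U : Y.Opens} [Nonempty U] {r : Γ(Y, U)} (y : PrimeDivisor Y)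
    (hy : y.1 ∈ U) (hr : IsUnit (Y.presheaf.germ U y.1 hy r)) :
    Scheme.ord (Y.germToFunctionField U r) y.1 = 0 := by
  have := ord_algebraMap_eq_zero y hr
  rwa [show algebraMap (Y.presheaf.stalk y.1) Y.functionField (Y.presheaf.germ U y.1 hy r) =
    Y.germToFunctionField U r from Y.presheaf.germ_stalkSpecializes_apply _ _ _] at this

omit [IsLocallyNoetherian Y] in
lemma germToFunctionField_ne_zero_of_isUnit {U : Y.Opens} [Nonempty U] {r : Γ(Y, U)} {y : Y}
    (hy : y ∈ U) (hr : IsUnit (Y.presheaf.germ U y hy r)) : Y.germToFunctionField U r ≠ 0 := by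
  refine germToFunctionField_ne_zero ?_
  rintro rfl
  rw [map_zero] at hr
  exact not_isUnit_zero hr

namespace GenericData

variable (M : c.GenericData)
include M

/-- The order of a section of an eigensheaf is bounded below. -/
lemma two_mul_ord_ge {χ : Chars n} {U : Y.Opens} [Nonempty U] {s : Γ(c.X, c.f ⁻¹ᵁ U)}
    (hs : s ∈ c.eigen χ U) (hs0 : s ≠ 0) (y : PrimeDivisor Y) (hy : y.1 ∈ U) :
    haveI := nonempty_top Y
    Scheme.ord (M.Φ 1 ⊤ 1) y.1 - Scheme.ord (M.φ χ χ) y.1 ≤ 2 * Scheme.ord (M.Φ χ U s) y.1 := by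
  have := nonempty_top Y
  have hΦ : M.Φ χ U s ≠ 0 := fun h => hs0 (M.eq_zero χ U s hs h)
  have h1 := M.map_mul χ χ U s hs s hs
  obtain ⟨r, hr⟩ := c.exists_app_eq_of_mem_eigen_one (c.mul_self_mem_eigen hs hs)
  -- The identification of the trivial eigensheaf need not send 1 to 1. This fixed value enters the
  -- bound, which comes from `s * s` being regular on the base.
  have hκ : M.Φ 1 U 1 = M.Φ 1 ⊤ 1 := by
    rw [← M.map_res 1 ⊤ U le_top 1 (c.one_mem_eigen ⊤)]
    congr 1
    exact (map_one (resOver c.f (le_top : U ≤ ⊤)).hom).symm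
  have h3 : M.Φ 1 U (s * s) = Y.germToFunctionField U r * M.Φ 1 ⊤ 1 := by
    rw [← hκ, ← M.map_app_mul 1 U r 1 (c.one_mem_eigen U), mul_one, hr]
  rw [χ.mul_self, h3] at h1
  have hne : M.φ χ χ * M.Φ χ U s * M.Φ χ U s ≠ 0 := mul_ne_zero (mul_ne_zero (M.ne_zero _ _) hΦ) hΦ
  have hr0 : Y.germToFunctionField U r ≠ 0 := fun h => hne (by rw [← h1, h, zero_mul])
  have hκ0 : M.Φ 1 ⊤ 1 ≠ 0 := fun h => hne (by rw [← h1, h, mul_zero])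
  have h4 := congrArg (fun a => Scheme.ord a y.1) h1
  simp only [Scheme.ord_mul hr0 hκ0, Scheme.ord_mul (mul_ne_zero (M.ne_zero _ _) hΦ) hΦ,
    Scheme.ord_mul (M.ne_zero χ χ) hΦ] at h4
  have h5 := ord_germToFunctionField_nonneg r y hy
  omega

omit [IsLocallyNoetherian Y] in
lemma exists_ne_zero (h2 : IsUnit (2 : Γ(Y, ⊤))) (χ : Chars n) {U : Y.Opens} [Nonempty U]
    (hU : IsAffineOpen U) : ∃ s ∈ c.eigen χ U, s ≠ 0 := by
  obtain ⟨U₀, _, h⟩ := M.exists_eq_one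
  obtain ⟨s, hs, hs1⟩ := h χ
  obtain ⟨⟨y, hyU, hy0⟩⟩ := nonempty_inf U U₀
  obtain ⟨g, hg, t, ht, hts⟩ := M.exists_extension h2 hU hyU hy0 hs
  refine ⟨t, ht, ?_⟩
  rintro rfl
  rw [map_zero, hs1, mul_one] at hts
  exact germToFunctionField_ne_zero_of_isUnit hyU hg hts.symm

/-- The minimal order of the sections of an eigensheaf at a prime divisor. -/
lemma exists_min_ord (h2 : IsUnit (2 : Γ(Y, ⊤))) (χ : Chars n) (y : PrimeDivisor Y) :
    ∃ m : ℤ, (∃ U : Y.Opens, Nonempty U ∧ y.1 ∈ U ∧ ∃ s ∈ c.eigen χ U, s ≠ 0 ∧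
        Scheme.ord (M.Φ χ U s) y.1 = m) ∧
      ∀ U : Y.Opens, Nonempty U → y.1 ∈ U → ∀ s ∈ c.eigen χ U, s ≠ 0 →
        m ≤ Scheme.ord (M.Φ χ U s) y.1 := by
  have := nonempty_top Y
  obtain ⟨m, hm, hmin⟩ := Int.exists_least_of_bdd
    (P := fun m => ∃ U : Y.Opens, Nonempty U ∧ y.1 ∈ U ∧ ∃ s ∈ c.eigen χ U, s ≠ 0 ∧
        Scheme.ord (M.Φ χ U s) y.1 = m)
    ⟨(Scheme.ord (M.Φ 1 ⊤ 1) y.1 - Scheme.ord (M.φ χ χ) y.1) / 2, by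
      rintro _ ⟨U, _, hy, s, hs, hs0, rfl⟩
      have := M.two_mul_ord_ge hs hs0 y hy
      omega⟩ (by
      obtain ⟨U, hU, hy, -⟩ := exists_affine_le (U := (⊤ : Y.Opens)) (y := y.1) trivial
      have : Nonempty U := ⟨⟨_, hy⟩⟩
      obtain ⟨s, hs, hs0⟩ := M.exists_ne_zero h2 χ hU
      exact ⟨_, U, this, hy, s, hs, hs0, rfl⟩)
  exact ⟨m, hm, fun U hU hy s hs hs0 => hmin _ ⟨U, hU, hy, s, hs, hs0, rfl⟩⟩

/-- Covers with divisorial direct image are given by divisorial sheaves. -/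
theorem exists_eigenData [CompactSpace Y] (hN : IsNormalScheme Y) (h2 : IsUnit (2 : Γ(Y, ⊤)))
    (hdiv : ∀ (U : Y.Opens) [Nonempty U], IsAffineOpen U → c.IsDivisorialOn U) :
    Nonempty c.EigenData := by
  classical
  have := nonempty_top Y
  choose m hm hmin using M.exists_min_ord h2
  obtain ⟨U₀, _, h₀⟩ := M.exists_eq_one
  have hκ : M.Φ 1 ⊤ 1 ≠ 0 := by
    intro h
    exact one_ne_zero (α := Γ(Y, ⊤)) (c.injective ⊤ (by
      rw [map_one, map_zero]
      exact M.eq_zero 1 ⊤ 1 (c.one_mem_eigen ⊤) h))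
  -- Over the open set where the eigensheaves contain sections with value 1 the minimal order is at
  -- most zero. Where moreover `M.Φ 1 ⊤ 1` and `φ χ χ` have order zero, the lower bound is zero as
  -- well.
  have hfin : ∀ χ, {y | m χ y ≠ 0}.Finite := by
    intro χ
    refine (((finite_primeDivisors_notMem U₀).union (finite_ord_ne_zero hκ)).union
      (finite_ord_ne_zero (M.ne_zero χ χ))).subset fun y hy => ?_
    by_contra h
    simp only [Set.mem_union, Set.mem_ofPred_eq, not_or, not_not] at h
    obtain ⟨⟨h1, h3⟩, h4⟩ := h
    apply hy
    obtain ⟨s, hs, hs1⟩ := h₀ χ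
    have hle := hmin χ y U₀ inferInstance h1 s hs (by
      rintro rfl
      simp at hs1)
    rw [hs1, ord_one] at hle
    obtain ⟨U, _, hyU, t, ht, ht0, htm⟩ := hm χ y
    have := M.two_mul_ord_ge ht ht0 y hyU
    rw [htm] at this
    omega
  let E : Chars n → WeilDivisor Y := fun χ => Finsupp.ofSupportFinite (m χ) (hfin χ)
  have hE : ∀ χ y, E χ y = m χ y := fun χ y => rfl
  have hinj : ∀ χ (U : Y.Opens) [Nonempty U], Set.InjOn (M.Φ χ U) (c.eigen χ U) := by
    intro χ U _ s hs t ht h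
    exact sub_eq_zero.mp (M.eq_zero χ U _ (c.sub_mem_eigen hs ht) (by rw [map_sub, h, sub_self]))
  suffices hbij : ∀ χ (U : Y.Opens) [Nonempty U], IsAffineOpen U →
      Set.BijOn (M.Φ χ U) (c.eigen χ U) (sectionsNeg (E χ) U) by
    obtain ⟨N, -, -⟩ := c.exists_eigenData E M.φ M.Φ M.ne_zero hbij
      (fun χ U _ _ r s hs => M.map_app_mul χ U r s hs)
      (fun χ U V _ _ _ _ h s hs => M.map_res χ U V h s hs)
      (fun χ ψ U _ _ s hs t ht => M.map_mul χ ψ U s hs t ht)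
    exact ⟨N⟩
  intro χ U _ hU
  refine ⟨fun s hs => ?_, hinj χ U, fun a ha => ?_⟩
  · refine or_iff_not_imp_left.mpr fun h0 y hy => hmin χ y U inferInstance hy s hs ?_
    rintro rfl
    exact h0 (map_zero _)
  by_cases ha0 : a = 0
  · exact ⟨0, c.zero_mem_eigen χ U, by rw [map_zero, ha0]⟩
  replace ha := ha.resolve_left ha0
  obtain ⟨s, hs, hs0⟩ := M.exists_ne_zero h2 χ hU
  have hΦs : M.Φ χ U s ≠ 0 := fun h => hs0 (M.eq_zero χ U s hs h)
  have := functionField_isFractionRing_of_isAffineOpen Y U hU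
  obtain ⟨r₁, r₂, hr₂, hr⟩ := IsFractionRing.div_surjective (A := Γ(Y, U)) (a / M.Φ χ U s)
  have hr₂' : r₂ ≠ 0 := nonZeroDivisors.ne_zero hr₂
  change Y.germToFunctionField U r₁ / Y.germToFunctionField U r₂ = _ at hr
  have hg₂ := germToFunctionField_ne_zero hr₂'
  rw [div_eq_div_iff hg₂ hΦs] at hr
  -- The function `a` is written as `r₁ / r₂` times the value of a nonzero section, so it lies in
  -- the image once `r₂` divides `r₁ * s`. At each prime divisor a section of minimal order supplies
  -- this divisibility.
  obtain ⟨b, hb⟩ := hdiv U hU r₂ (c.f.app U r₁ * s) hr₂' fun y hy => by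
    obtain ⟨V, _, hyV, s', hs', hs'0, hord⟩ := hm χ y
    obtain ⟨g, hg, t, ht, hts⟩ := M.exists_extension h2 hU hy hyV hs'
    have hΦs' : M.Φ χ V s' ≠ 0 := fun h => hs'0 (M.eq_zero χ V s' hs' h)
    have hgne := germToFunctionField_ne_zero_of_isUnit hy hg
    have ht0 : M.Φ χ U t ≠ 0 := by
      rw [hts]
      exact mul_ne_zero hgne hΦs'
    have hordt : Scheme.ord (M.Φ χ U t) y.1 = E χ y := by
      rw [hts, Scheme.ord_mul hgne hΦs', ord_germToFunctionField_eq_zero y hy hg, hord, zero_add, hE]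
    obtain ⟨x, hx⟩ := exists_stalk_of_ord_nonneg hN y (a := a / M.Φ χ U t) (by
      rw [div_eq_mul_inv, Scheme.ord_mul ha0 (inv_ne_zero ht0), ord_inv ht0, hordt]
      have := ha y hy
      omega)
    obtain ⟨p, q, hq, hpq⟩ := exists_germ_mul_eq hU ⟨y.1, hy⟩ x
    have h1 := congrArg (algebraMap (Y.presheaf.stalk y.1) Y.functionField) hpq
    rw [_root_.map_mul, hx, Scheme.algebraMap_germ_eq_germToFunctionField,
      Scheme.algebraMap_germ_eq_germToFunctionField, mul_div_assoc', div_eq_iff ht0] at h1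
    refine ⟨q, hq, c.f.app U p * t, hinj χ U (c.app_mul_mem_eigen _ (c.app_mul_mem_eigen _ hs))
      (c.app_mul_mem_eigen _ (c.app_mul_mem_eigen _ ht)) ?_⟩
    rw [M.map_app_mul χ U q _ (c.app_mul_mem_eigen _ hs), M.map_app_mul χ U r₁ _ hs,
      M.map_app_mul χ U r₂ _ (c.app_mul_mem_eigen _ ht), M.map_app_mul χ U p _ ht]
    linear_combination Y.germToFunctionField U q * hr + Y.germToFunctionField U r₂ * h1
  refine ⟨c.proj χ U b, c.proj_mem_eigen χ U b, mul_left_cancel₀ hg₂ ?_⟩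
  have h1 := congrArg (fun z => M.Φ χ U (c.proj χ U z)) hb
  simp only [proj_app_mul] at h1
  rw [c.proj_of_mem_eigen h2 hs, if_pos rfl, M.map_app_mul χ U _ _ hs,
    M.map_app_mul χ U _ _ (c.proj_mem_eigen χ U b)] at h1
  rw [← h1, hr, mul_comm]

end GenericData

/-- The direct image of the structure sheaf of a reduced `S₂` cover is a sum of divisorial
sheaves. -/
theorem nonempty_eigenData [CompactSpace Y] (hN : IsNormalScheme Y) (h2 : IsUnit (2 : Γ(Y, ⊤)))
    [IsReduced c.X] (hS : IsSTwo c.X) : Nonempty c.EigenData := by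
  obtain ⟨M⟩ := c.nonempty_genericData h2
  exact M.exists_eigenData hN h2 fun U _ hU =>
    c.isDivisorialOn_of_isSTwo (c.isTorsionFree_of_isReduced h2) hS hU

end Cover

/-! ### Bases and primes after localization of the base -/

section Localization

variable {R A O B : Type*} [CommRing R] [CommRing A] [CommRing O] [CommRing B] [Algebra R A]
  [Algebra R O] [Algebra A B] [Algebra O B] [Algebra R B] [IsScalarTower R O B]
  [IsScalarTower R A B] (S : Submonoid R) [IsLocalization S O]
  [IsLocalization (Algebra.algebraMapSubmonoid A S) B]

include S in
/-- A family which is a basis up to the denominators in `S` is a basis of the localization. -/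
lemma exists_basis_localization {ι : Type*} [Fintype ι] {z : ι → A} (hz : LinearIndependent R z)
    (hspan : ∀ a : A, ∃ s ∈ S, ∃ r : ι → R, s • a = ∑ i, r i • z i) :
    ∃ b : Module.Basis ι O B, ∀ i, b i = algebraMap A B (z i) := by
  have hli : LinearIndependent O (fun i => algebraMap A B (z i)) :=
    hz.of_isLocalizedModule O S (IsScalarTower.toAlgHom R A B).toLinearMap
  refine ⟨Module.Basis.mk hli fun b _ => ?_, fun i => by simp⟩
  obtain ⟨⟨a, ⟨_, s, hs, rfl⟩⟩, hb⟩ := IsLocalization.surj (Algebra.algebraMapSubmonoid A S) b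
  obtain ⟨t, ht, r, h⟩ := hspan a
  have hs' : IsUnit (algebraMap R O s) := IsLocalization.map_units O ⟨s, hs⟩
  have ht' : IsUnit (algebraMap R O t) := IsLocalization.map_units O ⟨t, ht⟩
  obtain ⟨v, hv⟩ := (hs'.mul ht').exists_left_inv
  have h1 : algebraMap O B (algebraMap R O s) * b = algebraMap A B a := by
    rw [← IsScalarTower.algebraMap_apply R O B, IsScalarTower.algebraMap_apply R A B, mul_comm]
    exact hb
  have h2 : algebraMap O B (algebraMap R O t) * algebraMap A B a =
      ∑ i, algebraMap R O (r i) • algebraMap A B (z i) := by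
    have := congrArg (algebraMap A B) h
    simp only [Algebra.smul_def, map_mul, map_sum, ← IsScalarTower.algebraMap_apply R A B] at this ⊢
    simp only [← IsScalarTower.algebraMap_apply R O B]
    exact this
  have h3 : b = ∑ i, (v * algebraMap R O (r i)) • algebraMap A B (z i) := by
    have : b = v • (algebraMap O B (algebraMap R O t) * (algebraMap O B (algebraMap R O s) * b)) := by
      rw [Algebra.smul_def, ← mul_assoc, ← mul_assoc, ← map_mul, ← map_mul, mul_assoc v,
        mul_comm (algebraMap R O t), hv, map_one, one_mul]
    rw [this, h1, h2, Finset.smul_sum]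
    simp only [smul_smul]
  rw [h3]
  exact Submodule.sum_mem _ fun i _ => Submodule.smul_mem _ _ (Submodule.subset_span ⟨i, rfl⟩)

-- Transitivity of localization: inverting elements outside `P` first does not change the
-- localization at `P`. It identifies a stalk of the cover with a local ring of its localization
-- over a prime divisor.
omit [Algebra O B] [Algebra R B] [IsScalarTower R O B] [IsScalarTower R A B] [Algebra R O]
  [IsLocalization S O] [IsLocalization (Algebra.algebraMapSubmonoid A S) B] [CommRing R]
  [Algebra R A] [CommRing O] in
lemma isLocalization_atPrime_comap_maximalIdeal {T : Type*} [CommRing T] [IsLocalRing T]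
    [Algebra A T] [Algebra B T] [IsScalarTower A B T] (M : Submonoid A) [IsLocalization M B]
    (P : Ideal A) [P.IsPrime] [IsLocalization.AtPrime T P] (h : M ≤ P.primeCompl) :
    IsLocalization.AtPrime T ((IsLocalRing.maximalIdeal T).comap (algebraMap B T)) := by
  have := IsLocalization.isLocalization_of_submonoid_le B T M P.primeCompl h
  refine @IsLocalization.isLocalization_of_is_exists_mul_mem _ _ _ _ _ _ _ this ?_ ?_
  · rintro _ ⟨a, ha, rfl⟩ h'
    rw [SetLike.mem_coe, Ideal.mem_comap, ← IsScalarTower.algebraMap_apply,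
      IsLocalRing.mem_maximalIdeal] at h'
    exact h' (IsLocalization.map_units T (⟨a, ha⟩ : P.primeCompl))
  · rintro ⟨b, hb⟩
    obtain ⟨a, s, rfl⟩ := IsLocalization.exists_mk'_eq M b
    refine ⟨algebraMap A B s, a, ?_, (IsLocalization.mk'_spec' B a s).symm⟩
    intro ha
    refine hb ?_
    rw [SetLike.mem_coe, Ideal.mem_comap]
    have h1 := congrArg (algebraMap B T) (IsLocalization.mk'_spec' B a s)
    rw [map_mul, ← IsScalarTower.algebraMap_apply, ← IsScalarTower.algebraMap_apply] at h1
    have hs : IsUnit (algebraMap A T s) :=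
      IsLocalization.map_units T (⟨s, h s.2⟩ : P.primeCompl)
    rw [← Ideal.unit_mul_mem_iff_mem _ hs, h1]
    exact (IsLocalization.AtPrime.to_map_mem_maximal_iff T P a).mpr ha

end Localization

/-! ### Local structure of a cover over a prime divisor -/

namespace Cover

variable {Y : Scheme.{u}} {n : ℕ} [IsIntegral Y] [IsLocallyNoetherian Y] {c : Cover Y n}

namespace EigenData

variable (M : c.EigenData)
include M

lemma ord_ge {χ : Chars n} {U : Y.Opens} [Nonempty U] {s : Γ(c.X, c.f ⁻¹ᵁ U)}
    (hs : s ∈ c.eigen χ U) (h0 : M.Φ χ U s ≠ 0) (y : PrimeDivisor Y) (hy : y.1 ∈ U) :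
    M.E χ y ≤ Scheme.ord (M.Φ χ U s) y.1 :=
  ((M.bijOn χ U).mapsTo hs).resolve_left h0 y hy

lemma exists_extension (h2 : IsUnit (2 : Γ(Y, ⊤)))
    {χ : Chars n} {U V : Y.Opens} [Nonempty U] [Nonempty V] (hU : IsAffineOpen U) {y : Y}
    (hyU : y ∈ U) (hyV : y ∈ V) {s : Γ(c.X, c.f ⁻¹ᵁ V)} (hs : s ∈ c.eigen χ V) :
    ∃ g : Γ(Y, U), IsUnit (Y.presheaf.germ U y hyU g) ∧ ∃ t ∈ c.eigen χ U,
      M.Φ χ U t = Y.germToFunctionField U g * M.Φ χ V s := by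
  obtain ⟨g, hg, t, ht, W, hWU, hWV, hyW, h⟩ := c.exists_eigen_extension hU hyU hyV hs h2
  refine ⟨g, hg, t, ht, ?_⟩
  have : Nonempty W := ⟨⟨y, hyW⟩⟩
  rw [← M.map_res χ U W hWU t ht, h, M.map_app_mul _ _ _ _ (c.res_mem_eigen hWV hs),
    germToFunctionField_res, M.map_res χ V W hWV s hs]

/-- A rational function of the right order is a section of the divisorial sheaf near `y`, and it
extends to the given affine set after multiplication by a function invertible at `y`. -/
lemma exists_generator [CompactSpace Y] (hN : IsNormalScheme Y) (h2 : IsUnit (2 : Γ(Y, ⊤)))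
    (χ : Chars n) {U : Y.Opens} [Nonempty U] (hU : IsAffineOpen U) (y : PrimeDivisor Y)
    (hy : y.1 ∈ U) : ∃ z ∈ c.eigen χ U, M.Φ χ U z ≠ 0 ∧ Scheme.ord (M.Φ χ U z) y.1 = M.E χ y := by
  obtain ⟨V, -, hyV, -, a, ha0, hord, ha⟩ := exists_mem_sectionsNeg hN (M.E χ) y ⊤ trivial
  have : Nonempty V := ⟨⟨_, hyV⟩⟩
  obtain ⟨s, hs, rfl⟩ := (M.bijOn χ V).surjOn ha
  obtain ⟨g, hg, t, ht, hts⟩ := M.exists_extension h2 hU hy hyV hs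
  have hg0 := germToFunctionField_ne_zero_of_isUnit hy hg
  refine ⟨t, ht, ?_, ?_⟩
  · rw [hts]
    exact mul_ne_zero hg0 ha0
  · rw [hts, Scheme.ord_mul hg0 ha0, ord_germToFunctionField_eq_zero y hy hg, hord, zero_add]

lemma one_ne_zero (U : Y.Opens) [Nonempty U] : M.Φ 1 U 1 ≠ 0 := fun h =>
  _root_.one_ne_zero (α := Γ(Y, U)) (c.injective U (by
    rw [map_one, map_zero]
    exact M.eq_zero (c.one_mem_eigen U) h))

lemma map_app (U : Y.Opens) [Nonempty U] (r : Γ(Y, U)) :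
    M.Φ 1 U (c.f.app U r) = Y.germToFunctionField U r * M.Φ 1 U 1 := by
  rw [← M.map_app_mul 1 U r 1 (c.one_mem_eigen U), mul_one]

/-- A generator of the trivial eigensheaf is a regular function times 1, so 1 has minimal order too.
-/
lemma ord_one_eq [CompactSpace Y] (hN : IsNormalScheme Y) (h2 : IsUnit (2 : Γ(Y, ⊤)))
    {U : Y.Opens} [Nonempty U] (hU : IsAffineOpen U) (y : PrimeDivisor Y) (hy : y.1 ∈ U) :
    Scheme.ord (M.Φ 1 U 1) y.1 = M.E 1 y := by
  refine le_antisymm ?_ (M.ord_ge (c.one_mem_eigen U) (M.one_ne_zero U) y hy)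
  obtain ⟨z, hz, hz0, hord⟩ := M.exists_generator hN h2 1 hU y hy
  obtain ⟨r, rfl⟩ := c.exists_app_eq_of_mem_eigen_one hz
  rw [M.map_app] at hz0 hord
  rw [Scheme.ord_mul (left_ne_zero_of_mul hz0) (M.one_ne_zero U)] at hord
  have := ord_germToFunctionField_nonneg r y hy
  omega

/-- A section of minimal order at a prime divisor generates the eigensheaf there. -/
lemma exists_app_mul_eq (hN : IsNormalScheme Y) {χ : Chars n} {U : Y.Opens} [Nonempty U]
    (hU : IsAffineOpen U) (y : PrimeDivisor Y) (hy : y.1 ∈ U) {s z : Γ(c.X, c.f ⁻¹ᵁ U)}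
    (hs : s ∈ c.eigen χ U) (hz : z ∈ c.eigen χ U) (hz0 : M.Φ χ U z ≠ 0)
    (hord : Scheme.ord (M.Φ χ U z) y.1 = M.E χ y) :
    ∃ (x : Y.presheaf.stalk y.1) (t a : Γ(Y, U)), algebraMap _ _ x = M.Φ χ U s / M.Φ χ U z ∧
      IsUnit (Y.presheaf.germ U y.1 hy t) ∧
      Y.presheaf.germ U y.1 hy t * x = Y.presheaf.germ U y.1 hy a ∧
      c.f.app U t * s = c.f.app U a * z := by
  obtain ⟨x, hx⟩ := exists_stalk_of_ord_nonneg hN y (a := M.Φ χ U s / M.Φ χ U z) (by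
    by_cases h0 : M.Φ χ U s = 0
    · simp [h0]
    rw [div_eq_mul_inv, Scheme.ord_mul h0 (inv_ne_zero hz0), ord_inv hz0, hord]
    have := M.ord_ge hs h0 y hy
    omega)
  obtain ⟨a, t, ht, h⟩ := exists_germ_mul_eq hU ⟨y.1, hy⟩ x
  refine ⟨x, t, a, hx, ht, h, (M.bijOn χ U).injOn (c.app_mul_mem_eigen _ hs)
    (c.app_mul_mem_eigen _ hz) ?_⟩
  have h1 := congrArg (algebraMap (Y.presheaf.stalk y.1) Y.functionField) h
  rw [_root_.map_mul, hx, Scheme.algebraMap_germ_eq_germToFunctionField,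
    Scheme.algebraMap_germ_eq_germToFunctionField, mul_div_assoc', div_eq_iff hz0] at h1
  rw [M.map_app_mul _ _ _ _ hs, M.map_app_mul _ _ _ _ hz, h1]

lemma linearIndependent (h2 : IsUnit (2 : Γ(Y, ⊤))) {U : Y.Opens} [Nonempty U]
    {z : Chars n → Γ(c.X, c.f ⁻¹ᵁ U)} (hz : ∀ χ, z χ ∈ c.eigen χ U)
    (hz0 : ∀ χ, M.Φ χ U (z χ) ≠ 0) :
    letI := c.algebra U
    LinearIndependent Γ(Y, U) z := by
  let _ := c.algebra U
  rw [Fintype.linearIndependent_iff]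
  intro r hr χ
  have h1 := c.eq_zero_of_sum_eq_zero h2 (fun χ => c.app_mul_mem_eigen (r χ) (hz χ)) hr χ
  have h3 := M.map_app_mul χ U (r χ) _ (hz χ)
  rw [h1, map_zero] at h3
  by_contra h0
  exact mul_ne_zero (germToFunctionField_ne_zero h0) (hz0 χ) h3.symm

lemma exists_smul_eq_sum (hN : IsNormalScheme Y) (h2 : IsUnit (2 : Γ(Y, ⊤)))
    {U : Y.Opens} [Nonempty U] (hU : IsAffineOpen U) (y : PrimeDivisor Y) (hy : y.1 ∈ U)
    {z : Chars n → Γ(c.X, c.f ⁻¹ᵁ U)} (hz : ∀ χ, z χ ∈ c.eigen χ U)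
    (hz0 : ∀ χ, M.Φ χ U (z χ) ≠ 0) (hord : ∀ χ, Scheme.ord (M.Φ χ U (z χ)) y.1 = M.E χ y)
    (a : Γ(c.X, c.f ⁻¹ᵁ U)) : ∃ t : Γ(Y, U), IsUnit (Y.presheaf.germ U y.1 hy t) ∧
      ∃ r : Chars n → Γ(Y, U), c.f.app U t * a = ∑ χ, c.f.app U (r χ) * z χ := by
  classical
  choose x t b hx ht htx htb using fun χ => M.exists_app_mul_eq hN hU y hy
    (c.proj_mem_eigen χ U a) (hz χ) (hz0 χ) (hord χ)
  refine ⟨∏ χ, t χ, ?_, fun χ => (∏ ψ ∈ Finset.univ.erase χ, t ψ) * b χ, ?_⟩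
  · rw [map_prod]
    exact IsUnit.prod_univ_iff.mpr ht
  · conv_lhs => rw [← c.sum_proj h2 U a]
    rw [Finset.mul_sum]
    refine Finset.sum_congr rfl fun χ _ => ?_
    rw [← Finset.prod_erase_mul _ _ (Finset.mem_univ χ), _root_.map_mul, _root_.map_mul, mul_assoc,
      mul_assoc, htb]

end EigenData

end Cover

lemma ord_algebraMap_irreducible {Y : Scheme.{u}} [IsIntegral Y] [IsLocallyNoetherian Y]
    (hN : IsNormalScheme Y) (y : PrimeDivisor Y) {ϖ : Y.presheaf.stalk y.1} (hϖ : Irreducible ϖ) :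
    Scheme.ord (algebraMap (Y.presheaf.stalk y.1) Y.functionField ϖ) y.1 = 1 := by
  have := isDiscreteValuationRing_stalk hN y
  have h0 : algebraMap (Y.presheaf.stalk y.1) Y.functionField ϖ ≠ 0 := by
    simpa using hϖ.ne_zero
  rw [Scheme.ord_eq_iff y.2 h0]
  exact Ring.ordFrac_irreducible hϖ

namespace Cover

variable {Y : Scheme.{u}} {n : ℕ}

lemma app_mem_primeIdealOf_iff (c : Cover Y n) {U : Y.Opens} (hU : IsAffineOpen U)
    (x : c.f ⁻¹ᵁ U) {y : U} (hxy : c.f x.1 = y.1) (r : Γ(Y, U)) :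
    c.f.app U r ∈ ((c.isAffineOpen_preimage hU).primeIdealOf x).asIdeal ↔
      r ∈ (hU.primeIdealOf y).asIdeal := by
  obtain rfl : (⟨c.f x.1, x.2⟩ : U) = y := Subtype.ext hxy
  have h1 := congrArg PrimeSpectrum.asIdeal (IsAffineOpen.comap_primeIdealOf_appLE (f := c.f) U hU
    (c.f ⁻¹ᵁ U) (c.isAffineOpen_preimage hU) le_rfl x.2)
  rw [← h1]
  simp only [Scheme.Hom.appLE_eq_app]
  rfl

variable [IsIntegral Y] [IsLocallyNoetherian Y] {c : Cover Y n}

/-- The local structure of a cover over a prime divisor. -/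
theorem EigenData.exists_charBasis [CompactSpace Y] (M : c.EigenData) (hN : IsNormalScheme Y)
    (h2 : IsUnit (2 : Γ(Y, ⊤))) (x : c.X) (y : PrimeDivisor Y) (hxy : c.f x = y.1) :
    ∃ (O B : Type u) (_ : CommRing O) (_ : IsDomain O) (_ : IsNoetherianRing O) (_ : CommRing B)
      (_ : Algebra O B) (D : CharBasis O B n) (Q : Ideal B) (_ : Q.IsPrime)
      (_ : Algebra B (c.X.presheaf.stalk x))
      (_ : IsLocalization.AtPrime (c.X.presheaf.stalk x) Q),
      IsUnit (2 : O) ∧ algebraMap O B D.π ∈ Q ∧ ∀ χ ψ, (D.e χ ψ : ℤ) = M.exponent y χ ψ := by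
  obtain ⟨U, hU, hy, -⟩ := exists_affine_le (U := (⊤ : Y.Opens)) (y := y.1) trivial
  have : Nonempty U := ⟨⟨_, hy⟩⟩
  obtain ⟨x, rfl⟩ : ∃ x' : c.f ⁻¹ᵁ U, x'.1 = x := ⟨⟨x, by
    change c.f x ∈ U
    rwa [hxy]⟩, rfl⟩
  -- The generator for the trivial character is taken to be 1, as the normalization of `CharBasis`
  -- demands.
  have hz' : ∀ χ, ∃ z, (χ = 1 → z = 1) ∧ z ∈ c.eigen χ U ∧ M.Φ χ U z ≠ 0 ∧
      Scheme.ord (M.Φ χ U z) y.1 = M.E χ y := by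
    intro χ
    by_cases h : χ = 1
    · subst h
      exact ⟨1, fun _ => rfl, c.one_mem_eigen U, M.one_ne_zero U, M.ord_one_eq hN h2 hU y hy⟩
    · obtain ⟨z, hz⟩ := M.exists_generator hN h2 χ hU y hy
      exact ⟨z, fun h' => absurd h' h, hz⟩
  choose z hz1 hz hz0 hord using hz'
  have := isDiscreteValuationRing_stalk hN y
  let _ : Algebra Γ(Y, U) (Y.presheaf.stalk y.1) :=
    TopCat.Presheaf.algebra_section_stalk Y.presheaf ⟨y.1, hy⟩
  let _ := c.algebra U
  let S := (hU.primeIdealOf ⟨y.1, hy⟩).asIdeal.primeCompl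
  have hS : ∀ r, r ∈ S ↔ IsUnit (Y.presheaf.germ U y.1 hy r) := fun r =>
    (mem_primeIdealOf_iff hU ⟨y.1, hy⟩ r).not.trans not_not
  have : IsLocalization S (Y.presheaf.stalk y.1) := hU.isLocalization_stalk ⟨y.1, hy⟩
  let A := Γ(c.X, c.f ⁻¹ᵁ U)
  let T := Algebra.algebraMapSubmonoid A S
  let B := Localization T
  let _ : Algebra (Y.presheaf.stalk y.1) B := localizationAlgebra S A
  have : IsScalarTower Γ(Y, U) (Y.presheaf.stalk y.1) B := isScalarTower_localizationAlgebra S A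
  let P := ((c.isAffineOpen_preimage hU).primeIdealOf x).asIdeal
  have : IsLocalization.AtPrime (c.X.presheaf.stalk x.1) P :=
    (c.isAffineOpen_preimage hU).isLocalization_stalk x
  have hT : T ≤ P.primeCompl := by
    rintro _ ⟨r, hr, rfl⟩ h
    exact hr ((c.app_mem_primeIdealOf_iff hU x (y := ⟨y.1, hy⟩) hxy r).mp h)
  let _ : Algebra B (c.X.presheaf.stalk x.1) :=
    IsLocalization.localizationAlgebraOfSubmonoidLe B (c.X.presheaf.stalk x.1) T P.primeCompl hT
  have : IsScalarTower A B (c.X.presheaf.stalk x.1) :=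
    IsLocalization.localization_isScalarTower_of_submonoid_le B (c.X.presheaf.stalk x.1) T
      P.primeCompl hT
  have := isLocalization_atPrime_comap_maximalIdeal (B := B) (T := c.X.presheaf.stalk x.1) T P hT
  obtain ⟨b, hb⟩ := exists_basis_localization (O := Y.presheaf.stalk y.1) (B := B) S
    (M.linearIndependent h2 hz hz0) fun a => by
      obtain ⟨t, ht, r, h⟩ := M.exists_smul_eq_sum hN h2 hU y hy hz hz0 hord a
      exact ⟨t, (hS t).mpr ht, r, h⟩
  obtain ⟨ϖ, hϖ⟩ := IsDiscreteValuationRing.exists_irreducible (Y.presheaf.stalk y.1)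
  have e1 : ∀ r : Γ(Y, U), algebraMap (Y.presheaf.stalk y.1) B (Y.presheaf.germ U y.1 hy r) =
      algebraMap A B (c.f.app U r) := fun r =>
    (IsScalarTower.algebraMap_apply Γ(Y, U) (Y.presheaf.stalk y.1) B r).symm.trans
      (IsScalarTower.algebraMap_apply Γ(Y, U) A B r)
  -- Over the discrete valuation ring a product of generators is a multiple `v` of a generator; the
  -- valuation of `v` is the order of `φ χ ψ` corrected by the three minimal orders, that is, the
  -- exponent.
  have hmul : ∀ χ ψ, ∃ (u : (Y.presheaf.stalk y.1)ˣ) (k : ℕ), (k : ℤ) = M.exponent y χ ψ ∧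
      b χ * b ψ = ((u : Y.presheaf.stalk y.1) * ϖ ^ k) • b (χ * ψ) := by
    intro χ ψ
    obtain ⟨v, t, a, hv, ht, hta, h⟩ := M.exists_app_mul_eq hN hU y hy
      (c.mul_mem_eigen (hz χ) (hz ψ)) (hz (χ * ψ)) (hz0 _) (hord _)
    have h3 := mul_ne_zero (M.ne_zero χ ψ) (hz0 χ)
    rw [M.map_mul χ ψ U _ (hz χ) _ (hz ψ)] at hv
    have hv0 : algebraMap (Y.presheaf.stalk y.1) Y.functionField v ≠ 0 := by
      rw [hv]
      exact div_ne_zero (mul_ne_zero h3 (hz0 ψ)) (hz0 _)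
    have hvne : v ≠ 0 := by
      rintro rfl
      exact hv0 (map_zero _)
    obtain ⟨k, u, rfl⟩ := IsDiscreteValuationRing.eq_unit_mul_pow_irreducible hvne hϖ
    refine ⟨u, k, ?_, ?_⟩
    · have e2 := congrArg (fun a => Scheme.ord a y.1) hv
      have hϖ0 : algebraMap (Y.presheaf.stalk y.1) Y.functionField ϖ ≠ 0 := by
        simpa using hϖ.ne_zero
      have hu0 : algebraMap (Y.presheaf.stalk y.1) Y.functionField u ≠ 0 := by
        simp
      simp only [div_eq_mul_inv] at e2
      rw [Scheme.ord_mul (mul_ne_zero h3 (hz0 ψ)) (inv_ne_zero (hz0 _)), ord_inv (hz0 _),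
        Scheme.ord_mul h3 (hz0 ψ), Scheme.ord_mul (M.ne_zero χ ψ) (hz0 χ), _root_.map_mul, map_pow,
        Scheme.ord_mul hu0 (pow_ne_zero k hϖ0), ord_pow hϖ0, ord_algebraMap_irreducible hN y hϖ,
        ord_algebraMap_eq_zero y u.isUnit, hord, hord, hord] at e2
      rw [EigenData.exponent]
      linarith
    · have hu : IsUnit (algebraMap (Y.presheaf.stalk y.1) B (Y.presheaf.germ U y.1 hy t)) :=
        ht.map _
      refine hu.mul_left_cancel ?_
      have e3 : algebraMap (Y.presheaf.stalk y.1) B (Y.presheaf.germ U y.1 hy t) *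
          algebraMap (Y.presheaf.stalk y.1) B (u * ϖ ^ k) = algebraMap A B (c.f.app U a) := by
        rw [← _root_.map_mul, hta, e1]
      have h' := congrArg (algebraMap A B) h
      rw [_root_.map_mul, _root_.map_mul, _root_.map_mul, ← e1, ← e3] at h'
      rw [hb, hb, hb, Algebra.smul_def, ← mul_assoc (algebraMap (Y.presheaf.stalk y.1) B _)
        (algebraMap (Y.presheaf.stalk y.1) B _)]
      exact h'
  choose u e he hmul using hmul
  refine ⟨Y.presheaf.stalk y.1, B, inferInstance, inferInstance, inferInstance, inferInstance,
    inferInstance, ⟨b, ϖ, u, e, hmul, ?_, hϖ.prime, ?_⟩, _, inferInstance, inferInstance, this,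
    ?_, ?_, he⟩
  · rw [hb, hz1 1 rfl, map_one]
  · rw [← hϖ.maximalIdeal_eq]
    infer_instance
  · have h := (isUnit_two h2 U).map (Y.presheaf.germ U y.1 hy).hom
    rwa [map_ofNat] at h
  · rw [Ideal.mem_comap, IsLocalRing.mem_maximalIdeal]
    intro hunit
    obtain ⟨a, t, ht, hta⟩ := exists_germ_mul_eq hU ⟨y.1, hy⟩ ϖ
    have ha : a ∈ (hU.primeIdealOf ⟨y.1, hy⟩).asIdeal := by
      rw [mem_primeIdealOf_iff, ← hta]
      exact fun h => hϖ.not_isUnit (isUnit_of_mul_isUnit_right h)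
    have haP := (c.app_mem_primeIdealOf_iff hU x (y := ⟨y.1, hy⟩) hxy a).mpr ha
    have h1 := (IsLocalization.AtPrime.to_map_mem_maximal_iff (c.X.presheaf.stalk x.1) P _).mpr haP
    rw [IsScalarTower.algebraMap_apply A B, IsLocalRing.mem_maximalIdeal, ← e1, ← hta,
      _root_.map_mul, _root_.map_mul] at h1
    exact h1 (((ht.map _).map _).mul hunit)

end Cover

/-- In dimension zero the maximal ideal is the nilradical, which vanishes, so the ring is a field.
-/
lemma isRegularLocalRing_of_isReduced_of_ringKrullDim {S : Type*} [CommRing S] [IsLocalRing S]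
    [IsReduced S] (hd : ringKrullDim S = 0) : IsRegularLocalRing S := by
  have : Ring.KrullDimLE 0 S := by
    rw [Ring.krullDimLE_iff, hd]
    rfl
  have hm : IsLocalRing.maximalIdeal S = ⊥ := by
    rw [← IsLocalRing.ringJacobson_eq_maximalIdeal,
      Ring.jacobson_eq_nilradical_of_krullDimLE_zero]
    exact nilradical_eq_zero S
  have hF := IsLocalRing.isField_iff_maximalIdeal_eq.mpr hm
  have := hF.isDomain
  have := hF.isPrincipalIdealRing
  infer_instance

/-! ### Singularities and existence of building data -/

namespace Cover

variable {Y : Scheme.{u}} {n : ℕ}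

lemma exists_f_eq (c : Cover Y n) (y : Y) : ∃ x, c.f x = y := by
  obtain ⟨U, hU, hy, -⟩ := exists_affine_le (U := (⊤ : Y.Opens)) (y := y) trivial
  let _ := c.algebra U
  have : Algebra.IsIntegral Γ(Y, U) Γ(c.X, c.f ⁻¹ᵁ U) := ⟨(c.finite_app hU).to_isIntegral⟩
  obtain ⟨P, -, _, hP⟩ := Ideal.exists_ideal_over_prime_of_isIntegral
    (hU.primeIdealOf ⟨y, hy⟩).asIdeal (⊥ : Ideal Γ(c.X, c.f ⁻¹ᵁ U)) (by
      intro r hr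
      have : r = 0 := c.injective U (by rw [map_zero]; exact hr)
      rw [this]
      exact Ideal.zero_mem _)
  obtain ⟨x, rfl⟩ := exists_primeIdealOf_eq (c.isAffineOpen_preimage hU) P
  refine ⟨x.1, ?_⟩
  have h : hU.primeIdealOf ⟨c.f x.1, x.2⟩ = hU.primeIdealOf ⟨y, hy⟩ := by
    ext r
    rw [← c.app_mem_primeIdealOf_iff hU x rfl, ← hP]
    rfl
  have := congrArg hU.fromSpec h
  rwa [hU.fromSpec_primeIdealOf, hU.fromSpec_primeIdealOf] at this

variable [IsIntegral Y] [IsLocallyNoetherian Y] {c : Cover Y n} [CompactSpace Y]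
  (M : c.EigenData) (hN : IsNormalScheme Y) (h2 : IsUnit (2 : Γ(Y, ⊤)))

namespace EigenData

include M hN h2

/-- One point over `y` suffices, since the exponents depend only on `y`. It has codimension one, so
its local ring is regular or a node. -/
theorem exists_multiplicities (hX : IsNCInCodimOne c.X) (y : PrimeDivisor Y) :
    ∃ m : {h : Grp n // h ≠ 0} → ℤ, (∀ h, 0 ≤ m h) ∧ ∑ h, m h ≤ 2 ∧
      ∀ χ ψ, M.exponent y χ ψ = ∑ h, eps χ ψ h.1 * m h := by
  obtain ⟨x, hx⟩ := c.exists_f_eq y.1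
  have hco : Order.coheight x = 1 := by rw [c.coheight_eq, hx, y.2]
  obtain ⟨O, B, _, _, _, _, _, D, Q, _, _, _, h2O, hQ, he⟩ := M.exists_charBasis hN h2 x y hx
  have hS : NodeLike (c.X.presheaf.stalk x) := by
    rcases hX x hco.le with h | h
    · refine IsRegularLocalRing.nodeLike ?_
      rw [ringKrullDim_stalk_eq_coheight, hco]
      rfl
    · exact h.nodeLike
  obtain ⟨m, h0, hm2, hm⟩ := D.exists_multiplicities Q _ h2O hQ hS
  exact ⟨m, h0, hm2, fun χ ψ => by rw [← he, hm]⟩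

theorem isNCInCodimOne (D : {h : Grp n // h ≠ 0} → WeilDivisor Y) (hD : ∀ h, 0 ≤ D h)
    (hD2 : ∀ y, (∑ h, D h) y ≤ 2)
    (he : ∀ y χ ψ, M.exponent y χ ψ = ∑ h, eps χ ψ h.1 * D h y) : IsNCInCodimOne c.X := by
  intro x hx
  rcases Order.le_one_iff.mp hx with h0 | h1
  · left
    have := M.isReduced h2
    refine isRegularLocalRing_of_isReduced_of_ringKrullDim ?_
    rw [ringKrullDim_stalk_eq_coheight, h0]
    rfl
  · obtain ⟨O, B, _, _, _, _, _, D', Q, _, _, _, h2O, hQ, he'⟩ :=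
      M.exists_charBasis hN h2 x ⟨c.f x, by rw [← c.coheight_eq, h1]⟩ rfl
    refine D'.isRegularLocalRing_or_isNode Q h2O ?_ hQ
      (fun h => D h ⟨c.f x, by rw [← c.coheight_eq, h1]⟩) (fun h => hD h _) ?_
      (fun χ ψ => by rw [he', he])
    · rw [ringKrullDim_stalk_eq_coheight, h1]
      rfl
    · have := hD2 ⟨c.f x, by rw [← c.coheight_eq, h1]⟩
      rwa [Finsupp.finsetSum_apply] at this

end EigenData

include hN h2

/-- The singularities of a standard cover in terms of the multiplicities of the branch divisor. -/
theorem IsStandard.isSTwoNC_iff {B : BuildingData Y n} (h : c.IsStandard B) :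
    c.IsSTwoNC ↔ B.MultLETwo := by
  obtain ⟨M, -, hM⟩ := (isStandard_iff c B).mp h
  constructor
  · rintro ⟨-, -, hNC⟩ y
    obtain ⟨m, h0, hm2, hm⟩ := M.exists_multiplicities hN h2 hNC y
    -- The multiplicities extracted from the singularities are those of the given data, because the
    -- exponents determine them.
    have : m = fun h => B.D h y := eq_of_sum_eps_eq fun χ => by rw [← hm, hM]
    rw [this] at hm2
    rwa [Finsupp.finsetSum_apply]
  · intro hB
    exact ⟨M.isReduced h2, M.isSTwo h2, M.isNCInCodimOne hN h2 B.D B.effective hB hM⟩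

/-- The building data of a cover with divisorial eigensheaves. -/
lemma EigenData.exists_isStandard (M : c.EigenData) (hX : IsNCInCodimOne c.X) :
    ∃ B : BuildingData Y n, c.IsStandard B := by
  choose m h0 hm2 hm using M.exists_multiplicities hN h2 hX
  have hfin : ∀ h, {y | m y h ≠ 0}.Finite := by
    intro h
    have : ∀ y, m y h ≠ 0 → ∃ χ : Chars n, M.exponent y χ χ ≠ 0 := by
      intro y hy
      by_contra! hall
      refine hy ?_
      have : m y = 0 := eq_of_sum_eps_eq fun χ => by
        rw [← hm, hall]
        simp
      rw [this]
      rfl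
    -- A nonzero multiplicity at `y` forces a nonzero diagonal exponent, hence `y` lies in the
    -- support of one of finitely many divisors.
    refine Set.Finite.subset (s := ⋃ χ : Chars n, ({y | Scheme.ord (M.φ χ χ) y.1 ≠ 0} ∪
      ((M.E χ).support : Set (PrimeDivisor Y))) ∪ ((M.E (χ * χ)).support : Set (PrimeDivisor Y)))
      (Set.finite_iUnion fun χ => ((finite_ord_ne_zero (M.ne_zero χ χ)).union
        (Finset.finite_toSet _)).union (Finset.finite_toSet _)) fun y hy => ?_
    obtain ⟨χ, hχ⟩ := this y hy
    refine Set.mem_iUnion.mpr ⟨χ, ?_⟩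
    by_contra h'
    simp only [Set.mem_union, Set.mem_ofPred_eq, Finset.mem_coe, Finsupp.mem_support_iff, not_or,
      not_not] at h'
    apply hχ
    rw [exponent, h'.1.1, h'.1.2, h'.2]
    rfl
  let D : {h : Grp n // h ≠ 0} → WeilDivisor Y := fun h =>
    Finsupp.ofSupportFinite (fun y => m y h) (hfin h)
  have hD : ∀ h y, D h y = m y h := fun h y => rfl
  refine ⟨⟨fun χ => divClass (M.E χ), D, fun h y => h0 y h, fun χ ψ => ?_⟩,
    (isStandard_iff c _).mpr ⟨M, fun χ => rfl, fun y χ ψ => hm y χ ψ⟩⟩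
  rw [divClass, divClass, divClass, divClass, ← QuotientAddGroup.mk_add, ← QuotientAddGroup.mk_add,
    eq_comm, QuotientAddGroup.eq]
  -- The section of `𝒪_Y(E_χ + E_ψ - E_χψ)` defining the multiplication provides the linear
  -- equivalence; the inverse comes from the direction of the quotient relation.
  refine ⟨(M.φ χ ψ)⁻¹, inv_ne_zero (M.ne_zero _ _), fun y => ?_⟩
  have h1 := hm y χ ψ
  rw [exponent] at h1
  simp only [Finsupp.add_apply, Finsupp.neg_apply, Finsupp.finsetSum_apply, Finsupp.smul_apply,
    smul_eq_mul, hD, ord_inv (M.ne_zero χ ψ)]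
  rw [← h1]
  ring

omit M in
/-- The covers which are reduced, `S₂` and normal crossing in codimension one are the standard
covers whose branch divisor has multiplicities at most two. -/
theorem isSTwoNC_iff : c.IsSTwoNC ↔ ∃ B : BuildingData Y n, B.MultLETwo ∧ c.IsStandard B := by
  constructor
  · intro h
    have := h.1
    obtain ⟨M⟩ := nonempty_eigenData hN h2 h.2.1
    obtain ⟨B, hB⟩ := M.exists_isStandard hN h2 h.2.2
    exact ⟨B, (hB.isSTwoNC_iff hN h2).mp h, hB⟩
  · rintro ⟨B, hB, h⟩
    exact (h.isSTwoNC_iff hN h2).mpr hB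

end Cover

/-! ### Global functions on projective varieties -/

section

variable {k : Type u} [Field k]

/-- The projective spectrum is universally closed over the spectrum of its degree zero part, which
is a closed subscheme of `Spec k` by surjectivity. -/
lemma universallyClosed_proj {A : Type u} [CommRing A] [Algebra k A] (𝒜 : ℕ → Submodule k A)
    [GradedAlgebra 𝒜] [Algebra.FiniteType k A] (h : Function.Surjective (algebraMap k (𝒜 0))) :
    UniversallyClosed (Proj.toSpecZero 𝒜 ≫ Spec.map (CommRingCat.ofHom (algebraMap k (𝒜 0)))) := by
  have : IsScalarTower k (𝒜 0) A := ⟨fun x y z => smul_mul_assoc x (y : A) z⟩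
  have : Algebra.FiniteType (𝒜 0) A := Algebra.FiniteType.of_restrictScalars_finiteType k _ _
  have : IsClosedImmersion (Spec.map (CommRingCat.ofHom (algebraMap k (𝒜 0)))) :=
    IsClosedImmersion.spec_of_surjective _ h
  infer_instance

variable {Y : Scheme.{u}} {s : Y ⟶ Spec (.of k)}

lemma IsProjectiveOver.universallyClosed (hs : IsProjectiveOver s) : UniversallyClosed s := by
  obtain ⟨N, i, hi, rfl⟩ := hs
  let _ : GradedAlgebra (MvPolynomial.homogeneousSubmodule (Fin (N + 1)) k) :=
    MvPolynomial.gradedAlgebra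
  have := universallyClosed_proj (MvPolynomial.homogeneousSubmodule (Fin (N + 1)) k) (by
    rintro ⟨x, hx⟩
    rw [MvPolynomial.mem_homogeneousSubmodule] at hx
    refine ⟨MvPolynomial.coeff 0 x, Subtype.ext ?_⟩
    exact (MvPolynomial.totalDegree_eq_zero_iff_eq_C.mp
      ((MvPolynomial.totalDegree_zero_iff_isHomogeneous _).mpr hx)).symm)
  exact MorphismProperty.comp_mem _ _ _ inferInstance this

include s

lemma isUnit_two_globalSections (h2 : (2 : k) ≠ 0) : IsUnit (2 : Γ(Y, ⊤)) := by
  have := (IsUnit.mk0 _ h2).map ((Scheme.ΓSpecIso (.of k)).inv ≫ s.appTop).hom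
  rwa [map_ofNat] at this

variable [IsAlgClosed k] [IsIntegral Y] [UniversallyClosed s]

/-- The global sections of a universally closed integral scheme over an algebraically closed field
are constant. -/
lemma surjective_globalSections :
    Function.Surjective ((Scheme.ΓSpecIso (.of k)).inv ≫ s.appTop).hom := by
  have h1 : ((Scheme.ΓSpecIso (.of k)).inv ≫ s.appTop).hom.IsIntegral := by
    apply RingHom.isIntegral_respectsIso.2
      (e := (Scheme.ΓSpecIso _).symm.commRingCatIsoToRingEquiv)
    exact isIntegral_appTop_of_universallyClosed s
  have := (isField_of_universallyClosed k s).isDomain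
  exact IsAlgClosed.ringHom_bijective_of_isIntegral _ h1 |>.2

lemma isSquare_globalSections (x : Γ(Y, ⊤)) : IsSquare x := by
  obtain ⟨r, rfl⟩ := surjective_globalSections (s := s) x
  obtain ⟨z, hz⟩ := IsAlgClosed.exists_pow_nat_eq r (n := 2) two_pos
  exact ⟨((Scheme.ΓSpecIso (.of k)).inv ≫ s.appTop).hom z, by rw [← _root_.map_mul, ← hz, sq]⟩

end

variable {Y : Scheme.{u}} [IsIntegral Y] [IsLocallyNoetherian Y]

/-- A rational function without poles on a nonempty open subset is regular there. -/
lemma exists_section_eq (hN : IsNormalScheme Y) (U : Y.Opens) [Nonempty U] {a : Y.functionField}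
    (ha : ∀ y : PrimeDivisor Y, y.1 ∈ U → 0 ≤ Scheme.ord a y.1) :
    ∃ r : Γ(Y, U), Y.germToFunctionField U r = a := by
  choose r hr using fun (V : Y.Opens) (_ : Nonempty V) (hV : IsAffineOpen V) (h : V ≤ U) =>
    exists_germToFunctionField_eq hN hV (a := a) fun y hy => ha y (h hy)
  obtain ⟨t, ht⟩ := exists_resOver_eq (𝟙 Y) (U := U) (fun V _ hV h => r V ‹_› hV h) (by
    intro V W _ _ hV hW hVU hWV
    apply Scheme.germToFunctionField_injective Y W
    exact (germToFunctionField_res hWV _).trans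
      ((hr V ‹_› hV hVU).trans (hr W ‹_› hW (hWV.trans hVU)).symm))
  obtain ⟨V, hV, _, hVU⟩ := exists_affine_nonempty_le U
  refine ⟨t, (germToFunctionField_res hVU _).symm.trans ?_⟩
  exact (congrArg _ (ht V hV hVU)).trans (hr V ‹_› hV hVU)

/-- The rational functions without zeros and poles are squares of such functions. -/
lemma exists_mul_self_eq (hN : IsNormalScheme Y) (hsq : ∀ x : Γ(Y, ⊤), IsSquare x)
    {a : Y.functionField} (ha0 : a ≠ 0) (ha : ∀ y : PrimeDivisor Y, Scheme.ord a y.1 = 0) :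
    ∃ b : Y.functionField, b ≠ 0 ∧ (∀ y : PrimeDivisor Y, Scheme.ord b y.1 = 0) ∧ b * b = a := by
  have := Cover.nonempty_top Y
  obtain ⟨r, rfl⟩ := exists_section_eq hN ⊤ (a := a) fun y _ => (ha y).ge
  obtain ⟨b, rfl⟩ := hsq r
  rw [_root_.map_mul] at *
  have hb0 := left_ne_zero_of_mul ha0
  refine ⟨_, hb0, fun y => ?_, rfl⟩
  have := ha y
  rw [Scheme.ord_mul hb0 hb0] at this
  omega

/-! ### Uniqueness of the building data -/

namespace Cover

variable {Y : Scheme.{u}} {n : ℕ} [IsIntegral Y] [IsLocallyNoetherian Y] [CompactSpace Y]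
  (hN : IsNormalScheme Y) (h2 : IsUnit (2 : Γ(Y, ⊤))) {c c' : Cover Y n} (M : c.EigenData)

namespace EigenData

include hN h2

lemma exists_map_ne_zero (χ : Chars n) {U : Y.Opens} [Nonempty U] (hU : IsAffineOpen U) :
    ∃ z ∈ c.eigen χ U, M.Φ χ U z ≠ 0 := by
  by_cases h : ∃ y : PrimeDivisor Y, y.1 ∈ U
  · obtain ⟨y, hy⟩ := h
    obtain ⟨z, hz, h0, -⟩ := M.exists_generator hN h2 χ hU y hy
    exact ⟨z, hz, h0⟩
  · push Not at h
    obtain ⟨z, hz, h1⟩ := (M.bijOn χ U).surjOn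
      (show (1 : Y.functionField) ∈ sectionsNeg (M.E χ) U from Or.inr fun y hy => absurd hy (h y))
    exact ⟨z, hz, by rw [h1]; exact _root_.one_ne_zero⟩

/-- Two identifications of an eigensheaf with a divisorial sheaf differ by a rational function. -/
lemma exists_map_eq (M' : c.EigenData) (χ : Chars n) : ∃ a : Y.functionField, a ≠ 0 ∧
    ∀ (U : Y.Opens) [Nonempty U], ∀ s ∈ c.eigen χ U, M'.Φ χ U s = a * M.Φ χ U s := by
  have := nonempty_top Y
  obtain ⟨U₀, hU₀, _, -⟩ := exists_affine_nonempty_le (⊤ : Y.Opens)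
  obtain ⟨z, hz, hz0⟩ := M.exists_map_ne_zero hN h2 χ hU₀
  have hz0' : M'.Φ χ U₀ z ≠ 0 := fun h => hz0 (by rw [M'.eq_zero hz h, map_zero])
  refine ⟨M'.Φ χ U₀ z / M.Φ χ U₀ z, div_ne_zero hz0' hz0, fun U _ s hs => ?_⟩
  have := nonempty_inf U U₀
  obtain ⟨W, hW, _, hWle⟩ := exists_affine_nonempty_le (U ⊓ U₀)
  have hWU := hWle.trans inf_le_left
  have hWU₀ := hWle.trans inf_le_right
  have := functionField_isFractionRing_of_isAffineOpen Y W hW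
  obtain ⟨r, t, ht, h⟩ := IsFractionRing.div_surjective (A := Γ(Y, W)) (M.Φ χ U s / M.Φ χ U₀ z)
  have ht0 : Y.germToFunctionField W t ≠ 0 :=
    IsFractionRing.to_map_ne_zero_of_mem_nonZeroDivisors ht
  change Y.germToFunctionField W r / Y.germToFunctionField W t = _ at h
  rw [div_eq_div_iff ht0 hz0] at h
  have hs' := c.res_mem_eigen hWU hs
  have hz' := c.res_mem_eigen hWU₀ hz
  have h1 : c.f.app W r * resOver c.f hWU₀ z = c.f.app W t * resOver c.f hWU s := by
    refine (M.bijOn χ W).injOn (c.app_mul_mem_eigen _ hz') (c.app_mul_mem_eigen _ hs') ?_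
    rw [M.map_app_mul χ W _ _ hz', M.map_app_mul χ W _ _ hs', M.map_res χ _ _ _ _ hs,
      M.map_res χ _ _ _ _ hz, h, mul_comm]
  have h2 := congrArg (M'.Φ χ W) h1
  rw [M'.map_app_mul χ W _ _ hz', M'.map_app_mul χ W _ _ hs', M'.map_res χ _ _ _ _ hs,
      M'.map_res χ _ _ _ _ hz] at h2
  refine mul_left_cancel₀ ht0 ?_
  rw [← h2, div_mul_eq_mul_div, mul_div_assoc', eq_div_iff hz0]
  linear_combination M'.Φ χ U₀ z * h

/-- Both identifications attain their minimal order at a prime divisor, and they differ by the fixed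
function `a`; comparing generators for the two gives both inequalities. -/
lemma exists_eq_add (M' : c.EigenData) (χ : Chars n) : ∃ a : Y.functionField, a ≠ 0 ∧
    (∀ (U : Y.Opens) [Nonempty U], ∀ s ∈ c.eigen χ U, M'.Φ χ U s = a * M.Φ χ U s) ∧
    ∀ y, M'.E χ y = Scheme.ord a y.1 + M.E χ y := by
  obtain ⟨a, ha0, ha⟩ := M.exists_map_eq hN h2 M' χ
  refine ⟨a, ha0, fun U _ => ha U, fun y => ?_⟩
  obtain ⟨U, hU, hy, -⟩ := exists_affine_le (U := (⊤ : Y.Opens)) (y := y.1) trivial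
  have : Nonempty U := ⟨⟨_, hy⟩⟩
  obtain ⟨z, hz, h0, h⟩ := M.exists_generator hN h2 χ hU y hy
  obtain ⟨w, hw, hw0, h'⟩ := M'.exists_generator hN h2 χ hU y hy
  have hw1 : M.Φ χ U w ≠ 0 := fun h => hw0 (by rw [M.eq_zero hw h, map_zero])
  have h3 := M'.ord_ge hz (by rw [ha U z hz]; exact mul_ne_zero ha0 h0) y hy
  rw [ha U z hz, Scheme.ord_mul ha0 h0, h] at h3
  have h4 := M.ord_ge hw hw1 y hy
  rw [ha U w hw, Scheme.ord_mul ha0 hw1] at h'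
  omega

lemma φ_comm (χ ψ : Chars n) : M.φ χ ψ = M.φ ψ χ := by
  have := nonempty_top Y
  obtain ⟨U, hU, _, -⟩ := exists_affine_nonempty_le (⊤ : Y.Opens)
  obtain ⟨z, hz, hz0⟩ := M.exists_map_ne_zero hN h2 χ hU
  obtain ⟨w, hw, hw0⟩ := M.exists_map_ne_zero hN h2 ψ hU
  have h := M.map_mul χ ψ U z hz w hw
  have h' := M.map_mul ψ χ U w hw z hz
  rw [mul_comm ψ χ, mul_comm w z, h, mul_assoc, mul_assoc, mul_comm (M.Φ ψ U w)] at h'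
  exact mul_right_cancel₀ (mul_ne_zero hz0 hw0) h'

/-- Associativity of the multiplication, evaluated on three eigensections with nonzero values, as
commutativity gave `φ_comm`. -/
lemma φ_cocycle (χ ψ θ : Chars n) : M.φ χ ψ * M.φ (χ * ψ) θ = M.φ ψ θ * M.φ χ (ψ * θ) := by
  have := nonempty_top Y
  obtain ⟨U, hU, _, -⟩ := exists_affine_nonempty_le (⊤ : Y.Opens)
  obtain ⟨z, hz, hz0⟩ := M.exists_map_ne_zero hN h2 χ hU
  obtain ⟨w, hw, hw0⟩ := M.exists_map_ne_zero hN h2 ψ hU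
  obtain ⟨v, hv, hv0⟩ := M.exists_map_ne_zero hN h2 θ hU
  have h := M.map_mul (χ * ψ) θ U _ (c.mul_mem_eigen hz hw) v hv
  have h' := M.map_mul χ (ψ * θ) U z hz _ (c.mul_mem_eigen hw hv)
  rw [M.map_mul χ ψ U z hz w hw] at h
  rw [M.map_mul ψ θ U w hw v hv] at h'
  rw [mul_assoc χ, mul_assoc z, h'] at h
  refine mul_right_cancel₀ (mul_ne_zero hz0 (mul_ne_zero hw0 hv0)) ?_
  linear_combination - h

/-- Rescaling the identifications changes `φ` by a coboundary and the divisors `E` by the orders of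
the same functions; in the exponent the two changes cancel. -/
lemma exponent_eq (M' : c.EigenData) (y : PrimeDivisor Y) (χ ψ : Chars n) :
    M.exponent y χ ψ = M'.exponent y χ ψ := by
  choose a ha0 ha hE using M.exists_eq_add hN h2 M'
  have hφ : M'.φ χ ψ * (a χ * a ψ) = a (χ * ψ) * M.φ χ ψ := by
    obtain ⟨U, hU, hy, -⟩ := exists_affine_le (U := (⊤ : Y.Opens)) (y := y.1) trivial
    have : Nonempty U := ⟨⟨_, hy⟩⟩
    obtain ⟨z, hz, hz0⟩ := M.exists_map_ne_zero hN h2 χ hU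
    obtain ⟨w, hw, hw0⟩ := M.exists_map_ne_zero hN h2 ψ hU
    have h := M'.map_mul χ ψ U z hz w hw
    rw [ha _ U _ (c.mul_mem_eigen hz hw), ha _ U _ hz, ha _ U _ hw,
      M.map_mul χ ψ U z hz w hw] at h
    refine mul_right_cancel₀ (mul_ne_zero hz0 hw0) ?_
    linear_combination - h
  have h : Scheme.ord (M'.φ χ ψ * (a χ * a ψ)) y.1 = Scheme.ord (a (χ * ψ) * M.φ χ ψ) y.1 := by
    rw [hφ]
  rw [Scheme.ord_mul (M'.ne_zero _ _) (mul_ne_zero (ha0 _) (ha0 _)),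
    Scheme.ord_mul (ha0 _) (ha0 _), Scheme.ord_mul (ha0 _) (M.ne_zero _ _)] at h
  simp only [exponent, hE]
  omega

end EigenData

omit M in
include hN h2 in
/-- The building data of a standard cover are unique. -/
theorem IsStandard.unique {B B' : BuildingData Y n} (h : c.IsStandard B) (h' : c.IsStandard B') :
    B = B' := by
  obtain ⟨M, hL, hD⟩ := (isStandard_iff c B).mp h
  obtain ⟨M', hL', hD'⟩ := (isStandard_iff c B').mp h'
  have h1 : B.L = B'.L := by
    funext χ
    rw [← hL, ← hL', divClass, divClass, QuotientAddGroup.eq]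
    obtain ⟨a, ha0, -, hE⟩ := M.exists_eq_add hN h2 M' χ
    exact ⟨a, ha0, fun y => by rw [Finsupp.add_apply, hE, Finsupp.neg_apply]; ring⟩
  have h3 : B.D = B'.D := by
    funext g
    ext y
    refine congrFun (eq_of_sum_eps_eq (x := fun g => B.D g y) (y := fun g => B'.D g y)
      fun χ => ?_) g
    rw [← hD, ← hD', M.exponent_eq hN h2 M']
  cases B; cases B'
  subst h1 h3
  rfl

omit [CompactSpace Y] in
/-- Scaling the identifications of the eigensheaves with divisorial sheaves. -/
lemma EigenData.exists_rescale (a : Chars n → Y.functionField) (ha : ∀ χ, a χ ≠ 0)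
    (E : Chars n → WeilDivisor Y) (hE : ∀ χ y, E χ y = Scheme.ord (a χ) y.1 + M.E χ y) :
    ∃ M' : c.EigenData, M'.E = E ∧ ∀ χ ψ, M'.φ χ ψ = a (χ * ψ) * M.φ χ ψ / (a χ * a ψ) := by
  have hsec : ∀ χ (U : Y.Opens) (x : Y.functionField),
      a χ * x ∈ sectionsNeg (E χ) U ↔ x ∈ sectionsNeg (M.E χ) U := by
    intro χ U x
    by_cases hx : x = 0
    · exact iff_of_true (Or.inl (by rw [hx, mul_zero])) (Or.inl hx)
    · simp only [sectionsNeg, Set.mem_ofPred_eq, mul_eq_zero, ha, hx, or_self, false_or, hE,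
        Scheme.ord_mul (ha χ) hx, add_le_add_iff_left]
  refine ⟨⟨E, fun χ ψ => a (χ * ψ) * M.φ χ ψ / (a χ * a ψ),
    fun χ U => (AddMonoidHom.mulLeft (a χ)).comp (M.Φ χ U),
    fun χ ψ => div_ne_zero (mul_ne_zero (ha _) (M.ne_zero _ _)) (mul_ne_zero (ha _) (ha _)),
    fun χ U _ => ⟨fun s hs => (hsec χ U _).mpr ((M.bijOn χ U).mapsTo hs),
      fun s hs t ht h => (M.bijOn χ U).injOn hs ht (mul_left_cancel₀ (ha χ) h), fun x hx => ?_⟩,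
    fun χ U _ r s hs => ?_, fun χ U V _ _ hVU s hs => ?_, fun χ ψ U _ s hs t ht => ?_⟩,
    rfl, fun _ _ => rfl⟩
  · have h : a χ * ((a χ)⁻¹ * x) = x := mul_inv_cancel_left₀ (ha χ) x
    rw [← h, hsec] at hx
    obtain ⟨s, hs, hsx⟩ := (M.bijOn χ U).surjOn hx
    exact ⟨s, hs, by rw [← h, ← hsx]; rfl⟩
  · change a χ * _ = _ * (a χ * _)
    rw [M.map_app_mul χ U r s hs]
    ring
  · exact congrArg (a χ * ·) (M.map_res χ U V hVU s hs)
  · change a (χ * ψ) * _ = _ * (a χ * _) * (a ψ * _)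
    rw [M.map_mul χ ψ U s hs t ht]
    have := ha χ
    have := ha ψ
    field_simp

end Cover

/-! ### Uniqueness of the cover with given building data -/

namespace Cover

variable {Y : Scheme.{u}} {n : ℕ} [IsIntegral Y] [IsLocallyNoetherian Y]
  {c c' : Cover Y n} (M : c.EigenData) (M' : c'.EigenData)

namespace EigenData

/-- A homomorphism of algebras compatible with the identifications of the eigensheaves. -/
structure IsCompatible {U : Y.Opens} (ψ : Γ(c'.X, c'.f ⁻¹ᵁ U) ⟶ Γ(c.X, c.f ⁻¹ᵁ U)) : Prop where
  mem : ∀ χ, ∀ s ∈ c'.eigen χ U, ψ s ∈ c.eigen χ U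
  map : ∀ [Nonempty U], ∀ χ, ∀ s ∈ c'.eigen χ U, M.Φ χ U (ψ s) = M'.Φ χ U s

/-- The relation `1 * 1 = 1` determines the value at 1, so that covers with equal `φ` have matching
unit sections. -/
lemma map_one_eq (U : Y.Opens) [Nonempty U] : M.Φ 1 U 1 = (M.φ 1 1)⁻¹ := by
  have h := M.map_mul 1 1 U 1 (c.one_mem_eigen U) 1 (c.one_mem_eigen U)
  rw [one_mul, one_mul] at h
  exact eq_inv_of_mul_eq_one_right (mul_right_cancel₀ (M.one_ne_zero U) (by rw [← h, one_mul]))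

variable (hE : M.E = M'.E) (hφ : M.φ = M'.φ) (h2 : IsUnit (2 : Γ(Y, ⊤)))

-- Eigencomponents are matched through their images in the function field, which form the same set
-- since the divisors agree. Equality of the functions `φ` makes the resulting sum multiplicative.
include hE hφ h2 in
lemma exists_isCompatible (U : Y.Opens) [Nonempty U] :
    ∃ ψ : Γ(c'.X, c'.f ⁻¹ᵁ U) ⟶ Γ(c.X, c.f ⁻¹ᵁ U), M.IsCompatible M' ψ := by
  have hex : ∀ χ s, ∃ t ∈ c.eigen χ U, M.Φ χ U t = M'.Φ χ U (c'.proj χ U s) := by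
    intro χ s
    refine (M.bijOn χ U).surjOn ?_
    rw [hE]
    exact (M'.bijOn χ U).mapsTo (c'.proj_mem_eigen χ U s)
  choose T hT hTΦ using hex
  have hTeq : ∀ χ {s t}, t ∈ c.eigen χ U → M.Φ χ U t = M'.Φ χ U (c'.proj χ U s) → T χ s = t :=
    fun χ s t ht h => (M.bijOn χ U).injOn (hT χ s) ht ((hTΦ χ s).trans h.symm)
  have hTadd : ∀ χ s t, T χ (s + t) = T χ s + T χ t := fun χ s t =>
    hTeq χ (c.add_mem_eigen (hT χ s) (hT χ t)) (by
      rw [map_add, map_add, map_add, hTΦ, hTΦ])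
  let S : Γ(c'.X, c'.f ⁻¹ᵁ U) →+ Γ(c.X, c.f ⁻¹ᵁ U) :=
    ∑ χ, AddMonoidHom.mk' (T χ) (hTadd χ)
  have hS : ∀ χ, ∀ s ∈ c'.eigen χ U, S s ∈ c.eigen χ U ∧ M.Φ χ U (S s) = M'.Φ χ U s := by
    intro χ s hs
    have : S s = T χ s := by
      rw [AddMonoidHom.finsetSum_apply, Finset.sum_eq_single χ]
      · rfl
      · intro ψ _ hψ
        refine hTeq ψ (c.zero_mem_eigen ψ U) ?_
        rw [c'.proj_of_mem_eigen h2 hs, if_neg hψ, map_zero, map_zero]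
      · simp
    rw [this]
    refine ⟨hT χ s, ?_⟩
    rw [hTΦ, c'.proj_of_mem_eigen h2 hs, if_pos rfl]
  have hmul' : ∀ χ ψ, ∀ s ∈ c'.eigen χ U, ∀ t ∈ c'.eigen ψ U, S (s * t) = S s * S t := by
    intro χ ψ s hs t ht
    have h := hS _ _ (c'.mul_mem_eigen hs ht)
    refine (M.bijOn _ U).injOn h.1 (c.mul_mem_eigen (hS χ s hs).1 (hS ψ t ht).1) ?_
    rw [h.2, M.map_mul χ ψ U _ (hS χ s hs).1 _ (hS ψ t ht).1, (hS χ s hs).2, (hS ψ t ht).2,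
      M'.map_mul χ ψ U s hs t ht, hφ]
  have hmul : ∀ s t, S (s * t) = S s * S t := by
    intro s t
    conv_lhs => rw [← c'.sum_proj h2 U s, ← c'.sum_proj h2 U t]
    conv_rhs => rw [← c'.sum_proj h2 U s, ← c'.sum_proj h2 U t]
    rw [Finset.sum_mul_sum, map_sum, map_sum, map_sum, Finset.sum_mul_sum]
    refine Finset.sum_congr rfl fun χ _ => ?_
    rw [map_sum]
    exact Finset.sum_congr rfl fun ψ _ =>
      hmul' χ ψ _ (c'.proj_mem_eigen χ U s) _ (c'.proj_mem_eigen ψ U t)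
  have hone : S 1 = 1 := by
    have h := hS 1 1 (c'.one_mem_eigen U)
    refine (M.bijOn 1 U).injOn h.1 (c.one_mem_eigen U) ?_
    rw [h.2, map_one_eq, map_one_eq, hφ]
  exact ⟨CommRingCat.ofHom (RingHom.mk' ⟨⟨S, hone⟩, hmul⟩ (map_add S)),
    ⟨fun χ s hs => (hS χ s hs).1, fun χ s hs => (hS χ s hs).2⟩⟩

include h2 in
omit M [IsIntegral Y] [IsLocallyNoetherian Y] in
lemma hom_ext_eigen {U : Y.Opens} {A : CommRingCat} {ψ θ : Γ(c.X, c.f ⁻¹ᵁ U) ⟶ A}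
    (h : ∀ χ, ∀ s ∈ c.eigen χ U, ψ s = θ s) : ψ = θ := by
  ext s
  rw [← c.sum_proj h2 U s, map_sum, map_sum]
  exact Finset.sum_congr rfl fun χ _ => h χ _ (c.proj_mem_eigen χ U s)

include hE hφ h2 in
lemma exists_hom : ∃ (a : c.X ⟶ c'.X) (ha : a ≫ c'.f = c.f), ∀ (U : Y.Opens) [Nonempty U],
    IsAffineOpen U → M.IsCompatible M'
      (a.appLE (c'.f ⁻¹ᵁ U) (c.f ⁻¹ᵁ U) (preimage_le_preimage ha U)) := by
  have := c.isAffineHom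
  have := c'.isAffineHom
  -- Over the empty set the sections form the zero ring, where any map is a homomorphism.
  have hsub : ∀ U : Y.Opens, ¬ Nonempty U → ∀ s t : Γ(c.X, c.f ⁻¹ᵁ U), s = t := by
    intro U hU s t
    exact eq_of_resOver_affine c.f fun V hV _ hVU => absurd ⟨_, hVU hV.some.2⟩ hU
  have hex : ∀ U : Y.affineOpens, ∃ ψ : Γ(c'.X, c'.f ⁻¹ᵁ U.1) ⟶ Γ(c.X, c.f ⁻¹ᵁ U.1),
      Nonempty U.1 → M.IsCompatible M' ψ := by
    intro U
    by_cases hU : Nonempty U.1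
    · obtain ⟨ψ, hψ⟩ := M.exists_isCompatible M' hE hφ h2 U.1
      exact ⟨ψ, fun _ => hψ⟩
    · exact ⟨CommRingCat.ofHom (RingHom.mk' ⟨⟨0, hsub _ hU _ _⟩, fun _ _ => hsub _ hU _ _⟩
        fun _ _ => hsub _ hU _ _), fun h => absurd h hU⟩
  choose ψ hψ using hex
  obtain ⟨a, ha, h⟩ := exists_hom_over (f := c.f) (f' := c'.f) ψ (fun U => by
    ext r
    by_cases hU : Nonempty U.1
    · have h := (hψ U hU).mem 1 _ (c'.app_mem_eigen r)
      refine (M.bijOn 1 U.1).injOn h (c.app_mem_eigen r) ?_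
      refine ((hψ U hU).map 1 _ (c'.app_mem_eigen r)).trans ?_
      rw [map_app, map_app, map_one_eq, map_one_eq, hφ]
    · exact hsub _ hU _ _) (fun U V hVU => by
    by_cases hV : Nonempty V.1
    · have hU : Nonempty U.1 := hV.map fun x => ⟨x.1, hVU x.2⟩
      refine hom_ext_eigen h2 fun χ s hs => ?_
      have hs' := (hψ U hU).mem χ s hs
      have hsr := c'.res_mem_eigen hVU hs
      refine (M.bijOn χ V.1).injOn (c.res_mem_eigen hVU hs') ((hψ V hV).mem χ _ hsr) ?_
      refine (M.map_res χ _ _ hVU _ hs').trans ?_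
      rw [(hψ U hU).map χ s hs]
      exact ((M'.map_res χ _ _ hVU _ hs).symm.trans ((hψ V hV).map χ _ hsr).symm)
    · ext s
      exact hsub _ hV _ _)
  refine ⟨a, ha, fun U hU hUa => ?_⟩
  rw [h ⟨U, hUa⟩]
  exact hψ ⟨U, hUa⟩ hU

variable {M M'} in
include h2 in
lemma comp_eq_id {a : c.X ⟶ c'.X} {b : c'.X ⟶ c.X} (ha : a ≫ c'.f = c.f) (hb : b ≫ c.f = c'.f)
    (h : ∀ (U : Y.Opens) [Nonempty U], IsAffineOpen U → M.IsCompatible M'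
      (a.appLE (c'.f ⁻¹ᵁ U) (c.f ⁻¹ᵁ U) (preimage_le_preimage ha U)))
    (h' : ∀ (U : Y.Opens) [Nonempty U], IsAffineOpen U → M'.IsCompatible M
      (b.appLE (c.f ⁻¹ᵁ U) (c'.f ⁻¹ᵁ U) (preimage_le_preimage hb U))) : a ≫ b = 𝟙 _ := by
  have := c.isAffineHom
  refine hom_ext_over (f := c.f) (f' := c.f) (by rw [Category.assoc, hb, ha])
    (Category.id_comp _) fun U _ hU => ?_
  rw [← Scheme.Hom.appLE_comp_appLE _ _ _ (c'.f ⁻¹ᵁ U) _ (preimage_le_preimage hb U)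
    (preimage_le_preimage ha U)]
  have hid : (𝟙 c.X : c.X ⟶ c.X).appLE (c.f ⁻¹ᵁ U) (c.f ⁻¹ᵁ U) le_rfl = 𝟙 _ := by
    simp only [Scheme.Hom.appLE, Scheme.Hom.id_app]
    ext s
    exact resOver_self c.f s
  rw [hid]
  refine hom_ext_eigen h2 fun χ s hs => ?_
  have h1 := (h' U hU).mem χ s hs
  have h3 := (h U hU).mem χ _ h1
  refine (M.bijOn χ U).injOn h3 hs ?_
  exact ((h U hU).map χ _ h1).trans ((h' U hU).map χ s hs)

include hE hφ h2 in
/-- Covers with the same divisors and multiplication functions are isomorphic. -/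
lemma isIso_of_eq : c.IsIso c' := by
  obtain ⟨a, ha, h⟩ := M.exists_hom M' hE hφ h2
  obtain ⟨b, hb, h'⟩ := M'.exists_hom M hE.symm hφ.symm h2
  refine ⟨⟨a, b, comp_eq_id h2 ha hb h h', comp_eq_id h2 hb ha h' h⟩, ha, fun g => ?_⟩
  have := c'.isAffineHom
  refine hom_ext_over (f := c.f) (f' := c'.f) (by rw [Category.assoc, ha, c.comp_f])
    (by rw [Category.assoc, c'.comp_f, ha]) fun U _ hU => ?_
  rw [← Scheme.Hom.appLE_comp_appLE _ _ _ (c.f ⁻¹ᵁ U) _ (preimage_le_preimage ha U)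
    (preimage_le_preimage (c.comp_f g) U),
    ← Scheme.Hom.appLE_comp_appLE _ _ _ (c'.f ⁻¹ᵁ U) _ (preimage_le_preimage (c'.comp_f g) U)
    (preimage_le_preimage ha U)]
  refine hom_ext_eigen h2 fun χ s hs => ?_
  have h1 := (h U hU).mem χ s hs
  refine (h1 g.toAdd).trans ?_
  refine Eq.trans ?_ (congrArg (a.appLE _ _ (preimage_le_preimage ha U)) (hs g.toAdd)).symm
  rw [map_zsmul]

omit M M'

variable (hN : IsNormalScheme Y) [CompactSpace Y] (hsq : ∀ x : Γ(Y, ⊤), IsSquare x)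

include hN h2 hsq in
/-- Standard covers for the same building data are isomorphic. -/
theorem _root_.ZTwoCovers.Cover.IsStandard.isIso {B : BuildingData Y n} (h : c.IsStandard B)
    (h' : c'.IsStandard B) : c.IsIso c' := by
  obtain ⟨M, hL, hD⟩ := (isStandard_iff c B).mp h
  obtain ⟨M', hL', hD'⟩ := (isStandard_iff c' B).mp h'
  have hcl : ∀ χ, ∃ a : Y.functionField, a ≠ 0 ∧
      ∀ y : PrimeDivisor Y, M.E χ y = Scheme.ord a y.1 + M'.E χ y := by
    intro χ
    have := (hL' χ).trans (hL χ).symm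
    rw [divClass, divClass, QuotientAddGroup.eq] at this
    obtain ⟨a, ha0, ha⟩ := this
    exact ⟨a, ha0, fun y => by
      rw [← ha, Finsupp.add_apply, Finsupp.neg_apply]; ring⟩
  choose a ha0 ha using hcl
  -- Since the classes `L_χ` agree, rescaling makes the divisors equal; only the multiplication
  -- functions still have to be compared.
  obtain ⟨N, hNE, hNφ⟩ := M'.exists_rescale a ha0 M.E ha
  let K := Y.functionField
  let H : Subgroup Kˣ :=
    { carrier := {x | ∀ y : PrimeDivisor Y, Scheme.ord (x : K) y.1 = 0}
      one_mem' := fun y => ord_one y.1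
      mul_mem' := fun {x z} hx hz y => by
        rw [Units.val_mul, Scheme.ord_mul x.ne_zero z.ne_zero, hx y, hz y, add_zero]
      inv_mem' := fun {x} hx y => by
        rw [Units.val_inv_eq_inv_val, ord_inv x.ne_zero, hx y, neg_zero] }
  have hord : ∀ χ ψ (y : PrimeDivisor Y), Scheme.ord (N.φ χ ψ / M.φ χ ψ) y.1 = 0 := by
    intro χ ψ y
    have h1 := (hD y χ ψ).trans (hD' y χ ψ).symm
    simp only [EigenData.exponent, ha] at h1
    rw [hNφ, div_eq_mul_inv, div_eq_mul_inv,
      Scheme.ord_mul (mul_ne_zero (mul_ne_zero (ha0 _) (M'.ne_zero _ _))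
        (inv_ne_zero (mul_ne_zero (ha0 _) (ha0 _)))) (inv_ne_zero (M.ne_zero _ _)),
      Scheme.ord_mul (mul_ne_zero (ha0 _) (M'.ne_zero _ _))
        (inv_ne_zero (mul_ne_zero (ha0 _) (ha0 _))), Scheme.ord_mul (ha0 _) (M'.ne_zero _ _),
      ord_inv (mul_ne_zero (ha0 _) (ha0 _)), Scheme.ord_mul (ha0 _) (ha0 _),
      ord_inv (M.ne_zero _ _)]
    omega
  -- With equal divisors and equal branch divisors, the ratio of the multiplication functions has no
  -- zeros or poles, and it is a symmetric cocycle because both algebras are commutative and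
  -- associative.
  let m : Chars n → Chars n → H := fun χ ψ =>
    ⟨Units.mk0 (N.φ χ ψ / M.φ χ ψ) (div_ne_zero (N.ne_zero _ _) (M.ne_zero _ _)), hord χ ψ⟩
  have hm : IsSymmCocycle m := by
    refine ⟨fun χ ψ => Subtype.ext (Units.ext ?_), fun χ ψ θ => Subtype.ext (Units.ext ?_)⟩
    · change N.φ χ ψ / M.φ χ ψ = N.φ ψ χ / M.φ ψ χ
      rw [N.φ_comm hN h2, M.φ_comm hN h2]
    · change N.φ χ ψ / M.φ χ ψ * (N.φ (χ * ψ) θ / M.φ (χ * ψ) θ) =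
        N.φ ψ θ / M.φ ψ θ * (N.φ χ (ψ * θ) / M.φ χ (ψ * θ))
      rw [div_mul_div_comm, div_mul_div_comm, N.φ_cocycle hN h2, M.φ_cocycle hN h2]
  -- Functions without zeros and poles are squares of such functions, so the ratio is removed by a
  -- rescaling which leaves the divisors unchanged.
  obtain ⟨b, hb⟩ := hm.exists_coboundary fun x => by
    obtain ⟨z, hz0, hz, h⟩ := _root_.ZTwoCovers.exists_mul_self_eq hN hsq (a := (x.1 : K)) x.1.ne_zero x.2
    exact ⟨⟨Units.mk0 z hz0, hz⟩, Subtype.ext (Units.ext h)⟩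
  have hb' : ∀ χ ψ, ((b χ).1 : K) * (b ψ).1 * (N.φ χ ψ / M.φ χ ψ) = (b (χ * ψ)).1 :=
    fun χ ψ => congrArg (fun x : H => (x.1 : K)) (hb χ ψ)
  obtain ⟨N', hNE', hNφ'⟩ := N.exists_rescale (fun χ => ((b χ).1⁻¹ : Kˣ))
    (fun χ => Units.ne_zero _) M.E fun χ y => by
      have : Scheme.ord (((b χ).1⁻¹ : Kˣ) : K) y.1 = 0 := ((b χ)⁻¹).2 y
      rw [hNE, this, zero_add]
  refine M.isIso_of_eq N' hNE'.symm ?_ h2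
  funext χ ψ
  have h1 := (b χ).1.ne_zero
  have h3 := (b ψ).1.ne_zero
  have h4 := N.ne_zero χ ψ
  have h5 := M.ne_zero χ ψ
  rw [hNφ']
  simp only [Units.val_inv_eq_inv_val]
  rw [← hb']
  field_simp

end EigenData

end Cover

/-! ### Relative spectra of quasi-coherent algebras -/

open Scheme.AffineZariskiSite in
/-- A scheme over `Y` glued from the spectra of the values of a quasi-coherent algebra. -/
lemma exists_glued {Y : Scheme.{u}} (F : Y.Opensᵒᵖ ⥤ CommRingCat.{u}) (η : Y.presheaf ⟶ F)
    (hloc : ∀ (U : Y.Opens), IsAffineOpen U → ∀ r : Γ(Y, U),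
      letI := (F.map (homOfLE (Y.basicOpen_le r)).op).hom.toAlgebra
      IsLocalization.Away (η.app (.op U) r) (F.obj (.op (Y.basicOpen r)))) :
    ∃ (X : Scheme.{u}) (f : X ⟶ Y) (j : ∀ U : Y.affineOpens, Spec (F.obj (.op U.1)) ⟶ X),
      (∀ U, j U ≫ f = Spec.map (η.app (.op U.1)) ≫ U.2.fromSpec) ∧
      (∀ U, ∃ _ : IsOpenImmersion (j U), (j U).opensRange = f ⁻¹ᵁ U.1) ∧
      ∀ (U : Y.affineOpens) (r : Γ(Y, U.1)),
        Spec.map (F.map (homOfLE (Y.basicOpen_le r)).op) ≫ j U = j (Y.affineBasicOpen r) := by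
  have H : ((toOpensFunctor Y).op.whiskerLeft η).Coequifibered :=
    coequifibered_iff_forall_isLocalizationAway.mpr fun U r => hloc U.1 U.2 r
  let d := relativeGluingData H
  have : (d.functor ⋙ Scheme.forget).IsLocallyDirected :=
    Scheme.Cover.RelativeGluingData.instIsLocallyDirectedI₀CompFunctorForgetOfIsThin ..
  refine ⟨d.glued, d.toBase, fun U => Limits.colimit.ι d.functor (⟨U.1, U.2⟩ : Y.AffineZariskiSite),
    fun U => ?_, fun U => ⟨d.cover.map_prop (⟨U.1, U.2⟩ : Y.AffineZariskiSite), ?_⟩, fun U r => ?_⟩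
  · exact Limits.colimit.ι_desc _ _
  · refine (d.toBase_preimage_eq_opensRange_ι (⟨U.1, U.2⟩ : Y.AffineZariskiSite)).symm.trans ?_
    exact congrArg (d.toBase ⁻¹ᵁ ·) (Scheme.Opens.opensRange_ι U.1)
  · exact Limits.colimit.w d.functor
      (homOfLE (Scheme.AffineZariskiSite.basicOpen_le (⟨U.1, U.2⟩ : Y.AffineZariskiSite) r))

lemma specMap_fromSpec_appLE {Y : Scheme.{u}} {U : Y.Opens} (hU : IsAffineOpen U)
    {R : CommRingCat.{u}} (φ : Γ(Y, U) ⟶ R) (h : ⊤ ≤ (Spec.map φ ≫ hU.fromSpec) ⁻¹ᵁ U) :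
    (Spec.map φ ≫ hU.fromSpec).appLE U ⊤ h =
      (Scheme.ΓSpecIso _).inv ≫ (Spec.map φ).appTop := by
  rw [Scheme.Hom.comp_appLE, IsAffineOpen.fromSpec_app_self, Category.assoc,
    Scheme.Hom.appTop, Scheme.Hom.app_eq_appLE]
  exact congrArg (_ ≫ ·) (Scheme.Hom.map_appLE _ _ _)

/-- The relative spectrum of a quasi-coherent algebra. -/
theorem exists_relativeSpec {Y : Scheme.{u}} (F : Y.Opensᵒᵖ ⥤ CommRingCat.{u}) (η : Y.presheaf ⟶ F)
    (hloc : ∀ (U : Y.Opens), IsAffineOpen U → ∀ r : Γ(Y, U),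
      letI := (F.map (homOfLE (Y.basicOpen_le r)).op).hom.toAlgebra
      IsLocalization.Away (η.app (.op U) r) (F.obj (.op (Y.basicOpen r)))) :
    ∃ (X : Scheme.{u}) (f : X ⟶ Y) (θ : ∀ U : Y.affineOpens, Γ(X, f ⁻¹ᵁ U.1) ≅ F.obj (.op U.1)),
      IsAffineHom f ∧ (∀ U, f.app U.1 ≫ (θ U).hom = η.app (.op U.1)) ∧
      ∀ (U : Y.affineOpens) (r : Γ(Y, U.1)),
        resOver f (Y.basicOpen_le r) ≫ (θ (Y.affineBasicOpen r)).hom =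
          (θ U).hom ≫ F.map (homOfLE (Y.basicOpen_le r)).op := by
  obtain ⟨X, f, j, hjf, hj, hres⟩ := exists_glued F η hloc
  choose hj hrange using hj
  have htop : ∀ U : Y.affineOpens, j U ⁻¹ᵁ f ⁻¹ᵁ U.1 = ⊤ := fun U => by
    rw [← hrange]; simp
  let θ : ∀ U : Y.affineOpens, Γ(X, f ⁻¹ᵁ U.1) ⟶ F.obj (.op U.1) := fun U =>
    (j U).appLE (f ⁻¹ᵁ U.1) ⊤ (htop U).ge ≫ (Scheme.ΓSpecIso _).hom
  have hθ : ∀ U, IsIso (θ U) := fun U => by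
    have : IsIso ((j U).app (f ⁻¹ᵁ U.1)) := Scheme.Hom.isIso_app _ _ (hrange U).ge
    have : IsIso (homOfLE (htop U).ge) := ⟨homOfLE (htop U).le, rfl, rfl⟩
    simp only [θ, Scheme.Hom.appLE]
    infer_instance
  refine ⟨X, f, fun U => asIso (θ U), ⟨fun U hU => ?_⟩, fun U => ?_, fun U r => ?_⟩
  · rw [← hrange ⟨U, hU⟩]
    exact isAffineOpen_opensRange _
  · have hle : ⊤ ≤ (j U ≫ f) ⁻¹ᵁ U.1 := (htop U).ge
    have h1 : f.app U.1 ≫ (j U).appLE (f ⁻¹ᵁ U.1) ⊤ (htop U).ge = (j U ≫ f).appLE U.1 ⊤ hle :=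
      (Scheme.Hom.comp_appLE ..).symm
    have h2 : (j U ≫ f).appLE U.1 ⊤ hle =
        (Scheme.ΓSpecIso _).inv ≫ (Spec.map (η.app (.op U.1))).appTop := by
      simp only [hjf U]
      exact specMap_fromSpec_appLE U.2 _ _
    refine (Category.assoc _ _ _).symm.trans ?_
    rw [h1, h2]
    simp
  · have hle : ⊤ ≤ (Spec.map (F.map (homOfLE (Y.basicOpen_le r)).op) ≫ j U) ⁻¹ᵁ f ⁻¹ᵁ U.1 := by
      rw [Scheme.Hom.comp_preimage, htop]; exact le_rfl
    have h1 : resOver f (Y.basicOpen_le r) ≫ (j (Y.affineBasicOpen r)).appLE _ ⊤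
        (htop (Y.affineBasicOpen r)).ge =
        (Spec.map (F.map (homOfLE (Y.basicOpen_le r)).op) ≫ j U).appLE (f ⁻¹ᵁ U.1) ⊤ hle := by
      simp only [hres U r]
      exact Scheme.Hom.map_appLE _ _ _
    have h2 : (Spec.map (F.map (homOfLE (Y.basicOpen_le r)).op) ≫ j U).appLE (f ⁻¹ᵁ U.1) ⊤ hle =
        (j U).appLE _ ⊤ (htop U).ge ≫ (Spec.map (F.map (homOfLE (Y.basicOpen_le r)).op)).appTop := by
      rw [Scheme.Hom.appTop, Scheme.Hom.app_eq_appLE]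
      exact (Scheme.Hom.appLE_comp_appLE ..).symm
    change _ ≫ _ ≫ _ = (_ ≫ _) ≫ _
    refine (Category.assoc _ _ _).symm.trans ((congrArg (· ≫ _) (h1.trans h2)).trans ?_)
    exact (Category.assoc _ _ _).trans ((congrArg (_ ≫ ·) (Scheme.ΓSpecIso_naturality _)).trans
      (Category.assoc _ _ _).symm)

/-! ### Representatives of building data -/

section Count

variable {n : ℕ}

/-- The number of coordinate characters appearing in `χ` and nontrivial at `h`. -/
def oddCount (χ : Chars n) (h : Grp n) : ℕ :=
  (Finset.univ.filter fun i => bit χ i ∧ coordChar i h = -1).card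

/-- The number of coordinate characters appearing in `χ` and `ψ` and nontrivial at `h`. -/
def commonCount (χ ψ : Chars n) (h : Grp n) : ℕ :=
  (Finset.univ.filter fun i => (bit χ i ∧ bit ψ i) ∧ coordChar i h = -1).card

lemma apply_eq_neg_one_pow (χ : Chars n) (h : Grp n) : χ h = (-1) ^ oddCount χ h := by
  have h1 : χ h = ∏ i, if bit χ i ∧ coordChar i h = -1 then (-1 : ℤˣ) else 1 := by
    conv_lhs => rw [χ.eq_prod]
    rw [AddChar.coe_prod, Finset.prod_apply]
    refine Finset.prod_congr rfl fun i _ => ?_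
    by_cases h1 : bit χ i
    · rcases Int.units_eq_one_or (coordChar i h) with h3 | h3 <;> simp [h1, h3]
    · simp [h1]
  rw [h1, Finset.prod_ite, Finset.prod_const, Finset.prod_const_one, mul_one, oddCount]

lemma oddCount_mul (χ ψ : Chars n) (h : Grp n) :
    oddCount (χ * ψ) h + 2 * commonCount χ ψ h = oddCount χ h + oddCount ψ h := by
  simp only [oddCount, commonCount, Finset.card_filter, Finset.mul_sum, ← Finset.sum_add_distrib]
  refine Finset.sum_congr rfl fun i _ => ?_
  simp only [bit_mul]
  by_cases h1 : bit χ i <;> by_cases h2 : bit ψ i <;> by_cases h3 : coordChar i h = -1 <;>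
    simp [h1, h2, h3]

/-- The value `χ h` is the sign of `oddCount χ h`, and these counts add up to twice the common
count. Then `eps χ ψ h` is the carry lost when the two counts are halved separately: it is 1 exactly
when both are odd. -/
lemma eps_eq_oddCount (χ ψ : Chars n) (h : Grp n) : eps χ ψ h =
    ((oddCount (χ * ψ) h / 2 : ℕ) : ℤ) + commonCount χ ψ h - ((oddCount χ h / 2 : ℕ) : ℤ) -
      ((oddCount ψ h / 2 : ℕ) : ℤ) := by
  have hodd : ∀ χ : Chars n, χ h = -1 ↔ oddCount χ h % 2 = 1 := by
    intro χ
    rw [apply_eq_neg_one_pow]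
    rcases Nat.even_or_odd (oddCount χ h) with he | ho
    · rw [he.neg_one_pow]
      have := Nat.even_iff.mp he
      exact ⟨fun h => absurd h (by decide), fun h => by omega⟩
    · rw [ho.neg_one_pow]
      exact ⟨fun _ => Nat.odd_iff.mp ho, fun _ => rfl⟩
  have := oddCount_mul χ ψ h
  have h3 := hodd (χ * ψ)
  unfold eps
  simp only [hodd]
  split_ifs with hc <;> omega

end Count

section Divisors

variable {Y : Scheme.{u}} [IsIntegral Y] [IsLocallyNoetherian Y] {n : ℕ}

/-- The divisors of the eigensheaves in terms of those of the coordinate characters. -/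
noncomputable def eigenDivisor (e : Fin n → WeilDivisor Y)
    (D : {h : Grp n // h ≠ 0} → WeilDivisor Y) (χ : Chars n) : WeilDivisor Y :=
  (∑ i, if bit χ i then e i else 0) - ∑ h, (oddCount χ h.1 / 2) • D h

/-- The multiplication functions in terms of the squares of the coordinate eigenfunctions. -/
def mulFunction {K : Type*} [CommMonoid K] (f : Fin n → K) (χ ψ : Chars n) : K :=
  ∏ i, if bit χ i ∧ bit ψ i then f i else 1

/-- The eigenfunctions. -/
def eigenFunction {L : Type*} [CommMonoid L] (b : Fin n → L) (χ : Chars n) : L :=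
  ∏ i, if bit χ i then b i else 1

lemma eigenFunction_mul {L : Type*} [CommMonoid L] (b : Fin n → L) (χ ψ : Chars n) :
    eigenFunction b χ * eigenFunction b ψ =
      mulFunction (fun i => b i * b i) χ ψ * eigenFunction b (χ * ψ) := by
  simp only [eigenFunction, mulFunction, ← Finset.prod_mul_distrib]
  refine Finset.prod_congr rfl fun i _ => ?_
  simp only [bit_mul]
  by_cases h1 : bit χ i <;> by_cases h2 : bit ψ i <;> simp [h1, h2]

lemma eigenFunction_one {L : Type*} [CommMonoid L] (b : Fin n → L) : eigenFunction b 1 = 1 :=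
  Finset.prod_eq_one fun i _ => if_neg (not_bit_one i)

omit [IsIntegral Y] [IsLocallyNoetherian Y] in
lemma eigenDivisor_one (e : Fin n → WeilDivisor Y) (D : {h : Grp n // h ≠ 0} → WeilDivisor Y) :
    eigenDivisor e D 1 = 0 := by
  simp [eigenDivisor, oddCount, not_bit_one]

omit [IsIntegral Y] [IsLocallyNoetherian Y] in
lemma eigenDivisor_coordChar (e : Fin n → WeilDivisor Y)
    (D : {h : Grp n // h ≠ 0} → WeilDivisor Y) (i : Fin n) :
    eigenDivisor e D (coordChar i) = e i := by
  have h0 : ∀ h : Grp n, oddCount (coordChar i) h / 2 = 0 := fun h => by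
    refine Nat.div_eq_of_lt (lt_of_le_of_lt (b := 1) ?_ one_lt_two)
    refine Finset.card_le_one.mpr fun j hj k hk => ?_
    rw [Finset.mem_filter, bit_coordChar] at hj hk
    rw [hj.2.1, hk.2.1]
  simp [eigenDivisor, h0, bit_coordChar]

/-- Overlapping coordinates of `χ` and `ψ` contribute the divisors of the `f i`, that is, common
counts of the `D h` minus `2 * e i`. The rounded halves built into `eigenDivisor` turn these counts
into `eps`, by `eps_eq_oddCount`. -/
lemma ord_mulFunction {e : Fin n → WeilDivisor Y} {D : {h : Grp n // h ≠ 0} → WeilDivisor Y}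
    {f : Fin n → Y.functionField} (hf0 : ∀ i, f i ≠ 0)
    (hf : ∀ i (y : PrimeDivisor Y), Scheme.ord (f i) y.1 + 2 * e i y =
      ∑ h, eps (coordChar i) (coordChar i) h.1 * D h y) (χ ψ : Chars n) (y : PrimeDivisor Y) :
    Scheme.ord (mulFunction f χ ψ) y.1 + eigenDivisor e D χ y + eigenDivisor e D ψ y =
      eigenDivisor e D (χ * ψ) y + ∑ h, eps χ ψ h.1 * D h y := by
  have h1 : Scheme.ord (mulFunction f χ ψ) y.1 =
      (∑ h, (commonCount χ ψ h.1 : ℤ) * D h y) - ∑ i, if bit χ i ∧ bit ψ i then 2 * e i y else 0 := by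
    rw [mulFunction, ord_prod _ _ fun i => by split_ifs; exacts [hf0 i, one_ne_zero]]
    have h2 : ∀ i, Scheme.ord (if bit χ i ∧ bit ψ i then f i else 1) y.1 =
        (∑ h : {h : Grp n // h ≠ 0}, (if (bit χ i ∧ bit ψ i) ∧ coordChar i h.1 = -1 then 1 else 0) *
          D h y) - if bit χ i ∧ bit ψ i then 2 * e i y else 0 := by
      intro i
      by_cases hc : bit χ i ∧ bit ψ i
      · simp only [hc, and_self, if_true, true_and]
        have := hf i y
        simp only [eps, and_self] at this
        omega
      · simp [hc, ord_one]
    rw [Finset.sum_congr rfl fun i _ => h2 i, Finset.sum_sub_distrib, Finset.sum_comm]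
    congr 1
    refine Finset.sum_congr rfl fun h _ => ?_
    rw [← Finset.sum_mul, commonCount, Finset.card_filter]
    push_cast
    rfl
  have h2 : ∀ χ : Chars n, eigenDivisor e D χ y = (∑ i, if bit χ i then e i y else 0) -
      ∑ h, ((oddCount χ h.1 / 2 : ℕ) : ℤ) * D h y := by
    intro χ
    have : ∀ i, (if bit χ i then e i else 0) y = if bit χ i then e i y else 0 := fun i => by
      split_ifs <;> rfl
    simp [eigenDivisor, this]
  have h3 : (∑ i, if bit (χ * ψ) i then e i y else 0) =
      (∑ i, if bit χ i then e i y else 0) + (∑ i, if bit ψ i then e i y else 0) -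
        ∑ i, if bit χ i ∧ bit ψ i then 2 * e i y else 0 := by
    rw [← Finset.sum_add_distrib, ← Finset.sum_sub_distrib]
    refine Finset.sum_congr rfl fun i _ => ?_
    simp only [bit_mul]
    by_cases h1 : bit χ i <;> by_cases h2 : bit ψ i <;> simp [h1, h2, two_mul]
  rw [h1, h2, h2, h2, h3]
  simp only [eps_eq_oddCount, sub_mul, add_mul, Finset.sum_sub_distrib, Finset.sum_add_distrib]
  ring

/-- Representatives of building data: divisors and multiplication functions. -/
lemma BuildingData.exists_representatives (B : BuildingData Y n) :
    ∃ (e : Fin n → WeilDivisor Y) (f : Fin n → Y.functionField), (∀ i, f i ≠ 0) ∧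
      (∀ χ, divClass (eigenDivisor e B.D χ) = B.L χ) ∧
      ∀ i (y : PrimeDivisor Y), Scheme.ord (f i) y.1 + 2 * e i y =
        ∑ h, eps (coordChar i) (coordChar i) h.1 * B.D h y := by
  choose e he using fun i => QuotientAddGroup.mk_surjective (B.L (coordChar i))
  have hL1 : B.L 1 = 0 := by
    have := B.relation 1 1
    simp only [eps, AddChar.one_apply] at this
    simpa [divClass] using this
  have hex : ∀ i, ∃ a : Y.functionField, a ≠ 0 ∧ ∀ y : PrimeDivisor Y,
      Scheme.ord a y.1 + 2 * e i y = ∑ h, eps (coordChar i) (coordChar i) h.1 * B.D h y := by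
    intro i
    have := B.relation (coordChar i) (coordChar i)
    rw [Chars.mul_self, hL1, zero_add, ← he, ← QuotientAddGroup.mk_add, divClass,
      QuotientAddGroup.eq] at this
    obtain ⟨a, ha0, ha⟩ := this
    refine ⟨a, ha0, fun y => ?_⟩
    rw [← ha]
    simp
    ring
  choose f hf0 hf using hex
  refine ⟨e, f, hf0, ?_, hf⟩
  -- The constructed classes and the given ones satisfy the same relations, so their difference is a
  -- homomorphism; it vanishes on the coordinate characters, hence everywhere.
  let δ : Chars n → ClassGroupOf Y := fun χ => divClass (eigenDivisor e B.D χ) - B.L χ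
  have hδ : ∀ χ ψ, δ (χ * ψ) = δ χ + δ ψ := by
    intro χ ψ
    have h1 : divClass (eigenDivisor e B.D χ) + divClass (eigenDivisor e B.D ψ) =
        divClass (eigenDivisor e B.D (χ * ψ)) +
          divClass (∑ h : {h : Grp n // h ≠ 0}, eps χ ψ h.1 • B.D h) := by
      rw [divClass, divClass, divClass, divClass, ← QuotientAddGroup.mk_add,
        ← QuotientAddGroup.mk_add, QuotientAddGroup.eq]
      refine ⟨mulFunction f χ ψ, Finset.prod_ne_zero_iff.mpr fun i _ => by
        split_ifs; exacts [hf0 i, one_ne_zero], fun y => ?_⟩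
      have := ord_mulFunction hf0 hf χ ψ y
      simp only [Finsupp.add_apply, Finsupp.neg_apply, Finsupp.finsetSum_apply,
        Finsupp.smul_apply, smul_eq_mul]
      linarith
    have h2 := B.relation χ ψ
    simp only [δ]
    rw [sub_add_sub_comm, h1, h2]
    abel
  let δ' : Chars n →* Multiplicative (ClassGroupOf Y) :=
    MonoidHom.mk' (fun χ => Multiplicative.ofAdd (δ χ)) hδ
  have h0 : ∀ χ, δ' χ = 1 := by
    intro χ
    rw [χ.eq_prod, map_prod]
    refine Finset.prod_eq_one fun i _ => ?_
    split_ifs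
    · change Multiplicative.ofAdd (δ (coordChar i)) = 1
      simp only [δ]
      rw [eigenDivisor_coordChar, ← he]
      simp [divClass]
    · exact map_one _
  exact fun χ => sub_eq_zero.mp (h0 χ)

end Divisors

/-! ### Sections of divisorial sheaves over affine open sets -/

section Divisorial

variable {Y : Scheme.{u}} [IsIntegral Y] [IsLocallyNoetherian Y]

lemma add_mem_sectionsNeg (hN : IsNormalScheme Y) {E : WeilDivisor Y} {U : Y.Opens}
    {a b : Y.functionField} (ha : a ∈ sectionsNeg E U) (hb : b ∈ sectionsNeg E U) :
    a + b ∈ sectionsNeg E U := by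
  by_cases hab : a + b = 0
  · exact Or.inl hab
  rcases ha with rfl | ha
  · rwa [zero_add]
  rcases hb with rfl | hb
  · rw [add_zero]
    exact Or.inr ha
  refine Or.inr fun y hy => ?_
  have := isDiscreteValuationRing_stalk hN y
  exact (le_min (ha y hy) (hb y hy)).trans (Scheme.ord_add hab)

lemma sum_mem_sectionsNeg (hN : IsNormalScheme Y) {E : WeilDivisor Y} {U : Y.Opens} {ι : Type*}
    (s : Finset ι) {a : ι → Y.functionField} (ha : ∀ i ∈ s, a i ∈ sectionsNeg E U) :
    ∑ i ∈ s, a i ∈ sectionsNeg E U :=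
  Finset.sum_induction a (· ∈ sectionsNeg E U) (fun _ _ => add_mem_sectionsNeg hN) (Or.inl rfl) ha

lemma neg_mem_sectionsNeg {E : WeilDivisor Y} {U : Y.Opens} {a : Y.functionField}
    (ha : a ∈ sectionsNeg E U) : -a ∈ sectionsNeg E U := by
  rcases ha with rfl | ha
  · exact Or.inl neg_zero
  refine Or.inr fun y hy => ?_
  by_cases ha0 : a = 0
  · rw [ha0, neg_zero, ← ha0]
    exact ha y hy
  · have h1 : Scheme.ord ((-1 : Y.functionField)) y.1 = 0 := by
      have h := Scheme.ord_mul (x := y.1) (f := (-1 : Y.functionField)) (g := -1)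
        (neg_ne_zero.mpr one_ne_zero) (neg_ne_zero.mpr one_ne_zero)
      rw [neg_mul_neg, one_mul, ord_one] at h
      omega
    rw [neg_eq_neg_one_mul, Scheme.ord_mul (neg_ne_zero.mpr one_ne_zero) ha0, h1, zero_add]
    exact ha y hy

lemma mul_mem_sectionsNeg {E E' E'' : WeilDivisor Y} {U : Y.Opens} {f a b : Y.functionField}
    (hf0 : f ≠ 0) (hf : ∀ y : PrimeDivisor Y, E'' y ≤ Scheme.ord f y.1 + E y + E' y)
    (ha : a ∈ sectionsNeg E U) (hb : b ∈ sectionsNeg E' U) : f * a * b ∈ sectionsNeg E'' U := by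
  by_cases ha0 : a = 0
  · exact Or.inl (by rw [ha0, mul_zero, zero_mul])
  by_cases hb0 : b = 0
  · exact Or.inl (by rw [hb0, mul_zero])
  refine Or.inr fun y hy => ?_
  have h1 := ha.resolve_left ha0 y hy
  have h2 := hb.resolve_left hb0 y hy
  have h3 := hf y
  rw [Scheme.ord_mul (mul_ne_zero hf0 ha0) hb0, Scheme.ord_mul hf0 ha0]
  omega

lemma sectionsNeg_anti {E : WeilDivisor Y} {U V : Y.Opens} (h : V ≤ U) :
    sectionsNeg E U ⊆ sectionsNeg E V :=
  fun _ ha => ha.imp id fun ha y hy => ha y (h hy)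

lemma germ_mem_sectionsNeg {U : Y.Opens} [Nonempty U] (r : Γ(Y, U)) :
    Y.germToFunctionField U r ∈ sectionsNeg 0 U :=
  Or.inr fun y hy => Cover.ord_germToFunctionField_nonneg r y hy

/-- Sections over a basic open set extend after multiplication with a power of the equation. -/
lemma exists_pow_mul_mem_sectionsNeg [CompactSpace Y] (hN : IsNormalScheme Y)
    {E : WeilDivisor Y} {U : Y.Opens} [Nonempty U] {r : Γ(Y, U)} (hr : r ≠ 0) {a : Y.functionField}
    (ha : a ∈ sectionsNeg E (Y.basicOpen r)) :
    ∃ m : ℕ, ∀ k, m ≤ k → Y.germToFunctionField U r ^ k * a ∈ sectionsNeg E U := by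
  by_cases ha0 : a = 0
  · exact ⟨0, fun k _ => Or.inl (by rw [ha0, mul_zero])⟩
  have hr0 : Y.germToFunctionField U r ≠ 0 := Cover.germToFunctionField_ne_zero hr
  let T : Set (PrimeDivisor Y) := {y | Scheme.ord a y.1 ≠ 0} ∪ (E.support : Set (PrimeDivisor Y))
  have hT : T.Finite := (finite_ord_ne_zero ha0).union (Finset.finite_toSet _)
  -- At a prime divisor of `U` outside the basic open set `r` has order at least one, so an exponent
  -- exceeding every defect `E y - ord a` suffices. Only the finitely many divisors in `T` can have
  -- a nonzero defect.
  refine ⟨∑ y ∈ hT.toFinset, (E y - Scheme.ord a y.1).toNat, fun k hk => Or.inr fun y hy => ?_⟩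
  rw [Scheme.ord_mul (pow_ne_zero _ hr0) ha0, ord_pow hr0]
  by_cases hyr : y.1 ∈ Y.basicOpen r
  · have h1 := ha.resolve_left ha0 y hyr
    rw [Cover.ord_germToFunctionField_eq_zero y hy ((Y.mem_basicOpen r y.1 hy).mp hyr)]
    omega
  · have h1 : 1 ≤ Scheme.ord (Y.germToFunctionField U r) y.1 := by
      have h2 := Cover.ord_germToFunctionField_nonneg r y hy
      by_contra h
      have h3 : algebraMap (Y.presheaf.stalk y.1) Y.functionField (Y.presheaf.germ U y.1 hy r) =
        Y.germToFunctionField U r := Y.presheaf.germ_stalkSpecializes_apply _ _ _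
      refine hyr ((Y.mem_basicOpen r y.1 hy).mpr (isUnit_of_ord_eq_zero hN y ?_ ?_))
      · intro h4
        rw [h4, map_zero] at h3
        exact hr0 h3.symm
      · rw [h3]
        omega
    have h2 : E y - Scheme.ord a y.1 ≤ k := by
      by_cases hyT : y ∈ T
      · have := Finset.single_le_sum (f := fun y => (E y - Scheme.ord a y.1).toNat)
          (fun _ _ => Nat.zero_le _) (hT.mem_toFinset.mpr hyT)
        omega
      · simp only [T, Set.mem_union, Set.mem_ofPred_eq, Finset.mem_coe, Finsupp.mem_support_iff,
          not_or, not_not] at hyT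
        omega
    nlinarith

/-- A divisorial sheaf has nonzero sections over affine open sets. -/
lemma exists_ne_zero_mem_sectionsNeg [CompactSpace Y] (hN : IsNormalScheme Y) (E : WeilDivisor Y)
    {U : Y.Opens} (hU : IsAffineOpen U) [Nonempty U] :
    ∃ a : Y.functionField, a ≠ 0 ∧ a ∈ sectionsNeg E U := by
  -- For each prime divisor meeting `U` a regular function vanishing there; powers of these produce
  -- the prescribed positive multiplicities.
  have hp : ∀ y : PrimeDivisor Y, ∃ p : Y.functionField, p ≠ 0 ∧ (y.1 ∈ U → 1 ≤ Scheme.ord p y.1) ∧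
      ∀ z : PrimeDivisor Y, z.1 ∈ U → 0 ≤ Scheme.ord p z.1 := by
    intro y
    by_cases hy : y.1 ∈ U
    · obtain ⟨a, ha0, ha⟩ := exists_ord_eq_one hN y
      have := functionField_isFractionRing_of_isAffineOpen Y U hU
      obtain ⟨p, q, hq, h⟩ := IsFractionRing.div_surjective (A := Γ(Y, U)) a
      change Y.germToFunctionField U p / Y.germToFunctionField U q = a at h
      have hq0 : Y.germToFunctionField U q ≠ 0 :=
        IsFractionRing.to_map_ne_zero_of_mem_nonZeroDivisors hq
      have hp : Y.germToFunctionField U p = a * Y.germToFunctionField U q := by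
        rw [← h, div_mul_cancel₀ _ hq0]
      refine ⟨Y.germToFunctionField U p, by rw [hp]; exact mul_ne_zero ha0 hq0, fun _ => ?_,
        fun z hz => Cover.ord_germToFunctionField_nonneg p z hz⟩
      have := Cover.ord_germToFunctionField_nonneg q y hy
      rw [hp, Scheme.ord_mul ha0 hq0]
      omega
    · exact ⟨1, one_ne_zero, fun h => absurd h hy, fun z _ => (ord_one z.1).ge⟩
  choose p hp0 hp1 hp using hp
  refine ⟨∏ y ∈ E.support, p y ^ (E y).toNat,
    Finset.prod_ne_zero_iff.mpr fun y _ => pow_ne_zero _ (hp0 y), Or.inr fun z hz => ?_⟩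
  rw [ord_prod _ _ fun y => pow_ne_zero _ (hp0 y)]
  have hnn : ∀ y, 0 ≤ Scheme.ord (p y ^ (E y).toNat) z.1 := fun y => by
    rw [ord_pow (hp0 y)]
    exact mul_nonneg (by positivity) (hp y z hz)
  by_cases hzE : z ∈ E.support
  · refine le_trans ?_ (Finset.single_le_sum (f := fun y => Scheme.ord (p y ^ (E y).toNat) z.1)
      (fun y _ => hnn y) hzE)
    rw [ord_pow (hp0 z)]
    have := hp1 z hz
    have := Int.self_le_toNat (E z)
    nlinarith
  · rw [Finsupp.notMem_support_iff.mp hzE]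
    exact Finset.sum_nonneg fun y _ => hnn y

/-- Divisorial sheaves are contained in invertible sheaves over affine open sets. -/
lemma exists_mul_mem_range [CompactSpace Y] (hN : IsNormalScheme Y) (E : WeilDivisor Y)
    {U : Y.Opens} (hU : IsAffineOpen U) [Nonempty U] :
    ∃ g : Y.functionField, g ≠ 0 ∧
      ∀ a ∈ sectionsNeg E U, ∃ r, Y.germToFunctionField U r = g * a := by
  -- A nonzero section of `𝒪_Y(E)` multiplies `𝒪_Y(-E)` into the structure sheaf.
  obtain ⟨g, hg0, hg⟩ := exists_ne_zero_mem_sectionsNeg hN (-E) hU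
  refine ⟨g, hg0, fun a ha => ?_⟩
  rcases ha with rfl | ha
  · exact ⟨0, by rw [map_zero, mul_zero]⟩
  refine exists_germToFunctionField_eq hN hU fun y hy => ?_
  by_cases ha0 : a = 0
  · rw [ha0, mul_zero, Scheme.ord_zero]; rfl
  have h1 := ha y hy
  have h2 := hg.resolve_left hg0 y hy
  rw [Finsupp.neg_apply] at h2
  rw [Scheme.ord_mul hg0 ha0]
  omega

end Divisorial

/-! ### The algebra of a standard cover, realized by functions on the group -/

lemma Chars.mul_mul_cancel {n : ℕ} (χ θ : Chars n) : χ * (χ * θ) = θ := by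
  rw [← mul_assoc, χ.mul_self, one_mul]

/-- Divisors, multiplication functions, and eigenfunctions in an extension of the function field,
describing a sheaf of algebras. -/
structure TwistData (Y : Scheme.{u}) [IsIntegral Y] [IsLocallyNoetherian Y] (n : ℕ) (L : Type u)
    [Field L] [Algebra Y.functionField L] where
  E : Chars n → WeilDivisor Y
  φ : Chars n → Chars n → Y.functionField
  β : Chars n → L
  φ_ne_zero : ∀ χ ψ, φ χ ψ ≠ 0
  β_ne_zero : ∀ χ, β χ ≠ 0
  E_one : E 1 = 0
  β_one : β 1 = 1
  β_mul : ∀ χ ψ, β χ * β ψ = algebraMap Y.functionField L (φ χ ψ) * β (χ * ψ)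
  ord_ge : ∀ χ ψ (y : PrimeDivisor Y),
    E (χ * ψ) y ≤ Scheme.ord (φ χ ψ) y.1 + E χ y + E ψ y

namespace TwistData

variable {Y : Scheme.{u}} [IsIntegral Y] [IsLocallyNoetherian Y] {n : ℕ} {L : Type u}
  [Field L] [Algebra Y.functionField L] (T : TwistData Y n L)

/-- Elements of the `χ`-eigenspace of the algebra of functions on the group. -/
noncomputable def w (χ : Chars n) (a : Y.functionField) : Grp n → L := fun g =>
  ((χ g : ℤˣ) : ℤ) • (algebraMap Y.functionField L a * T.β χ)

lemma w_zero (χ : Chars n) : T.w χ 0 = 0 := by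
  ext g; simp [w]

lemma w_add (χ : Chars n) (a b : Y.functionField) : T.w χ (a + b) = T.w χ a + T.w χ b := by
  ext g; simp [w, add_mul]

lemma w_neg (χ : Chars n) (a : Y.functionField) : T.w χ (-a) = -T.w χ a := by
  ext g; simp [w]

/-- The relation `β_mul` carries the twisted multiplication to the pointwise one on functions on the
group. This spares a direct verification of the ring axioms for the direct sum. -/
lemma w_mul (χ ψ : Chars n) (a b : Y.functionField) :
    T.w χ a * T.w ψ b = T.w (χ * ψ) (T.φ χ ψ * a * b) := by
  ext g
  simp only [w, Pi.mul_apply, AddChar.mul_apply, Units.val_mul, map_mul, zsmul_eq_mul, Int.cast_mul]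
  linear_combination ((χ g : ℤˣ) : ℤ) * ((ψ g : ℤˣ) : ℤ) * algebraMap Y.functionField L a *
    algebraMap Y.functionField L b * T.β_mul χ ψ

lemma w_one (a : Y.functionField) : T.w 1 a = fun _ => algebraMap Y.functionField L a := by
  ext g; simp [w, T.β_one]

/-- The sum of the eigencomponents. -/
noncomputable def total (a : Chars n → Y.functionField) : Grp n → L := ∑ χ, T.w χ (a χ)

lemma total_single (χ : Chars n) (a : Y.functionField) : T.total (Pi.single χ a) = T.w χ a := by
  rw [total, Finset.sum_eq_single χ]
  · simp
  · intro ψ _ h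
    rw [Pi.single_eq_of_ne h, w_zero]
  · simp

lemma total_zero : T.total 0 = 0 := by simp [total, w_zero]

lemma total_add (a b : Chars n → Y.functionField) : T.total (a + b) = T.total a + T.total b := by
  simp [total, w_add, Finset.sum_add_distrib]

lemma total_neg (a : Chars n → Y.functionField) : T.total (-a) = -T.total a := by
  simp [total, w_neg]

lemma total_mul (a b : Chars n → Y.functionField) : T.total a * T.total b =
    T.total (fun θ => ∑ χ, T.φ χ (χ * θ) * a χ * b (χ * θ)) := by
  have h : ∀ θ, T.w θ (∑ χ, T.φ χ (χ * θ) * a χ * b (χ * θ)) =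
      ∑ χ, T.w χ (a χ) * T.w (χ * θ) (b (χ * θ)) := by
    intro θ
    refine (map_sum (AddMonoidHom.mk' (T.w θ) (T.w_add θ)) _ _).trans ?_
    refine Finset.sum_congr rfl fun χ _ => ?_
    rw [w_mul, Chars.mul_mul_cancel]
    rfl
  simp only [total]
  rw [Finset.sum_congr rfl fun θ _ => h θ, Finset.sum_comm, Finset.sum_mul_sum]
  refine Finset.sum_congr rfl fun χ _ => ?_
  exact (Equiv.sum_comp (Equiv.mulLeft χ) fun ψ => T.w χ (a χ) * T.w ψ (b ψ)).symm

/-- Translation by a group element. -/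
def translate (g : Grp n) : (Grp n → L) →+* (Grp n → L) :=
  RingHom.pi fun h => Pi.evalRingHom (fun _ : Grp n => L) (g + h)

omit [IsIntegral Y] [IsLocallyNoetherian Y] [Algebra Y.functionField L] in
lemma translate_apply (g h : Grp n) (s : Grp n → L) : translate g s h = s (g + h) := rfl

lemma translate_w (g : Grp n) (χ : Chars n) (a : Y.functionField) :
    translate g (T.w χ a) = ((χ g : ℤˣ) : ℤ) • T.w χ a := by
  ext h
  simp [translate_apply, w, AddChar.map_add_eq_mul, mul_assoc]

lemma translate_total (g : Grp n) (a : Chars n → Y.functionField) :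
    translate g (T.total a) = T.total fun χ => ((χ g : ℤˣ) : ℤ) • a χ := by
  rw [total, map_sum]
  refine Finset.sum_congr rfl fun χ _ => ?_
  rw [translate_w]
  ext h
  simp [w]
  ring

/-- The `χ`-component of a function on the group. -/
noncomputable def coef (χ : Chars n) : (Grp n → L) →+ Y.functionField :=
  ((LinearMap.exists_leftInverse_of_injective (Algebra.linearMap Y.functionField L)
    (LinearMap.ker_eq_bot.mpr (algebraMap Y.functionField L).injective)).choose.toAddMonoidHom).comp
  { toFun := fun s => (T.β χ)⁻¹ * ((2 ^ n)⁻¹ * ∑ g, ((χ g : ℤˣ) : ℤ) • s g)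
    map_zero' := by simp
    map_add' := fun s t => by simp [Finset.sum_add_distrib, mul_add] }

/-- Averaging against `χ` isolates one component by orthogonality, and dividing by `β χ` leaves an
element of the function field inside `L`; `coef` then applies a linear retraction, fixed by an
arbitrary choice, which does not affect such elements. -/
lemma coef_total (h2 : (2 : L) ≠ 0) (χ : Chars n) (a : Chars n → Y.functionField) :
    T.coef χ (T.total a) = a χ := by
  have hw : ∀ ψ (b : Y.functionField), T.coef χ (T.w ψ b) = if ψ = χ then b else 0 := by
    intro ψ b
    have hπ := LinearMap.exists_leftInverse_of_injective (Algebra.linearMap Y.functionField L)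
      (LinearMap.ker_eq_bot.mpr (algebraMap Y.functionField L).injective)
    change hπ.choose ((T.β χ)⁻¹ * ((2 ^ n)⁻¹ * ∑ g, ((χ g : ℤˣ) : ℤ) • T.w ψ b g)) = _
    have h1 : ∑ g, ((χ g : ℤˣ) : ℤ) • T.w ψ b g =
        (∑ g, (((χ * ψ) g : ℤˣ) : ℤ)) • (algebraMap Y.functionField L b * T.β ψ) := by
      rw [Finset.sum_smul]
      refine Finset.sum_congr rfl fun g _ => ?_
      rw [w, smul_smul, AddChar.mul_apply, Units.val_mul]
    rw [h1]
    split_ifs with h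
    · subst h
      have h3 : ∑ g : Grp n, ((((ψ * ψ) g : ℤˣ)) : ℤ) = 2 ^ n := by
        simp [ZMod.card]
      have h4 : (T.β ψ)⁻¹ * ((2 ^ n)⁻¹ * (2 ^ n : ℤ) • (algebraMap Y.functionField L b * T.β ψ)) =
          Algebra.linearMap Y.functionField L b := by
        have := T.β_ne_zero ψ
        rw [zsmul_eq_mul]
        push_cast
        rw [Algebra.linearMap_apply]
        field_simp
      rw [h3, h4]
      exact LinearMap.congr_fun hπ.choose_spec b
    · rw [sum_elements_eq_zero, zero_smul, mul_zero, mul_zero, map_zero]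
      intro h'
      exact h (mul_left_cancel (h'.trans χ.mul_self.symm))
  rw [total, map_sum, Finset.sum_congr rfl fun ψ _ => hw ψ _]
  simp

end TwistData

namespace TwistData

variable {Y : Scheme.{u}} [IsIntegral Y] [IsLocallyNoetherian Y] {n : ℕ} {L : Type u}
  [Field L] [Algebra Y.functionField L] (T : TwistData Y n L) (hN : IsNormalScheme Y)

/-- The sections of the algebra `⨁ 𝒪_Y(-E_χ)` over `U`, as constant functions on `U`. -/
noncomputable def sections (U : Y.Opens) : Subring (U → Grp n → L) where
  -- Functions on the points of `U`, rather than single elements, make the ring over the empty set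
  -- zero, as for sections of a sheaf.
  carrier := {s | ∃ a : Chars n → Y.functionField, (∀ χ, a χ ∈ sectionsNeg (T.E χ) U) ∧
    ∀ u, s u = T.total a}
  mul_mem' := by
    rintro s t ⟨a, ha, hs⟩ ⟨b, hb, ht⟩
    refine ⟨_, fun θ => sum_mem_sectionsNeg hN Finset.univ fun χ _ =>
      mul_mem_sectionsNeg (T.φ_ne_zero χ (χ * θ)) (fun y => ?_) (ha χ) (hb (χ * θ)),
      fun u => by rw [Pi.mul_apply, hs, ht, total_mul]⟩
    have := T.ord_ge χ (χ * θ) y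
    rwa [Chars.mul_mul_cancel] at this
  one_mem' := by
    refine ⟨Pi.single 1 1, fun χ => ?_, fun u => by
      rw [total_single, w_one, map_one]; rfl⟩
    by_cases h : χ = 1
    · subst h
      rw [Pi.single_eq_same, T.E_one]
      exact Or.inr fun y _ => (ord_one y.1).ge
    · exact Or.inl (Pi.single_eq_of_ne h 1)
  add_mem' := by
    rintro s t ⟨a, ha, hs⟩ ⟨b, hb, ht⟩
    exact ⟨a + b, fun χ => add_mem_sectionsNeg hN (ha χ) (hb χ), fun u => by
      rw [Pi.add_apply, hs, ht, total_add]⟩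
  zero_mem' := ⟨0, fun χ => Or.inl rfl, fun u => T.total_zero.symm⟩
  neg_mem' := by
    rintro s ⟨a, ha, hs⟩
    exact ⟨-a, fun χ => neg_mem_sectionsNeg (ha χ), fun u => by
      rw [Pi.neg_apply, hs, total_neg]⟩

/-- Restriction of functions. -/
noncomputable def restrict {U V : Y.Opens} (h : V ≤ U) : T.sections hN U →+* T.sections hN V :=
  ((RingHom.pi fun v : V => Pi.evalRingHom (fun _ : U => Grp n → L) ⟨v.1, h v.2⟩).comp
    (T.sections hN U).subtype).codRestrict (T.sections hN V) (by
      rintro ⟨s, a, ha, hs⟩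
      exact ⟨a, fun χ => sectionsNeg_anti h (ha χ), fun v => hs ⟨v.1, h v.2⟩⟩)

/-- The presheaf of algebras `⨁ 𝒪_Y(-E_χ)`. -/
noncomputable def presheaf : Y.Opensᵒᵖ ⥤ CommRingCat.{u} where
  obj U := CommRingCat.of (T.sections hN U.unop)
  map i := CommRingCat.ofHom (T.restrict hN i.unop.le)

/-- The structure map of the algebra. -/
noncomputable def unit (U : Y.Opens) : Γ(Y, U) →+* T.sections hN U :=
  (RingHom.pi fun u : U => RingHom.pi fun _ : Grp n => (algebraMap Y.functionField L).comp
    (haveI : Nonempty U := ⟨u⟩; (Y.germToFunctionField U).hom)).codRestrict (T.sections hN U) (by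
      intro r
      by_cases hU : Nonempty U
      · refine ⟨Pi.single 1 (Y.germToFunctionField U r), fun χ => ?_, fun u => by
          rw [total_single, w_one]; rfl⟩
        by_cases h : χ = 1
        · subst h
          rw [Pi.single_eq_same, T.E_one]
          exact germ_mem_sectionsNeg r
        · exact Or.inl (Pi.single_eq_of_ne h _)
      · exact ⟨0, fun χ => Or.inl rfl, fun u => absurd ⟨u⟩ hU⟩)

lemma unit_apply {U : Y.Opens} [Nonempty U] (r : Γ(Y, U)) (u : U) :
    (T.unit hN U r).1 u = fun _ => algebraMap Y.functionField L (Y.germToFunctionField U r) := rfl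

/-- The structure map, as a map of presheaves. -/
noncomputable def unitHom : Y.presheaf ⟶ T.presheaf hN where
  app U := CommRingCat.ofHom (T.unit hN U.unop)
  naturality U V i := by
    ext r
    refine Subtype.ext (funext fun v => funext fun g => ?_)
    have : Nonempty V.unop := ⟨v⟩
    have : Nonempty U.unop := ⟨⟨v.1, i.unop.le v.2⟩⟩
    exact congrArg (algebraMap Y.functionField L) (germToFunctionField_res i.unop.le r)

lemma unit_mul_total {U : Y.Opens} [Nonempty U] (r : Γ(Y, U)) (u : U)
    (a : Chars n → Y.functionField) : (T.unit hN U r).1 u * T.total a =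
      T.total fun χ => Y.germToFunctionField U r * a χ := by
  rw [unit_apply, total, total, Finset.mul_sum]
  refine Finset.sum_congr rfl fun χ _ => ?_
  ext g
  simp [w]
  ring

/-- Surjectivity up to powers of `r` comes from bounding the poles of all components at once. The
empty basic open set, where `r = 0` on nonempty `U`, needs separate treatment. -/
lemma isLocalization_away [CompactSpace Y] {U : Y.Opens} (r : Γ(Y, U)) :
    letI := (T.restrict hN (Y.basicOpen_le r)).toAlgebra
    IsLocalization.Away (T.unit hN U r) (T.sections hN (Y.basicOpen r)) := by
  let _ := (T.restrict hN (Y.basicOpen_le r)).toAlgebra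
  have hmap : ∀ x, algebraMap (T.sections hN U) (T.sections hN (Y.basicOpen r)) (T.unit hN U x) =
      T.unit hN _ (Y.presheaf.map (homOfLE (Y.basicOpen_le r)).op x) := fun x =>
    congrArg (fun f => f.hom x) ((T.unitHom hN).naturality (homOfLE (Y.basicOpen_le r)).op).symm
  have hbot : ¬ Nonempty (Y.basicOpen r) → Nonempty U → r = 0 := fun h _ => by
    refine (basicOpen_eq_bot_iff r).mp (le_bot_iff.mp fun y hy => absurd ⟨y, hy⟩ h)
  refine (isLocalization_iff ..).mpr ⟨?_, ?_, ?_⟩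
  · rintro ⟨_, k, rfl⟩
    simp only [map_pow, hmap]
    exact ((Y.toRingedSpace.isUnit_res_basicOpen r).map (T.unit hN _)).pow k
  · intro z
    by_cases hne : Nonempty (Y.basicOpen r)
    · have : Nonempty U := hne.map fun y => ⟨y.1, Y.basicOpen_le r y.2⟩
      have hr : r ≠ 0 := by
        rintro rfl
        rw [Scheme.basicOpen_zero] at hne
        exact hne.some.2
      obtain ⟨s, a, ha, hs⟩ := z
      choose m hm using fun χ => exists_pow_mul_mem_sectionsNeg hN hr (ha χ)
      refine ⟨(⟨fun _ => T.total fun χ => Y.germToFunctionField U (r ^ (∑ χ, m χ)) * a χ, _,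
        fun χ => ?_, fun _ => rfl⟩, ⟨T.unit hN U (r ^ (∑ χ, m χ)), _, (map_pow _ _ _).symm⟩), ?_⟩
      · rw [map_pow]
        exact hm χ _ (Finset.single_le_sum (fun _ _ => Nat.zero_le _) (Finset.mem_univ χ))
      · refine Subtype.ext (funext fun v => ?_)
        change s v * (T.unit hN U _).1 ⟨v.1, Y.basicOpen_le r v.2⟩ = _
        rw [hs, mul_comm, unit_mul_total]
        rfl
    · exact ⟨(0, 1), Subtype.ext (funext fun v => absurd ⟨v⟩ hne)⟩
  · rintro ⟨x, a, ha, hx⟩ ⟨y, b, hb, hy⟩ h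
    by_cases hne : Nonempty (Y.basicOpen r)
    · refine ⟨1, congrArg _ (Subtype.ext (funext fun u => ?_))⟩
      obtain ⟨v⟩ := hne
      have h1 := congrFun (congrArg Subtype.val h) v
      change x _ = y _ at h1
      rw [hx, hy] at h1
      exact (hx u).trans (h1.trans (hy u).symm)
    · by_cases hU : Nonempty U
      · refine ⟨⟨T.unit hN U r, 1, pow_one _⟩, ?_⟩
        rw [hbot hne hU, map_zero, zero_mul, zero_mul]
      · exact ⟨1, Subtype.ext (funext fun u => absurd ⟨u⟩ hU)⟩

end TwistData

namespace TwistData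

variable {Y : Scheme.{u}} [IsIntegral Y] [IsLocallyNoetherian Y] {n : ℕ} {L : Type u}
  [Field L] [Algebra Y.functionField L] (T : TwistData Y n L) (hN : IsNormalScheme Y)

/-- The common value of a section. -/
lemma exists_total {U : Y.Opens} (s : T.sections hN U) : ∃ a : Chars n → Y.functionField,
    (∀ χ, a χ ∈ sectionsNeg (T.E χ) U) ∧ ∀ u, s.1 u = T.total a := s.2

/-- Multiplying each component by a suitable nonzero function embeds the sections into a finite free
module over the noetherian ring of functions of `U`. -/
lemma finite_unit [CompactSpace Y] (h2 : (2 : L) ≠ 0) {U : Y.Opens} (hU : IsAffineOpen U) :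
    (T.unit hN U).Finite := by
  let _ := (T.unit hN U).toAlgebra
  change Module.Finite Γ(Y, U) (T.sections hN U)
  by_cases hne : Nonempty U
  · have hnoeth : IsNoetherianRing Γ(Y, U) := IsLocallyNoetherian.component_noetherian ⟨U, hU⟩
    choose g hg0 hg using fun χ => exists_mul_mem_range hN (T.E χ) hU
    have u : U := hne.some
    have hex : ∀ (s : T.sections hN U) χ, ∃ r,
        Y.germToFunctionField U r = g χ * T.coef χ (s.1 u) := by
      intro s χ
      obtain ⟨a, ha, hs⟩ := T.exists_total hN s
      rw [hs, T.coef_total h2]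
      exact hg χ _ (ha χ)
    choose R hR using hex
    let Ψ : T.sections hN U →ₗ[Γ(Y, U)] (Chars n → Γ(Y, U)) :=
      { toFun := R
        map_add' := fun s t => funext fun χ => Scheme.germToFunctionField_injective Y U (by
          rw [Pi.add_apply, map_add, hR, hR, hR, ← mul_add, ← map_add]
          rfl)
        map_smul' := fun r s => funext fun χ => Scheme.germToFunctionField_injective Y U (by
          obtain ⟨a, ha, hs⟩ := T.exists_total hN s
          have h1 : (r • s).1 u = T.total fun χ => Y.germToFunctionField U r * a χ := by
            rw [← T.unit_mul_total hN r u, ← hs]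
            rfl
          rw [hR, h1, T.coef_total h2, Pi.smul_apply, smul_eq_mul, RingHom.id_apply, map_mul, hR,
            hs, T.coef_total h2]
          ring) }
    refine Module.Finite.of_injective Ψ fun s t h => ?_
    obtain ⟨a, ha, hs⟩ := T.exists_total hN s
    obtain ⟨b, hb, ht⟩ := T.exists_total hN t
    have hab : a = b := funext fun χ => by
      have h1 := (hR s χ).symm.trans ((congrArg (fun r => Y.germToFunctionField U (r χ)) h).trans
        (hR t χ))
      rw [hs, ht, T.coef_total h2, T.coef_total h2] at h1
      exact mul_left_cancel₀ (hg0 χ) h1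
    exact Subtype.ext (funext fun v => by rw [hs, ht, hab])
  · have : Subsingleton (T.sections hN U) :=
      ⟨fun s t => Subtype.ext (funext fun u => absurd ⟨u⟩ hne)⟩
    infer_instance

/-- The action of the group on the sections by translation. -/
noncomputable def translateSections (g : Grp n) (U : Y.Opens) :
    T.sections hN U →+* T.sections hN U :=
  ((RingHom.pi fun u : U => (translate g).comp (Pi.evalRingHom (fun _ : U => Grp n → L) u)).comp
    (T.sections hN U).subtype).codRestrict (T.sections hN U) (by
      rintro ⟨s, a, ha, hs⟩
      refine ⟨fun χ => ((χ g : ℤˣ) : ℤ) • a χ, fun χ => ?_, fun u =>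
        (congrArg (translate g) (hs u)).trans (T.translate_total g a)⟩
      rcases Int.units_eq_one_or (χ g) with h | h
      · simpa [h] using ha χ
      · simpa [h] using neg_mem_sectionsNeg (ha χ))

lemma translateSections_apply (g : Grp n) {U : Y.Opens} (s : T.sections hN U) (u : U) (h : Grp n) :
    (T.translateSections hN g U s).1 u h = s.1 u (g + h) := rfl

/-- The relative spectrum of the algebra. -/
structure Model where
  X : Scheme.{u}
  f : X ⟶ Y
  isAffineHom : IsAffineHom f
  e : ∀ U : Y.affineOpens, Γ(X, f ⁻¹ᵁ U.1) ≃+* T.sections hN U.1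
  e_app : ∀ U r, e U (f.app U.1 r) = T.unit hN U.1 r
  e_res : ∀ (U V : Y.affineOpens) (h : V.1 ≤ U.1) s, e V (resOver f h s) = T.restrict hN h (e U s)

lemma nonempty_model [CompactSpace Y] : Nonempty (T.Model hN) := by
  obtain ⟨X, f, θ, hf, hθ, hres⟩ := exists_relativeSpec (T.presheaf hN) (T.unitHom hN)
    fun U _ r => T.isLocalization_away hN r
  refine ⟨⟨X, f, hf, fun U => (θ U).commRingCatIsoToRingEquiv,
    fun U r => congrArg (fun F => F.hom r) (hθ U), fun U V h s => ?_⟩⟩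
  -- Compatibility is known only for basic open sets. For an inclusion of affine sets it is checked
  -- at each point, on a neighbourhood that is basic in both.
  have key : ∀ (U W : Y.affineOpens) (r : Γ(Y, U.1)) (hr : Y.basicOpen r = W.1) (hWU : W.1 ≤ U.1)
      (s : Γ(X, f ⁻¹ᵁ U.1)) (w : W.1),
      ((θ W).hom (resOver f hWU s) : T.sections hN W.1).1 w =
        ((θ U).hom s : T.sections hN U.1).1 ⟨w.1, hWU w.2⟩ := by
    intro U W r hr hWU s w
    obtain rfl : Y.affineBasicOpen r = W := Subtype.ext hr
    exact congrArg (fun F => (F.hom s : T.sections hN _).1 w) (hres U r)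
  refine Subtype.ext (funext fun v => ?_)
  obtain ⟨p, q, hpq, hv⟩ := exists_basicOpen_le_affine_inter V.2 U.2 v.1 ⟨v.2, h v.2⟩
  have h1 := key V (Y.affineBasicOpen p) p rfl (Y.basicOpen_le p) (resOver f h s) ⟨v.1, hv⟩
  have h3 := key U (Y.affineBasicOpen p) q hpq.symm ((Y.basicOpen_le p).trans h) s ⟨v.1, hv⟩
  have h2 := congrArg (fun x => ((θ (Y.affineBasicOpen p)).hom x : T.sections hN _).1 ⟨v.1, hv⟩)
    (resOver_resOver f h (Y.basicOpen_le p) s)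
  exact h1.symm.trans (h2.trans h3)

end TwistData

/-! ### Invariants and group action on the model -/

namespace TwistData

variable {Y : Scheme.{u}} [IsIntegral Y] [IsLocallyNoetherian Y] {n : ℕ} {L : Type u}
  [Field L] [Algebra Y.functionField L] (T : TwistData Y n L) (hN : IsNormalScheme Y)

lemma unit_injective (U : Y.Opens) [hU : Nonempty U] : Function.Injective (T.unit hN U) := by
  intro r r' h
  obtain ⟨u⟩ := hU
  have : Nonempty U := ⟨u⟩
  refine Scheme.germToFunctionField_injective Y U ((algebraMap Y.functionField L).injective ?_)
  exact congrFun (congrFun (congrArg Subtype.val h) u) 0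

omit [IsLocallyNoetherian Y] in
lemma two_ne_zero_functionField (h2 : (2 : L) ≠ 0) : (2 : Y.functionField) ≠ 0 := fun h =>
  h2 (by rw [← map_ofNat (algebraMap Y.functionField L) 2, h, map_zero])

/-- A constant function in an eigenspace. -/
noncomputable def wSection (χ : Chars n) (U : Y.Opens) (a : Y.functionField)
    (ha : a ∈ sectionsNeg (T.E χ) U) : T.sections hN U :=
  ⟨fun _ => T.w χ a, Pi.single χ a, fun ψ => by
    by_cases h : ψ = χ
    · subst h
      rwa [Pi.single_eq_same]
    · exact Or.inl (Pi.single_eq_of_ne (M := fun _ => Y.functionField) h a), fun _ => (T.total_single χ a).symm⟩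

lemma translateSections_wSection (g : Grp n) (χ : Chars n) (U : Y.Opens) (a : Y.functionField)
    (ha : a ∈ sectionsNeg (T.E χ) U) : T.translateSections hN g U (T.wSection hN χ U a ha) =
      ((χ g : ℤˣ) : ℤ) • T.wSection hN χ U a ha :=
  Subtype.ext (funext fun _ => T.translate_w g χ a)

/-- A component at another character `ψ` satisfies `ψ g * a ψ = χ g * a ψ` with opposite signs for
some `g`, so it vanishes because 2 is nonzero. -/
lemma exists_wSection_eq (h2 : (2 : L) ≠ 0) {U : Y.Opens} [hU : Nonempty U] (χ : Chars n)
    (s : T.sections hN U) (hs : ∀ g, T.translateSections hN g U s = ((χ g : ℤˣ) : ℤ) • s) :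
    ∃ a ha, s = T.wSection hN χ U a ha := by
  obtain ⟨a, ha, hsa⟩ := T.exists_total hN s
  have u : U := hU.some
  have h0 : ∀ ψ, ψ ≠ χ → a ψ = 0 := by
    intro ψ hψ
    obtain ⟨g, hg⟩ : ∃ g, ψ g ≠ χ g := by
      by_contra! h
      exact hψ (DFunLike.ext _ _ h)
    have h1 : T.total (fun ψ => ((ψ g : ℤˣ) : ℤ) • a ψ) =
        T.total (fun ψ => ((χ g : ℤˣ) : ℤ) • a ψ) := by
      rw [← translate_total, ← hsa u]
      refine (congrFun (congrArg Subtype.val (hs g)) u).trans ?_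
      change ((χ g : ℤˣ) : ℤ) • s.1 u = _
      rw [hsa, total, total, Finset.smul_sum]
      refine Finset.sum_congr rfl fun θ _ => ?_
      ext x
      simp [w]
      ring
    have h3 := congrArg (T.coef ψ) h1
    rw [T.coef_total h2, T.coef_total h2] at h3
    have h4 := two_ne_zero_functionField (Y := Y) h2
    have h5 : (2 : Y.functionField) * a ψ = 0 := by
      rcases Int.units_eq_one_or (ψ g) with h | h <;>
        rcases Int.units_eq_one_or (χ g) with h' | h' <;>
        simp only [h, h', ne_eq, not_true_eq_false, Units.val_one, Units.val_neg, one_smul,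
          neg_smul] at hg h3
      · linear_combination h3
      · linear_combination -h3
    exact (mul_eq_zero.mp h5).resolve_left h4
  refine ⟨a χ, ha χ, Subtype.ext (funext fun v => (hsa v).trans ?_)⟩
  rw [total, Finset.sum_eq_single χ (fun ψ _ h => by rw [h0 ψ h, w_zero]) (by simp)]
  rfl

lemma exists_unit_eq (h2 : (2 : L) ≠ 0) {U : Y.Opens} (hU : IsAffineOpen U) [Nonempty U]
    (s : T.sections hN U) (hs : ∀ g, T.translateSections hN g U s = s) :
    ∃ r, T.unit hN U r = s := by
  obtain ⟨a, ha, rfl⟩ := T.exists_wSection_eq hN h2 1 s fun g => by rw [hs]; simp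
  obtain ⟨r, hr⟩ : ∃ r, Y.germToFunctionField U r = a := by
    rcases ha with rfl | ha
    · exact ⟨0, map_zero _⟩
    · exact exists_germToFunctionField_eq hN hU fun y hy => by
        simpa [T.E_one] using ha y hy
  refine ⟨r, Subtype.ext (funext fun u => ?_)⟩
  rw [unit_apply, hr, ← T.w_one]
  rfl

lemma exists_translateSections_ne [CompactSpace Y] (h2 : (2 : L) ≠ 0) {U : Y.Opens}
    (hU : IsAffineOpen U) [hne : Nonempty U] {g : Grp n} (hg : g ≠ 0) :
    ∃ s, T.translateSections hN g U s ≠ s := by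
  obtain ⟨χ, hχ⟩ := exists_char_eq_neg_one hg
  obtain ⟨a, ha0, ha⟩ := exists_ne_zero_mem_sectionsNeg hN (T.E χ) hU
  refine ⟨T.wSection hN χ U a ha, fun h => ?_⟩
  rw [translateSections_wSection, hχ] at h
  obtain ⟨u⟩ := hne
  have h1 : ((-1 : ℤˣ) : ℤ) • T.w χ a 0 = T.w χ a 0 :=
    congrFun (congrFun (congrArg Subtype.val h) u) 0
  have h3 : T.w χ a 0 ≠ 0 := by
    simpa [w, T.β_ne_zero] using ha0
  refine mul_ne_zero h2 h3 ?_
  simp only [Units.val_neg, Units.val_one, neg_smul, one_smul] at h1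
  linear_combination -h1

namespace Model

variable {T hN} (A : T.Model hN)

instance : IsAffineHom A.f := A.isAffineHom

lemma hom_ext {a b : A.X ⟶ A.X} (ha : a ≫ A.f = A.f) (hb : b ≫ A.f = A.f)
    (h : ∀ (U : Y.affineOpens) s, A.e U (a.appLE _ _ (preimage_le_preimage ha U.1) s) =
      A.e U (b.appLE _ _ (preimage_le_preimage hb U.1) s)) : a = b :=
  hom_ext_over ha hb fun U _ hU => by
    ext s
    exact (A.e ⟨U, hU⟩).injective (h ⟨U, hU⟩ s)

lemma exists_hom_translate (g : Grp n) : ∃ (a : A.X ⟶ A.X) (ha : a ≫ A.f = A.f),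
    ∀ (U : Y.affineOpens) s, A.e U (a.appLE _ _ (preimage_le_preimage ha U.1) s) =
      T.translateSections hN g U.1 (A.e U s) := by
  obtain ⟨a, ha, h⟩ := exists_hom_over (f := A.f) (f' := A.f)
    (fun U => CommRingCat.ofHom (((A.e U).symm : T.sections hN U.1 →+* _).comp
      ((T.translateSections hN g U.1).comp (A.e U : _ →+* T.sections hN U.1)))) (fun U => by
        ext r
        change (A.e U).symm (T.translateSections hN g U.1 (A.e U (A.f.app U.1 r))) = A.f.app U.1 r
        rw [RingEquiv.symm_apply_eq, A.e_app]
        rfl) (fun U V hVU => by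
        ext s
        change resOver A.f hVU ((A.e U).symm (T.translateSections hN g U.1 (A.e U s))) =
          (A.e V).symm (T.translateSections hN g V.1 (A.e V (resOver A.f hVU s)))
        rw [RingEquiv.eq_symm_apply, A.e_res _ _ hVU, A.e_res _ _ hVU, RingEquiv.apply_symm_apply]
        rfl)
  refine ⟨a, ha, fun U s => ?_⟩
  rw [h U]
  exact (A.e U).apply_symm_apply _

end Model

end TwistData

/-! ### Construction of the cover -/

namespace TwistData

variable {Y : Scheme.{u}} [IsIntegral Y] [IsLocallyNoetherian Y] {n : ℕ} {L : Type u}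
  [Field L] [Algebra Y.functionField L] {T : TwistData Y n L} {hN : IsNormalScheme Y}

namespace Model

variable (A : T.Model hN)

lemma isFinite [CompactSpace Y] (h2 : (2 : L) ≠ 0) : IsFinite A.f := by
  refine (isFinite_iff A.f).mpr ⟨A.isAffineHom, fun U hU => ?_⟩
  have h1 : A.f.app U = CommRingCat.ofHom (((A.e ⟨U, hU⟩).symm : T.sections hN U →+* _).comp
      (T.unit hN U)) := by
    ext r
    exact ((A.e ⟨U, hU⟩).symm_apply_eq.mpr (A.e_app ⟨U, hU⟩ r).symm).symm
  rw [h1]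
  exact (RingHom.Finite.of_surjective _ (A.e ⟨U, hU⟩).symm.surjective).comp
    (T.finite_unit hN h2 hU)

lemma app_injective (U : Y.Opens) : Function.Injective (A.f.app U) := by
  intro r r' h
  refine eq_of_resOver_affine (𝟙 Y) fun V _ hV hVU => T.unit_injective hN V ?_
  have h1 := congrArg (resOver A.f hVU) h
  rw [resOver_app, resOver_app] at h1
  exact (A.e_app ⟨V, hV⟩ _).symm.trans ((congrArg (A.e ⟨V, hV⟩) h1).trans (A.e_app ⟨V, hV⟩ _))

lemma exists_app_eq (h2 : (2 : L) ≠ 0) (a : Grp n → (A.X ⟶ A.X)) (ha : ∀ g, a g ≫ A.f = A.f)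
    (h : ∀ g (U : Y.affineOpens) s, A.e U ((a g).appLE _ _ (preimage_le_preimage (ha g) U.1) s) =
      T.translateSections hN g U.1 (A.e U s)) {U : Y.Opens} {s : Γ(A.X, A.f ⁻¹ᵁ U)}
    (hs : ∀ g, (a g).appLE _ _ (preimage_le_preimage (ha g) U) s = s) : ∃ r, A.f.app U r = s := by
  have hex : ∀ (V : Y.Opens) [Nonempty V] (_ : IsAffineOpen V) (hVU : V ≤ U),
      ∃ r, A.f.app V r = resOver A.f hVU s := by
    intro V _ hV hVU
    obtain ⟨r, hr⟩ := T.exists_unit_eq hN h2 hV (A.e ⟨V, hV⟩ (resOver A.f hVU s)) fun g => by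
      rw [← h g ⟨V, hV⟩]
      congr 1
      conv_rhs => rw [← hs g]
      rw [← CommRingCat.comp_apply, ← CommRingCat.comp_apply, resOver, Scheme.Hom.appLE_map,
        Scheme.Hom.map_appLE]
    exact ⟨r, (A.e ⟨V, hV⟩).injective ((A.e_app ⟨V, hV⟩ r).trans hr)⟩
  choose r hr using hex
  obtain ⟨t, ht⟩ := exists_resOver_eq (𝟙 Y) (U := U) (fun V _ hV h => r V hV h) (by
    intro V W _ _ hV hW hVU hWV
    refine A.app_injective W ?_
    refine (resOver_app A.f hWV _).symm.trans ?_
    rw [hr, hr, resOver_resOver])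
  refine ⟨t, eq_of_resOver_affine A.f fun V _ hV hVU => ?_⟩
  refine (resOver_app A.f hVU _).trans ?_
  rw [← hr V hV hVU]
  exact congrArg (A.f.app V) (ht V hV hVU)

include A in
/-- The model carries the structure of a cover. -/
theorem exists_cover [CompactSpace Y] (h2 : (2 : L) ≠ 0) : ∃ (c : Cover Y n)
    (e : ∀ U : Y.affineOpens, Γ(c.X, c.f ⁻¹ᵁ U.1) ≃+* T.sections hN U.1),
    (∀ U r, e U (c.f.app U.1 r) = T.unit hN U.1 r) ∧
    (∀ (U V : Y.affineOpens) (h : V.1 ≤ U.1) s, e V (resOver c.f h s) = T.restrict hN h (e U s)) ∧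
    ∀ g U s, e U (c.act g U.1 s) = T.translateSections hN g U.1 (e U s) := by
  choose a ha h using A.exists_hom_translate
  have hzero : a 0 = 𝟙 _ := A.hom_ext (ha 0) (Category.id_comp _) fun U s => by
    rw [h]
    have hid : (𝟙 A.X : A.X ⟶ A.X).appLE (A.f ⁻¹ᵁ U.1) (A.f ⁻¹ᵁ U.1) le_rfl s = s := by
      simp only [Scheme.Hom.appLE, Scheme.Hom.id_app]
      exact resOver_self A.f s
    rw [hid]
    refine Subtype.ext (funext fun u => funext fun x => ?_)
    rw [translateSections_apply, zero_add]
  have hadd : ∀ g g', a (g + g') = a g ≫ a g' := fun g g' =>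
    A.hom_ext (ha _) (by rw [Category.assoc, ha, ha]) fun U s => by
      rw [h, ← Scheme.Hom.appLE_comp_appLE _ _ _ (A.f ⁻¹ᵁ U.1) _
        (preimage_le_preimage (ha g') U.1) (preimage_le_preimage (ha g) U.1),
        CommRingCat.comp_apply, h, h]
      refine Subtype.ext (funext fun u => funext fun x => ?_)
      rw [translateSections_apply, translateSections_apply, translateSections_apply,
        ← add_assoc, add_comm g]
  have hself : ∀ g, a g ≫ a g = 𝟙 _ := fun g => by
    rw [← hadd, ← hzero]
    congr 1
    ext i
    exact CharTwo.add_self_eq_zero _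
  let ρ : Multiplicative (Grp n) →* Aut A.X :=
    { toFun := fun g => ⟨a g.toAdd, a g.toAdd, hself _, hself _⟩
      map_one' := Iso.ext hzero
      map_mul' := fun g g' => Iso.ext (by
        change a (g.toAdd + g'.toAdd) = a g'.toAdd ≫ a g.toAdd
        rw [add_comm, hadd]) }
  refine ⟨⟨A.X, A.f, A.isFinite h2, ρ, fun g => ha _, ?_, A.app_injective, fun U => ?_⟩, A.e,
    A.e_app, A.e_res, fun g U s => h g U s⟩
  · refine (injective_iff_map_eq_one ρ).mpr fun g hg => ?_
    by_contra hg0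
    have : Nonempty (⊤ : Y.Opens) := ⟨⟨genericPoint Y, trivial⟩⟩
    obtain ⟨V, hV, _, -⟩ := exists_affine_nonempty_le (⊤ : Y.Opens)
    obtain ⟨s, hs⟩ := T.exists_translateSections_ne hN h2 hV (g := g.toAdd) hg0
    refine hs ?_
    have h1 : a g.toAdd = a 0 := (congrArg Iso.hom hg).trans hzero.symm
    have h3 := h g.toAdd ⟨V, hV⟩ ((A.e ⟨V, hV⟩).symm s)
    rw [RingEquiv.apply_symm_apply] at h3
    refine h3.symm.trans ?_
    have h4 := h 0 ⟨V, hV⟩ ((A.e ⟨V, hV⟩).symm s)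
    simp only [h1]
    rw [h4, RingEquiv.apply_symm_apply]
    refine Subtype.ext (funext fun u => funext fun x => ?_)
    rw [translateSections_apply, zero_add]
  · refine Set.Subset.antisymm ?_ fun s hs => A.exists_app_eq h2 a ha h fun g => hs (.ofAdd g)
    rintro _ ⟨r, rfl⟩ g
    change (a g.toAdd).appLE _ _ _ (A.f.app U r) = A.f.app U r
    rw [Scheme.Hom.app_eq_appLE, ← CommRingCat.comp_apply, Scheme.Hom.appLE_comp_appLE]
    simp only [ha]

end Model

end TwistData

variable {Y : Scheme.{u}} [IsIntegral Y] [IsLocallyNoetherian Y] {n : ℕ}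

namespace TwistData

variable {L : Type u} [Field L] [Algebra Y.functionField L] (T : TwistData Y n L)
  (hN : IsNormalScheme Y)

open Classical in
/-- The component of a section. -/
noncomputable def sectionCoef (χ : Chars n) (U : Y.Opens) : T.sections hN U →+ Y.functionField :=
  if h : Nonempty U then ((T.coef χ).comp (Pi.evalAddMonoidHom (fun _ : U => Grp n → L) h.some)).comp
    (T.sections hN U).subtype.toAddMonoidHom else 0

variable {T hN}

lemma sectionCoef_of_forall (h2 : (2 : L) ≠ 0) {χ : Chars n} {U : Y.Opens} [hU : Nonempty U]
    {s : T.sections hN U} {a : Chars n → Y.functionField} (h : ∀ u, s.1 u = T.total a) :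
    T.sectionCoef hN χ U s = a χ := by
  rw [sectionCoef, dif_pos hU]
  exact (congrArg (T.coef χ) (h _)).trans (T.coef_total h2 χ a)

lemma sectionCoef_wSection (h2 : (2 : L) ≠ 0) {χ : Chars n} {U : Y.Opens} [Nonempty U]
    {a : Y.functionField} (ha : a ∈ sectionsNeg (T.E χ) U) :
    T.sectionCoef hN χ U (T.wSection hN χ U a ha) = a := by
  rw [sectionCoef_of_forall h2 fun u => (T.total_single χ a).symm]
  exact Pi.single_eq_same (M := fun _ => Y.functionField) χ a

lemma sectionCoef_restrict (h2 : (2 : L) ≠ 0) (χ : Chars n) {U V : Y.Opens} [Nonempty U]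
    [Nonempty V] (h : V ≤ U) (s : T.sections hN U) :
    T.sectionCoef hN χ V (T.restrict hN h s) = T.sectionCoef hN χ U s := by
  obtain ⟨a, ha, hs⟩ := T.exists_total hN s
  rw [sectionCoef_of_forall h2 hs, sectionCoef_of_forall h2 fun v => hs ⟨v.1, h v.2⟩]

lemma sectionCoef_unit_mul (h2 : (2 : L) ≠ 0) (χ : Chars n) {U : Y.Opens} [Nonempty U]
    (r : Γ(Y, U)) (s : T.sections hN U) : T.sectionCoef hN χ U (T.unit hN U r * s) =
      Y.germToFunctionField U r * T.sectionCoef hN χ U s := by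
  obtain ⟨a, ha, hs⟩ := T.exists_total hN s
  rw [sectionCoef_of_forall h2 hs, sectionCoef_of_forall h2 fun u => ?_]
  rw [← T.unit_mul_total hN r u, ← hs u]
  rfl

variable (T)

include T in
/-- Every set of data is realized by a cover. -/
theorem exists_cover (hN : IsNormalScheme Y) [CompactSpace Y] (h2 : (2 : L) ≠ 0) :
    ∃ (c : Cover Y n) (M : c.EigenData), M.E = T.E ∧ M.φ = T.φ := by
  obtain ⟨A⟩ := T.nonempty_model hN
  obtain ⟨c, e, e_app, e_res, e_act⟩ := A.exists_cover h2
  classical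
  -- The value on non-affine sets is the default zero, as only affine sets enter
  -- `Cover.exists_eigenData`.
  let Φ : ∀ (_ : Chars n) (U : Y.Opens), Γ(c.X, c.f ⁻¹ᵁ U) →+ Y.functionField := fun χ U =>
    if h : IsAffineOpen U then
      (T.sectionCoef hN χ U).comp (e ⟨U, h⟩ : _ →+* T.sections hN U).toAddMonoidHom else 0
  have hΦ : ∀ χ (U : Y.Opens) (h : IsAffineOpen U) s,
      Φ χ U s = T.sectionCoef hN χ U (e ⟨U, h⟩ s) := fun χ U h s => by
    simp only [Φ, dif_pos h]
    rfl
  have heig : ∀ χ (U : Y.Opens) [Nonempty U] (h : IsAffineOpen U), ∀ s ∈ c.eigen χ U,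
      ∃ a ha, e ⟨U, h⟩ s = T.wSection hN χ U a ha := fun χ U _ h s hs =>
    T.exists_wSection_eq hN h2 χ _ fun g => by
      rw [← e_act g ⟨U, h⟩, ← map_zsmul]
      exact congrArg _ (hs g)
  refine ⟨c, c.exists_eigenData T.E T.φ Φ T.φ_ne_zero (fun χ U _ hU => ⟨?_, ?_, ?_⟩) ?_ ?_ ?_⟩
  · intro s hs
    obtain ⟨a, ha, h⟩ := heig χ U hU s hs
    rw [hΦ χ U hU, h, sectionCoef_wSection h2]
    exact ha
  · intro s hs t ht hst
    obtain ⟨a, ha, h⟩ := heig χ U hU s hs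
    obtain ⟨b, hb, h'⟩ := heig χ U hU t ht
    rw [hΦ χ U hU, hΦ χ U hU, h, h', sectionCoef_wSection h2, sectionCoef_wSection h2] at hst
    subst hst
    exact (e ⟨U, hU⟩).injective (h.trans h'.symm)
  · intro a ha
    refine ⟨(e ⟨U, hU⟩).symm (T.wSection hN χ U a ha), fun g => ?_, ?_⟩
    · refine (e ⟨U, hU⟩).injective ((e_act g ⟨U, hU⟩ _).trans ?_)
      rw [map_zsmul, RingEquiv.apply_symm_apply, translateSections_wSection]
    · rw [hΦ χ U hU, RingEquiv.apply_symm_apply, sectionCoef_wSection h2]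
  · intro χ U _ hU r s _
    rw [hΦ χ U hU, hΦ χ U hU, map_mul, e_app ⟨U, hU⟩, sectionCoef_unit_mul h2]
  · intro χ U V _ _ hU hV hVU s _
    rw [hΦ χ U hU, hΦ χ V hV, e_res ⟨U, hU⟩ ⟨V, hV⟩ hVU, sectionCoef_restrict h2]
  · intro χ ψ U _ hU s hs t ht
    obtain ⟨a, ha, h⟩ := heig χ U hU s hs
    obtain ⟨b, hb, h'⟩ := heig ψ U hU t ht
    rw [hΦ _ U hU, hΦ _ U hU, hΦ _ U hU, map_mul, h, h', sectionCoef_wSection h2,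
      sectionCoef_wSection h2, sectionCoef_of_forall h2 fun u =>
      (T.w_mul χ ψ a b).trans (T.total_single _ _).symm]
    exact Pi.single_eq_same (M := fun _ => Y.functionField) _ _

end TwistData

/-! ### Classification of covers by building data -/

variable {Y : Scheme.{u}} {n : ℕ}

namespace Cover

variable {c c' : Cover Y n}

lemma appLE_mem_eigen {a : c.X ⟶ c'.X} (ha : a ≫ c'.f = c.f)
    (hg : ∀ g, (c.ρ g).hom ≫ a = a ≫ (c'.ρ g).hom) {χ : Chars n} {U : Y.Opens}
    {s : Γ(c'.X, c'.f ⁻¹ᵁ U)} (hs : s ∈ c'.eigen χ U) :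
    a.appLE _ _ (preimage_le_preimage ha U) s ∈ c.eigen χ U := by
  intro g
  have h := congrArg (a.appLE _ _ (preimage_le_preimage ha U)) (hs g)
  rw [map_zsmul] at h
  refine Eq.trans ?_ h
  simp only [act]
  rw [← CommRingCat.comp_apply, ← CommRingCat.comp_apply, Scheme.Hom.appLE_comp_appLE,
    Scheme.Hom.appLE_comp_appLE]
  simp only [hg]

lemma appLE_appLE_eq {a : c.X ⟶ c'.X} {b : c'.X ⟶ c.X} (ha : a ≫ c'.f = c.f) (hb : b ≫ c.f = c'.f)
    (hab : a ≫ b = 𝟙 _) (U : Y.Opens) (s : Γ(c.X, c.f ⁻¹ᵁ U)) :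
    a.appLE _ _ (preimage_le_preimage ha U) (b.appLE _ _ (preimage_le_preimage hb U) s) = s := by
  rw [← CommRingCat.comp_apply, Scheme.Hom.appLE_comp_appLE]
  simp only [hab]
  simp only [Scheme.Hom.appLE, Scheme.Hom.id_app]
  exact resOver_self c.f s

variable [IsIntegral Y] [IsLocallyNoetherian Y]

/-- Being standard is invariant under isomorphism. -/
theorem IsStandard.of_isIso {B : BuildingData Y n} (h : c.IsStandard B) (hc : c.IsIso c') :
    c'.IsStandard B := by
  obtain ⟨M, hL, hD⟩ := (isStandard_iff c B).mp h
  obtain ⟨e, ha, hg⟩ := hc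
  have hb : e.inv ≫ c.f = c'.f := by rw [← ha, e.inv_hom_id_assoc]
  have hg' : ∀ g, (c'.ρ g).hom ≫ e.inv = e.inv ≫ (c.ρ g).hom := fun g => by
    rw [Iso.comp_inv_eq, Category.assoc, hg, e.inv_hom_id_assoc]
  let p : ∀ U : Y.Opens, Γ(c'.X, c'.f ⁻¹ᵁ U) ⟶ Γ(c.X, c.f ⁻¹ᵁ U) := fun U =>
    e.hom.appLE _ _ (preimage_le_preimage ha U)
  have hp : ∀ {χ U s}, s ∈ c'.eigen χ U → p U s ∈ c.eigen χ U := appLE_mem_eigen ha hg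
  have hinj : ∀ U, Function.Injective (p U) := fun U =>
    Function.LeftInverse.injective (appLE_appLE_eq hb ha e.inv_hom_id U)
  refine (isStandard_iff c' B).mpr ⟨⟨M.E, M.φ,
    fun χ U => (M.Φ χ U).comp (p U).hom.toAddMonoidHom, M.ne_zero,
    fun χ U _ => ⟨fun s hs => (M.bijOn χ U).mapsTo (hp hs),
      fun s hs t ht h => hinj U ((M.bijOn χ U).injOn (hp hs) (hp ht) h), fun x hx => ?_⟩,
    fun χ U _ r s hs => ?_, fun χ U V _ _ hVU s hs => ?_, fun χ ψ U _ s hs t ht => ?_⟩, hL, hD⟩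
  · obtain ⟨s, hs, rfl⟩ := (M.bijOn χ U).surjOn hx
    exact ⟨_, appLE_mem_eigen hb hg' hs,
      congrArg (M.Φ χ U) (appLE_appLE_eq ha hb e.hom_inv_id U s)⟩
  · change M.Φ χ U (p U (c'.f.app U r * s)) = _ * M.Φ χ U (p U s)
    have h1 : p U (c'.f.app U r) = c.f.app U r := by
      simp only [p]
      rw [Scheme.Hom.app_eq_appLE, ← CommRingCat.comp_apply, Scheme.Hom.appLE_comp_appLE,
        Scheme.Hom.app_eq_appLE]
      simp only [ha]
    rw [map_mul, h1, M.map_app_mul χ U r _ (hp hs)]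
  · change M.Φ χ V (p V (resOver c'.f hVU s)) = M.Φ χ U (p U s)
    rw [← M.map_res χ U V hVU _ (hp hs)]
    simp only [p]
    rw [← CommRingCat.comp_apply, ← CommRingCat.comp_apply, resOver, resOver,
      Scheme.Hom.appLE_map, Scheme.Hom.map_appLE]
  · change M.Φ _ U (p U (s * t)) = _ * M.Φ χ U (p U s) * M.Φ ψ U (p U t)
    rw [map_mul, M.map_mul χ ψ U _ (hp hs) _ (hp ht)]

/-- Every set of building data has a standard cover. -/
theorem exists_isStandard [CompactSpace Y] (hN : IsNormalScheme Y) (h2 : IsUnit (2 : Γ(Y, ⊤)))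
    (B : BuildingData Y n) : ∃ c : Cover Y n, c.IsStandard B := by
  obtain ⟨e, f, hf0, hL, hf⟩ := B.exists_representatives
  let K := Y.functionField
  -- Square roots of the `f i` are needed to define the eigenfunctions. Any field containing them
  -- would do, even if the roots already lie in `K`, since the signs `χ g` keep the eigenspaces
  -- apart.
  let L := AlgebraicClosure K
  have h2K : (2 : K) ≠ 0 := by
    have : Nonempty (⊤ : Y.Opens) := ⟨⟨genericPoint Y, trivial⟩⟩
    have := (h2.map (Y.germToFunctionField ⊤).hom).ne_zero
    rwa [map_ofNat] at this
  have h2L : (2 : L) ≠ 0 := by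
    rw [← map_ofNat (algebraMap K L) 2]
    exact (map_ne_zero _).mpr h2K
  choose b hb using fun i => IsAlgClosed.exists_eq_mul_self (algebraMap K L (f i))
  have hφ0 : ∀ χ ψ : Chars n, mulFunction f χ ψ ≠ 0 := fun χ ψ =>
    Finset.prod_ne_zero_iff.mpr fun i _ => by split_ifs; exacts [hf0 i, one_ne_zero]
  have hφ : ∀ χ ψ : Chars n, mulFunction (fun i => b i * b i) χ ψ =
      algebraMap K L (mulFunction f χ ψ) := by
    intro χ ψ
    rw [mulFunction, mulFunction, map_prod]
    refine Finset.prod_congr rfl fun i _ => ?_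
    split_ifs
    exacts [(hb i).symm, (map_one _).symm]
  let T : TwistData Y n L :=
    { E := eigenDivisor e B.D
      φ := mulFunction f
      β := eigenFunction b
      φ_ne_zero := hφ0
      β_ne_zero := fun χ => Finset.prod_ne_zero_iff.mpr fun i _ => by
        split_ifs
        · intro h
          have h1 := hb i
          rw [h, mul_zero, map_eq_zero] at h1
          exact hf0 i h1
        · exact one_ne_zero
      E_one := eigenDivisor_one e B.D
      β_one := eigenFunction_one b
      β_mul := fun χ ψ => by rw [eigenFunction_mul, hφ]
      ord_ge := fun χ ψ y => by
        rw [ord_mulFunction hf0 hf]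
        refine le_add_of_nonneg_right (Finset.sum_nonneg fun h _ => mul_nonneg ?_ ?_)
        · unfold eps
          split_ifs <;> norm_num
        · exact B.effective h y }
  obtain ⟨c, M, hE, hM⟩ := T.exists_cover hN h2L
  refine ⟨c, (isStandard_iff c B).mpr ⟨M, fun χ => by rw [hE]; exact hL χ, fun y χ ψ => ?_⟩⟩
  rw [EigenData.exponent, hE, hM]
  have := ord_mulFunction hf0 hf χ ψ y
  simp only [T]
  omega

/-- Classification of the covers up to isomorphism. -/
theorem exists_equiv [CompactSpace Y] (hN : IsNormalScheme Y) (h2 : IsUnit (2 : Γ(Y, ⊤)))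
    (hsq : ∀ x : Γ(Y, ⊤), IsSquare x) : ∃ e : Quotient (isoSetoid Y n) ≃
      {B : BuildingData Y n // B.MultLETwo}, ∀ (c : {c : Cover Y n // c.IsSTwoNC})
        (B : {B : BuildingData Y n // B.MultLETwo}),
        e (Quotient.mk (isoSetoid Y n) c) = B ↔ c.1.IsStandard B.1 := by
  choose F hF using fun c : {c : Cover Y n // c.IsSTwoNC} => (isSTwoNC_iff hN h2).mp c.2
  let G : Quotient (isoSetoid Y n) → {B : BuildingData Y n // B.MultLETwo} :=
    Quotient.lift (fun c => ⟨F c, (hF c).1⟩) fun c c' h =>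
      Subtype.ext (((hF c).2.of_isIso h).unique hN h2 (hF c').2)
  have hG : ∀ c B, G (Quotient.mk (isoSetoid Y n) c) = B ↔ c.1.IsStandard B.1 := fun c B =>
    ⟨fun h => h ▸ (hF c).2, fun h => Subtype.ext ((hF c).2.unique hN h2 h)⟩
  refine ⟨Equiv.ofBijective G ⟨fun x y => ?_, fun B => ?_⟩, hG⟩
  · refine Quotient.inductionOn₂ x y fun c c' h => Quotient.sound ?_
    exact ((hG c _).mp h).isIso h2 hN hsq (hF c').2
  · obtain ⟨c, hc⟩ := exists_isStandard hN h2 B.1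
    exact ⟨Quotient.mk _ ⟨c, (hc.isSTwoNC_iff hN h2).mpr B.2⟩, (hG _ _).mpr hc⟩

end Cover

end ZTwoCovers

theorem mainTheorem6 {k : Type u} [Field k] [IsAlgClosed k] (h2 : (2 : k) ≠ 0)
    (Y : Scheme.{u}) [IsIntegral Y] [IsLocallyNoetherian Y] (s : Y ⟶ Spec (.of k))
    (hproj : ZTwoCovers.IsProjectiveOver s) (hnormal : ZTwoCovers.IsNormalScheme Y) (n : ℕ) :
    (∀ c : ZTwoCovers.Cover Y n,
      c.IsSTwoNC ↔ ∃ B : ZTwoCovers.BuildingData Y n, B.MultLETwo ∧ c.IsStandard B) ∧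
    (∀ (c : ZTwoCovers.Cover Y n) (B : ZTwoCovers.BuildingData Y n),
      c.IsStandard B → (c.IsSTwoNC ↔ B.MultLETwo)) ∧
    (∃ e : Quotient (ZTwoCovers.isoSetoid Y n) ≃
        {B : ZTwoCovers.BuildingData Y n // B.MultLETwo},
      ∀ (c : {c : ZTwoCovers.Cover Y n // c.IsSTwoNC})
        (B : {B : ZTwoCovers.BuildingData Y n // B.MultLETwo}),
        e (Quotient.mk (ZTwoCovers.isoSetoid Y n) c) = B ↔ c.1.IsStandard B.1) := by
  -- Projectivity enters through universal closedness: it gives quasi-compactness, hence finiteness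
  -- of supports, and constancy of global functions, hence their square roots.
  have := ZTwoCovers.IsProjectiveOver.universallyClosed hproj
  have : CompactSpace Y := compactSpace_of_universallyClosed s
  have hu : IsUnit (2 : Γ(Y, ⊤)) := ZTwoCovers.isUnit_two_globalSections (s := s) h2
  exact ⟨fun c => ZTwoCovers.Cover.isSTwoNC_iff hnormal hu,
    fun c B h => h.isSTwoNC_iff hnormal hu,
    ZTwoCovers.Cover.exists_equiv hnormal hu (ZTwoCovers.isSquare_globalSections (s := s))⟩
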